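/- Let $0<q<1$ and $\lambda=q-q^{-1}$. For $c\in[0,\infty]$ put $(s,t)=(1,c)$ if $c<\infty$ and $(s,t)=(0,1)$ if $c=\infty$, and let $\mathcal O(S^2_{qc})\rtimes\mathcal U_q(\mathrm{su}_2)$ be the unital complex $\ast$-algebra with generators $A=A^\ast$, $B,B^\ast$, $E$, $F=E^\ast$, $K=K^\ast$, $K^{-1}$ and relations $$KK^{-1}=K^{-1}K=1,\quad KE=qEK,\quad FK=qKF,\quad EF-FE=\lambda^{-1}(K^2-K^{-2}),$$ $$AB=q^{-2}BA,\quad AB^\ast=q^2B^\ast A,\quad B^\ast B=sA-A^2+t,\quad BB^\ast=sq^2A-q^4A^2+t,$$ $$KA=AK,\quad EA=AE+q^{-1/2}B^\ast K,\quad FA=AF-q^{-3/2}BK,$$ $$KB=q^{-1}BK,\quad EB=qBE-q^{1/2}(1+q^2)AK+sq^{1/2}K,\quad FB=qBF,$$ $$KB^\ast=qB^\ast K,\quad EB^\ast=q^{-1}B^\ast E,\quad FB^\ast=q^{-1}B^\ast F+q^{-1/2}(1+q^2)AK-sq^{-1/2}K.$$ Let $\hat{\mathcal O}(S^2_{qc})\rtimes\mathcal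 U_q(\mathrm{su}_2)$ be obtained from it by adjoining an inverse $A^{-1}$ of $A$. In the latter algebra put $$X=q^{3/2}\lambda FK^{-1}A+qB,\qquad Y=Y^\ast=qK^{-2}A,$$ and let $\mathcal Y_c$ be the $\ast$-subalgebra generated by $X,X^\ast,Y,Y^{-1}$. A $\ast$-representation $\pi$ of a unital $\ast$-algebra on a Hilbert space $\mathcal H$ is a unital algebra homomorphism into the linear maps of a dense subspace $\mathcal D\subseteq\mathcal H$ into itself such that $\langle\pi(a)\varphi,\psi\rangle=\langle\varphi,\pi(a^\ast)\psi\rangle$ for $\varphi,\psi\in\mathcal D$. We write $\bar a$ for the closure of $\pi(a)$. Strong commutation of two self-adjoint operators means that their spectral measures commute; products and sums of unbounded operators have their natural domains. For $c\in[0,\infty)$, a $\ast$-representation of $\hat{\mathcal O}(S^2_{qc})\rtimes\mathcal U_q(\mathrm{su}_2)$ is called well-behaved if (a) $\bar A,\bar K$ are self-adjoint and strongly commute; (b) the spectral projections of $\bar A$ commute with $\bar y$ for every $y\in\mathcal Y_c$; (c) $(\bar X)^\ast=\overline{X^\ast}$, and $\bar Y$ and $\bar X^\ast\bar X$ are self-adjoint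 and strongly commute; (d) the defining relations of $\mathcal Y_c$ hold for the closed operators: $\bar Y\bar X=q^2\bar X\bar Y$ on $D(\bar X)\cap D(\bar Y)$ and $\bar Y\bar X^\ast=q^{-2}\bar X^\ast\bar Y$ on $D(\bar X^\ast)\cap D(\bar Y)$ (meaning that for a vector of this intersection one side is defined if and only if the other one is, and then they agree), and $\bar X^\ast\bar X=q^2\bar X\bar X^\ast+(1-q^2)(\bar Y^2+c)$ as an equality of operators. For $c\in[0,\infty)$ put $\lambda_\pm=\frac12\pm(c+\frac14)^{1/2}$, $c_\pm(n)=(c+\lambda_\pm q^{2n}-(\lambda_\pm q^{2n})^2)^{1/2}$ and $\lambda_n=(1-q^{2n})^{1/2}$. For a self-adjoint operator $H$ with trivial kernel on a Hilbert space $\mathcal G$, the formulas $(I)_{\pm,H}$ on $\bigoplus_{n,j\ge0}\mathcal G$ (with $\eta_{nj}$ denoting $\eta\in\mathcal G$ placed in the $(n,j)$-th summand, and $\eta_{-1,j}=\eta_{n,-1}=0$) are $$A\eta_{nj}=\lambda_\pm q^{2n}\eta_{nj},\quad B\eta_{nj}=c_\pm(n)\eta_{n-1,j},\quad B^\ast\eta_{nj}=c_\pm(n+1)\eta_{n+1,j},\quad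 K\eta_{nj}=q^{n-j}H\eta_{nj},$$ $$E\eta_{nj}=\pm q^{-1/2}\lambda^{-1}\big[q^{-n}\lambda_j(\lambda_\pm^{-2}q^{-2j}c+H^{-4})^{1/2}H\eta_{n,j-1}-q^{-j}(\lambda_\pm^{-2}q^{-2n-2}c+\lambda_\pm^{-1}-q^{2n+2})^{1/2}H\eta_{n+1,j}\big],$$ $$F\eta_{nj}=\pm q^{-1/2}\lambda^{-1}\big[q^{-n}\lambda_{j+1}(\lambda_\pm^{-2}q^{-2j-2}c+H^{-4})^{1/2}H\eta_{n,j+1}-q^{-j}(\lambda_\pm^{-2}q^{-2n}c+\lambda_\pm^{-1}-q^{2n})^{1/2}H\eta_{n-1,j}\big],$$ with $A^{-1}$ and $K^{-1}$ acting by the inverses. Then: 1. Let $c\in[0,\infty]$. For every $\ast$-representation of $\mathcal O(S^2_{qc})\rtimes\mathcal U_q(\mathrm{su}_2)$ such that $\bar A$ and $\bar K$ are self-adjoint and strongly commute, $\ker\bar A=\{0\}$. 2. Let $c\in(0,\infty)$. For every well-behaved $\ast$-representation $\pi$ of $\hat{\mathcal O}(S^2_{qc})\rtimes\mathcal U_q(\mathrm{su}_2)$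 there are Hilbert spaces $\mathcal G_+,\mathcal G_-$ (possibly $\{0\}$) with self-adjoint operators $H_+,H_-$ with trivial kernels such that, up to unitary equivalence, $\mathcal H=\bigoplus_{n,j}\mathcal G_+\oplus\bigoplus_{n,j}\mathcal G_-$ and all generators act on the domain of $\pi$ by the formulas $(I)_{+,H_+}$ on the first and $(I)_{-,H_-}$ on the second summand. 3. Let $c=0$. For every well-behaved $\ast$-representation there are a Hilbert space $\mathcal G$ and a self-adjoint operator $H$ with trivial kernel on $\mathcal G$ such that, up to unitary equivalence, $\mathcal H=\bigoplus_{n,j}\mathcal G$ and all generators act on the domain of $\pi$ by the formulas $(I)_{+,H}$. 4. Conversely, for every $\mathcal G$ and $H$ as above the formulas $(I)_{+,H}$ ($c\in[0,\infty)$) and $(I)_{-,H}$ ($c\in(0,\infty)$) define a $\ast$-representation of $\hat{\mathcal O}(S^2_{qc})\rtimes\mathcal U_q(\mathrm{su}_2)$ on the domain of all finite sums of vectors $\eta_{nj}$ with $\eta\in\bigcap_{k\ge0}D(H^k)\cap D(H^{-k})$. -/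

import Mathlib

open scoped ENNReal NNReal InnerProductSpace

universe u

noncomputable section

namespace Podles

/-! ## Complex `*`-algebras given by generators and relations -/

/-- The free unital complex `*`-algebra on a set `X` of generators on which the involution is
prescribed by `[InvolutiveStar X]`. -/
def FreeStarAlgebra (X : Type) : Type := FreeAlgebra ℂ X

instance (X : Type) : Ring (FreeStarAlgebra X) := inferInstanceAs (Ring (FreeAlgebra ℂ X))

instance (X : Type) : Algebra ℂ (FreeStarAlgebra X) :=
  inferInstanceAs (Algebra ℂ (FreeAlgebra ℂ X))

/-- A generator, as an element of the free `*`-algebra. -/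
def FreeStarAlgebra.gen {X : Type} (x : X) : FreeStarAlgebra X := FreeAlgebra.ι ℂ x

/-- The opposite algebra with the complex conjugate scalar multiplication; the involution is an
algebra homomorphism into it. -/
def ConjOpposite (X : Type) : Type := (FreeStarAlgebra X)ᵐᵒᵖ

instance (X : Type) : Ring (ConjOpposite X) := inferInstanceAs (Ring (FreeStarAlgebra X)ᵐᵒᵖ)

instance (X : Type) : Algebra ℂ (ConjOpposite X) :=
  RingHom.toAlgebra' ((algebraMap ℂ (FreeStarAlgebra X)ᵐᵒᵖ).comp (starRingEnd ℂ))
    (fun c x => Algebra.commutes (A := (FreeStarAlgebra X)ᵐᵒᵖ) (starRingEnd ℂ c) x)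

/-- The involution of the free `*`-algebra: conjugate linear, reversing products, and given on
generators by `star`. -/
def freeStarHom (X : Type) [InvolutiveStar X] : FreeAlgebra ℂ X →ₐ[ℂ] ConjOpposite X :=
  FreeAlgebra.lift ℂ
    (fun x => (MulOpposite.op (FreeStarAlgebra.gen (star x)) : (FreeStarAlgebra X)ᵐᵒᵖ))

/-- `freeStarHom`, read as a map of the free `*`-algebra into itself. -/
def freeStar {X : Type} [InvolutiveStar X] (a : FreeStarAlgebra X) : FreeStarAlgebra X :=
  MulOpposite.unop (α := FreeStarAlgebra X) (freeStarHom X a)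

section

variable {X : Type} [InvolutiveStar X]

theorem freeStar_gen (x : X) :
    freeStar (FreeStarAlgebra.gen x) = FreeStarAlgebra.gen (star x) := by
  unfold freeStar freeStarHom
  erw [FreeAlgebra.lift_ι_apply]
  rfl

theorem freeStar_algebraMap (r : ℂ) :
    freeStar (algebraMap ℂ (FreeStarAlgebra X) r)
      = algebraMap ℂ (FreeStarAlgebra X) (starRingEnd ℂ r) := by
  unfold freeStar
  erw [AlgHom.commutes]
  rfl

theorem freeStar_mul (a b : FreeStarAlgebra X) :
    freeStar (a * b) = freeStar b * freeStar a := by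
  unfold freeStar
  erw [map_mul]
  rfl

theorem freeStar_add (a b : FreeStarAlgebra X) :
    freeStar (a + b) = freeStar a + freeStar b := by
  unfold freeStar
  erw [map_add]
  rfl

theorem freeStar_freeStar (a : FreeStarAlgebra X) : freeStar (freeStar a) = a := by
  refine FreeAlgebra.induction (R := ℂ) (X := X)
    (motive := fun a => freeStar (X := X) (freeStar (X := X) a) = a) ?_ ?_ ?_ ?_ a
  · intro r
    have h := freeStar_algebraMap (X := X) r
    have h' := freeStar_algebraMap (X := X) (starRingEnd ℂ r)
    rw [Complex.conj_conj] at h'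
    exact (congrArg freeStar h).trans h'
  · intro x
    have h := freeStar_gen (X := X) x
    have h' := freeStar_gen (X := X) (star x)
    rw [star_star] at h'
    exact (congrArg freeStar h).trans h'
  · intro a b ha hb
    have h := freeStar_mul (X := X) a b
    have h' := freeStar_mul (X := X) (freeStar (X := X) b) (freeStar (X := X) a)
    rw [ha, hb] at h'
    exact (congrArg freeStar h).trans h'
  · intro a b ha hb
    have h := freeStar_add (X := X) a b
    have h' := freeStar_add (X := X) (freeStar (X := X) a) (freeStar (X := X) b)
    rw [ha, hb] at h'
    exact (congrArg freeStar h).trans h'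

instance : StarRing (FreeStarAlgebra X) where
  star := freeStar
  star_involutive := freeStar_freeStar
  star_mul := freeStar_mul
  star_add := freeStar_add

/-- The relations `R` together with their adjoints. -/
inductive StarClosure (R : Set (FreeStarAlgebra X × FreeStarAlgebra X)) :
    FreeStarAlgebra X → FreeStarAlgebra X → Prop
  | rel (a b : FreeStarAlgebra X) (h : (a, b) ∈ R) : StarClosure R a b
  | star (a b : FreeStarAlgebra X) (h : (a, b) ∈ R) : StarClosure R (star a) (star b)

/-- The `*`-algebra with generators `X` and defining relations `R`: the free `*`-algebra modulo
the `*`-ideal generated by the differences of the two sides of the relations. -/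
def PresentedStarAlgebra (R : Set (FreeStarAlgebra X × FreeStarAlgebra X)) : Type :=
  RingQuot (StarClosure R)

instance (R : Set (FreeStarAlgebra X × FreeStarAlgebra X)) : Ring (PresentedStarAlgebra R) :=
  inferInstanceAs (Ring (RingQuot (StarClosure R)))

instance (R : Set (FreeStarAlgebra X × FreeStarAlgebra X)) :
    Algebra ℂ (PresentedStarAlgebra R) :=
  inferInstanceAs (Algebra ℂ (RingQuot (StarClosure R)))

instance (R : Set (FreeStarAlgebra X × FreeStarAlgebra X)) : StarRing (PresentedStarAlgebra R) :=
  RingQuot.starRing (StarClosure R) (by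
    intro a b h
    cases h with
    | rel a b h => exact StarClosure.star a b h
    | star a b h =>
      rw [star_star, star_star]
      exact StarClosure.rel a b h)

/-- The quotient map from the free `*`-algebra. -/
def PresentedStarAlgebra.mk (R : Set (FreeStarAlgebra X × FreeStarAlgebra X)) :
    FreeStarAlgebra X →ₐ[ℂ] PresentedStarAlgebra R :=
  RingQuot.mkAlgHom ℂ (StarClosure R)

theorem PresentedStarAlgebra.star_mk (R : Set (FreeStarAlgebra X × FreeStarAlgebra X))
    (a : FreeStarAlgebra X) :
    star (PresentedStarAlgebra.mk R a) = PresentedStarAlgebra.mk R (star a) := by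
  have e : ∀ a : FreeStarAlgebra X, RingQuot.mkAlgHom ℂ (StarClosure R) a
      = (⟨Quot.mk _ a⟩ : RingQuot (StarClosure R)) := by
    intro a
    rw [← RingHom.coe_coe, RingQuot.mkAlgHom_coe]
    simp [RingQuot.mkRingHom]
  unfold PresentedStarAlgebra.mk
  exact (congrArg (star : PresentedStarAlgebra R → PresentedStarAlgebra R) (e a)).trans
    (e (star a)).symm

instance (R : Set (FreeStarAlgebra X × FreeStarAlgebra X)) :
    StarModule ℂ (PresentedStarAlgebra R) where
  star_smul r a := by
    have h0 : star (algebraMap ℂ (PresentedStarAlgebra R) r)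
        = algebraMap ℂ (PresentedStarAlgebra R) (starRingEnd ℂ r) := by
      rw [← (PresentedStarAlgebra.mk R).commutes r, PresentedStarAlgebra.star_mk,
        ← (PresentedStarAlgebra.mk R).commutes]
      exact congrArg _ (freeStar_algebraMap r)
    rw [Algebra.smul_def, star_mul, h0, Algebra.smul_def]
    exact (Algebra.commutes _ _).symm

/-- A generator, as an element of the `*`-algebra given by generators and relations. -/
def PresentedStarAlgebra.gen (R : Set (FreeStarAlgebra X × FreeStarAlgebra X)) (x : X) :
    PresentedStarAlgebra R :=
  PresentedStarAlgebra.mk R (FreeStarAlgebra.gen x)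

theorem PresentedStarAlgebra.star_gen (R : Set (FreeStarAlgebra X × FreeStarAlgebra X)) (x : X) :
    star (PresentedStarAlgebra.gen R x) = PresentedStarAlgebra.gen R (star x) := by
  unfold PresentedStarAlgebra.gen
  rw [PresentedStarAlgebra.star_mk]
  exact congrArg _ (freeStar_gen x)

end

/-! ## The cross product algebras -/

/-- The generators `A`, `B`, `B*`, `E`, `F`, `K`, `K⁻¹`. -/
inductive Gen
  | A | B | Bs | E | F | K | Ki

/-- `A* = A`, `E* = F`, `K* = K`. -/
def Gen.adj : Gen → Gen
  | .A => .A
  | .B => .Bs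
  | .Bs => .B
  | .E => .F
  | .F => .E
  | .K => .K
  | .Ki => .Ki

instance : InvolutiveStar Gen where
  star := Gen.adj
  star_involutive := by intro g; cases g <;> rfl

/-- The generators, with `A⁻¹` added. -/
inductive HatGen
  | of (g : Gen)
  | Ai

/-- `A⁻¹` is hermitian, too. -/
def HatGen.adj : HatGen → HatGen
  | .of g => .of g.adj
  | .Ai => .Ai

instance : InvolutiveStar HatGen where
  star := HatGen.adj
  star_involutive := by
    intro g
    rcases g with g | _
    · cases g <;> rfl
    · rfl

/-- The coefficient `λ = q - q⁻¹`. -/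
def lam (q : ℝ) : ℝ := q - q⁻¹

/-- The defining relations of the cross product of the coordinate algebra of the Podleś sphere
`S²_{qc}` with `U_q(su₂)`. For `c < ∞` take `(s, t) = (1, c)`, for `c = ∞` take
`(s, t) = (0, 1)`. -/
def crossRelations (q s t : ℝ) {R : Type} [Ring R] [Algebra ℂ R] (g : Gen → R) :
    Set (R × R) :=
  let A := g .A
  let B := g .B
  let Bs := g .Bs
  let E := g .E
  let F := g .F
  let K := g .K
  let Ki := g .Ki
  let co : ℝ → ℂ := fun r => (r : ℂ)
  { -- the quantized enveloping algebra
    (K * Ki, 1), (Ki * K, 1),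
    (K * E, co q • (E * K)),
    (F * K, co q • (K * F)),
    (E * F - F * E, co (lam q)⁻¹ • (K * K - Ki * Ki)),
    -- the Podleś sphere
    (A * B, co (q ^ (-2 : ℤ)) • (B * A)),
    (A * Bs, co (q ^ 2) • (Bs * A)),
    (Bs * B, co s • A - A * A + co t • 1),
    (B * Bs, co (s * q ^ 2) • A - co (q ^ 4) • (A * A) + co t • 1),
    -- the cross relations
    (K * A, A * K),
    (E * A, A * E + co (q ^ (-(1 / 2) : ℝ)) • (Bs * K)),
    (F * A, A * F - co (q ^ (-(3 / 2) : ℝ)) • (B * K)),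
    (K * B, co q⁻¹ • (B * K)),
    (E * B, co q • (B * E) - co (q ^ (1 / 2 : ℝ) * (1 + q ^ 2)) • (A * K)
      + co (s * q ^ (1 / 2 : ℝ)) • K),
    (F * B, co q • (B * F)),
    (K * Bs, co q • (Bs * K)),
    (E * Bs, co q⁻¹ • (Bs * E)),
    (F * Bs, co q⁻¹ • (Bs * F) + co (q ^ (-(1 / 2) : ℝ) * (1 + q ^ 2)) • (A * K)
      - co (s * q ^ (-(1 / 2) : ℝ)) • K) }

/-- The coefficient of `A` in the relation for `B* B`: it is `1` for `c < ∞` and `0` for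
`c = ∞`. -/
def linCoeff (c : ℝ≥0∞) : ℝ := if c = ∞ then 0 else 1

/-- The constant term in the relation for `B* B`: it is `c` for `c < ∞` and `1` for `c = ∞`. -/
def constCoeff (c : ℝ≥0∞) : ℝ := if c = ∞ then 1 else c.toReal

/-- The cross product `*`-algebra `O(S²_{qc}) ⋊ U_q(su₂)`, `c ∈ [0, ∞]`. -/
abbrev CrossProduct (q : ℝ) (c : ℝ≥0∞) : Type :=
  PresentedStarAlgebra
    (crossRelations q (linCoeff c) (constCoeff c) (FreeStarAlgebra.gen (X := Gen)))

/-- The generators of `O(S²_{qc}) ⋊ U_q(su₂)`. -/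
def CrossProduct.gen (q : ℝ) (c : ℝ≥0∞) (g : Gen) : CrossProduct q c :=
  PresentedStarAlgebra.gen _ g

/-- The defining relations after the inverse of `A` has been adjoined. -/
def hatRelations (q s t : ℝ) : Set (FreeStarAlgebra HatGen × FreeStarAlgebra HatGen) :=
  crossRelations q s t (fun g => FreeStarAlgebra.gen (HatGen.of g)) ∪
    {(FreeStarAlgebra.gen (.of .A) * FreeStarAlgebra.gen .Ai, 1),
     (FreeStarAlgebra.gen .Ai * FreeStarAlgebra.gen (.of .A), 1)}

/-- The cross product `*`-algebra `Ô(S²_{qc}) ⋊ U_q(su₂)` of the localization of `O(S²_{qc})` at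
the powers of `A`. -/
abbrev HatCrossProduct (q : ℝ) (c : ℝ≥0∞) : Type :=
  PresentedStarAlgebra (hatRelations q (linCoeff c) (constCoeff c))

namespace HatCrossProduct

/-- The generators of `Ô(S²_{qc}) ⋊ U_q(su₂)`. -/
def gen (q : ℝ) (c : ℝ≥0∞) (g : HatGen) : HatCrossProduct q c :=
  PresentedStarAlgebra.gen _ g

/-- `X = q^{3/2} λ F K⁻¹ A + q B`. -/
def X (q : ℝ) (c : ℝ≥0∞) : HatCrossProduct q c :=
  ((q ^ (3 / 2 : ℝ) * lam q : ℝ) : ℂ) • (gen q c (.of .F) * gen q c (.of .Ki) * gen q c (.of .A))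
    + (q : ℂ) • gen q c (.of .B)

/-- `Y = q K⁻² A`. -/
def Y (q : ℝ) (c : ℝ≥0∞) : HatCrossProduct q c :=
  (q : ℂ) • (gen q c (.of .Ki) * gen q c (.of .Ki) * gen q c (.of .A))

/-- `Y⁻¹ = q⁻¹ A⁻¹ K²`. -/
def Yi (q : ℝ) (c : ℝ≥0∞) : HatCrossProduct q c :=
  (q : ℂ)⁻¹ • (gen q c .Ai * gen q c (.of .K) * gen q c (.of .K))

/-- The `*`-subalgebra `𝒴_c` generated by `X`, `X*`, `Y = Y*` and `Y⁻¹`. -/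
def decoupled (q : ℝ) (c : ℝ≥0∞) : Subalgebra ℂ (HatCrossProduct q c) :=
  Algebra.adjoin ℂ {X q c, star (X q c), Y q c, Yi q c}

end HatCrossProduct

/-! ## Unbounded operators -/

section Operators

variable {H : Type*} [NormedAddCommGroup H] [InnerProductSpace ℂ H]

/-- The identity operator, defined everywhere. -/
def idOp : H →ₗ.[ℂ] H := LinearMap.toPMap LinearMap.id ⊤

/-- The product `S T` of unbounded operators, on its natural domain
`{x ∈ D(T) | T x ∈ D(S)}`. -/
def opMul (S T : H →ₗ.[ℂ] H) : H →ₗ.[ℂ] H :=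
  S.comp (T.domRestrict ((S.domain.comap T.toFun).map T.domain.subtype)) (by
    rintro ⟨x, hx, hx'⟩
    obtain ⟨y, hy, rfl⟩ := hx
    exact hy)

/-- Powers of an unbounded operator, on their natural domains. -/
def opPow (T : H →ₗ.[ℂ] H) : ℕ → (H →ₗ.[ℂ] H)
  | 0 => idOp
  | k + 1 => opMul (opPow T k) T

/-- `S` is the square root `T^{1/2}` of `T`: the positive self-adjoint operator with `S² = T`. -/
def IsPositiveSqrt [CompleteSpace H] (S T : H →ₗ.[ℂ] H) : Prop :=
  IsSelfAdjoint S ∧ (∀ x : S.domain, 0 ≤ (⟪(x : H), S x⟫_ℂ).re) ∧ opMul S S = T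

/-- The relation `S T = a T S` for unbounded operators: on vectors of `D(S) ∩ D(T)` one side is
defined if and only if the other one is, and then the two sides agree. -/
def QCommute (a : ℂ) (S T : H →ₗ.[ℂ] H) : Prop :=
  ∀ (x : H) (hS : x ∈ S.domain) (hT : x ∈ T.domain),
    (T ⟨x, hT⟩ ∈ S.domain ↔ S ⟨x, hS⟩ ∈ T.domain) ∧
      ∀ (h₁ : T ⟨x, hT⟩ ∈ S.domain) (h₂ : S ⟨x, hS⟩ ∈ T.domain),
        S ⟨T ⟨x, hT⟩, h₁⟩ = a • T ⟨S ⟨x, hS⟩, h₂⟩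

variable (H) in
/-- A projection-valued (spectral) measure on the Borel sets of the real line. -/
structure SpectralMeasure [CompleteSpace H] where
  proj : Set ℝ → H →L[ℂ] H
  isStarProjection : ∀ s, MeasurableSet s → IsStarProjection (proj s)
  univ : proj Set.univ = 1
  inter : ∀ s t, MeasurableSet s → MeasurableSet t → proj (s ∩ t) = proj s * proj t
  empty : proj ∅ = 0
  iUnion : ∀ s : ℕ → Set ℝ, (∀ i, MeasurableSet (s i)) → Pairwise (Function.onFun Disjoint s) →
    ∀ x, HasSum (fun i => proj (s i) x) (proj (⋃ i, s i) x)

namespace SpectralMeasure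

variable [CompleteSpace H]

theorem re_inner_nonneg (P : SpectralMeasure H) (x : H) {s : Set ℝ} (hs : MeasurableSet s) :
    0 ≤ (⟪x, P.proj s x⟫_ℂ).re := by
  have h := P.isStarProjection s hs
  have h1 : P.proj s (P.proj s x) = P.proj s x := by
    have := congrArg (fun T : H →L[ℂ] H => T x) h.isIdempotentElem.eq
    simpa using this
  have h2 : ⟪x, P.proj s x⟫_ℂ = ⟪P.proj s x, P.proj s x⟫_ℂ := by
    conv_lhs => rw [← h1]
    rw [← ContinuousLinearMap.adjoint_inner_left, ← ContinuousLinearMap.star_eq_adjoint,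
      h.isSelfAdjoint.star_eq]
  rw [h2]
  exact inner_self_nonneg (𝕜 := ℂ)

/-- The measure `s ↦ ⟪x, P(s) x⟫`. -/
def measure (P : SpectralMeasure H) (x : H) : MeasureTheory.Measure ℝ :=
  MeasureTheory.Measure.ofMeasurable (fun s _ => ENNReal.ofReal (⟪x, P.proj s x⟫_ℂ).re)
    (by simp [P.empty])
    (by
      intro s hs hd
      have h := (P.iUnion s hs hd x).mapL (innerSL ℂ x)
      have h' := Complex.hasSum_re h
      simp only [innerSL_apply_apply] at h'
      rw [← h'.tsum_eq]
      exact ENNReal.ofReal_tsum_of_nonneg (fun i => P.re_inner_nonneg x (hs i)) h'.summable)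

/-- `T = ∫ t dP(t)`, on the domain of all `x` with `∫ t² d⟪x, P(t) x⟫ < ∞`. -/
def Represents (P : SpectralMeasure H) (T : H →ₗ.[ℂ] H) : Prop :=
  (∀ x, x ∈ T.domain ↔ ∫⁻ t, ENNReal.ofReal (t ^ 2) ∂(P.measure x) < ∞) ∧
    ∀ x : T.domain, ⟪(x : H), T x⟫_ℂ = ((∫ t, t ∂(P.measure (x : H)) : ℝ) : ℂ)

end SpectralMeasure

/-- `S` and `T` are self-adjoint operators that strongly commute: their spectral measures
commute. -/
def StronglyCommute [CompleteSpace H] (S T : H →ₗ.[ℂ] H) : Prop :=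
  IsSelfAdjoint S ∧ IsSelfAdjoint T ∧
    ∃ P Q : SpectralMeasure H, P.Represents S ∧ Q.Represents T ∧
      ∀ s t, MeasurableSet s → MeasurableSet t → Commute (P.proj s) (Q.proj t)

end Operators

/-! ## Representations -/

/-- A `*`-representation of a complex `*`-algebra on a dense domain of a Hilbert space. -/
structure StarRep (𝒜 : Type*) [Ring 𝒜] [StarRing 𝒜] [Algebra ℂ 𝒜] [StarModule ℂ 𝒜]
    (H : Type*) [NormedAddCommGroup H] [InnerProductSpace ℂ H] where
  domain : Submodule ℂ H
  dense_domain : Dense (domain : Set H)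
  hom : 𝒜 →ₐ[ℂ] Module.End ℂ domain
  inner_hom : ∀ (a : 𝒜) (x y : domain),
    ⟪(hom a x : H), (y : H)⟫_ℂ = ⟪(x : H), (hom (star a) y : H)⟫_ℂ

namespace StarRep

variable {𝒜 : Type*} [Ring 𝒜] [StarRing 𝒜] [Algebra ℂ 𝒜] [StarModule ℂ 𝒜]
  {H : Type*} [NormedAddCommGroup H] [InnerProductSpace ℂ H]

/-- The operator `π(a)` on the Hilbert space, with domain the domain of `π`. -/
def op (π : StarRep 𝒜 H) (a : 𝒜) : H →ₗ.[ℂ] H := ⟨π.domain, π.domain.subtype ∘ₗ π.hom a⟩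

/-- The closure of the operator `π(a)`. -/
def cl (π : StarRep 𝒜 H) (a : 𝒜) : H →ₗ.[ℂ] H := (π.op a).closure

end StarRep

open HatCrossProduct in
/-- Well-behaved `*`-representations of `Ô(S²_{qc}) ⋊ U_q(su₂)`, `c ∈ [0, ∞)`. -/
structure WellBehaved (q : ℝ) (c : ℝ≥0) {H : Type*} [NormedAddCommGroup H]
    [InnerProductSpace ℂ H] [CompleteSpace H] (π : StarRep (HatCrossProduct q c) H) : Prop where
  /-- `A` and `K` are strongly commuting self-adjoint operators. -/
  strong_A_K : StronglyCommute (π.cl (gen q c (.of .A))) (π.cl (gen q c (.of .K)))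
  /-- The spectral projections of `A` commute with all operators of `𝒴_c`. -/
  spectral_A : ∃ P : SpectralMeasure H, P.Represents (π.cl (gen q c (.of .A))) ∧
    ∀ y ∈ decoupled q c, ∀ s, MeasurableSet s → ∀ x : (π.cl y).domain,
      ∃ h : P.proj s x ∈ (π.cl y).domain, π.cl y ⟨P.proj s x, h⟩ = P.proj s (π.cl y x)
  /-- The closed operators given by `X` and `X*` are adjoint to each other. -/
  adjoint_X : (π.cl (X q c)).adjoint = π.cl (star (X q c))
  /-- `Y` and `X* X` are strongly commuting self-adjoint operators. -/
  strong_Y_XX : StronglyCommute (π.cl (Y q c)) (opMul (π.cl (star (X q c))) (π.cl (X q c)))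
  /-- `Y X = q² X Y`. -/
  rel_Y_X : QCommute ((q : ℂ) ^ 2) (π.cl (Y q c)) (π.cl (X q c))
  /-- `Y X* = q⁻² X* Y`. -/
  rel_Y_Xs : QCommute ((q : ℂ) ^ 2)⁻¹ (π.cl (Y q c)) (π.cl (star (X q c)))
  /-- `X* X = q² X X* + (1 - q²) (Y² + c)`. -/
  rel_X_Xs : opMul (π.cl (star (X q c))) (π.cl (X q c))
    = ((q : ℂ) ^ 2) • opMul (π.cl (X q c)) (π.cl (star (X q c)))
      + (1 - (q : ℂ) ^ 2) •
        (opMul (π.cl (Y q c)) (π.cl (Y q c)) + (((c : ℝ) : ℂ) • idOp : H →ₗ.[ℂ] H))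

/-! ## The representations `(I)_{±,H}` -/

/-- `λ_± = 1/2 ± (c + 1/4)^{1/2}`, where `ε = ±1` is the sign. -/
def lamSign (c ε : ℝ) : ℝ := 1 / 2 + ε * √(c + 1 / 4)

/-- `c_±(n) = (c + λ_± q^{2n} - (λ_± q^{2n})²)^{1/2}`. -/
def cSign (q c ε : ℝ) (n : ℕ) : ℝ :=
  √(c + lamSign c ε * q ^ (2 * n) - (lamSign c ε * q ^ (2 * n)) ^ 2)

/-- `λ_n = (1 - q^{2n})^{1/2}`. -/
def lamN (q : ℝ) (n : ℕ) : ℝ := √(1 - q ^ (2 * n))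

/-- `(λ_±^{-2} q^{-2n} c + λ_±^{-1} - q^{2n})^{1/2}`. -/
def dSign (q c ε : ℝ) (n : ℕ) : ℝ :=
  √((lamSign c ε)⁻¹ ^ 2 * (q ^ (2 * n))⁻¹ * c + (lamSign c ε)⁻¹ - q ^ (2 * n))

section TypeOne

variable {G : Type*} [NormedAddCommGroup G] [InnerProductSpace ℂ G]

/-- An invertible self-adjoint operator: self-adjoint with trivial kernel. -/
def IsInvertibleSelfAdjoint [CompleteSpace G] (T : G →ₗ.[ℂ] G) : Prop :=
  IsSelfAdjoint T ∧ ∀ x : T.domain, T x = 0 → (x : G) = 0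

/-- The operator `λ_±^{-2} q^{-2j} c + H^{-4}`. -/
def radicand (q c ε : ℝ) (T : G →ₗ.[ℂ] G) (j : ℕ) : G →ₗ.[ℂ] G :=
  ((((lamSign c ε)⁻¹ ^ 2 * (q ^ (2 * j))⁻¹ * c : ℝ) : ℂ) • idOp : G →ₗ.[ℂ] G)
    + opPow T.inverse 4

/-- The coefficient with first index lowered by one; `η_{-1,j} = 0`. -/
def lowerN (x : ℕ × ℕ → G) : ℕ × ℕ → G
  | (0, _) => 0
  | (n + 1, j) => x (n, j)

/-- The coefficient with second index lowered by one; `η_{n,-1} = 0`. -/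
def lowerJ (x : ℕ × ℕ → G) : ℕ × ℕ → G
  | (_, 0) => 0
  | (n, j + 1) => x (n, j)

/-- `TypeOneActs q c ε T g x y`: the vector `x = ∑ η_{nj}`, `η_{nj} = x (n, j) ∈ G`, lies in the
natural domain of the generator `g` in the representation `(I)_{ε,T}`, and `y = g x`.
The formulas are those of `(I)_{ε,T}` on `⨁_{n,j} G`, sorted by components: for instance
`K η_{nj} = q^{n-j} T η_{nj}`, and
`E η_{nj} = ε q^{-1/2} λ⁻¹ (q^{-n} λ_j (λ_±^{-2} q^{-2j} c + T^{-4})^{1/2} T η_{n,j-1}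
  - q^{-j} (λ_±^{-2} q^{-2n-2} c + λ_±^{-1} - q^{2n+2})^{1/2} T η_{n+1,j})`,
`F η_{nj} = ε q^{-1/2} λ⁻¹ (q^{-n} λ_{j+1} (λ_±^{-2} q^{-2j-2} c + T^{-4})^{1/2} T η_{n,j+1}
  - q^{-j} (λ_±^{-2} q^{-2n} c + λ_±^{-1} - q^{2n})^{1/2} T η_{n-1,j})`. -/
def TypeOneActs [CompleteSpace G] (q c ε : ℝ) (T : G →ₗ.[ℂ] G) :
    HatGen → (ℕ × ℕ → G) → (ℕ × ℕ → G) → Prop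
  | .of .A, x, y => ∀ n j, y (n, j) = ((lamSign c ε * q ^ (2 * n) : ℝ) : ℂ) • x (n, j)
  | .Ai, x, y => ∀ n j, y (n, j) = ((lamSign c ε * q ^ (2 * n) : ℝ) : ℂ)⁻¹ • x (n, j)
  | .of .B, x, y => ∀ n j, y (n, j) = (cSign q c ε (n + 1) : ℂ) • x (n + 1, j)
  | .of .Bs, x, y => ∀ n j, y (n, j) = (cSign q c ε n : ℂ) • lowerN x (n, j)
  | .of .K, x, y => ∀ n j, ∃ z, (x (n, j), z) ∈ T.graph ∧
      y (n, j) = ((q ^ ((n : ℤ) - (j : ℤ)) : ℝ) : ℂ) • z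
  | .of .Ki, x, y => ∀ n j, ∃ z, (x (n, j), z) ∈ T.inverse.graph ∧
      y (n, j) = ((q ^ ((n : ℤ) - (j : ℤ)) : ℝ) : ℂ)⁻¹ • z
  | .of .E, x, y => ∃ S : ℕ → (G →ₗ.[ℂ] G), (∀ j, IsPositiveSqrt (S j) (radicand q c ε T j)) ∧
      ∀ n j, ∃ z w, (x (n, j + 1), z) ∈ (opMul (S (j + 1)) T).graph ∧
        (lowerN x (n, j), w) ∈ T.graph ∧
        y (n, j) = ((ε * q ^ (-(1 / 2) : ℝ) * (lam q)⁻¹ : ℝ) : ℂ) •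
          ((((q ^ n)⁻¹ * lamN q (j + 1) : ℝ) : ℂ) • z
            - (((q ^ j)⁻¹ * dSign q c ε n : ℝ) : ℂ) • w)
  | .of .F, x, y => ∃ S : ℕ → (G →ₗ.[ℂ] G), (∀ j, IsPositiveSqrt (S j) (radicand q c ε T j)) ∧
      ∀ n j, ∃ z w, (lowerJ x (n, j), z) ∈ (opMul (S j) T).graph ∧
        (x (n + 1, j), w) ∈ T.graph ∧
        y (n, j) = ((ε * q ^ (-(1 / 2) : ℝ) * (lam q)⁻¹ : ℝ) : ℂ) •
          ((((q ^ n)⁻¹ * lamN q j : ℝ) : ℂ) • z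
            - (((q ^ j)⁻¹ * dSign q c ε (n + 1) : ℝ) : ℂ) • w)

variable (G) in
/-- The Hilbert space `⨁_{n,j ≥ 0} G`. -/
abbrev DoubleSum : Type _ := lp (fun _ : ℕ × ℕ => G) 2

/-- The vectors that lie in the domains of all powers of `T` and of `T⁻¹`. -/
def smoothVectors (T : G →ₗ.[ℂ] G) : Submodule ℂ G :=
  ⨅ k : ℕ, (opPow T k).domain ⊓ (opPow T.inverse k).domain

/-- The finite sums `∑ η_{nj}`, where each `η_{nj}` lies in the domains of all powers of `T` and
of `T⁻¹`. -/
def typeOneDomain (T : G →ₗ.[ℂ] G) : Submodule ℂ (DoubleSum G) where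
  carrier := {x | {i | x i ≠ 0}.Finite ∧ ∀ i, x i ∈ smoothVectors T}
  zero_mem' := by
    refine ⟨?_, fun i => ?_⟩
    · simp
    · simp
  add_mem' := by
    rintro x y ⟨hx, hx'⟩ ⟨hy, hy'⟩
    refine ⟨(hx.union hy).subset ?_, fun i => (smoothVectors T).add_mem (hx' i) (hy' i)⟩
    intro i hi
    by_contra h
    simp only [Set.mem_union, Set.mem_ofPred_eq, not_or, not_not] at h
    exact hi (by simp [h.1, h.2])
  smul_mem' := by
    rintro a x ⟨hx, hx'⟩
    refine ⟨hx.subset ?_, fun i => (smoothVectors T).smul_mem a (hx' i)⟩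
    intro i hi h
    exact hi (by simp [h])

end TypeOne

end Podles

end

noncomputable section

namespace Podles

section

/-! ## Graphs of unbounded operators -/

section Graphs

variable {H G : Type*} [NormedAddCommGroup H] [InnerProductSpace ℂ H]
  [NormedAddCommGroup G] [InnerProductSpace ℂ G]

/-! Kernel of `A`. The relation for `B* B` bounds `A` and `B`, and the projection `P` onto `ker A`
is a strong limit of polynomials in `A` (mean ergodic theorem). So `P` weakly intertwines every
element `w` with `w A = μ A w`, although `w` may be unbounded (`StarRep.inner_kerProj`). The element
`X` commutes with `A`, and `A` can be moved to either side of `F K⁻¹` in it, at the cost of changing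
the coefficient of `B` from `q` to `q⁻¹`; compressing by `P` gives `q⁻¹ P B = q B P`. Hence `B = 0`
on `ker A`, and `B* B = t` there, which excludes `t > 0`. For `c = 0` both `B` and `B*` vanish on
`ker A`, and the element `E B + α (K - A K)` with a suitable `α` gives `P K = 0`, so `P = 0` because
`K` is invertible.

Classification. Two independent ladders generate the space. The operator `B*` multiplies an
eigenvalue of `A` by `q²` and starts from the roots `l` of `l² = l + c`. The operator `X` commutes
with `A` and with `B*`, and climbs inside each eigenspace of `A`, starting from `ker X*`.

In the eigenspace of a root `l`, let `G` be the ground space `ker (A - l) ∩ ker X*` and `T` the part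
of `K` in `G`. No strong commutation of `K` with `X` is assumed, so the self-adjointness of `T`
needs an argument: the projection onto `G` commutes with `Y`, which is formally `q K⁻² A`, and the
positivity of `Y A` forces `(1 + K²)⁻¹` to preserve `G` (`isSelfAdjoint_part`). On the `j`-th copy
of `G` the operator `Y` is a multiple of `T⁻²`, so the relation between `X* X` and `X X*` computes
`X* X` there, and a polar decomposition of `X` yields the next copy (`IsLevel.exists_succ`).

Nothing else is left in the eigenspace. On a reducing subspace without ground vectors the polar part
of `X` is unitary and `q²`-commutes with `Y`. Transporting the bound `X* X ≥ (1 - q²) Y²` through it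
improves the constant by `q⁻²` each time, whence `Y = 0`, which is impossible
(`eq_bot_of_reducing`). Nothing else is left in the spectrum of `A` either: on the subspace not
reached from the two extreme eigenspaces, `|B|` has dense range, and `B A = q² A B` shows that `‖A‖`
there is at most `q² ‖A‖`, hence zero (`eq_zero_of_forall_pow`). For `c = 0` the second root is `0`,
which is no eigenvalue. The formulas for `E` and `F` are then read off from those for `X*` and `X`.

Converse. On the vectors that are smooth for `T` and `T⁻¹`, the operator `T` is a bijection and the
square roots of `κ + T⁻⁴` act and commute with it. The relations become identities between scalars
on families indexed by `ℕ × ℕ` (`gridOp_crossRel`), and the adjoint relations are shifts of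
summation indices (`gridOp_adjoint`). Density of the smooth vectors comes from cutting off the
bounded operator `T (1 + T²)⁻¹` near `0` (`dense_smoothVectors`). -/

theorem mem_graph_opMul {S T : H →ₗ.[ℂ] H} {x z : H} :
    (x, z) ∈ (opMul S T).graph ↔ ∃ y, (x, y) ∈ T.graph ∧ (y, z) ∈ S.graph := by
  constructor
  · intro h
    rw [LinearPMap.mem_graph_iff] at h
    obtain ⟨⟨y, hy, hyT⟩, h1, h2⟩ := h
    obtain ⟨w, hw, hwy⟩ := hy
    simp only at h1 h2
    subst h1
    refine ⟨T ⟨y, hyT⟩, T.mem_graph ⟨y, hyT⟩, ?_⟩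
    rw [← h2]
    have hS : T ⟨y, hyT⟩ ∈ S.domain := by
      have : w = ⟨y, hyT⟩ := Subtype.ext hwy
      exact this ▸ hw
    exact S.mem_graph ⟨T ⟨y, hyT⟩, hS⟩
  · rintro ⟨y, h1, h2⟩
    rw [LinearPMap.mem_graph_iff] at h1 h2
    obtain ⟨a, ha, hay⟩ := h1
    obtain ⟨b, hb, hbz⟩ := h2
    simp only at ha hay hb hbz
    subst ha hbz
    have hTa : T a ∈ S.domain := by rw [hay, ← hb]; exact b.2
    have hdom : (a : H) ∈ (opMul S T).domain := ⟨⟨a, hTa, rfl⟩, a.2⟩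
    rw [LinearPMap.mem_graph_iff]
    refine ⟨⟨a, hdom⟩, rfl, ?_⟩
    have : b = ⟨T a, hTa⟩ := Subtype.ext (hb.trans hay.symm)
    rw [this]
    rfl

theorem mem_graph_idOp {x y : H} : (x, y) ∈ (idOp : H →ₗ.[ℂ] H).graph ↔ y = x := by
  rw [LinearPMap.mem_graph_iff]
  constructor
  · rintro ⟨a, h1, h2⟩
    exact (h1.symm.trans h2).symm
  · rintro rfl
    exact ⟨⟨y, trivial⟩, rfl, rfl⟩

theorem mem_graph_add {S T : H →ₗ.[ℂ] G} {x : H} {y : G} :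
    (x, y) ∈ (S + T).graph ↔ ∃ a b, (x, a) ∈ S.graph ∧ (x, b) ∈ T.graph ∧ y = a + b := by
  constructor
  · intro h
    rw [LinearPMap.mem_graph_iff] at h
    obtain ⟨⟨z, hz⟩, h1, h2⟩ := h
    simp only at h1 h2
    subst h1
    exact ⟨S ⟨z, hz.1⟩, T ⟨z, hz.2⟩, S.mem_graph ⟨z, hz.1⟩, T.mem_graph ⟨z, hz.2⟩, h2.symm⟩
  · rintro ⟨a, b, h1, h2, rfl⟩
    rw [LinearPMap.mem_graph_iff] at h1 h2
    obtain ⟨s, hs, rfl⟩ := h1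
    obtain ⟨t, ht, rfl⟩ := h2
    simp only at hs ht
    rw [LinearPMap.mem_graph_iff]
    refine ⟨⟨x, hs ▸ s.2, ht ▸ t.2⟩, rfl, ?_⟩
    rw [LinearPMap.add_apply]
    congr 2 <;> exact Subtype.ext (by simp [hs, ht])

theorem mem_graph_smul {S : H →ₗ.[ℂ] G} {r : ℂ} {x : H} {y : G} :
    (x, y) ∈ (r • S).graph ↔ ∃ a, (x, a) ∈ S.graph ∧ y = r • a := by
  constructor
  · intro h
    rw [LinearPMap.mem_graph_iff] at h
    obtain ⟨z, h1, h2⟩ := h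
    simp only at h1 h2
    subst h1
    exact ⟨S z, S.mem_graph z, h2.symm⟩
  · rintro ⟨a, h1, rfl⟩
    rw [LinearPMap.mem_graph_iff] at h1
    obtain ⟨s, hs, rfl⟩ := h1
    rw [LinearPMap.mem_graph_iff]
    exact ⟨s, hs, rfl⟩

theorem mem_domain_iff_exists_graph {T : H →ₗ.[ℂ] G} {x : H} :
    x ∈ T.domain ↔ ∃ y, (x, y) ∈ T.graph := LinearPMap.mem_domain_iff

theorem graph_unique {T : H →ₗ.[ℂ] G} {x : H} {y y' : G} (h : (x, y) ∈ T.graph)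
    (h' : (x, y') ∈ T.graph) : y = y' := LinearPMap.mem_graph_snd_inj T h h' rfl

theorem ker_toFun_eq_bot {T : H →ₗ.[ℂ] G} (hT : ∀ x, (x, 0) ∈ T.graph → x = 0) :
    LinearMap.ker T.toFun = ⊥ := by
  rw [LinearMap.ker_eq_bot']
  intro m hm
  have := hT m (by rw [LinearPMap.mem_graph_iff]; exact ⟨m, rfl, hm⟩)
  exact Subtype.ext this

theorem mem_graph_inverse {T : H →ₗ.[ℂ] G} (hT : ∀ x, (x, 0) ∈ T.graph → x = 0) {x : H} {y : G} :
    (y, x) ∈ T.inverse.graph ↔ (x, y) ∈ T.graph := by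
  rw [LinearPMap.inverse_graph (ker_toFun_eq_bot hT)]
  constructor
  · rintro ⟨⟨a, b⟩, hab, h⟩
    simp only [LinearEquiv.coe_coe, LinearEquiv.prodComm_apply, Prod.swap_prod_mk,
      Prod.mk.injEq] at h
    obtain ⟨rfl, rfl⟩ := h
    exact hab
  · intro h
    exact ⟨(x, y), h, rfl⟩

theorem mem_graph_adjoint [CompleteSpace H] {T : H →ₗ.[ℂ] G} (hT : Dense (T.domain : Set H))
    {y : G} {w : H} :
    (y, w) ∈ T.adjoint.graph ↔ ∀ x z, (x, z) ∈ T.graph → ⟪w, x⟫_ℂ = ⟪y, z⟫_ℂ := by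
  rw [LinearPMap.adjoint_graph_eq_graph_adjoint hT, Submodule.mem_adjoint_iff]
  refine forall_congr' fun a => forall_congr' fun b => forall_congr' fun _ => ?_
  rw [sub_eq_zero]
  constructor
  · intro h
    rw [← inner_conj_symm, ← h, inner_conj_symm]
  · intro h
    rw [← inner_conj_symm, ← h, inner_conj_symm]

theorem dense_domain_of_forall [CompleteSpace H] {T : H →ₗ.[ℂ] G}
    (h : ∀ x, (∀ y z, (y, z) ∈ T.graph → ⟪x, y⟫_ℂ = 0) → x = 0) :
    Dense (T.domain : Set H) := by
  rw [Submodule.dense_iff_topologicalClosure_eq_top, Submodule.topologicalClosure_eq_top_iff,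
    Submodule.eq_bot_iff]
  intro x hx
  refine h x fun y z hyz => ?_
  rw [Submodule.mem_orthogonal'] at hx
  exact hx y (LinearPMap.mem_domain_of_mem_graph hyz)

theorem eq_zero_of_forall_inner_graph {T : H →ₗ.[ℂ] G} (hT : Dense (T.domain : Set H)) {x : H}
    (h : ∀ y z, (y, z) ∈ T.graph → ⟪x, y⟫_ℂ = 0) : x = 0 :=
  hT.eq_zero_of_inner_left ℂ fun y hy => h y _ (T.mem_graph ⟨y, hy⟩)

section SelfAdjoint

variable [CompleteSpace H]

theorem sa_mem_graph {T : H →ₗ.[ℂ] H} (hT : IsSelfAdjoint T) {y w : H} :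
    (y, w) ∈ T.graph ↔ ∀ x z, (x, z) ∈ T.graph → ⟪w, x⟫_ℂ = ⟪y, z⟫_ℂ := by
  conv_lhs => rw [← LinearPMap.isSelfAdjoint_def.mp hT]
  exact mem_graph_adjoint hT.dense_domain

theorem sa_symm {T : H →ₗ.[ℂ] H} (hT : IsSelfAdjoint T) {x y x' y' : H}
    (h : (x, y) ∈ T.graph) (h' : (x', y') ∈ T.graph) : ⟪y, x'⟫_ℂ = ⟪x, y'⟫_ℂ :=
  (sa_mem_graph hT).1 h x' y' h'

theorem isSelfAdjoint_of_graph {T : H →ₗ.[ℂ] H} (hd : Dense (T.domain : Set H))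
    (hs : ∀ x y x' y', (x, y) ∈ T.graph → (x', y') ∈ T.graph → ⟪y, x'⟫_ℂ = ⟪x, y'⟫_ℂ)
    (hm : ∀ y w, (∀ x z, (x, z) ∈ T.graph → ⟪w, x⟫_ℂ = ⟪y, z⟫_ℂ) → (y, w) ∈ T.graph) :
    IsSelfAdjoint T := by
  rw [LinearPMap.isSelfAdjoint_def]
  apply LinearPMap.eq_of_eq_graph
  ext ⟨y, w⟩
  rw [mem_graph_adjoint hd]
  exact ⟨hm y w, fun h x z hxz => hs y w x z h hxz⟩

theorem sa_isClosed_graph {T : H →ₗ.[ℂ] H} (hT : IsSelfAdjoint T) :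
    IsClosed (T.graph : Set (H × H)) := hT.isClosed

/-- A self-adjoint operator with trivial kernel has dense range. -/
theorem sa_eq_zero_of_orthogonal_range {T : H →ₗ.[ℂ] H} (hT : IsSelfAdjoint T)
    (hk : ∀ x, (x, 0) ∈ T.graph → x = 0) {x : H}
    (h : ∀ y z, (y, z) ∈ T.graph → ⟪x, z⟫_ℂ = 0) : x = 0 := by
  apply hk
  rw [sa_mem_graph hT]
  intro y z hyz
  rw [h y z hyz, inner_zero_left]

theorem sa_inverse {T : H →ₗ.[ℂ] H} (hT : IsSelfAdjoint T)
    (hk : ∀ x, (x, 0) ∈ T.graph → x = 0) : IsSelfAdjoint T.inverse := by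
  refine isSelfAdjoint_of_graph (dense_domain_of_forall fun x hx => ?_) ?_ ?_
  · exact sa_eq_zero_of_orthogonal_range hT hk
      fun y z hyz => hx z y ((mem_graph_inverse hk).2 hyz)
  · intro x y x' y' h h'
    rw [mem_graph_inverse hk] at h h'
    exact (sa_symm hT h h').symm
  · intro y w h
    rw [mem_graph_inverse hk, sa_mem_graph hT]
    intro x z hxz
    exact (h z x ((mem_graph_inverse hk).2 hxz)).symm

omit [CompleteSpace H] in
theorem inverse_inj {T : H →ₗ.[ℂ] H}
    (hk : ∀ x, (x, 0) ∈ T.graph → x = 0) : ∀ x, (x, 0) ∈ T.inverse.graph → x = 0 := by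
  intro x hx
  rw [mem_graph_inverse hk] at hx
  exact LinearPMap.graph_fst_eq_zero_snd _ hx rfl

/-- A symmetric operator `T` with `1 + T²` surjective is self-adjoint. -/
theorem isSelfAdjoint_of_surjective_one_add_sq {T : H →ₗ.[ℂ] H}
    (hs : ∀ x y x' y', (x, y) ∈ T.graph → (x', y') ∈ T.graph → ⟪y, x'⟫_ℂ = ⟪x, y'⟫_ℂ)
    (h1 : ∀ g, ∃ x y z, (x, y) ∈ T.graph ∧ (y, z) ∈ T.graph ∧ x + z = g) :
    IsSelfAdjoint T := by
  -- On the domain of `T²` one has `(T - i)(T + i) = 1 + T²`. So both `T - i` and `T + i` are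
  -- surjective, which for a symmetric operator means self-adjointness.
  have hplus : ∀ g, ∃ x y, (x, y) ∈ T.graph ∧ y - Complex.I • x = g := by
    intro g
    obtain ⟨x, y, z, hxy, hyz, rfl⟩ := h1 g
    refine ⟨y + Complex.I • x, z + Complex.I • y,
      T.graph.add_mem hyz (T.graph.smul_mem Complex.I hxy), ?_⟩
    rw [smul_add, smul_smul, Complex.I_mul_I]
    module
  have hminus : ∀ g, ∃ x y, (x, y) ∈ T.graph ∧ y + Complex.I • x = g := by
    intro g
    obtain ⟨x, y, z, hxy, hyz, rfl⟩ := h1 g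
    refine ⟨y - Complex.I • x, z - Complex.I • y,
      T.graph.sub_mem hyz (T.graph.smul_mem Complex.I hxy), ?_⟩
    rw [smul_sub, smul_smul, Complex.I_mul_I]
    module
  refine isSelfAdjoint_of_graph (dense_domain_of_forall fun x hx => ?_) hs ?_
  · obtain ⟨u, v, w, huv, hvw, rfl⟩ := h1 x
    have e1 := hx u v huv
    rw [inner_add_left, hs v w u v hvw huv] at e1
    have e2 : ((‖u‖ ^ 2 + ‖v‖ ^ 2 : ℝ) : ℂ) = 0 := by
      rw [← e1, inner_self_eq_norm_sq_to_K, inner_self_eq_norm_sq_to_K]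
      push_cast
      rfl
    have e3 : ‖u‖ ^ 2 + ‖v‖ ^ 2 = 0 := by exact_mod_cast e2
    have hu : u = 0 := by
      rw [← norm_eq_zero]; nlinarith [sq_nonneg ‖u‖, sq_nonneg ‖v‖]
    have hv : v = 0 := by
      rw [← norm_eq_zero]; nlinarith [sq_nonneg ‖u‖, sq_nonneg ‖v‖]
    subst hu hv
    rw [LinearPMap.graph_fst_eq_zero_snd _ hvw rfl, add_zero]
  · intro y w h
    obtain ⟨u, v, huv, e⟩ := hplus (w - Complex.I • y)
    have h0 : ∀ x z, (x, z) ∈ T.graph → ⟪y - u, z + Complex.I • x⟫_ℂ = 0 := by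
      intro x z hxz
      have e1 := h x z hxz
      have e2 := hs u v x z huv hxz
      have e3 : w - v = Complex.I • (y - u) := by
        rw [smul_sub]
        rw [sub_eq_sub_iff_add_eq_add] at e ⊢
        rw [add_comm, ← sub_eq_sub_iff_add_eq_add] at e
        rw [← sub_eq_zero] at e ⊢
        rw [← neg_eq_zero, ← e]
        abel
      have e4 : ⟪y - u, z⟫_ℂ = ⟪w - v, x⟫_ℂ := by
        rw [inner_sub_left, inner_sub_left, e1, e2]
      rw [inner_add_right, e4, e3, inner_smul_left, inner_smul_right]
      simp
    obtain ⟨a, b, hab, e'⟩ := hminus (y - u)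
    have h2 := h0 a b hab
    rw [e', inner_self_eq_zero, sub_eq_zero] at h2
    subst h2
    have : w = v := by
      have := e
      rw [sub_left_inj] at this
      exact this.symm
    rw [this]
    exact huv

end SelfAdjoint

/-- A subspace of a closed subspace of a product of Hilbert spaces is dense in it if its
orthogonal complement there is trivial. -/
theorem le_topologicalClosure_of_graph_orthogonal [CompleteSpace H] [CompleteSpace G]
    {𝒞 L : Submodule ℂ (H × G)} (hle : 𝒞 ≤ L) (hL : IsClosed (L : Set (H × G)))
    (h : ∀ x y, (x, y) ∈ L → (∀ a b, (a, b) ∈ 𝒞 → ⟪a, x⟫_ℂ + ⟪b, y⟫_ℂ = 0) → x = 0 ∧ y = 0) :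
    L ≤ 𝒞.topologicalClosure := by
  let e := WithLp.prodContinuousLinearEquiv 2 ℂ H G
  let C' : Submodule ℂ (WithLp 2 (H × G)) := 𝒞.comap (e : WithLp 2 (H × G) →ₗ[ℂ] H × G)
  rintro ⟨x, y⟩ hxy
  let v : WithLp 2 (H × G) := e.symm (x, y)
  let K := C'.topologicalClosure
  have hKL : ∀ w ∈ K, e w ∈ L := by
    intro w hw
    have hcl : IsClosed {w : WithLp 2 (H × G) | e w ∈ L} := hL.preimage e.continuous
    have hsub : (C' : Set (WithLp 2 (H × G))) ⊆ {w | e w ∈ L} := fun w hw => hle hw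
    exact closure_minimal hsub hcl hw
  have : CompleteSpace K := C'.isClosed_topologicalClosure.completeSpace_coe
  have hp := K.starProjection_apply_mem v
  have hq : v - K.starProjection v ∈ Kᗮ := K.sub_starProjection_mem_orthogonal v
  have hz := h (e (v - K.starProjection v)).1 (e (v - K.starProjection v)).2
    (by
      change e (v - K.starProjection v) ∈ L
      rw [map_sub]
      exact L.sub_mem (by simpa [v] using hxy) (hKL _ hp))
    (by
      intro a b hab
      have := (Submodule.mem_orthogonal _ _).1 hq (e.symm (a, b))
        (C'.le_topologicalClosure (by simpa [C'] using hab))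
      rw [WithLp.prod_inner_apply] at this
      simpa [e, inner_sub_right] using this)
  have hv : v = K.starProjection v := by
    rw [← sub_eq_zero]
    apply e.injective
    rw [map_zero]
    exact Prod.ext hz.1 hz.2
  have hvK : v ∈ K := hv ▸ hp
  have : e v ∈ closure (𝒞 : Set (H × G)) := by
    have hmaps : Set.MapsTo e (C' : Set (WithLp 2 (H × G))) (𝒞 : Set (H × G)) := fun w hw => hw
    exact hmaps.closure e.continuous hvK
  rw [← SetLike.mem_coe, Submodule.topologicalClosure_coe]
  simpa [v] using this

/-! ### The resolvent of `X* X` obtained from the graph of `X`. -/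

section Resolvent

variable [CompleteSpace H]

/-- `C = (1 + X* X)⁻¹` and `b = X C`. -/
structure IsGraphResolvent (X : H →ₗ.[ℂ] H) (C b : H →L[ℂ] H) : Prop where
  mem : ∀ g, (C g, b g) ∈ X.graph
  mem_adj : ∀ g, (b g, g - C g) ∈ X.adjoint.graph

/-- The orthogonal projection of `(g, 0)` onto the closed graph of `X` is `(C g, b g)`. The
remainder `(g - C g, -b g)` is orthogonal to the graph, which is exactly the statement `X* (b g) = g
- C g`. -/
theorem exists_isGraphResolvent {X : H →ₗ.[ℂ] H} (hd : Dense (X.domain : Set H))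
    (hX : IsClosed (X.graph : Set (H × H))) : ∃ C b : H →L[ℂ] H, IsGraphResolvent X C b := by
  let e := WithLp.prodContinuousLinearEquiv 2 ℂ H H
  let K : Submodule ℂ (WithLp 2 (H × H)) := X.graph.comap (e : WithLp 2 (H × H) →ₗ[ℂ] H × H)
  have hK : IsClosed (K : Set (WithLp 2 (H × H))) := hX.preimage e.continuous
  have : CompleteSpace K := hK.completeSpace_coe
  let R : H →L[ℂ] H × H := (e : WithLp 2 (H × H) →L[ℂ] H × H) ∘L K.starProjection ∘L
    (e.symm : H × H →L[ℂ] WithLp 2 (H × H)) ∘L ContinuousLinearMap.inl ℂ H H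
  refine ⟨ContinuousLinearMap.fst ℂ H H ∘L R, ContinuousLinearMap.snd ℂ H H ∘L R, ?_, ?_⟩
  · intro g
    have := K.starProjection_apply_mem (e.symm (g, 0))
    exact this
  · intro g
    rw [mem_graph_adjoint hd]
    intro x z hxz
    have hq := K.sub_starProjection_mem_orthogonal (e.symm (g, 0))
    have := (Submodule.mem_orthogonal' _ _).1 hq (e.symm (x, z)) (by simpa [K] using hxz)
    rw [WithLp.prod_inner_apply] at this
    simp only [e, WithLp.prodContinuousLinearEquiv_symm_apply, WithLp.ofLp_sub, Prod.fst_sub,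
      Prod.snd_sub, zero_sub, inner_neg_left] at this
    rw [← sub_eq_add_neg, sub_eq_zero] at this
    exact this

namespace IsGraphResolvent

variable {X : H →ₗ.[ℂ] H} {C b : H →L[ℂ] H}

theorem inner_eq (h : IsGraphResolvent X C b) (hd : Dense (X.domain : Set H)) (g k : H) :
    ⟪g, C k⟫_ℂ = ⟪C g, C k⟫_ℂ + ⟪b g, b k⟫_ℂ := by
  have h1 := (mem_graph_adjoint hd).1 (h.mem_adj g) _ _ (h.mem k)
  rw [← h1, ← inner_add_left, add_sub_cancel]

theorem inner_symm (h : IsGraphResolvent X C b) (hd : Dense (X.domain : Set H)) (g k : H) :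
    ⟪C g, k⟫_ℂ = ⟪g, C k⟫_ℂ := by
  rw [← inner_conj_symm, h.inner_eq hd k g, h.inner_eq hd g k, map_add, inner_conj_symm,
    inner_conj_symm]

theorem isSelfAdjoint (h : IsGraphResolvent X C b) (hd : Dense (X.domain : Set H)) :
    IsSelfAdjoint C := by
  rw [ContinuousLinearMap.isSelfAdjoint_iff_isSymmetric]
  exact h.inner_symm hd

theorem re_inner (h : IsGraphResolvent X C b) (hd : Dense (X.domain : Set H)) (g : H) :
    (⟪g, C g⟫_ℂ).re = ‖C g‖ ^ 2 + ‖b g‖ ^ 2 := by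
  rw [h.inner_eq hd, inner_self_eq_norm_sq_to_K, inner_self_eq_norm_sq_to_K]
  norm_cast

theorem nonneg (h : IsGraphResolvent X C b) (hd : Dense (X.domain : Set H)) : 0 ≤ C := by
  rw [ContinuousLinearMap.nonneg_iff_isPositive, ContinuousLinearMap.isPositive_def']
  refine ⟨h.isSelfAdjoint hd, fun g => ?_⟩
  rw [ContinuousLinearMap.reApplyInnerSelf_apply, h.inner_symm hd]
  change 0 ≤ (⟪g, C g⟫_ℂ).re
  rw [h.re_inner hd]
  positivity

theorem one_sub_nonneg (h : IsGraphResolvent X C b) (hd : Dense (X.domain : Set H)) :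
    0 ≤ 1 - C := by
  rw [ContinuousLinearMap.nonneg_iff_isPositive, ContinuousLinearMap.isPositive_def']
  refine ⟨(IsSelfAdjoint.one _).sub (h.isSelfAdjoint hd), fun g => ?_⟩
  rw [ContinuousLinearMap.reApplyInnerSelf_apply]
  have e1 : ((1 : H →L[ℂ] H) - C) g = g - C g := rfl
  have e2 : ⟪g - C g, g⟫_ℂ = ⟪g - C g, g - C g⟫_ℂ + (⟪g, C g⟫_ℂ - ⟪C g, C g⟫_ℂ) := by
    rw [← inner_sub_left, ← inner_add_right, sub_add_cancel]
  rw [e1, e2, h.inner_eq hd, add_sub_cancel_left, inner_self_eq_norm_sq_to_K,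
    inner_self_eq_norm_sq_to_K]
  norm_cast
  positivity

/-- For the difference `(d, e)` of two solutions one has `e = X d` and `X* e = -d`, so `-‖d‖² =
‖e‖²` and both vanish. This is how `C` and `b` are evaluated throughout: it suffices to exhibit the
chain `x`, `X x`, `X* X x`. -/
theorem unique (h : IsGraphResolvent X C b) (hd : Dense (X.domain : Set H)) {x y z : H}
    (hxy : (x, y) ∈ X.graph) (hyz : (y, z) ∈ X.adjoint.graph) : C (x + z) = x ∧ b (x + z) = y := by
  have h1 := X.graph.sub_mem hxy (h.mem (x + z))
  have h2 := X.adjoint.graph.sub_mem hyz (h.mem_adj (x + z))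
  have h3 := (mem_graph_adjoint hd).1 h2 _ _ h1
  have e : z - (x + z - C (x + z)) = -(x - C (x + z)) := by abel
  simp only [e, inner_neg_left] at h3
  have h4 : ((‖x - C (x + z)‖ ^ 2 + ‖y - b (x + z)‖ ^ 2 : ℝ) : ℂ) = 0 := by
    rw [inner_self_eq_norm_sq_to_K, inner_self_eq_norm_sq_to_K] at h3
    push_cast
    rw [neg_eq_iff_add_eq_zero] at h3
    exact h3
  have h5 : ‖x - C (x + z)‖ ^ 2 + ‖y - b (x + z)‖ ^ 2 = 0 := by exact_mod_cast h4
  constructor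
  · rw [eq_comm, ← sub_eq_zero, ← norm_eq_zero]
    nlinarith [sq_nonneg ‖x - C (x + z)‖, sq_nonneg ‖y - b (x + z)‖]
  · rw [eq_comm, ← sub_eq_zero, ← norm_eq_zero]
    nlinarith [sq_nonneg ‖x - C (x + z)‖, sq_nonneg ‖y - b (x + z)‖]

theorem injective (h : IsGraphResolvent X C b) {g : H} (hg : C g = 0) : g = 0 := by
  have h1 := h.mem g
  rw [hg] at h1
  have h2 := LinearPMap.graph_fst_eq_zero_snd _ h1 rfl
  have h3 := h.mem_adj g
  rw [hg, h2, sub_zero] at h3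
  exact LinearPMap.graph_fst_eq_zero_snd _ h3 rfl

end IsGraphResolvent

end Resolvent

end Graphs

end

/-! ### Bounded operators that commute with unbounded ones; projections onto kernels. -/

section

open Filter Topology Polynomial

section Commutes

variable {H : Type*} [NormedAddCommGroup H] [InnerProductSpace ℂ H]

/-- `C T ⊆ T C` for a bounded operator `C`. -/
def Commutes (C : H →L[ℂ] H) (T : H →ₗ.[ℂ] H) : Prop :=
  ∀ x y, (x, y) ∈ T.graph → (C x, C y) ∈ T.graph

namespace Commutes

variable {C C' : H →L[ℂ] H} {T S : H →ₗ.[ℂ] H}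

theorem one : Commutes (1 : H →L[ℂ] H) T := fun _ _ h => h

theorem smul (h : Commutes C T) (r : ℂ) : Commutes (r • C) T :=
  fun x y hxy => T.graph.smul_mem r (h x y hxy)

theorem add (h : Commutes C T) (h' : Commutes C' T) : Commutes (C + C') T :=
  fun x y hxy => T.graph.add_mem (h x y hxy) (h' x y hxy)

theorem sub (h : Commutes C T) (h' : Commutes C' T) : Commutes (C - C') T :=
  fun x y hxy => T.graph.sub_mem (h x y hxy) (h' x y hxy)

theorem mul (h : Commutes C T) (h' : Commutes C' T) : Commutes (C * C') T :=
  fun x y hxy => h _ _ (h' x y hxy)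

theorem aeval (h : Commutes C T) (p : ℂ[X]) : Commutes (aeval C p) T := by
  induction p using Polynomial.induction_on' with
  | add p q hp hq => rw [map_add]; exact hp.add hq
  | monomial n a =>
    rw [aeval_monomial, ← Algebra.smul_def]
    refine Commutes.smul ?_ a
    induction n with
    | zero => rw [pow_zero]; exact one
    | succ n ih => rw [pow_succ]; exact ih.mul h

theorem opMul (hS : Commutes C S) (hT : Commutes C T) : Commutes C (opMul S T) := by
  intro x z h
  rw [mem_graph_opMul] at h ⊢
  obtain ⟨y, h1, h2⟩ := h
  exact ⟨C y, hT _ _ h1, hS _ _ h2⟩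

theorem inverse (h : Commutes C T) (hk : ∀ x, (x, 0) ∈ T.graph → x = 0) :
    Commutes C T.inverse := by
  intro x y hxy
  rw [mem_graph_inverse hk] at hxy ⊢
  exact h _ _ hxy

theorem of_tendsto {ι : Type*} {l : Filter ι} [l.NeBot] {Cs : ι → H →L[ℂ] H}
    (hT : IsClosed (T.graph : Set (H × H))) (h : ∀ i, Commutes (Cs i) T)
    (hl : ∀ x, Tendsto (fun i => Cs i x) l (𝓝 (C x))) : Commutes C T := by
  intro x y hxy
  exact hT.mem_of_tendsto ((hl x).prodMk_nhds (hl y)) (Eventually.of_forall fun i => h i x y hxy)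

end Commutes

/-- Averages of the powers of `1 - (r x)²`. -/
def kerPoly (r : ℝ) (n : ℕ) : ℂ[X] :=
  C (n : ℂ)⁻¹ * ∑ k ∈ Finset.range n, (1 - (C (r : ℂ) * X) ^ 2) ^ k

variable [CompleteSpace H]

/-- Von Neumann's mean ergodic theorem for the contraction `1 - (r e)²`, whose fixed vectors are the
kernel of `e`. It makes the kernel projection a strong limit of polynomials in `e`, so algebraic
relations with `e` pass to the projection. -/
theorem tendsto_kerPoly {e : H →L[ℂ] H} (he : IsSelfAdjoint e) {r : ℝ} (hr : 0 < r)
    (hre : r * ‖e‖ ≤ 1) (x : H) :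
    Tendsto (fun n => aeval e (kerPoly r n) x) atTop (𝓝 ((e.ker).starProjection x)) := by
  set u : H →L[ℂ] H := (r : ℂ) • e with hu
  set f : H →L[ℂ] H := 1 - u * u with hf
  have hus : ∀ x y, ⟪u x, y⟫_ℂ = ⟪x, u y⟫_ℂ := by
    intro x y
    have := (ContinuousLinearMap.isSelfAdjoint_iff_isSymmetric.1 he) x y
    simp only [ContinuousLinearMap.coe_coe] at this
    simp [hu, this]
  have hun : ∀ x, ‖u x‖ ≤ ‖x‖ := by
    intro x
    have h1 : ‖u x‖ = r * ‖e x‖ := by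
      simp [hu, norm_smul, abs_of_pos hr]
    rw [h1]
    calc r * ‖e x‖ ≤ r * (‖e‖ * ‖x‖) := by gcongr; exact e.le_opNorm x
      _ = (r * ‖e‖) * ‖x‖ := by ring
      _ ≤ 1 * ‖x‖ := by gcongr
      _ = ‖x‖ := one_mul _
  have hfn : ‖f‖ ≤ 1 := by
    refine ContinuousLinearMap.opNorm_le_bound _ zero_le_one fun x => ?_
    rw [one_mul, ← sq_le_sq₀ (norm_nonneg _) (norm_nonneg _)]
    have e1 : f x = x - u (u x) := rfl
    rw [e1, @norm_sub_sq ℂ, ← hus, inner_self_eq_norm_sq_to_K]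
    have e2 : RCLike.re ((‖u x‖ : ℂ) ^ 2) = ‖u x‖ ^ 2 := by norm_cast
    have e3 := hun (u x)
    have e4 : ‖u (u x)‖ ^ 2 ≤ ‖u x‖ ^ 2 := by gcongr
    erw [e2]
    nlinarith [sq_nonneg ‖u x‖]
  have hloc : f.eqLocus (1 : H →L[ℂ] H) = e.ker := by
    ext y
    rw [LinearMap.mem_ker]
    change f y = y ↔ e y = 0
    have e1 : f y = y - u (u y) := rfl
    rw [e1, sub_eq_self]
    constructor
    · intro h
      have h2 : ⟪u y, u y⟫_ℂ = 0 := by rw [hus, h, inner_zero_right]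
      rw [inner_self_eq_zero] at h2
      simpa [hu, hr.ne'] using h2
    · intro h
      simp [hu, h]
  have := f.tendsto_birkhoffAverage_orthogonalProjection hfn x
  have h2 : ∀ (K K' : Submodule ℂ H) [K.HasOrthogonalProjection] [K'.HasOrthogonalProjection],
      K = K' → (K.orthogonalProjectionOnto x : H) = K'.starProjection x := by
    intro K K' _ _ h
    subst h
    rfl
  rw [h2 _ _ hloc] at this
  refine this.congr fun n => ?_
  rw [birkhoffAverage, birkhoffSum, kerPoly, map_mul, aeval_C, map_sum, ← Algebra.smul_def,
    smul_apply, sum_apply]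
  congr 1
  refine Finset.sum_congr rfl fun k _ => ?_
  have : aeval e ((1 - (C (r : ℂ) * X) ^ 2) ^ k) = f ^ k := by
    rw [map_pow, map_sub, map_one, map_pow, map_mul, aeval_C, aeval_X, ← Algebra.smul_def, hf, hu,
      sq]
  rw [this]
  change f^[k] x = (f ^ k) x
  clear this
  induction k with
  | zero => rfl
  | succ k ih =>
    have hk : k ∈ Finset.range n := by
      rw [Finset.mem_range] at *
      omega
    rw [Function.iterate_succ_apply', pow_succ', ih hk]
    rfl

/-- Polynomials in `e` commute with `T`, and strong limits preserve this because the graph of `T` is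
closed. -/
theorem Commutes.ker_starProjection {e : H →L[ℂ] H} (he : IsSelfAdjoint e) {T : H →ₗ.[ℂ] H}
    (hT : IsClosed (T.graph : Set (H × H))) (h : Commutes e T) :
    Commutes (e.ker).starProjection T := by
  refine Commutes.of_tendsto hT (fun n => h.aeval (kerPoly (‖e‖ + 1)⁻¹ n))
    (tendsto_kerPoly he (by positivity) ?_)
  rw [inv_mul_le_one₀ (by positivity)]
  linarith

end Commutes

/-! ### Commutation with spectral projections. -/

section Spectral

variable {H : Type*} [NormedAddCommGroup H] [InnerProductSpace ℂ H] [CompleteSpace H]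

open MeasureTheory

namespace SpectralMeasure

variable (P : SpectralMeasure H)

theorem inner_proj {s : Set ℝ} (hs : MeasurableSet s) (x : H) :
    (⟪x, P.proj s x⟫_ℂ).re = ‖P.proj s x‖ ^ 2 := by
  have h := P.isStarProjection s hs
  have h1 : P.proj s (P.proj s x) = P.proj s x := by
    have := congrArg (fun T : H →L[ℂ] H => T x) h.isIdempotentElem.eq
    simpa using this
  have h2 := (ContinuousLinearMap.isSelfAdjoint_iff_isSymmetric.1 h.isSelfAdjoint) x (P.proj s x)
  simp only [ContinuousLinearMap.coe_coe, h1] at h2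
  rw [← h2, inner_self_eq_norm_sq_to_K]
  norm_cast

theorem measure_apply {s : Set ℝ} (hs : MeasurableSet s) (x : H) :
    P.measure x s = ENNReal.ofReal (‖P.proj s x‖ ^ 2) := by
  rw [measure, Measure.ofMeasurable_apply _ hs, P.inner_proj hs]

/-- The representation of `T` by its spectral measure is only given on the diagonal, as `⟪x, T x⟫ =
∫ t dμ_x`. The domain is preserved because the measure of `C x` is at most `‖C‖²` times that of `x`;
the equality `T C x = C T x` is recovered by polarization. -/
theorem commutes_of_commute {P : SpectralMeasure H} {T : H →ₗ.[ℂ] H} (hT : IsSelfAdjoint T)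
    (hP : P.Represents T) {C : H →L[ℂ] H} (hC : IsSelfAdjoint C)
    (h : ∀ s, MeasurableSet s → Commute C (P.proj s)) : Commutes C T := by
  have hc : ∀ s, MeasurableSet s → ∀ x, P.proj s (C x) = C (P.proj s x) := fun s hs x =>
    (congrArg (fun T : H →L[ℂ] H => T x) (h s hs).eq).symm
  have hCs : ∀ x y, ⟪C x, y⟫_ℂ = ⟪x, C y⟫_ℂ := fun x y =>
    (ContinuousLinearMap.isSelfAdjoint_iff_isSymmetric.1 hC) x y
  have hdom : ∀ x, x ∈ T.domain → C x ∈ T.domain := by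
    intro x hx
    rw [hP.1] at hx ⊢
    have hle : P.measure (C x) ≤ (ENNReal.ofReal (‖C‖ ^ 2)) • P.measure x := by
      refine Measure.le_iff.2 fun s hs => ?_
      rw [Measure.smul_apply, P.measure_apply hs, P.measure_apply hs, hc s hs, smul_eq_mul,
        ← ENNReal.ofReal_mul (by positivity), ← mul_pow]
      gcongr
      exact C.le_opNorm _
    refine (lintegral_mono' hle le_rfl).trans_lt ?_
    rw [lintegral_smul_measure]
    exact ENNReal.mul_lt_top ENNReal.ofReal_lt_top hx
  have hq : ∀ x y, (x, y) ∈ T.graph → ⟪x, y⟫_ℂ = ((∫ t, t ∂(P.measure x) : ℝ) : ℂ) := by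
    intro x y hxy
    rw [LinearPMap.mem_graph_iff] at hxy
    obtain ⟨a, rfl, rfl⟩ := hxy
    exact hP.2 a
  have hdiag : ∀ x y z, (x, y) ∈ T.graph → (C x, z) ∈ T.graph → ⟪x, z⟫_ℂ = ⟪C x, y⟫_ℂ := by
    intro x y z h1 h2
    have hp := T.graph.add_mem h1 (T.graph.smul_mem Complex.I h2)
    have hm := T.graph.sub_mem h1 (T.graph.smul_mem Complex.I h2)
    -- With `p` the image of `x` under a spectral projection, the cross term `Re (i ⟪p, C p⟫)`
    -- vanishes since `C` is self-adjoint. Equality of the two measures equates the quadratic form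
    -- of `T` at `x + i C x` and `x - i C x`, and the difference of these is a multiple of `⟪x, T C
    -- x⟫ - ⟪C x, T x⟫`.
    have hmeas : P.measure (x + Complex.I • C x) = P.measure (x - Complex.I • C x) := by
      ext s hs
      rw [P.measure_apply hs, P.measure_apply hs, map_add, map_sub, map_smul, hc s hs]
      set p := P.proj s x
      have e0 : ⟪p, C p⟫_ℂ = ⟪C p, p⟫_ℂ := (hCs p p).symm
      have e1 : (⟪p, C p⟫_ℂ).im = 0 := by
        have : (starRingEnd ℂ) ⟪p, C p⟫_ℂ = ⟪p, C p⟫_ℂ := by rw [inner_conj_symm, e0]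
        exact Complex.conj_eq_iff_im.1 this
      congr 1
      rw [@norm_add_sq ℂ, @norm_sub_sq ℂ, inner_smul_right]
      have : RCLike.re (Complex.I * ⟪p, C p⟫_ℂ) = 0 := by
        change (Complex.I * ⟪p, C p⟫_ℂ).re = 0
        rw [Complex.mul_re, e1]; simp
      rw [this]; ring
    have e1 := hq _ _ hp
    have e2 := hq _ _ hm
    simp only [Prod.smul_mk] at e1 e2
    rw [hmeas, ← e2] at e1
    simp only [inner_add_left, inner_add_right, inner_sub_left, inner_sub_right,
      inner_smul_left, inner_smul_right, Complex.conj_I] at e1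
    have e3 : 2 * Complex.I * (⟪x, z⟫_ℂ - ⟪C x, y⟫_ℂ) = 0 := by
      linear_combination e1
    have e4 : (2 * Complex.I : ℂ) ≠ 0 := by simp
    exact sub_eq_zero.1 ((mul_eq_zero.1 e3).resolve_left e4)
  have hpol : ∀ x y z x' y' z', (x, y) ∈ T.graph → (C x, z) ∈ T.graph → (x', y') ∈ T.graph →
      (C x', z') ∈ T.graph → ⟪x', z⟫_ℂ = ⟪C x', y⟫_ℂ := by
    intro x y z x' y' z' h1 h2 h1' h2'
    have a1 := hdiag x y z h1 h2
    have a2 := hdiag x' y' z' h1' h2'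
    have a3 := hdiag _ _ (z + z') (T.graph.add_mem h1 h1')
      (by simpa using T.graph.add_mem h2 h2')
    have a4 := hdiag _ _ (z + Complex.I • z') (T.graph.add_mem h1 (T.graph.smul_mem Complex.I h1'))
      (by simpa using T.graph.add_mem h2 (T.graph.smul_mem Complex.I h2'))
    simp only [Prod.smul_mk, map_add, map_smul, inner_add_left, inner_add_right,
      inner_smul_left, inner_smul_right, Complex.conj_I] at a3 a4
    have b1 : ⟪x, z'⟫_ℂ + ⟪x', z⟫_ℂ = ⟪C x, y'⟫_ℂ + ⟪C x', y⟫_ℂ := by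
      linear_combination a3 - a1 - a2
    have b2 : Complex.I * (⟪x, z'⟫_ℂ - ⟪x', z⟫_ℂ - (⟪C x, y'⟫_ℂ - ⟪C x', y⟫_ℂ)) = 0 := by
      linear_combination a4 - a1 - (-Complex.I * Complex.I) * a2
    have b3 := (mul_eq_zero.1 b2).resolve_left Complex.I_ne_zero
    linear_combination (b1 - b3) / 2
  intro x y hxy
  obtain ⟨z, hz⟩ := mem_domain_iff_exists_graph.1
    (hdom x (LinearPMap.mem_domain_of_mem_graph hxy))
  have : z = C y := by
    rw [← sub_eq_zero]
    refine hT.dense_domain.eq_zero_of_inner_right ℂ fun v hv => ?_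
    obtain ⟨v', hv'⟩ := mem_domain_iff_exists_graph.1 hv
    obtain ⟨w, hw⟩ := mem_domain_iff_exists_graph.1 (hdom v hv)
    rw [inner_sub_right, hpol x y z v v' w hxy hz hv' hw, hCs, sub_self]
  rw [← this]
  exact hz

end SpectralMeasure

end Spectral

end

/-! ### Squares and square roots of self-adjoint operators. -/

section

open Filter Topology

section SquareRoot

variable {H : Type*} [NormedAddCommGroup H] [InnerProductSpace ℂ H]

theorem mem_graph_opPow_succ {T : H →ₗ.[ℂ] H} {k : ℕ} {x z : H} :
    (x, z) ∈ (opPow T (k + 1)).graph ↔ ∃ y, (x, y) ∈ T.graph ∧ (y, z) ∈ (opPow T k).graph :=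
  mem_graph_opMul

theorem mem_graph_opPow_zero {T : H →ₗ.[ℂ] H} {x z : H} :
    (x, z) ∈ (opPow T 0).graph ↔ z = x := mem_graph_idOp

theorem opPow_one (T : H →ₗ.[ℂ] H) : opPow T 1 = T := by
  apply LinearPMap.eq_of_eq_graph
  ext ⟨x, y⟩
  rw [mem_graph_opPow_succ]
  simp only [mem_graph_opPow_zero]
  constructor
  · rintro ⟨z, h, rfl⟩
    exact h
  · intro h
    exact ⟨y, h, rfl⟩

theorem opPow_two (T : H →ₗ.[ℂ] H) : opPow T 2 = opMul T T :=
  congrArg (fun S => opMul S T) (opPow_one T)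

theorem opPow_four (T : H →ₗ.[ℂ] H) :
    opPow T 4 = opMul (opMul T T) (opMul T T) := by
  apply LinearPMap.eq_of_eq_graph
  ext ⟨x, y⟩
  rw [mem_graph_opPow_succ]
  simp only [mem_graph_opPow_succ (k := 2), opPow_two, mem_graph_opMul]
  constructor
  · rintro ⟨a, h1, b, h2, c, h3, h4⟩
    exact ⟨b, ⟨a, h1, h2⟩, c, h3, h4⟩
  · rintro ⟨b, ⟨a, h1, h2⟩, c, h3, h4⟩
    exact ⟨a, h1, b, h2, c, h3, h4⟩

theorem opMul_self_inj {T : H →ₗ.[ℂ] H} (hk : ∀ x, (x, 0) ∈ T.graph → x = 0) :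
    ∀ x, (x, 0) ∈ (opMul T T).graph → x = 0 := by
  intro x hx
  rw [mem_graph_opMul] at hx
  obtain ⟨y, h1, h2⟩ := hx
  obtain rfl := hk y h2
  exact hk x h1

variable [CompleteSpace H]

/-- A symmetric operator `T` with `1 + T` surjective is self-adjoint. -/
theorem isSelfAdjoint_of_surjective_one_add {T : H →ₗ.[ℂ] H}
    (hs : ∀ x y x' y', (x, y) ∈ T.graph → (x', y') ∈ T.graph → ⟪y, x'⟫_ℂ = ⟪x, y'⟫_ℂ)
    (h1 : ∀ g, ∃ x y, (x, y) ∈ T.graph ∧ x + y = g) : IsSelfAdjoint T := by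
  have h0 : ∀ x, (∀ y z, (y, z) ∈ T.graph → ⟪x, y + z⟫_ℂ = 0) → x = 0 := by
    intro x hx
    obtain ⟨u, v, huv, e⟩ := h1 x
    have := hx u v huv
    rwa [e, inner_self_eq_zero] at this
  refine isSelfAdjoint_of_graph (dense_domain_of_forall fun x hx => ?_) hs ?_
  · obtain ⟨u, v, huv, rfl⟩ := h1 x
    have hu : u = 0 := by
      refine h0 u fun y z hyz => ?_
      rw [inner_add_right, ← hs u v y z huv hyz, ← inner_add_left]
      exact hx y z hyz
    subst hu
    rw [LinearPMap.graph_fst_eq_zero_snd _ huv rfl, add_zero]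
  · intro y w h
    obtain ⟨u, v, huv, e⟩ := h1 (y + w)
    have hu : y - u = 0 := by
      refine h0 _ fun a b hab => ?_
      have e1 := h a b hab
      have e2 := hs u v a b huv hab
      rw [inner_add_right, inner_sub_left, inner_sub_left, ← e1, ← e2]
      have : ⟪u + v, a⟫_ℂ = ⟪y + w, a⟫_ℂ := by rw [e]
      rw [inner_add_left, inner_add_left] at this
      linear_combination -this
    rw [sub_eq_zero] at hu
    subst hu
    rw [← add_left_cancel e]
    exact huv

theorem sa_exists_resolvent {T : H →ₗ.[ℂ] H} (hT : IsSelfAdjoint T) :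
    ∃ C b : H →L[ℂ] H, IsGraphResolvent T C b :=
  exists_isGraphResolvent hT.dense_domain (sa_isClosed_graph hT)

namespace IsGraphResolvent

variable {T : H →ₗ.[ℂ] H} {C b : H →L[ℂ] H}

theorem mem_sa (h : IsGraphResolvent T C b) (hT : IsSelfAdjoint T) (g : H) :
    (b g, g - C g) ∈ T.graph := by
  have := h.mem_adj g
  rwa [LinearPMap.isSelfAdjoint_def.1 hT] at this

theorem unique_sa (h : IsGraphResolvent T C b) (hT : IsSelfAdjoint T) {x y z : H}
    (hxy : (x, y) ∈ T.graph) (hyz : (y, z) ∈ T.graph) : C (x + z) = x ∧ b (x + z) = y := by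
  refine h.unique hT.dense_domain hxy ?_
  rwa [LinearPMap.isSelfAdjoint_def.1 hT]

/-- The chain `b x`, `x - C x`, `T x - b x` consists of successive images under `T`, and its outer
terms add up to `T x`. Uniqueness gives `C T x = b x` and `b T x = x - C x`. -/
theorem commutes (h : IsGraphResolvent T C b) (hT : IsSelfAdjoint T) :
    Commutes C T ∧ Commutes b T := by
  have key : ∀ x y, (x, y) ∈ T.graph → C y = b x ∧ b y = x - C x := by
    intro x y hxy
    have h1 := T.graph.sub_mem hxy (h.mem x)
    have h2 := h.unique_sa hT (h.mem_sa hT x) h1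
    rwa [add_sub_cancel] at h2
  refine ⟨fun x y hxy => ?_, fun x y hxy => ?_⟩
  · rw [(key x y hxy).1]
    exact h.mem x
  · rw [(key x y hxy).2]
    exact h.mem_sa hT x

theorem inner_symm_b (h : IsGraphResolvent T C b) (hT : IsSelfAdjoint T) (g k : H) :
    ⟪b g, k⟫_ℂ = ⟪g, b k⟫_ℂ := by
  have e1 : ⟪b g, k⟫_ℂ = ⟪b g, C k⟫_ℂ + ⟪b g, k - C k⟫_ℂ := by
    rw [← inner_add_right, add_sub_cancel]
  have e2 : ⟪g, b k⟫_ℂ = ⟪C g, b k⟫_ℂ + ⟪g - C g, b k⟫_ℂ := by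
    rw [← inner_add_left, add_sub_cancel]
  rw [e1, e2, sa_symm hT (h.mem g) (h.mem k), sa_symm hT (h.mem_sa hT g) (h.mem_sa hT k)]

theorem isSelfAdjoint_b (h : IsGraphResolvent T C b) (hT : IsSelfAdjoint T) :
    IsSelfAdjoint b := by
  rw [ContinuousLinearMap.isSelfAdjoint_iff_isSymmetric]
  exact h.inner_symm_b hT

/-- A bounded operator commuting with `T` commutes with `(1 + T²)⁻¹` and `T (1 + T²)⁻¹`. -/
theorem commute_of_commutes (h : IsGraphResolvent T C b) (hT : IsSelfAdjoint T)
    {D : H →L[ℂ] H} (hD : Commutes D T) : Commute D C ∧ Commute D b := by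
  have key : ∀ g, C (D g) = D (C g) ∧ b (D g) = D (b g) := by
    intro g
    have h1 := h.unique_sa hT (hD _ _ (h.mem g)) (hD _ _ (h.mem_sa hT g))
    rwa [← map_add, add_sub_cancel] at h1
  exact ⟨ContinuousLinearMap.ext fun g => (key g).1.symm,
    ContinuousLinearMap.ext fun g => (key g).2.symm⟩

end IsGraphResolvent

/-- `1 + T²` is surjective because `(1 + T²)⁻¹` exists as a graph resolvent. -/
theorem sa_opMul_self {T : H →ₗ.[ℂ] H} (hT : IsSelfAdjoint T) : IsSelfAdjoint (opMul T T) := by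
  refine isSelfAdjoint_of_surjective_one_add ?_ ?_
  · intro x y x' y' h h'
    rw [mem_graph_opMul] at h h'
    obtain ⟨a, h1, h2⟩ := h
    obtain ⟨a', h1', h2'⟩ := h'
    rw [sa_symm hT h2 h1', sa_symm hT h1 h2']
  · intro g
    obtain ⟨C, b, h⟩ := sa_exists_resolvent hT
    exact ⟨C g, g - C g, mem_graph_opMul.2 ⟨b g, h.mem g, h.mem_sa hT g⟩, add_sub_cancel _ _⟩

theorem sa_smul {T : H →ₗ.[ℂ] H} (hT : IsSelfAdjoint T) {r : ℝ} (hr : r ≠ 0) :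
    IsSelfAdjoint ((r : ℂ) • T) := by
  refine isSelfAdjoint_of_graph hT.dense_domain ?_ ?_
  · intro x y x' y' h h'
    rw [mem_graph_smul] at h h'
    obtain ⟨a, h1, rfl⟩ := h
    obtain ⟨a', h1', rfl⟩ := h'
    rw [inner_smul_left, inner_smul_right, sa_symm hT h1 h1', Complex.conj_ofReal]
  · intro y w h
    have hr' : (r : ℂ) ≠ 0 := by exact_mod_cast hr
    rw [mem_graph_smul]
    refine ⟨(r : ℂ)⁻¹ • w, ?_, by rw [smul_inv_smul₀ hr']⟩
    rw [sa_mem_graph hT]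
    intro x z hxz
    have := h x _ (mem_graph_smul.2 ⟨z, hxz, rfl⟩)
    rw [inner_smul_left, this, inner_smul_right, map_inv₀, Complex.conj_ofReal,
      inv_mul_cancel_left₀ hr']

theorem re_inner_opMul_self {T : H →ₗ.[ℂ] H} (hT : IsSelfAdjoint T) {x y : H}
    (h : (x, y) ∈ (opMul T T).graph) : 0 ≤ (⟪x, y⟫_ℂ).re := by
  rw [mem_graph_opMul] at h
  obtain ⟨a, h1, h2⟩ := h
  rw [← sa_symm hT h1 h2]
  exact inner_self_nonneg (𝕜 := ℂ)

omit [CompleteSpace H] in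
theorem mem_graph_inverse_toPMap {D : H →L[ℂ] H} (hD : ∀ x, D x = 0 → x = 0) {x y : H} :
    (x, y) ∈ ((D : H →ₗ[ℂ] H).toPMap ⊤).inverse.graph ↔ x = D y := by
  have hg : ∀ x y, (x, y) ∈ ((D : H →ₗ[ℂ] H).toPMap ⊤).graph ↔ y = D x := by
    intro x y
    rw [LinearPMap.mem_graph_iff]
    constructor
    · rintro ⟨a, rfl, rfl⟩
      rfl
    · rintro rfl
      exact ⟨⟨x, trivial⟩, rfl, rfl⟩
  rw [mem_graph_inverse fun x hx => hD x ((hg _ _).1 hx).symm, hg]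

theorem sa_inverse_toPMap {D : H →L[ℂ] H} (hs : IsSelfAdjoint D) (hD : ∀ x, D x = 0 → x = 0) :
    IsSelfAdjoint ((D : H →ₗ[ℂ] H).toPMap ⊤).inverse := by
  have hDs : ∀ x y, ⟪D x, y⟫_ℂ = ⟪x, D y⟫_ℂ := fun x y =>
    (ContinuousLinearMap.isSelfAdjoint_iff_isSymmetric.1 hs) x y
  refine isSelfAdjoint_of_graph (dense_domain_of_forall fun x hx => ?_) ?_ ?_
  · apply hD
    rw [← inner_self_eq_zero (𝕜 := ℂ), hDs]
    exact hx _ _ ((mem_graph_inverse_toPMap hD).2 rfl)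
  · intro x y x' y' h h'
    rw [mem_graph_inverse_toPMap hD] at h h'
    rw [h, h', hDs]
  · intro y w h
    rw [mem_graph_inverse_toPMap hD]
    refine ext_inner_right ℂ fun v => ?_
    rw [hDs]
    exact (h (D v) v ((mem_graph_inverse_toPMap hD).2 rfl)).symm

/-- Pairing with `x` gives `κ ‖x‖² + ‖T⁻² x‖² = 0`, and `T⁻²` is injective. -/
theorem radicand_inj {T : H →ₗ.[ℂ] H} (hT : IsSelfAdjoint T)
    (hk : ∀ x, (x, 0) ∈ T.graph → x = 0) {κ : ℝ} (hκ : 0 ≤ κ) {x : H}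
    (h : (x, 0) ∈ ((κ : ℂ) • (idOp : H →ₗ.[ℂ] H) + opPow T.inverse 4).graph) : x = 0 := by
  have hi := sa_inverse hT hk
  have hM := sa_opMul_self hi
  rw [mem_graph_add] at h
  obtain ⟨a, m, h1, h2, h3⟩ := h
  rw [mem_graph_smul] at h1
  obtain ⟨x', h1, rfl⟩ := h1
  rw [mem_graph_idOp] at h1
  subst h1
  rw [opPow_four, mem_graph_opMul] at h2
  obtain ⟨n, h4, h5⟩ := h2
  have e1 : ⟪n, n⟫_ℂ = ⟪x', m⟫_ℂ := sa_symm hM h4 h5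
  have e2 : m = -((κ : ℂ) • x') := by rw [eq_neg_iff_add_eq_zero, add_comm]; exact h3.symm
  rw [e2, inner_neg_right, inner_smul_right, inner_self_eq_norm_sq_to_K,
    inner_self_eq_norm_sq_to_K] at e1
  have e3 : ‖n‖ ^ 2 = -(κ * ‖x'‖ ^ 2) := by
    have := congrArg Complex.re e1
    simp only [Complex.neg_re, Complex.re_ofReal_mul] at this
    norm_cast at this
  have e4 : n = 0 := by
    rw [← norm_eq_zero]
    nlinarith [sq_nonneg ‖n‖, mul_nonneg hκ (sq_nonneg ‖x'‖)]
  subst e4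
  exact opMul_self_inj (inverse_inj hk) _ h4

/-- The square root of `κ + T⁻⁴`. -/
theorem exists_sqrt_radicand {T : H →ₗ.[ℂ] H} (hT : IsSelfAdjoint T)
    (hk : ∀ x, (x, 0) ∈ T.graph → x = 0) {κ : ℝ} (hκ : 0 ≤ κ) :
    ∃ S : H →ₗ.[ℂ] H, IsPositiveSqrt S ((κ : ℂ) • (idOp : H →ₗ.[ℂ] H) + opPow T.inverse 4) ∧
      (∀ x, (x, 0) ∈ S.graph → x = 0) ∧ ∀ C : H →L[ℂ] H, Commutes C T → Commutes C S := by
  have hi := sa_inverse hT hk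
  have hM := sa_opMul_self hi
  set M := opMul T.inverse T.inverse with hMdef
  have hgr : ∀ x z, (x, z) ∈ ((κ : ℂ) • (idOp : H →ₗ.[ℂ] H) + opPow T.inverse 4).graph ↔
      ∃ m, (x, m) ∈ (opMul M M).graph ∧ z = (κ : ℂ) • x + m := by
    intro x z
    rw [mem_graph_add, opPow_four]
    constructor
    · rintro ⟨a, m, h1, h2, rfl⟩
      rw [mem_graph_smul] at h1
      obtain ⟨x', h1, rfl⟩ := h1
      rw [mem_graph_idOp] at h1
      subst h1
      exact ⟨m, h2, rfl⟩
    · rintro ⟨m, h2, rfl⟩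
      exact ⟨_, m, mem_graph_smul.2 ⟨x, mem_graph_idOp.2 rfl, rfl⟩, h2, rfl⟩
  have hinj : ∀ S : H →ₗ.[ℂ] H, opMul S S = (κ : ℂ) • (idOp : H →ₗ.[ℂ] H) + opPow T.inverse 4 →
      ∀ x, (x, 0) ∈ S.graph → x = 0 := by
    intro S hS x hx
    apply radicand_inj hT hk hκ
    rw [← hS]
    exact mem_graph_opMul.2 ⟨0, hx, S.graph.zero_mem⟩
  -- For `κ = 0` the root is `T⁻²` itself. For `κ > 0` the radicand is `κ (1 + N²)` with `N =
  -- κ^(-1/2) T⁻²`, so it has a bounded inverse whose square root is available from the continuous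
  -- functional calculus.
  rcases hκ.eq_or_lt with rfl | hpos
  · have hsq : opMul M M = ((0 : ℝ) : ℂ) • (idOp : H →ₗ.[ℂ] H) + opPow T.inverse 4 := by
      apply LinearPMap.eq_of_eq_graph
      ext ⟨x, z⟩
      rw [hgr]
      simp
    refine ⟨M, ⟨hM, fun x => ?_, hsq⟩, hinj M hsq, fun C hC => (hC.inverse hk).opMul (hC.inverse hk)⟩
    exact re_inner_opMul_self hi (M.mem_graph x)
  · obtain ⟨r, hr0, hrκ⟩ : ∃ r : ℝ, 0 < r ∧ r * r = κ := ⟨√κ, Real.sqrt_pos.2 hpos,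
      Real.mul_self_sqrt hκ⟩
    have hrC : (r : ℂ) ≠ 0 := by exact_mod_cast hr0.ne'
    have hN : IsSelfAdjoint (((r⁻¹ : ℝ) : ℂ) • M) := sa_smul hM (inv_ne_zero hr0.ne')
    set N := ((r⁻¹ : ℝ) : ℂ) • M with hNdef
    obtain ⟨C, b, hCb⟩ := sa_exists_resolvent hN
    have hC0 := hCb.nonneg hN.dense_domain
    -- With `C = (1 + N²)⁻¹` and `r² = κ`, the operator `s = r⁻¹ C^(1/2)` satisfies `s² = κ⁻¹ C`.
    -- The root wanted is therefore the unbounded inverse of the injective operator `s`.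
    set s : H →L[ℂ] H := ((r⁻¹ : ℝ) : ℂ) • CFC.sqrt C with hs
    have hs0 : 0 ≤ CFC.sqrt C := CFC.sqrt_nonneg C
    have hsp : (CFC.sqrt C).IsPositive := (ContinuousLinearMap.nonneg_iff_isPositive _).1 hs0
    have hss : ∀ x, s (s x) = ((r⁻¹ : ℝ) : ℂ) • ((r⁻¹ : ℝ) : ℂ) • C x := by
      intro x
      have h2 : CFC.sqrt C (CFC.sqrt C x) = C x :=
        congrArg (fun D : H →L[ℂ] H => D x) (CFC.sqrt_mul_sqrt_self C hC0)
      simp only [hs, smul_apply, map_smul, h2]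
    have hsi : ∀ x, s x = 0 → x = 0 := by
      intro x hx
      have := hss x
      rw [hx, map_zero] at this
      have h3 : C x = 0 := by simpa [hr0.ne'] using this.symm
      exact hCb.injective h3
    have hssa : IsSelfAdjoint s := by
      have h1 := hsp.isSelfAdjoint
      have : IsSelfAdjoint ((r⁻¹ : ℝ) : ℂ) := Complex.conj_ofReal _
      exact this.smul h1
    have hNN : ∀ x z, (x, z) ∈ (opMul M M).graph ↔
        (x, ((r⁻¹ : ℝ) : ℂ) • ((r⁻¹ : ℝ) : ℂ) • z) ∈ (opMul N N).graph := by
      have hri : ((r⁻¹ : ℝ) : ℂ) ≠ 0 := by simpa using hrC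
      intro x z
      rw [mem_graph_opMul, mem_graph_opMul]
      constructor
      · rintro ⟨y, h1, h2⟩
        exact ⟨((r⁻¹ : ℝ) : ℂ) • y, mem_graph_smul.2 ⟨y, h1, rfl⟩,
          mem_graph_smul.2 ⟨_, M.graph.smul_mem _ h2, rfl⟩⟩
      · rintro ⟨y, h1, h2⟩
        rw [mem_graph_smul] at h1 h2
        obtain ⟨a, h1, rfl⟩ := h1
        obtain ⟨d, h2, h3⟩ := h2
        refine ⟨a, h1, ?_⟩
        have h4 : ((r⁻¹ : ℝ) : ℂ) • z = d := smul_right_injective H hri h3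
        have h5 := M.graph.smul_mem ((r⁻¹ : ℝ) : ℂ)⁻¹ h2
        simp only [Prod.smul_mk, ← h4] at h5
        rwa [inv_smul_smul₀ hri, inv_smul_smul₀ hri] at h5
    have hsq : opMul ((s : H →ₗ[ℂ] H).toPMap ⊤).inverse ((s : H →ₗ[ℂ] H).toPMap ⊤).inverse
        = (κ : ℂ) • (idOp : H →ₗ.[ℂ] H) + opPow T.inverse 4 := by
      apply LinearPMap.eq_of_eq_graph
      ext ⟨x, z⟩
      rw [hgr, mem_graph_opMul]
      simp only [mem_graph_inverse_toPMap hsi]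
      have e0 : ∀ v : H, (κ : ℂ) • ((r⁻¹ : ℝ) : ℂ) • ((r⁻¹ : ℝ) : ℂ) • v = v := by
        intro v
        rw [smul_smul, smul_smul, ← hrκ, mul_assoc]
        have : (((r * r : ℝ) : ℂ) * (((r⁻¹ : ℝ) : ℂ) * ((r⁻¹ : ℝ) : ℂ))) = 1 := by
          push_cast
          field_simp
        rw [this, one_smul]
      have e1 : ∀ v : H, ((r⁻¹ : ℝ) : ℂ) • ((r⁻¹ : ℝ) : ℂ) • (κ : ℂ) • v = v := by
        intro v
        rw [smul_comm _ (κ : ℂ) v, smul_comm _ (κ : ℂ), e0]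
      constructor
      · rintro ⟨y, rfl, rfl⟩
        refine ⟨z - C z, (hNN _ _).2 ?_, ?_⟩
        · rw [hss]
          have := (opMul N N).graph.smul_mem (((r⁻¹ : ℝ) : ℂ) * ((r⁻¹ : ℝ) : ℂ))
            (mem_graph_opMul.2 ⟨b z, hCb.mem z, hCb.mem_sa hN z⟩)
          simpa only [Prod.smul_mk, mul_smul] using this
        · rw [hss, e0, add_sub_cancel]
      · rintro ⟨m, h1, rfl⟩
        refine ⟨_, ?_, rfl⟩
        rw [hNN, mem_graph_opMul] at h1
        obtain ⟨y, h2, h3⟩ := h1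
        have h4 := (hCb.unique_sa hN h2 h3).1
        rw [hss, ← map_smul, ← map_smul, smul_add, smul_add, e1, h4]
    refine ⟨_, ⟨sa_inverse_toPMap hssa hsi, fun x => ?_, hsq⟩, hinj _ hsq, fun D hD => ?_⟩
    · have hx := LinearPMap.mem_graph _ x
      rw [mem_graph_inverse_toPMap hsi] at hx
      rw [hx]
      have := hsp.re_inner_nonneg_left (((s : H →ₗ[ℂ] H).toPMap ⊤).inverse x)
      change 0 ≤ (⟪((r⁻¹ : ℝ) : ℂ) • CFC.sqrt C _, _⟫_ℂ).re
      rw [inner_smul_left, Complex.conj_ofReal, Complex.re_ofReal_mul]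
      exact mul_nonneg (inv_nonneg.2 hr0.le) this
    · have hDM : Commutes D M := (hD.inverse hk).opMul (hD.inverse hk)
      have hDN : Commutes D N := by
        intro x y hxy
        rw [hNdef, mem_graph_smul] at hxy ⊢
        obtain ⟨a, h1, rfl⟩ := hxy
        exact ⟨D a, hDM _ _ h1, map_smul _ _ _⟩
      have h1 := (hCb.commute_of_commutes hN hDN).1
      have h2 : Commute D (CFC.sqrt C) := (Commute.cfcₙ_nnreal h1.symm _).symm
      intro x y hxy
      rw [mem_graph_inverse_toPMap hsi] at hxy ⊢
      rw [hxy]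
      have h3 : D (CFC.sqrt C y) = CFC.sqrt C (D y) :=
        congrArg (fun E : H →L[ℂ] H => E y) h2.eq
      simp only [hs, smul_apply, map_smul, h3]

end SquareRoot

end

section

open Filter Topology Polynomial

/-! ## Closures of represented elements -/

namespace StarRep

variable {𝒜 : Type*} [Ring 𝒜] [StarRing 𝒜] [Algebra ℂ 𝒜] [StarModule ℂ 𝒜]
  {H : Type*} [NormedAddCommGroup H] [InnerProductSpace ℂ H] (π : StarRep 𝒜 H)

theorem mem_graph_op {a : 𝒜} {x y : H} :
    (x, y) ∈ (π.op a).graph ↔ ∃ v : π.domain, (v : H) = x ∧ (π.hom a v : H) = y := by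
  rw [LinearPMap.mem_graph_iff]
  rfl

theorem mul_apply (a b : 𝒜) (x : π.domain) : π.hom (a * b) x = π.hom a (π.hom b x) := by
  rw [map_mul]; rfl

theorem add_apply (a b : 𝒜) (x : π.domain) : π.hom (a + b) x = π.hom a x + π.hom b x := by
  rw [map_add]; rfl

theorem sub_apply (a b : 𝒜) (x : π.domain) : π.hom (a - b) x = π.hom a x - π.hom b x := by
  rw [map_sub]; rfl

theorem smul_apply (r : ℂ) (a : 𝒜) (x : π.domain) : π.hom (r • a) x = r • π.hom a x := by
  rw [map_smul]; rfl

theorem one_apply (x : π.domain) : π.hom 1 x = x := by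
  rw [map_one]; rfl

theorem inner_hom' (a : 𝒜) (x y : π.domain) :
    ⟪(π.hom (star a) x : H), (y : H)⟫_ℂ = ⟪(x : H), (π.hom a y : H)⟫_ℂ := by
  rw [π.inner_hom, star_star]

variable [CompleteSpace H]

theorem isClosable_op (a : 𝒜) : (π.op a).IsClosable := by
  rw [LinearPMap.isClosable_iff_exists_closed_extension]
  refine ⟨(π.op (star a)).adjoint, LinearPMap.adjoint_isClosed π.dense_domain, ?_⟩
  refine LinearPMap.IsFormalAdjoint.le_adjoint π.dense_domain fun x y => ?_
  exact π.inner_hom' a x y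

theorem graph_cl (a : 𝒜) :
    ((π.cl a).graph : Set (H × H)) = closure ((π.op a).graph : Set (H × H)) := by
  rw [cl, ← (π.isClosable_op a).graph_closure_eq_closure_graph, Submodule.topologicalClosure_coe]

theorem isClosed_graph_cl (a : 𝒜) : IsClosed ((π.cl a).graph : Set (H × H)) := by
  rw [graph_cl]; exact isClosed_closure

theorem mem_graph_cl (a : 𝒜) (x : π.domain) : ((x : H), (π.hom a x : H)) ∈ (π.cl a).graph := by
  rw [← SetLike.mem_coe, graph_cl]
  exact subset_closure (π.mem_graph_op.2 ⟨x, rfl, rfl⟩)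

theorem dense_domain_cl (a : 𝒜) : Dense ((π.cl a).domain : Set H) :=
  π.dense_domain.mono fun x hx =>
    LinearPMap.mem_domain_of_mem_graph (π.mem_graph_cl a ⟨x, hx⟩)

theorem cl_induction {a : 𝒜} {p : H × H → Prop} (hp : IsClosed {v | p v})
    (h : ∀ x : π.domain, p ((x : H), (π.hom a x : H))) {x y : H} (hxy : (x, y) ∈ (π.cl a).graph) :
    p (x, y) := by
  rw [← SetLike.mem_coe, graph_cl] at hxy
  refine closure_minimal ?_ hp hxy
  rintro ⟨u, v⟩ huv
  rw [SetLike.mem_coe, mem_graph_op] at huv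
  obtain ⟨w, rfl, rfl⟩ := huv
  exact h w

theorem mem_graph_adjoint_cl {a : 𝒜} {y w : H} : (y, w) ∈ (π.cl a).adjoint.graph ↔
    ∀ x : π.domain, ⟪w, (x : H)⟫_ℂ = ⟪y, (π.hom a x : H)⟫_ℂ := by
  rw [mem_graph_adjoint (π.dense_domain_cl a)]
  constructor
  · intro h x
    exact h _ _ (π.mem_graph_cl a x)
  · intro h x z hxz
    refine π.cl_induction (p := fun v => ⟪w, v.1⟫_ℂ = ⟪y, v.2⟫_ℂ) ?_ h hxz
    exact isClosed_eq (by fun_prop) (by fun_prop)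

/-- A self-adjoint closure can be tested weakly against the domain of `π`. This turns relations of
the algebra into statements on graphs without any question of domains for the products involved. -/
theorem mem_graph_cl_of_sa {a : 𝒜} (ha : IsSelfAdjoint (π.cl a)) {y w : H} :
    (y, w) ∈ (π.cl a).graph ↔ ∀ x : π.domain, ⟪w, (x : H)⟫_ℂ = ⟪y, (π.hom a x : H)⟫_ℂ := by
  rw [← π.mem_graph_adjoint_cl, LinearPMap.isSelfAdjoint_def.1 ha]

theorem ext_inner_domain {u v : H} (h : ∀ x : π.domain, ⟪u, (x : H)⟫_ℂ = ⟪v, (x : H)⟫_ℂ) :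
    u = v := π.dense_domain.eq_of_inner_left ℂ fun x hx => h ⟨x, hx⟩

/-- `F` is the continuous extension of `π(a)`. -/
def Extends (F : H →L[ℂ] H) (a : 𝒜) : Prop := ∀ x : π.domain, F (x : H) = π.hom a x

theorem exists_extends {a : 𝒜} {r : ℝ} (h : ∀ x : π.domain, ‖(π.hom a x : H)‖ ≤ r * ‖(x : H)‖) :
    ∃ F : H →L[ℂ] H, π.Extends F a := by
  refine ⟨(π.domain.subtype ∘ₗ π.hom a).extendOfNorm π.domain.subtype, fun x => ?_⟩
  exact LinearMap.extendOfNorm_eq (f := π.domain.subtype ∘ₗ π.hom a) (e := π.domain.subtype)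
    π.dense_domain.denseRange_val ⟨r, h⟩ x

variable {π}

theorem Extends.adjoint {F : H →L[ℂ] H} {a : 𝒜} (h : π.Extends F a) :
    π.Extends (ContinuousLinearMap.adjoint F) (star a) := by
  intro x
  refine π.ext_inner_domain fun y => ?_
  rw [ContinuousLinearMap.adjoint_inner_left, h y, π.inner_hom']

theorem Extends.isSelfAdjoint {F : H →L[ℂ] H} {a : 𝒜} (h : π.Extends F a) (ha : star a = a) :
    IsSelfAdjoint F := by
  rw [ContinuousLinearMap.isSelfAdjoint_iff']
  ext x
  have h' := h.adjoint
  rw [ha] at h'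
  refine congrFun (Continuous.ext_on π.dense_domain (ContinuousLinearMap.continuous _)
    (ContinuousLinearMap.continuous _) fun y hy => ?_) x
  rw [h' ⟨y, hy⟩, h ⟨y, hy⟩]

theorem Extends.ext {F F' : H →L[ℂ] H} {a : 𝒜} (h : π.Extends F a) (h' : π.Extends F' a) :
    F = F' := by
  ext x
  refine congrFun (Continuous.ext_on π.dense_domain (ContinuousLinearMap.continuous _)
    (ContinuousLinearMap.continuous _) fun y hy => ?_) x
  rw [h' ⟨y, hy⟩, h ⟨y, hy⟩]

theorem Extends.mul {F F' : H →L[ℂ] H} {a b : 𝒜} (h : π.Extends F a) (h' : π.Extends F' b) :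
    π.Extends (F * F') (a * b) := fun x => by
  rw [mul_apply, ← h, ← h']; rfl

theorem Extends.add {F F' : H →L[ℂ] H} {a b : 𝒜} (h : π.Extends F a) (h' : π.Extends F' b) :
    π.Extends (F + F') (a + b) := fun x => by
  rw [add_apply, Submodule.coe_add, ← h, ← h']; rfl

theorem Extends.sub {F F' : H →L[ℂ] H} {a b : 𝒜} (h : π.Extends F a) (h' : π.Extends F' b) :
    π.Extends (F - F') (a - b) := fun x => by
  rw [sub_apply, Submodule.coe_sub, ← h, ← h']; rfl

theorem Extends.smul {F : H →L[ℂ] H} {a : 𝒜} (h : π.Extends F a) (r : ℂ) :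
    π.Extends (r • F) (r • a) := fun x => by
  rw [smul_apply, Submodule.coe_smul, ← h]; rfl

theorem extends_one : π.Extends 1 (1 : 𝒜) := fun x => by rw [one_apply]; rfl

theorem Extends.aeval {F : H →L[ℂ] H} {a : 𝒜} (h : π.Extends F a) (p : ℂ[X]) :
    π.Extends (aeval F p) (aeval a p) := by
  induction p using Polynomial.induction_on' with
  | add p q hp hq => rw [map_add, map_add]; exact hp.add hq
  | monomial n r =>
    rw [aeval_monomial, aeval_monomial, ← Algebra.smul_def, ← Algebra.smul_def]
    refine Extends.smul ?_ r
    induction n with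
    | zero => rw [pow_zero, pow_zero]; exact extends_one
    | succ n ih => rw [pow_succ, pow_succ]; exact ih.mul h

theorem Extends.mem_graph {F : H →L[ℂ] H} {a : 𝒜} (h : π.Extends F a) {x y : H} :
    (x, y) ∈ (π.cl a).graph ↔ y = F x := by
  constructor
  · intro hxy
    refine π.cl_induction (p := fun v => v.2 = F v.1) ?_ (fun x => (h x).symm) hxy
    exact isClosed_eq (by fun_prop) (by fun_prop)
  · rintro rfl
    have : Set.MapsTo (fun x => (x, F x)) (π.domain : Set H) ((π.cl a).graph : Set (H × H)) := by
      intro x hx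
      have h1 := π.mem_graph_cl a ⟨x, hx⟩
      rw [← h ⟨x, hx⟩] at h1
      exact h1
    have h2 := this.closure (by fun_prop)
    rw [(π.isClosed_graph_cl a).closure_eq] at h2
    exact h2 (π.dense_domain x)

/-- If `b a = r a b` and `b` is bounded, then `b ā ⊆ r ā b`. -/
theorem Extends.intertwine {F : H →L[ℂ] H} {a b : 𝒜} (h : π.Extends F b) {r : ℂ}
    (hab : a * b = r • (b * a)) {x y : H} (hxy : (x, y) ∈ (π.cl a).graph) :
    (F x, r • F y) ∈ (π.cl a).graph := by
  refine π.cl_induction (p := fun v => (F v.1, r • F v.2) ∈ (π.cl a).graph) ?_ (fun x => ?_) hxy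
  · exact (π.isClosed_graph_cl a).preimage (by fun_prop)
  · have h1 := π.mem_graph_cl a (π.hom b x)
    rw [← π.mul_apply, hab, smul_apply, mul_apply, Submodule.coe_smul, ← h, ← h] at h1
    exact h1

theorem Extends.commutes {F : H →L[ℂ] H} {a b : 𝒜} (h : π.Extends F b)
    (hab : a * b = b * a) : Commutes F (π.cl a) := by
  intro x y hxy
  have := h.intertwine (r := 1) (by rw [hab, one_smul]) hxy
  rwa [one_smul] at this

end StarRep

/-! ## The relations of the cross product -/

/-- The relations of the cross product in terms of `h = q^{1/2}`. -/
structure CrossRel (h s t : ℂ) {R : Type*} [Ring R] [Algebra ℂ R] (g : Gen → R) : Prop where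
  KKi : g .K * g .Ki = 1
  KiK : g .Ki * g .K = 1
  KE : g .K * g .E = h ^ 2 • (g .E * g .K)
  FK : g .F * g .K = h ^ 2 • (g .K * g .F)
  EF : g .E * g .F - g .F * g .E = (h ^ 2 - (h ^ 2)⁻¹)⁻¹ • (g .K * g .K - g .Ki * g .Ki)
  AB : g .A * g .B = (h ^ 4)⁻¹ • (g .B * g .A)
  ABs : g .A * g .Bs = h ^ 4 • (g .Bs * g .A)
  BsB : g .Bs * g .B = s • g .A - g .A * g .A + t • 1
  BBs : g .B * g .Bs = (s * h ^ 4) • g .A - h ^ 8 • (g .A * g .A) + t • 1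
  KA : g .K * g .A = g .A * g .K
  EA : g .E * g .A = g .A * g .E + h⁻¹ • (g .Bs * g .K)
  FA : g .F * g .A = g .A * g .F - (h ^ 3)⁻¹ • (g .B * g .K)
  KB : g .K * g .B = (h ^ 2)⁻¹ • (g .B * g .K)
  EB : g .E * g .B = h ^ 2 • (g .B * g .E) - (h * (1 + h ^ 4)) • (g .A * g .K) + (s * h) • g .K
  FB : g .F * g .B = h ^ 2 • (g .B * g .F)
  KBs : g .K * g .Bs = h ^ 2 • (g .Bs * g .K)
  EBs : g .E * g .Bs = (h ^ 2)⁻¹ • (g .Bs * g .E)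
  FBs : g .F * g .Bs = (h ^ 2)⁻¹ • (g .Bs * g .F) + (h⁻¹ * (1 + h ^ 4)) • (g .A * g .K)
    - (s * h⁻¹) • g .K

/-- Every coefficient is a power of `h = q^{1/2}` up to rational functions, so in this form no real
exponents occur and `field_simp` and `ring` can compare coefficients. The homomorphism `f` serves
both to obtain the relations in the quotient algebra and to verify them for concrete operators. -/
theorem crossRel_iff {q : ℝ} (hq : 0 < q) (s t : ℝ) {R : Type} [Ring R] [Algebra ℂ R]
    {R' : Type*} [Ring R'] [Algebra ℂ R'] (f : R →ₐ[ℂ] R') (g : Gen → R) :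
    (∀ p ∈ crossRelations q s t g, f p.1 = f p.2) ↔
      CrossRel ((√q : ℝ) : ℂ) s t fun x => f (g x) := by
  have hh : √q ^ 2 = q := Real.sq_sqrt hq.le
  have e1 : (q : ℂ) = ((√q : ℝ) : ℂ) ^ 2 := by exact_mod_cast hh.symm
  have h0 : q ^ (1 / 2 : ℝ) = √q := (Real.sqrt_eq_rpow q).symm
  have h1 : q ^ (-(1 / 2) : ℝ) = (√q)⁻¹ := by rw [Real.rpow_neg hq.le, h0]
  have h3 : q ^ (-(3 / 2) : ℝ) = (√q ^ 3)⁻¹ := by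
    rw [Real.rpow_neg hq.le, show (3 / 2 : ℝ) = 1 + 1 / 2 by norm_num, Real.rpow_add hq,
      Real.rpow_one, h0]
    congr 1
    nth_rewrite 1 [← hh]
    ring
  have h4 : q ^ (-2 : ℤ) = (q ^ 2)⁻¹ := by
    rw [zpow_neg]; rfl
  have e2 : (√q : ℂ) ^ 4 = (q : ℂ) ^ 2 := by rw [e1]; ring
  have e3 : (√q : ℂ) ^ 8 = (q : ℂ) ^ 4 := by rw [e1]; ring
  simp only [crossRelations, Set.mem_insert_iff, Set.mem_singleton_iff, forall_eq_or_imp,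
    forall_eq, h0, h1, h3, h4, lam, map_mul, map_one, map_sub, map_add, map_smul]
  push_cast
  constructor
  · rintro ⟨a1, a2, a3, a4, a5, a6, a7, a8, a9, a10, a11, a12, a13, a14, a15, a16, a17, a18⟩
    constructor <;> (try simp only [← e1, e2, e3]) <;> assumption
  · rintro ⟨a1, a2, a3, a4, a5, a6, a7, a8, a9, a10, a11, a12, a13, a14, a15, a16, a17, a18⟩
    simp only [← e1, e2, e3] at a1 a2 a3 a4 a5 a6 a7 a8 a9 a10 a11 a12 a13 a14 a15 a16 a17 a18
    exact ⟨a1, a2, a3, a4, a5, a6, a7, a8, a9, a10, a11, a12, a13, a14, a15, a16, a17, a18⟩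

end

/-! ### Computations with the relations of the cross product. -/

section

namespace CrossRel

variable {h s t : ℂ} {R : Type*} [Ring R] [Algebra ℂ R] {g : Gen → R}

theorem reassoc {a b c : R} (e : a * b = c) (z : R) : a * (b * z) = c * z := by
  rw [← mul_assoc, e]

theorem BA (hr : CrossRel h s t g) (h0 : h ≠ 0) : g .B * g .A = h ^ 4 • (g .A * g .B) := by
  rw [hr.AB, smul_smul, mul_inv_cancel₀ (pow_ne_zero _ h0), one_smul]

theorem BsA (hr : CrossRel h s t g) (h0 : h ≠ 0) :
    g .Bs * g .A = (h ^ 4)⁻¹ • (g .A * g .Bs) := by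
  rw [hr.ABs, smul_smul, inv_mul_cancel₀ (pow_ne_zero _ h0), one_smul]

theorem Ki_mul (hr : CrossRel h s t g) {r : ℂ} (hr0 : r ≠ 0) {a : R}
    (e : g .K * a = r • (a * g .K)) : g .Ki * a = r⁻¹ • (a * g .Ki) := by
  have h1 : g .Ki * (g .K * a) * g .Ki = r • (g .Ki * (a * g .K) * g .Ki) := by
    rw [e, mul_smul_comm, smul_mul_assoc]
  have h2 : g .Ki * (g .K * a) * g .Ki = a * g .Ki := by
    rw [← mul_assoc, hr.KiK, one_mul]
  have h3 : g .Ki * (a * g .K) * g .Ki = g .Ki * a := by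
    rw [mul_assoc, mul_assoc, hr.KKi, mul_one]
  rw [← h2, h1, h3, smul_smul, inv_mul_cancel₀ hr0, one_smul]

theorem KF (hr : CrossRel h s t g) (h0 : h ≠ 0) :
    g .K * g .F = (h ^ 2)⁻¹ • (g .F * g .K) := by
  rw [hr.FK, smul_smul, inv_mul_cancel₀ (pow_ne_zero _ h0), one_smul]

theorem KiA (hr : CrossRel h s t g) : g .Ki * g .A = g .A * g .Ki := by
  have := hr.Ki_mul (r := 1) one_ne_zero (a := g .A) (by rw [hr.KA, one_smul])
  rwa [inv_one, one_smul] at this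

theorem KiB (hr : CrossRel h s t g) (h0 : h ≠ 0) : g .Ki * g .B = h ^ 2 • (g .B * g .Ki) := by
  have := hr.Ki_mul (inv_ne_zero (pow_ne_zero 2 h0)) hr.KB
  rwa [inv_inv] at this

theorem KiBs (hr : CrossRel h s t g) (h0 : h ≠ 0) :
    g .Ki * g .Bs = (h ^ 2)⁻¹ • (g .Bs * g .Ki) := hr.Ki_mul (pow_ne_zero 2 h0) hr.KBs

theorem KiE (hr : CrossRel h s t g) (h0 : h ≠ 0) :
    g .Ki * g .E = (h ^ 2)⁻¹ • (g .E * g .Ki) := hr.Ki_mul (pow_ne_zero 2 h0) hr.KE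

theorem KiF (hr : CrossRel h s t g) (h0 : h ≠ 0) : g .Ki * g .F = h ^ 2 • (g .F * g .Ki) := by
  have := hr.Ki_mul (inv_ne_zero (pow_ne_zero 2 h0)) (hr.KF h0)
  rwa [inv_inv] at this

end CrossRel

variable (h : ℂ) {R : Type*} [Ring R] [Algebra ℂ R] (g : Gen → R)

/-- `X = q^{3/2} λ F K⁻¹ A + q B`. -/
def elX : R := (h ^ 3 * (h ^ 2 - (h ^ 2)⁻¹)) • (g .F * g .Ki * g .A) + h ^ 2 • g .B

/-- `X* = q^{3/2} λ A K⁻¹ E + q B*`. -/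
def elXs : R := (h ^ 3 * (h ^ 2 - (h ^ 2)⁻¹)) • (g .A * (g .Ki * g .E)) + h ^ 2 • g .Bs

/-- `Y = q K⁻² A`. -/
def elY : R := h ^ 2 • (g .Ki * g .Ki * g .A)

/-- The relations between `X`, `X*`, `Y` and the generators. -/
structure DecoupledRel : Prop where
  X_mul_A : elX h g * g .A = g .A * elX h g
  X_eq : elX h g = (h ^ 3 * (h ^ 2 - (h ^ 2)⁻¹)) • (g .A * (g .F * g .Ki)) + (h ^ 2)⁻¹ • g .B
  Xs_mul_A : elXs h g * g .A = g .A * elXs h g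
  X_mul_Bs : elX h g * g .Bs = g .Bs * elX h g
  Xs_mul_Bs : elXs h g * g .Bs = g .Bs * elXs h g
  K_mul_X : g .K * elX h g = (h ^ 2)⁻¹ • (elX h g * g .K)
  K_mul_Xs : g .K * elXs h g = h ^ 2 • (elXs h g * g .K)
  Y_mul_A : elY h g * g .A = g .A * elY h g
  Xs_mul_K : elXs h g * g .K = (h * (h ^ 2 - (h ^ 2)⁻¹)) • (g .A * g .E)
    + h ^ 2 • (g .Bs * g .K)

variable {h g} {s t : ℂ}

open CrossRel in
-- The relations are used as rewrite rules that sort every monomial: `A` to the left of `B` and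
-- `B*`, these to the left of `E` and `F`, and `K`, `K⁻¹` on the right. After sorting only
-- coefficients remain to be compared.
theorem CrossRel.decoupled (hr : CrossRel h s t g) (h0 : h ≠ 0) :
    DecoupledRel h g := by
  constructor <;>
  simp only [elX, elXs, elY, mul_add, add_mul, mul_sub, sub_mul, smul_mul_assoc, mul_smul_comm,
    mul_assoc, smul_smul, smul_add, smul_sub, one_mul, mul_one,
    hr.KKi, hr.KiK, hr.KA, hr.KiA, hr.KB, hr.KBs, hr.KE, hr.KF h0, hr.KiB h0, hr.KiBs h0, hr.KiE
    h0, hr.KiF h0, hr.EA, hr.FA, hr.EB, hr.FB, hr.EBs, hr.FBs, hr.BA h0, hr.BsA h0, hr.BsB,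
    hr.BBs, reassoc hr.KKi, reassoc hr.KiK, reassoc hr.KA, reassoc hr.KiA, reassoc hr.KB,
    reassoc hr.KBs, reassoc hr.KE, reassoc (hr.KF h0), reassoc (hr.KiB h0), reassoc (hr.KiBs
    h0), reassoc (hr.KiE h0), reassoc (hr.KiF h0), reassoc hr.EA, reassoc hr.FA, reassoc hr.EB,
    reassoc hr.FB, reassoc hr.EBs, reassoc hr.FBs, reassoc (hr.BA h0), reassoc (hr.BsA h0),
    reassoc hr.BsB, reassoc hr.BBs] <;>
  match_scalars <;> field_simp <;> ring


open CrossRel in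
-- Moving `A` through `E B` produces `B B* K`, which for `t = 0` is a combination of `A K` and `A²
-- K`. The correction by `α` absorbs these terms, and the condition on `α` is the comparison of
-- coefficients of `A K`.
theorem CrossRel.elW_mul_A (hr : CrossRel h s t g) (h0 : h ≠ 0) (hs : s = 1) (ht : t = 0) {α : ℂ}
    (hα : h + α = h ^ 4 * α) :
    (g .E * g .B + α • g .K - α • (g .A * g .K)) * g .A
      = h ^ 4 • (g .A * (g .E * g .B + α • g .K - α • (g .A * g .K))) := by
  subst hs ht
  simp only [mul_add, add_mul, mul_sub, sub_mul, smul_mul_assoc, mul_smul_comm,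
    mul_assoc, smul_smul, smul_add, smul_sub, one_mul, mul_one, hr.KA, hr.EA, hr.EB,
    reassoc (hr.BA h0), reassoc hr.BBs]
  match_scalars <;> field_simp
  · linear_combination hα
  · linear_combination -hα
  · simp

end

/-! ### The kernel of `A`. -/

section

open Filter Topology Polynomial

section KernelA

theorem mul_aeval_of_mul_eq_smul {R : Type*} [Ring R] [Algebra ℂ R] {w a : R} {μ : ℂ}
    (h : w * a = μ • (a * w)) (p : ℂ[X]) : w * aeval a p = aeval (μ • a) p * w := by
  induction p using Polynomial.induction_on' with
  | add p q hp hq => rw [map_add, map_add, mul_add, add_mul, hp, hq]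
  | monomial n r =>
    rw [aeval_monomial, aeval_monomial, ← Algebra.smul_def, ← Algebra.smul_def, mul_smul_comm,
      smul_mul_assoc]
    congr 1
    induction n with
    | zero => simp
    | succ n ih =>
      rw [pow_succ, pow_succ, ← mul_assoc, ih, mul_assoc, h, mul_assoc, smul_mul_assoc]

variable {𝒜 : Type*} [Ring 𝒜] [StarRing 𝒜] [Algebra ℂ 𝒜] [StarModule ℂ 𝒜]
  {H : Type*} [NormedAddCommGroup H] [InnerProductSpace ℂ H] [CompleteSpace H]
  {π : StarRep 𝒜 H}

/-- The projection onto the kernel of `a` intertwines every element that `μ`-commutes with `a`,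
in the weak sense. -/
theorem StarRep.inner_kerProj {a w : 𝒜} {A : H →L[ℂ] H} (hA : π.Extends A a)
    (hsa : IsSelfAdjoint A) {μ : ℝ} (hμ0 : 0 < μ) (hμ1 : μ ≤ 1)
    (h : w * a = (μ : ℂ) • (a * w)) (φ ψ : π.domain) :
    ⟪A.ker.starProjection (π.hom w φ : H), (ψ : H)⟫_ℂ
      = ⟪A.ker.starProjection (φ : H), (π.hom (star w) ψ : H)⟫_ℂ := by
  have hμA : π.Extends ((μ : ℂ) • A) ((μ : ℂ) • a) := hA.smul _
  have hsa' : IsSelfAdjoint ((μ : ℂ) • A) := by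
    have : IsSelfAdjoint (μ : ℂ) := Complex.conj_ofReal _
    exact this.smul hsa
  have hker : ((μ : ℂ) • A).ker = A.ker := by
    ext x
    simp [hμ0.ne']
  have hr : (‖A‖ + 1)⁻¹ * ‖A‖ ≤ 1 := by
    rw [inv_mul_le_one₀ (by positivity)]; linarith
  have hr' : (‖A‖ + 1)⁻¹ * ‖(μ : ℂ) • A‖ ≤ 1 := by
    refine le_trans ?_ hr
    gcongr
    rw [norm_smul, Complex.norm_real, Real.norm_of_nonneg hμ0.le]
    exact mul_le_of_le_one_left (norm_nonneg _) hμ1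
  -- The same polynomials are evaluated at `A` and at `μ A`. Since `ker (μ A) = ker A`, both
  -- sequences converge to the same projection, while `w p(a) = p(μ a) w` holds for every polynomial
  -- `p`.
  have l1 := tendsto_kerPoly hsa (by positivity) hr (φ : H)
  have l2 := tendsto_kerPoly hsa' (by positivity) hr' (π.hom w φ : H)
  have h3 : ∀ (K K' : Submodule ℂ H) [K.HasOrthogonalProjection] [K'.HasOrthogonalProjection]
      (x : H), K = K' → K.starProjection x = K'.starProjection x := by
    intro K K' _ _ x h
    subst h
    rfl
  rw [h3 _ _ _ hker] at l2
  have l3 := l1.inner (𝕜 := ℂ) (tendsto_const_nhds (x := (π.hom (star w) ψ : H)))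
  have l4 := l2.inner (𝕜 := ℂ) (tendsto_const_nhds (x := (ψ : H)))
  refine tendsto_nhds_unique (l4.congr fun n => ?_) l3
  set p := kerPoly (‖A‖ + 1)⁻¹ n
  rw [hμA.aeval p, hA.aeval p, ← π.inner_hom, ← π.mul_apply, ← π.mul_apply,
    mul_aeval_of_mul_eq_smul h]

theorem kerProj_apply_self {A : H →L[ℂ] H} (hA : IsSelfAdjoint A) (x : H) :
    A.ker.starProjection (A x) = 0 := by
  rw [Submodule.starProjection_apply_eq_zero_iff, Submodule.mem_orthogonal]
  intro u hu
  have hu' : A u = 0 := hu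
  have := (ContinuousLinearMap.isSelfAdjoint_iff_isSymmetric.1 hA) u x
  change ⟪A u, x⟫_ℂ = ⟪u, A x⟫_ℂ at this
  rw [← this, hu', inner_zero_left]

theorem inner_kerProj_left {A : H →L[ℂ] H} (x y : H) :
    ⟪A.ker.starProjection x, y⟫_ℂ = ⟪x, A.ker.starProjection y⟫_ℂ :=
  Submodule.inner_starProjection_left_eq_right _ _ _

/-- The bounded operators `A` and `B`. -/
theorem exists_extends_A_B {h s t : ℝ} (hs : 0 ≤ s) (ht : 0 ≤ t) {g : Gen → 𝒜}
    (hr : CrossRel (h : ℂ) s t g) (hg : ∀ x, star (g x) = g (star x)) :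
    ∃ A B : H →L[ℂ] H, π.Extends A (g .A) ∧ π.Extends B (g .B) := by
  -- This is the relation for `B* B` in the form sense. As its left side is nonnegative, `a = ‖A x‖`
  -- and `f = ‖x‖` satisfy `a² ≤ s f a + t f²`, which bounds `A` and then `B`.
  have hB : ∀ x : π.domain, ‖(π.hom (g .B) x : H)‖ ^ 2
      = s * (⟪(x : H), (π.hom (g .A) x : H)⟫_ℂ).re - ‖(π.hom (g .A) x : H)‖ ^ 2
        + t * ‖(x : H)‖ ^ 2 := by
    intro x
    have e1 : ⟪(π.hom (g .B) x : H), (π.hom (g .B) x : H)⟫_ℂ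
        = ⟪(x : H), (π.hom (g .Bs * g .B) x : H)⟫_ℂ := by
      rw [π.inner_hom, hg, ← π.mul_apply]
      rfl
    have e2 : ⟪(x : H), (π.hom (g .A * g .A) x : H)⟫_ℂ
        = ⟪(π.hom (g .A) x : H), (π.hom (g .A) x : H)⟫_ℂ := by
      rw [π.inner_hom (g .A) x (π.hom (g .A) x), hg, ← π.mul_apply]
      rfl
    rw [hr.BsB, π.add_apply, π.sub_apply, π.smul_apply, π.smul_apply, π.one_apply,
      Submodule.coe_add, Submodule.coe_sub, Submodule.coe_smul, Submodule.coe_smul, inner_add_right,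
      inner_sub_right, inner_smul_right, inner_smul_right, e2] at e1
    have e3 := congrArg Complex.re e1
    rw [inner_self_eq_norm_sq_to_K, inner_self_eq_norm_sq_to_K, inner_self_eq_norm_sq_to_K,
      Complex.add_re, Complex.sub_re, Complex.re_ofReal_mul, Complex.re_ofReal_mul] at e3
    have e4 : ∀ r : ℝ, Complex.re ((r : ℂ) ^ 2) = r ^ 2 := fun r => by norm_cast
    simpa only [Complex.coe_algebraMap, e4] using e3
  have hi : ∀ x : π.domain, (⟪(x : H), (π.hom (g .A) x : H)⟫_ℂ).re
      ≤ ‖(x : H)‖ * ‖(π.hom (g .A) x : H)‖ := fun x =>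
    (Complex.re_le_norm _).trans (norm_inner_le_norm _ _)
  have hAb : ∀ x : π.domain, ‖(π.hom (g .A) x : H)‖ ≤ (s + t + 1) * ‖(x : H)‖ := by
    intro x
    by_contra hcon
    push Not at hcon
    have h1 := hB x
    have h2 := mul_le_mul_of_nonneg_left (hi x) hs
    set a := ‖(π.hom (g .A) x : H)‖
    set f := ‖(x : H)‖
    have hf : 0 ≤ f := norm_nonneg _
    have h3 : a ^ 2 ≤ s * (f * a) + t * f ^ 2 := by
      nlinarith [sq_nonneg ‖(π.hom (g .B) x : H)‖]
    have ha : 0 < a := lt_of_le_of_lt (by positivity) hcon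
    have h5 : f ≤ a := by nlinarith [mul_nonneg hs hf, mul_nonneg ht hf]
    have h6 : (s + t + 1) * f * a < a ^ 2 := by nlinarith
    have h7 : t * (f * f) ≤ t * (f * a) := by gcongr
    nlinarith [mul_nonneg hf ha.le]
  have hBb : ∀ x : π.domain, ‖(π.hom (g .B) x : H)‖
      ≤ √(s * (s + t + 1) + t) * ‖(x : H)‖ := by
    intro x
    rw [← Real.sqrt_sq (norm_nonneg (x : H)), ← Real.sqrt_mul (by positivity)]
    apply Real.le_sqrt_of_sq_le
    rw [hB x]
    have h2 := mul_le_mul_of_nonneg_left (hi x) hs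
    have h3 := mul_le_mul_of_nonneg_left (hAb x) (mul_nonneg hs (norm_nonneg (x : H)))
    nlinarith [sq_nonneg ‖(π.hom (g .A) x : H)‖]
  obtain ⟨A, hA⟩ := π.exists_extends hAb
  obtain ⟨B, hB'⟩ := π.exists_extends hBb
  exact ⟨A, B, hA, hB'⟩

/-- The kernel of `A` is trivial. -/
theorem ker_A_eq_zero {h s t : ℝ} (h0 : 0 < h) (h1 : h < 1) (hst : (0 ≤ s ∧ 0 < t) ∨ (s = 1 ∧ t = 0))
    {g : Gen → 𝒜} (hr : CrossRel (h : ℂ) s t g) (hg : ∀ x, star (g x) = g (star x))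
    {x : H} (hx : (x, 0) ∈ (π.cl (g .A)).graph) : x = 0 := by
  have hs : 0 ≤ s := by rcases hst with h | h; exacts [h.1, h.1 ▸ zero_le_one]
  have ht : 0 ≤ t := by rcases hst with h | h; exacts [h.2.le, h.2.ge]
  have hc0 : (h : ℂ) ≠ 0 := by exact_mod_cast h0.ne'
  obtain ⟨A, B, hA, hB⟩ := exists_extends_A_B (π := π) hs ht hr hg
  have hAsa : IsSelfAdjoint A := hA.isSelfAdjoint (hg .A)
  set Bs := ContinuousLinearMap.adjoint B with hBsdef
  have hBs : π.Extends Bs (g .Bs) := by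
    have := hB.adjoint
    rwa [hg .B] at this
  have hd := hr.decoupled hc0
  rw [hA.mem_graph] at hx
  set P := A.ker.starProjection with hP
  have hPfix : ∀ y, A y = 0 → P y = y := by
    intro y hy
    exact Submodule.starProjection_eq_self_iff.2 hy
  have hPA : ∀ y, P (A y) = 0 := kerProj_apply_self hAsa
  have hPs : ∀ y z, ⟪P y, z⟫_ℂ = ⟪y, P z⟫_ℂ := inner_kerProj_left
  have hAP : ∀ y, A (P y) = 0 := fun y => LinearMap.mem_ker.1 (A.ker.starProjection_apply_mem y)
  have eBsB : Bs * B = (s : ℂ) • A - A * A + (t : ℂ) • 1 := by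
    have := hBs.mul hB
    rw [hr.BsB] at this
    exact this.ext (((hA.smul _).sub (hA.mul hA)).add (StarRep.extends_one.smul _))
  have eBBs : B * Bs = ((s : ℂ) * h ^ 4) • A - (h : ℂ) ^ 8 • (A * A) + (t : ℂ) • 1 := by
    have := hB.mul hBs
    rw [hr.BBs] at this
    exact this.ext (((hA.smul _).sub ((hA.mul hA).smul _)).add (StarRep.extends_one.smul _))
  have eAB : A * B = ((h : ℂ) ^ 4)⁻¹ • (B * A) := by
    have := hA.mul hB
    rw [hr.AB] at this
    exact this.ext ((hB.mul hA).smul _)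
  rcases hst with ⟨_, ht0⟩ | ⟨rfl, rfl⟩
  -- `P` is moved across `X`. Of the two forms of `X`, the one with `A` on the left shows that `P X`
  -- acts as `h⁻² P B`, and in the same way `P X*` acts as `h² P B*`. For `x` in `ker A` also `B x`
  -- lies in `ker A`, so the two sides give `h⁻² B x = h² B x`.
  · have key : ∀ y, ((h : ℂ) ^ 2)⁻¹ • P (B y) = (h : ℂ) ^ 2 • B (P y) := by
      have hXs : star (elX (h : ℂ) g) = elXs (h : ℂ) g := by
        simp only [elX, elXs, star_add, star_smul, star_mul, hg, star_sub, star_inv₀, star_pow,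
          Complex.star_def, Complex.conj_ofReal]
        rw [mul_comm ((h : ℂ) ^ 2 - _)]
        rfl
      intro y
      refine congrFun (Continuous.ext_on π.dense_domain (f := fun y => ((h : ℂ) ^ 2)⁻¹ • P (B y))
        (g := fun y => (h : ℂ) ^ 2 • B (P y)) (by fun_prop) (by fun_prop) fun φ hφ => ?_) y
      refine π.ext_inner_domain fun ψ => ?_
      have e := StarRep.inner_kerProj hA hAsa one_pos le_rfl (w := elX (h : ℂ) g)
        (by rw [hd.X_mul_A, Complex.ofReal_one, one_smul]) ⟨φ, hφ⟩ ψ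
      rw [hXs] at e
      have e1 : P (π.hom (elX (h : ℂ) g) ⟨φ, hφ⟩ : H) = ((h : ℂ) ^ 2)⁻¹ • P (B φ) := by
        rw [hd.X_eq, π.add_apply, π.smul_apply, π.smul_apply, π.mul_apply, Submodule.coe_add,
          Submodule.coe_smul, Submodule.coe_smul, ← hA, ← hB, map_add, map_smul, map_smul, hPA,
          smul_zero, zero_add]
      have e2 : P (π.hom (elXs (h : ℂ) g) ψ : H) = (h : ℂ) ^ 2 • P (Bs ψ) := by
        rw [elXs, π.add_apply, π.smul_apply, π.smul_apply, π.mul_apply, Submodule.coe_add,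
          Submodule.coe_smul, Submodule.coe_smul, ← hA, ← hBs, map_add, map_smul, map_smul, hPA,
          smul_zero, zero_add]
      rw [← hP, e1, hPs, e2] at e
      change ⟪((h : ℂ) ^ 2)⁻¹ • P (B φ), (ψ : H)⟫_ℂ = ⟪(h : ℂ) ^ 2 • B (P φ), (ψ : H)⟫_ℂ
      rw [e, inner_smul_right, inner_smul_left, ← hPs, hBsdef,
        ContinuousLinearMap.adjoint_inner_right]
      congr 1
      simp
    have hABx : A (B x) = 0 := by
      have := congrArg (fun T : H →L[ℂ] H => T x) eAB
      simp only [mul_apply_eq_comp, smul_apply, ← hx, map_zero, smul_zero] at this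
      exact this
    have h2 := key x
    rw [hPfix x hx.symm, hPfix _ hABx, ← sub_eq_zero, ← sub_smul] at h2
    have hne : ((h : ℂ) ^ 2)⁻¹ - (h : ℂ) ^ 2 ≠ 0 := by
      have h3 : h ^ 2 < 1 := by nlinarith
      have h4 : 1 < (h ^ 2)⁻¹ := (one_lt_inv₀ (by positivity)).2 h3
      have : (h ^ 2)⁻¹ - h ^ 2 ≠ 0 := by linarith
      exact_mod_cast this
    have h3 := (smul_eq_zero.1 h2).resolve_left hne
    have h4 := congrArg (fun T : H →L[ℂ] H => T x) eBsB
    simp only [mul_apply_eq_comp, smul_apply, ← hx, map_zero, smul_zero, h3,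
      sub_apply, add_apply, one_apply_eq_self, sub_zero, zero_add] at h4
    exact (smul_eq_zero.1 h4.symm).resolve_left (by exact_mod_cast ht0.ne')
  -- For `t = 0` both `B* B` and `B B*` are divisible by `A`, so `B` and `B*` vanish on `ker A` and,
  -- by taking adjoints, `P B = P B* = 0`.
  · have hB0 : ∀ y, B (P y) = 0 := by
      intro y
      have h4 := congrArg (fun T : H →L[ℂ] H => T (P y)) eBsB
      simp only [mul_apply_eq_comp, smul_apply, hAP, map_zero, smul_zero,
        sub_apply, add_apply, one_apply_eq_self, sub_zero, Complex.ofReal_zero,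
        zero_smul, add_zero] at h4
      rw [← inner_self_eq_zero (𝕜 := ℂ), ← ContinuousLinearMap.adjoint_inner_left, ← hBsdef, h4,
        inner_zero_left]
    have hBs0 : ∀ y, Bs (P y) = 0 := by
      intro y
      have h4 := congrArg (fun T : H →L[ℂ] H => T (P y)) eBBs
      simp only [mul_apply_eq_comp, smul_apply, hAP, map_zero, smul_zero,
        sub_apply, add_apply, one_apply_eq_self, sub_zero, Complex.ofReal_zero,
        zero_smul, add_zero] at h4
      rw [← inner_self_eq_zero (𝕜 := ℂ), hBsdef, ContinuousLinearMap.adjoint_inner_right, ← hBsdef,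
        h4, inner_zero_left]
    have hPB : ∀ y, P (B y) = 0 := by
      intro y
      refine ext_inner_right ℂ fun v => ?_
      rw [hPs, ← ContinuousLinearMap.adjoint_inner_right, ← hBsdef, hBs0, inner_zero_right,
        inner_zero_left]
    have hPBs : ∀ y, P (Bs y) = 0 := by
      intro y
      refine ext_inner_right ℂ fun v => ?_
      rw [hPs, hBsdef, ContinuousLinearMap.adjoint_inner_left, hB0, inner_zero_right,
        inner_zero_left]
    -- This is the solution of `h + α = h⁴ α`. On the image of `P` the element `E B + α K - α A K`
    -- reduces to `(h + α) K`, while its adjoint reduces to `α K`; the discrepancy `h` forces `P K =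
    -- 0`.
    set α : ℝ := -h / (1 - h ^ 4) with hα
    have h4 : h ^ 4 < 1 := pow_lt_one₀ h0.le h1 (by norm_num)
    have hα' : h + α = h ^ 4 * α := by
      rw [hα]
      field_simp [(sub_pos.2 h4).ne']
      ring
    have hPK : ∀ φ : π.domain, P (π.hom (g .K) φ : H) = 0 := by
      intro φ
      refine π.ext_inner_domain fun ψ => ?_
      have e := StarRep.inner_kerProj hA hAsa (pow_pos h0 4) h4.le
        (w := g .E * g .B + (α : ℂ) • g .K - (α : ℂ) • (g .A * g .K))
        (by
          have := hr.elW_mul_A hc0 Complex.ofReal_one Complex.ofReal_zero (α := (α : ℂ))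
            (by exact_mod_cast hα')
          rw [this]
          push_cast
          rfl) φ ψ
      have hst : star (g .E * g .B + (α : ℂ) • g .K - (α : ℂ) • (g .A * g .K))
          = g .Bs * g .F + (α : ℂ) • g .K - (α : ℂ) • (g .A * g .K) := by
        simp only [star_add, star_sub, star_smul, star_mul, hg, Complex.star_def,
          Complex.conj_ofReal]
        change g .Bs * g .F + (α : ℂ) • g .K - (α : ℂ) • (g .K * g .A) = _
        rw [hr.KA]
      have e1 : P (π.hom (g .E * g .B + (α : ℂ) • g .K - (α : ℂ) • (g .A * g .K)) φ : H)
          = ((h : ℂ) + α) • P (π.hom (g .K) φ : H) := by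
        rw [hr.EB]
        simp only [π.add_apply, π.sub_apply, π.smul_apply, π.mul_apply, Submodule.coe_add,
          Submodule.coe_sub, Submodule.coe_smul, ← hA _, ← hB _, map_add P, map_sub P, map_smul P, hPA,
          hPB, smul_zero, sub_zero, zero_add, add_smul, Complex.ofReal_one, one_mul]
      have e2 : P (π.hom (g .Bs * g .F + (α : ℂ) • g .K - (α : ℂ) • (g .A * g .K)) ψ : H)
          = (α : ℂ) • P (π.hom (g .K) ψ : H) := by
        simp only [π.add_apply, π.sub_apply, π.smul_apply, π.mul_apply, Submodule.coe_add,
          Submodule.coe_sub, Submodule.coe_smul, ← hA _, ← hBs _, map_add P, map_sub P, map_smul P, hPA,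
          hPBs, smul_zero, sub_zero, zero_add]
      have e3 := StarRep.inner_kerProj hA hAsa one_pos le_rfl (w := g .K)
        (by rw [hr.KA, Complex.ofReal_one, one_smul]) φ ψ
      rw [hg, ← hP] at e3
      rw [hst, ← hP, e1, hPs φ, e2, inner_smul_right, ← hPs] at e
      change _ = ⟪P φ, (π.hom (g .K) ψ : H)⟫_ℂ at e3
      rw [← e3, inner_smul_left] at e
      have e5 : (starRingEnd ℂ) ((h : ℂ) + α) = (h : ℂ) + α := by simp
      rw [e5] at e
      have e6 : (h : ℂ) * ⟪P (π.hom (g .K) φ : H), (ψ : H)⟫_ℂ = 0 := by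
        linear_combination e
      rw [inner_zero_left]
      exact (mul_eq_zero.1 e6).resolve_left hc0
    have hP0 : ∀ y, P y = 0 := by
      intro y
      refine congrFun (Continuous.ext_on π.dense_domain (f := fun y => P y)
        (g := fun _ => (0 : H)) (by fun_prop) (by fun_prop) fun φ hφ => ?_) y
      have := hPK (π.hom (g .Ki) ⟨φ, hφ⟩)
      rwa [← π.mul_apply, hr.KKi, π.one_apply] at this
    rw [← hPfix x hx.symm, hP0]

end KernelA

end

/-! ### The presented algebras satisfy the relations. -/

section

section Presentation

theorem PresentedStarAlgebra.mk_eq_of_mem {Z : Type} [InvolutiveStar Z]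
    {R : Set (FreeStarAlgebra Z × FreeStarAlgebra Z)}
    {p : FreeStarAlgebra Z × FreeStarAlgebra Z} (h : p ∈ R) :
    PresentedStarAlgebra.mk R p.1 = PresentedStarAlgebra.mk R p.2 :=
  RingQuot.mkAlgHom_rel ℂ (StarClosure.rel p.1 p.2 h)

theorem sqrt_coe_pos {q : ℝ} (hq : 0 < q) : ((√q : ℝ) : ℂ) ≠ 0 := by
  exact_mod_cast (Real.sqrt_pos.2 hq).ne'

theorem CrossProduct.crossRel {q : ℝ} (hq : 0 < q) (c : ℝ≥0∞) :
    CrossRel ((√q : ℝ) : ℂ) (linCoeff c) (constCoeff c) (CrossProduct.gen q c) := by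
  exact (crossRel_iff hq _ _ (PresentedStarAlgebra.mk _) _).1 fun p hp =>
    PresentedStarAlgebra.mk_eq_of_mem hp

namespace HatCrossProduct

theorem crossRel {q : ℝ} (hq : 0 < q) (c : ℝ≥0∞) :
    CrossRel ((√q : ℝ) : ℂ) (linCoeff c) (constCoeff c) (fun g => gen q c (.of g)) := by
  exact (crossRel_iff hq _ _ (PresentedStarAlgebra.mk _) _).1 fun p hp =>
    PresentedStarAlgebra.mk_eq_of_mem (Or.inl hp)

theorem gen_A_mul_Ai (q : ℝ) (c : ℝ≥0∞) : gen q c (.of .A) * gen q c .Ai = 1 := by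
  have := PresentedStarAlgebra.mk_eq_of_mem (R := hatRelations q (linCoeff c) (constCoeff c))
    (p := (FreeStarAlgebra.gen (.of .A) * FreeStarAlgebra.gen .Ai, 1)) (Or.inr (Or.inl rfl))
  rw [map_mul, map_one] at this
  exact this

theorem star_gen (q : ℝ) (c : ℝ≥0∞) (x : HatGen) : star (gen q c x) = gen q c (star x) :=
  PresentedStarAlgebra.star_gen _ x

theorem X_eq_elX {q : ℝ} (hq : 0 < q) (c : ℝ≥0∞) :
    X q c = elX ((√q : ℝ) : ℂ) (fun g => gen q c (.of g)) := by
  have h1 : (√q) ^ 2 = q := Real.sq_sqrt hq.le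
  have h2 : q ^ (3 / 2 : ℝ) = √q ^ 3 := by
    rw [Real.sqrt_eq_rpow, ← Real.rpow_natCast, ← Real.rpow_mul hq.le]
    norm_num
  have h3 : (q : ℂ) = ((√q : ℝ) : ℂ) ^ 2 := by exact_mod_cast h1.symm
  rw [X, elX, h2, lam, mul_assoc]
  push_cast
  rw [← h3]

theorem Y_eq_elY {q : ℝ} (hq : 0 < q) (c : ℝ≥0∞) :
    Y q c = elY ((√q : ℝ) : ℂ) (fun g => gen q c (.of g)) := by
  have h3 : (q : ℂ) = ((√q : ℝ) : ℂ) ^ 2 := by exact_mod_cast (Real.sq_sqrt hq.le).symm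
  rw [Y, elY, h3, mul_assoc]

theorem star_X_eq_elXs {q : ℝ} (hq : 0 < q) (c : ℝ≥0∞) :
    star (X q c) = elXs ((√q : ℝ) : ℂ) (fun g => gen q c (.of g)) := by
  rw [X_eq_elX hq]
  simp only [elX, elXs, star_add, star_smul, star_mul, star_gen, star_sub, star_inv₀, star_pow,
    Complex.star_def, Complex.conj_ofReal]
  rw [mul_comm (((√q : ℝ) : ℂ) ^ 2 - _)]
  rfl

end HatCrossProduct

end Presentation

theorem StarRep.ker_A_eq_zero {q : ℝ} (hq0 : 0 < q) (hq1 : q < 1) (c : ℝ≥0∞) {H : Type*}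
    [NormedAddCommGroup H] [InnerProductSpace ℂ H] [CompleteSpace H]
    (π : StarRep (CrossProduct q c) H) (x : (π.cl (CrossProduct.gen q c .A)).domain)
    (hx : π.cl (CrossProduct.gen q c .A) x = 0) : (x : H) = 0 := by
  refine Podles.ker_A_eq_zero (Real.sqrt_pos.2 hq0) (by
    rw [Real.sqrt_lt' one_pos]; simpa using hq1) ?_ (CrossProduct.crossRel hq0 c) (π := π)
    (fun x => PresentedStarAlgebra.star_gen _ x) (x := (x : H)) ?_
  · unfold linCoeff constCoeff
    by_cases h : c = ∞
    · simp [h]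
    · simp only [h, if_false]
      rcases eq_or_lt_of_le (ENNReal.toReal_nonneg (a := c)) with h' | h'
      · exact Or.inr ⟨trivial, h'.symm⟩
      · exact Or.inl ⟨zero_le_one, h'⟩
  · rw [← hx]
    exact LinearPMap.mem_graph _ x

end

/-! ### Closed operators of a well-behaved representation. -/

section

section DecoupledSystem

variable {H : Type*} [NormedAddCommGroup H] [InnerProductSpace ℂ H] [CompleteSpace H]

/-- The relations between the closed operators of a well-behaved representation. -/
structure DecoupledSystem (q c : ℝ) (A B : H →L[ℂ] H) (X Y K : H →ₗ.[ℂ] H) : Prop where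
  q_pos : 0 < q
  q_lt_one : q < 1
  c_nonneg : 0 ≤ c
  A_sa : IsSelfAdjoint A
  A_inj : ∀ x, A x = 0 → x = 0
  BsB : ContinuousLinearMap.adjoint B * B = A - A * A + (c : ℂ) • 1
  BBs : B * ContinuousLinearMap.adjoint B
    = (q : ℂ) ^ 2 • A - (q : ℂ) ^ 4 • (A * A) + (c : ℂ) • 1
  AB : A * B = ((q : ℂ) ^ 2)⁻¹ • (B * A)
  X_closed : IsClosed (X.graph : Set (H × H))
  X_dense : Dense (X.domain : Set H)
  Y_sa : IsSelfAdjoint Y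
  K_sa : IsSelfAdjoint K
  Y_inj : ∀ x, (x, 0) ∈ Y.graph → x = 0
  K_inj : ∀ x, (x, 0) ∈ K.graph → x = 0
  A_X : Commutes A X
  A_Xs : Commutes A X.adjoint
  A_Y : Commutes A Y
  A_K : Commutes A K
  Bs_X : Commutes (ContinuousLinearMap.adjoint B) X
  Bs_Xs : Commutes (ContinuousLinearMap.adjoint B) X.adjoint
  K_Bs : ∀ {x y}, (x, y) ∈ K.graph →
    (ContinuousLinearMap.adjoint B x, (q : ℂ) • ContinuousLinearMap.adjoint B y) ∈ K.graph
  Y_of_K : ∀ {x y z}, (x, y) ∈ K.graph → (y, z) ∈ K.graph → (z, (q : ℂ) • A x) ∈ Y.graph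
  Y_A_nonneg : ∀ {x y}, (x, y) ∈ Y.graph → 0 ≤ (⟪y, A x⟫_ℂ).re
  K_of_X : ∀ {v u w w'}, (v, u) ∈ X.graph → (v, w) ∈ K.graph → (w, w') ∈ X.graph →
    (u, (q : ℂ)⁻¹ • w') ∈ K.graph
  K_of_Xs : ∀ {x y}, (x, 0) ∈ X.adjoint.graph → (x, y) ∈ K.graph → (y, 0) ∈ X.adjoint.graph
  strong : StronglyCommute Y (opMul X.adjoint X)
  rel_Y_X : QCommute ((q : ℂ) ^ 2) Y X
  rel_X_Xs : opMul X.adjoint X = ((q : ℂ) ^ 2) • opMul X X.adjoint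
    + (1 - (q : ℂ) ^ 2) • (opMul Y Y + ((c : ℂ) • idOp : H →ₗ.[ℂ] H))

theorem CrossRel.of_eq {h s t s' t' : ℂ} {R : Type*} [Ring R] [Algebra ℂ R] {g : Gen → R}
    (hr : CrossRel h s t g) (hs : s = s') (ht : t = t') : CrossRel h s' t' g := by
  subst hs ht
  exact hr

open HatCrossProduct in
theorem HatCrossProduct.Y_mul_Yi {q : ℝ} (hq : 0 < q) (c : ℝ≥0∞) : Y q c * Yi q c = 1 := by
  have hr := crossRel hq c
  have h1 : (q : ℂ) ≠ 0 := by exact_mod_cast hq.ne'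
  rw [Y, Yi, smul_mul_smul_comm, mul_inv_cancel₀ h1, one_smul, mul_assoc, mul_assoc (gen q c .Ai),
    ← mul_assoc (gen q c (.of .A)), gen_A_mul_Ai, one_mul, mul_assoc,
    ← mul_assoc (gen q c (.of .Ki)) (gen q c (.of .K)), hr.KiK, one_mul, hr.KiK]

open HatCrossProduct in
-- A relation with a bounded factor passes from the domain of `π` to the closures by continuity.
-- Relations that conclude membership in the graph of `Y` or `K` are checked weakly on the domain,
-- which suffices because the closures of `Y` and `K` are self-adjoint.
theorem WellBehaved.exists_system {q : ℝ} (hq0 : 0 < q) (hq1 : q < 1) {c : ℝ≥0}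
    {π : StarRep (HatCrossProduct q c) H} (hπ : WellBehaved q c π) :
    ∃ A B : H →L[ℂ] H, π.Extends A (gen q c (.of .A)) ∧ π.Extends B (gen q c (.of .B)) ∧
      DecoupledSystem q c A B (π.cl (X q c)) (π.cl (Y q c)) (π.cl (gen q c (.of .K))) := by
  have hc : linCoeff (c : ℝ≥0∞) = 1 := by simp [linCoeff]
  have ht : constCoeff (c : ℝ≥0∞) = c := by simp [constCoeff]
  have hh : (q : ℂ) = ((√q : ℝ) : ℂ) ^ 2 := by exact_mod_cast (Real.sq_sqrt hq0.le).symm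
  set h : ℂ := ((√q : ℝ) : ℂ) with hdef
  have h0 : h ≠ 0 := sqrt_coe_pos hq0
  have hr : CrossRel h (1 : ℝ) ((c : ℝ) : ℝ) (fun x => gen q (c : ℝ≥0∞) (.of x)) :=
    (crossRel hq0 (c : ℝ≥0∞)).of_eq (by rw [hc]) (by rw [ht])
  have hd := hr.decoupled h0
  have hX := X_eq_elX hq0 (c : ℝ≥0∞)
  have hXs := star_X_eq_elXs hq0 (c : ℝ≥0∞)
  have hY := Y_eq_elY hq0 (c : ℝ≥0∞)
  set g : Gen → HatCrossProduct q c := fun x => gen q c (.of x) with hg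
  have hst : ∀ x, star (g x) = g (star x) := fun x => star_gen q c (.of x)
  obtain ⟨A, B, hA, hB⟩ := exists_extends_A_B (π := π) zero_le_one c.2 hr hst
  refine ⟨A, B, hA, hB, ?_⟩
  have hBs : π.Extends (ContinuousLinearMap.adjoint B) (g .Bs) := by
    have := hB.adjoint
    rwa [hst .B] at this
  have hYst : star (Y q c) = Y q c := by
    rw [hY]
    simp only [elY, star_smul, star_mul, hst]
    change star (h ^ 2) • (g .A * (g .Ki * g .Ki)) = h ^ 2 • (g .Ki * g .Ki * g .A)
    rw [mul_assoc (g .Ki), hr.KiA, ← mul_assoc (g .Ki) (g .A), hr.KiA, mul_assoc]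
    congr 1
    rw [hdef, Complex.star_def, ← Complex.ofReal_pow, Complex.conj_ofReal]
  have hKst : star (g .K) = g .K := hst .K
  have hYsa : IsSelfAdjoint (π.cl (Y q c)) := hπ.strong_Y_XX.1
  have hKsa : IsSelfAdjoint (π.cl (g .K)) := hπ.strong_A_K.2.1
  have hadj := hπ.adjoint_X
  have hAsa : IsSelfAdjoint A := hA.isSelfAdjoint (hst .A)
  have hKKY : g .K * (g .K * Y q c) = (q : ℂ) • g .A := by
    rw [hY, elY, mul_smul_comm, mul_smul_comm, mul_assoc, ← mul_assoc (g .K) (g .Ki), hr.KKi,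
      one_mul, ← mul_assoc, hr.KKi, one_mul, hh]
  constructor
  case q_pos => exact hq0
  case q_lt_one => exact hq1
  case c_nonneg => exact c.2
  case A_sa => exact hAsa
  case A_inj =>
    intro x hx
    refine π.ext_inner_domain fun φ => ?_
    have h1 := hA (π.hom (gen q c .Ai) φ)
    rw [← π.mul_apply, gen_A_mul_Ai, π.one_apply] at h1
    rw [← h1, inner_zero_left, ← ContinuousLinearMap.adjoint_inner_left,
      ← ContinuousLinearMap.star_eq_adjoint, hAsa.star_eq, hx, inner_zero_left]
  case BsB =>
    have h1 := hBs.mul hB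
    rw [hr.BsB] at h1
    rw [h1.ext (((hA.smul _).sub (hA.mul hA)).add (StarRep.extends_one.smul _))]
    simp
  case BBs =>
    have h1 := hB.mul hBs
    rw [hr.BBs] at h1
    rw [h1.ext (((hA.smul _).sub ((hA.mul hA).smul _)).add (StarRep.extends_one.smul _)), hh]
    congr 3
    · simp; ring
    · ring
  case AB =>
    have h1 := hA.mul hB
    rw [hr.AB] at h1
    rw [h1.ext ((hB.mul hA).smul _), hh]
    congr 2
    ring
  case X_closed => exact π.isClosed_graph_cl _
  case X_dense => exact π.dense_domain_cl _
  case Y_sa => exact hYsa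
  case K_sa => exact hKsa
  case Y_inj =>
    intro x hx
    refine π.ext_inner_domain fun φ => ?_
    have h1 := (π.mem_graph_cl_of_sa hYsa).1 hx (π.hom (Yi q c) φ)
    rw [← π.mul_apply, Y_mul_Yi hq0, π.one_apply, inner_zero_left] at h1
    rw [← h1, inner_zero_left]
  case K_inj =>
    intro x hx
    refine π.ext_inner_domain fun φ => ?_
    have h1 := (π.mem_graph_cl_of_sa hKsa).1 hx (π.hom (g .Ki) φ)
    rw [← π.mul_apply, hr.KKi, π.one_apply, inner_zero_left] at h1
    rw [← h1, inner_zero_left]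
  case A_X => exact hA.commutes (by rw [hX]; exact hd.X_mul_A)
  case A_Xs =>
    rw [hadj]
    exact hA.commutes (by rw [hXs]; exact hd.Xs_mul_A)
  case A_Y => exact hA.commutes (by rw [hY]; exact hd.Y_mul_A)
  case A_K => exact hA.commutes hr.KA
  case Bs_X => exact hBs.commutes (by rw [hX]; exact hd.X_mul_Bs)
  case Bs_Xs =>
    rw [hadj]
    exact hBs.commutes (by rw [hXs]; exact hd.Xs_mul_Bs)
  case K_Bs =>
    intro x y hxy
    rw [hh]
    exact hBs.intertwine hr.KBs hxy
  case Y_of_K =>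
    intro x y z hxy hyz
    rw [π.mem_graph_cl_of_sa hYsa]
    intro φ
    rw [(π.mem_graph_cl_of_sa hKsa).1 hyz, (π.mem_graph_cl_of_sa hKsa).1 hxy, ← π.mul_apply,
      ← π.mul_apply, mul_assoc, hKKY, π.smul_apply, Submodule.coe_smul]
    change _ = ⟪x, (q : ℂ) • (π.hom (gen q c (.of .A)) φ : H)⟫_ℂ
    rw [← hA φ, inner_smul_left, inner_smul_right, Complex.conj_ofReal,
      ← ContinuousLinearMap.adjoint_inner_left, ← ContinuousLinearMap.star_eq_adjoint,
      hAsa.star_eq]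
  case Y_A_nonneg =>
    intro x y hxy
    refine π.cl_induction (p := fun v => 0 ≤ (⟪v.2, A v.1⟫_ℂ).re) ?_ (fun φ => ?_) hxy
    · exact isClosed_le (by fun_prop) (by fun_prop)
    · have h1 : (π.hom (Y q c) φ : H)
          = (q : ℂ) • (π.hom (star (g .Ki)) (π.hom (g .Ki) (π.hom (g .A) φ)) : H) := by
        rw [hY, elY, π.smul_apply, Submodule.coe_smul, mul_assoc, π.mul_apply, π.mul_apply, ← hh,
          hst]
        rfl
      have h2 : A (φ : H) = π.hom (g .A) φ := hA φ
      simp only [h1, h2, inner_smul_left, Complex.conj_ofReal, π.inner_hom',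
        Complex.re_ofReal_mul]
      exact mul_nonneg hq0.le (inner_self_nonneg (𝕜 := ℂ))
  -- Moving `X` and `K` one after the other to the test vector reduces the claim to `X* K = q⁻¹ K
  -- X*` on the domain of `π`.
  case K_of_X =>
    intro v u w w' hvu hvw hww
    rw [π.mem_graph_cl_of_sa hKsa]
    have hX' : ∀ {x y}, (x, y) ∈ (π.cl (X q c)).graph → ∀ φ : π.domain,
        ⟪y, (φ : H)⟫_ℂ = ⟪x, (π.hom (star (X q c)) φ : H)⟫_ℂ := by
      intro x y hxy φ
      refine π.cl_induction (p := fun z => ⟪z.2, (φ : H)⟫_ℂ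
        = ⟪z.1, (π.hom (star (X q c)) φ : H)⟫_ℂ) ?_ (fun ψ => π.inner_hom _ _ _) hxy
      exact isClosed_eq (by fun_prop) (by fun_prop)
    intro φ
    have h2 : star (X q c) * g .K = (q : ℂ)⁻¹ • (g .K * star (X q c)) := by
      rw [hXs, hd.K_mul_Xs, hh, smul_smul, inv_mul_cancel₀ (pow_ne_zero 2 h0), one_smul]
    rw [hX' hvu, ← π.mul_apply]
    change _ = ⟪v, (π.hom (star (X q c) * g .K) φ : H)⟫_ℂ
    rw [h2, π.smul_apply, Submodule.coe_smul, π.mul_apply, inner_smul_left, inner_smul_right,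
      ← (π.mem_graph_cl_of_sa hKsa).1 hvw, hX' hww, map_inv₀, Complex.conj_ofReal]
  case K_of_Xs =>
    intro x y hx hxy
    rw [π.mem_graph_adjoint_cl] at hx ⊢
    intro φ
    rw [inner_zero_left, (π.mem_graph_cl_of_sa hKsa).1 hxy, ← π.mul_apply]
    rw [hX, hd.K_mul_X, π.smul_apply, Submodule.coe_smul, inner_smul_right, π.mul_apply, ← hX,
      ← hx, inner_zero_left, mul_zero]
  case strong =>
    rw [hadj]
    exact hπ.strong_Y_XX
  case rel_Y_X => exact hπ.rel_Y_X
  case rel_X_Xs =>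
    rw [hadj]
    exact hπ.rel_X_Xs

end DecoupledSystem

end

/-! ### The ground space `ker (A - l) ∩ ker X*`. -/

section

open Filter Topology

section Ground

variable {H : Type*} [NormedAddCommGroup H] [InnerProductSpace ℂ H] [CompleteSpace H]

/-- The pairs `(C g, b g)` form a core of `X`: a vector `(x, y)` of the graph orthogonal to all of
them satisfies `⟪g, x⟫ = ⟪C g, x⟫ + ⟪b g, y⟫ = 0`. By continuity `g` may be restricted to a dense
set. -/
theorem IsGraphResolvent.graph_induction {X : H →ₗ.[ℂ] H} {C b : H →L[ℂ] H}
    (h : IsGraphResolvent X C b) (hd : Dense (X.domain : Set H))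
    (hX : IsClosed (X.graph : Set (H × H))) {p : H × H → Prop} (hp : IsClosed {v | p v})
    {D : Set H} (hD : Dense D) (hpD : ∀ g ∈ D, p (C g, b g)) {x y : H}
    (hxy : (x, y) ∈ X.graph) : p (x, y) := by
  have h1 : X.graph ≤ (LinearMap.range ((C.prod b : H →L[ℂ] H × H) : H →ₗ[ℂ] H × H)).topologicalClosure := by
    refine le_topologicalClosure_of_graph_orthogonal ?_ hX fun x y hxy ho => ?_
    · rintro _ ⟨g, rfl⟩
      exact h.mem g
    · have h2 : x = 0 := by
        refine ext_inner_left ℂ fun g => ?_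
        have h3 := ho (C g) (b g) ⟨g, rfl⟩
        have h4 := (mem_graph_adjoint hd).1 (h.mem_adj g) x y hxy
        rw [← h4, ← inner_add_left, add_sub_cancel] at h3
        rw [h3, inner_zero_right]
      subst h2
      exact ⟨rfl, (graph_unique hxy X.graph.zero_mem)⟩
  have h2 : ∀ g, p (C g, b g) := by
    intro g
    have : Set.MapsTo (fun g => (C g, b g)) D {v | p v} := hpD
    have h3 := this.closure (by fun_prop)
    rw [hp.closure_eq] at h3
    exact h3 (hD g)
  refine closure_minimal ?_ hp (h1 hxy)
  rintro _ ⟨g, rfl⟩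
  exact h2 g

/-- The range of `b` is dense in the range of `X`, since the pairs `(C g, b g)` form a core. Thus
`ker X*` becomes the kernel of a bounded operator. -/
theorem IsGraphResolvent.mem_ker_adjoint {X : H →ₗ.[ℂ] H} {C b : H →L[ℂ] H}
    (h : IsGraphResolvent X C b) (hd : Dense (X.domain : Set H))
    (hX : IsClosed (X.graph : Set (H × H))) {y : H} :
    ContinuousLinearMap.adjoint b y = 0 ↔ (y, 0) ∈ X.adjoint.graph := by
  constructor
  · intro hy
    rw [mem_graph_adjoint hd]
    intro x z hxz
    refine h.graph_induction hd hX (p := fun v => ⟪(0 : H), v.1⟫_ℂ = ⟪y, v.2⟫_ℂ)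
      (isClosed_eq (by fun_prop) (by fun_prop)) dense_univ (fun g _ => ?_) hxz
    change ⟪(0 : H), C g⟫_ℂ = ⟪y, b g⟫_ℂ
    rw [← ContinuousLinearMap.adjoint_inner_left b, hy, inner_zero_left, inner_zero_left]
  · intro hy
    refine ext_inner_right ℂ fun g => ?_
    rw [ContinuousLinearMap.adjoint_inner_left, inner_zero_left,
      ← (mem_graph_adjoint hd).1 hy _ _ (h.mem g), inner_zero_left]

/-- The part of an operator in a subspace. -/
theorem exists_part (K : H →ₗ.[ℂ] H) (G : Submodule ℂ H) :
    ∃ T : G →ₗ.[ℂ] G, ∀ x y : G, (x, y) ∈ T.graph ↔ ((x : H), (y : H)) ∈ K.graph := by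
  refine ⟨(K.graph.comap (G.subtype.prodMap G.subtype)).toLinearPMap, fun x y => ?_⟩
  rw [← SetLike.mem_coe, Submodule.toLinearPMap_graph_eq]
  · rfl
  · rintro ⟨x, y⟩ hx hx0
    change ((x : H), (y : H)) ∈ K.graph at hx
    change x = 0 at hx0
    subst hx0
    exact Subtype.ext (graph_unique hx K.graph.zero_mem)

theorem QCommute.mem_graph {a : ℂ} {S T : H →ₗ.[ℂ] H} (h : QCommute a S T) {x u v w : H}
    (hS : (x, u) ∈ S.graph) (hT : (x, v) ∈ T.graph) (hw : (u, w) ∈ T.graph) :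
    (v, a • w) ∈ S.graph := by
  obtain ⟨x', hx', hu⟩ := (LinearPMap.mem_graph_iff _).1 hS
  obtain ⟨y', hy', hv⟩ := (LinearPMap.mem_graph_iff _).1 hT
  obtain ⟨u', hu', hw'⟩ := (LinearPMap.mem_graph_iff _).1 hw
  dsimp only at hx' hu hy' hv hu' hw'
  subst hx' hu hv hw'
  have hy2 : y' = ⟨(x' : H), hy' ▸ y'.2⟩ := Subtype.ext hy'
  have hu2 : u' = ⟨S x', hu' ▸ u'.2⟩ := Subtype.ext hu'
  have hTd : (x' : H) ∈ T.domain := hy' ▸ y'.2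
  have hud : S x' ∈ T.domain := hu' ▸ u'.2
  obtain ⟨h1, h2⟩ := h x' x'.2 hTd
  have h3 := h1.2 hud
  have h4 := h2 h3 hud
  rw [hy2, hu2]
  change (T ⟨(x' : H), hTd⟩, a • T ⟨S ⟨x', x'.2⟩, hud⟩) ∈ S.graph
  rw [← h4]
  exact S.mem_graph ⟨_, h3⟩

theorem inner_self_ofReal (x : H) : ⟪x, x⟫_ℂ = ((‖x‖ ^ 2 : ℝ) : ℂ) := by
  rw [inner_self_eq_norm_sq_to_K]
  simp

theorem inner_self_add_eq_zero {e a b : H →L[ℂ] H} (ha : IsSelfAdjoint a)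
    (he : e = a * a + b * ContinuousLinearMap.adjoint b) {x : H} :
    e x = 0 ↔ a x = 0 ∧ ContinuousLinearMap.adjoint b x = 0 := by
  constructor
  · intro hx
    have h1 : ⟪e x, x⟫_ℂ = ⟪a x, a x⟫_ℂ
        + ⟪ContinuousLinearMap.adjoint b x, ContinuousLinearMap.adjoint b x⟫_ℂ := by
      rw [he, add_apply, inner_add_left, mul_apply_eq_comp, mul_apply_eq_comp,
        ContinuousLinearMap.adjoint_inner_right]
      congr 1
      rw [← ContinuousLinearMap.adjoint_inner_right, ← ContinuousLinearMap.star_eq_adjoint,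
        ha.star_eq]
    rw [hx, inner_zero_left, inner_self_ofReal, inner_self_ofReal] at h1
    have h2 : 0 = ‖a x‖ ^ 2 + ‖ContinuousLinearMap.adjoint b x‖ ^ 2 := by exact_mod_cast h1
    constructor
    · rw [← norm_eq_zero]
      nlinarith [sq_nonneg ‖a x‖, sq_nonneg ‖ContinuousLinearMap.adjoint b x‖]
    · rw [← norm_eq_zero]
      nlinarith [sq_nonneg ‖a x‖, sq_nonneg ‖ContinuousLinearMap.adjoint b x‖]
  · rintro ⟨h1, h2⟩
    rw [he, add_apply, mul_apply_eq_comp, mul_apply_eq_comp, h1, h2, map_zero, map_zero, add_zero]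

namespace DecoupledSystem

variable {q c : ℝ} {A B : H →L[ℂ] H} {X Y K : H →ₗ.[ℂ] H}

/-- Spectral projections of `Y` commute with those of `X* X`, hence with `X* X` as an operator,
hence with its resolvent `C`. -/
theorem exists_spectralMeasure_Y (S : DecoupledSystem q c A B X Y K) {C b : H →L[ℂ] H}
    (hC : IsGraphResolvent X C b) :
    ∃ P : SpectralMeasure H, P.Represents Y ∧ ∀ s, MeasurableSet s → Commute C (P.proj s) := by
  obtain ⟨-, hZ, P, Q, hP, hQ, hPQ⟩ := S.strong
  refine ⟨P, hP, fun s hs => ?_⟩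
  have hcom := SpectralMeasure.commutes_of_commute hZ hQ (P.isStarProjection s hs).isSelfAdjoint
    (fun t ht => hPQ s t hs ht)
  ext g
  have h1 : (C g, g - C g) ∈ (opMul X.adjoint X).graph :=
    mem_graph_opMul.2 ⟨b g, hC.mem g, hC.mem_adj g⟩
  obtain ⟨y, hy, hy'⟩ := mem_graph_opMul.1 (hcom _ _ h1)
  have h2 := (hC.unique S.X_dense hy hy').1
  rwa [← map_add, add_sub_cancel] at h2

/-- Everything in the bicommutant of `C = (1 + X* X)⁻¹` commutes with `Y`. -/
theorem commutes_Y (S : DecoupledSystem q c A B X Y K) {C b : H →L[ℂ] H}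
    (hC : IsGraphResolvent X C b) {D : H →L[ℂ] H} (hD : IsSelfAdjoint D)
    (hDC : ∀ F, Commute C F → Commute D F) : Commutes D Y := by
  obtain ⟨P, hP, hPC⟩ := S.exists_spectralMeasure_Y hC
  exact SpectralMeasure.commutes_of_commute S.Y_sa hP hD fun s hs => hDC _ (hPC s hs)

/-- Since `C` preserves the domain of `Y`, the vector `C y` lies in `D(X) ∩ D(Y)` and `Y C y = C z`
lies in `D(X)`, so the `q²`-commutation of `Y` and `X` applies to `b = X C`. -/
theorem Y_b (S : DecoupledSystem q c A B X Y K) {C b : H →L[ℂ] H}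
    (hC : IsGraphResolvent X C b) {y z : H} (hyz : (y, z) ∈ Y.graph) :
    (b y, (q : ℂ) ^ 2 • b z) ∈ Y.graph := by
  have hCY := S.commutes_Y hC (hC.isSelfAdjoint S.X_dense) (fun _ h => h)
  exact S.rel_Y_X.mem_graph (hCY _ _ hyz) (hC.mem y) (hC.mem z)

theorem Y_adjoint_b (S : DecoupledSystem q c A B X Y K) {C b : H →L[ℂ] H}
    (hC : IsGraphResolvent X C b) {y z : H} (hyz : (y, z) ∈ Y.graph) :
    (ContinuousLinearMap.adjoint b y, ((q : ℂ) ^ 2)⁻¹ • ContinuousLinearMap.adjoint b z)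
      ∈ Y.graph := by
  have hq : (q : ℂ) ^ 2 ≠ 0 := pow_ne_zero 2 (by exact_mod_cast S.q_pos.ne')
  rw [sa_mem_graph S.Y_sa]
  intro x w hxw
  have h1 := (sa_mem_graph S.Y_sa).1 hyz _ _ (S.Y_b hC hxw)
  rw [inner_smul_left, ContinuousLinearMap.adjoint_inner_left,
    ContinuousLinearMap.adjoint_inner_left, h1, inner_smul_right, map_inv₀, ← Complex.ofReal_pow,
    Complex.conj_ofReal, Complex.ofReal_pow, ← mul_assoc, inv_mul_cancel₀ hq, one_mul]

/-- The operator whose kernel is `ker (A - l) ∩ ker X*`. -/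
def groundOp (A b : H →L[ℂ] H) (l : ℝ) : H →L[ℂ] H :=
  (A - (l : ℂ) • 1) * (A - (l : ℂ) • 1) + b * ContinuousLinearMap.adjoint b

theorem isSelfAdjoint_sub (S : DecoupledSystem q c A B X Y K) (l : ℝ) :
    IsSelfAdjoint (A - (l : ℂ) • 1) :=
  S.A_sa.sub (IsSelfAdjoint.smul (Complex.conj_ofReal l) (.one _))

theorem isSelfAdjoint_groundOp (S : DecoupledSystem q c A B X Y K) (b : H →L[ℂ] H) (l : ℝ) :
    IsSelfAdjoint (groundOp A b l) := by
  have h1 := S.isSelfAdjoint_sub l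
  refine IsSelfAdjoint.add ?_ (IsSelfAdjoint.mul_star_self b)
  have := IsSelfAdjoint.mul_star_self (A - (l : ℂ) • 1)
  rwa [h1.star_eq] at this

theorem mem_ker_groundOp (S : DecoupledSystem q c A B X Y K) {C b : H →L[ℂ] H}
    (hC : IsGraphResolvent X C b) {l : ℝ} {x : H} :
    x ∈ (groundOp A b l).ker ↔ A x = (l : ℂ) • x ∧ (x, 0) ∈ X.adjoint.graph := by
  have : x ∈ (groundOp A b l).ker ↔ groundOp A b l x = 0 := Iff.rfl
  rw [this, inner_self_add_eq_zero (e := groundOp A b l) (S.isSelfAdjoint_sub l) rfl,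
    hC.mem_ker_adjoint S.X_dense S.X_closed, sub_apply, smul_apply, one_apply_eq_self, sub_eq_zero]

/-- The factors `q²` from `b` and `q⁻²` from its adjoint cancel, so `(A - l)² + b b*` commutes with
`Y`, and so does the projection onto its kernel. -/
theorem groundProj_commutes_Y (S : DecoupledSystem q c A B X Y K) {C b : H →L[ℂ] H}
    (hC : IsGraphResolvent X C b) (l : ℝ) :
    Commutes (groundOp A b l).ker.starProjection Y := by
  have hq : (q : ℂ) ^ 2 ≠ 0 := pow_ne_zero 2 (by exact_mod_cast S.q_pos.ne')
  refine Commutes.ker_starProjection (S.isSelfAdjoint_groundOp b l) (sa_isClosed_graph S.Y_sa) ?_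
  have h1 : Commutes (A - (l : ℂ) • 1) Y := S.A_Y.sub (Commutes.one.smul _)
  refine (h1.mul h1).add fun y z hyz => ?_
  have h2 := S.Y_b hC (S.Y_adjoint_b hC hyz)
  rwa [map_smul, smul_smul, mul_inv_cancel₀ hq, one_smul] at h2

/-- The part of `K` in the ground space is self-adjoint. -/
theorem isSelfAdjoint_part (S : DecoupledSystem q c A B X Y K) {C b : H →L[ℂ] H}
    (hC : IsGraphResolvent X C b) {l : ℝ} (hl : l ≠ 0) 
    {T : (groundOp A b l).ker →ₗ.[ℂ] (groundOp A b l).ker}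
    (hT : ∀ x y, (x, y) ∈ T.graph ↔ ((x : H), (y : H)) ∈ K.graph) : IsSelfAdjoint T := by
  refine isSelfAdjoint_of_surjective_one_add_sq ?_ ?_
  · intro x y x' y' h h'
    exact sa_symm S.K_sa ((hT _ _).1 h) ((hT _ _).1 h')
  rintro ⟨g, hg⟩
  obtain ⟨R, β, hR⟩ := sa_exists_resolvent S.K_sa
  have hg' := (S.mem_ker_groundOp hC).1 hg
  obtain ⟨hAR, hAβ⟩ := hR.commute_of_commutes S.K_sa S.A_K
  have hhA : A (R g) = (l : ℂ) • R g := by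
    have := congrArg (fun F : H →L[ℂ] H => F g) hAR.eq
    simpa [hg'.1] using this
  have huA : A (β g) = (l : ℂ) • β g := by
    have := congrArg (fun F : H →L[ℂ] H => F g) hAβ.eq
    simpa [hg'.1] using this
  set P := (groundOp A b l).ker.starProjection with hP
  -- With `R = (1 + K²)⁻¹` the vector `w` is `K² R g`. Formally `Y K² = q A`, so `Y w = q A R g = q
  -- l (g - w)`, and the same equation holds for `P w` because `P` commutes with `Y` and fixes `g`.
  obtain ⟨w, hw⟩ : ∃ w, w = g - R g := ⟨_, rfl⟩
  have hYw := S.Y_of_K (hR.mem g) (hR.mem_sa S.K_sa g)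
  rw [← hw, hhA, show R g = g - w by rw [hw]; abel] at hYw
  have hYP := S.groundProj_commutes_Y hC l _ _ hYw
  rw [← hP, map_smul, map_smul, map_sub, show P g = g from
    Submodule.starProjection_eq_self_iff.2 hg] at hYP
  have hPw : P w ∈ (groundOp A b l).ker := Submodule.starProjection_apply_mem _ _
  have hPw' := (S.mem_ker_groundOp hC).1 hPw
  -- The difference `d = w - P w` satisfies `Y d = -q l d` and `A d = l d`. Positivity of `Y A`
  -- gives `-q l² ‖d‖² ≥ 0`, so `d = 0` and `w` lies in the ground space.
  have hsub := Y.graph.sub_mem hYw hYP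
  rw [Prod.mk_sub_mk] at hsub
  have h3 := S.Y_A_nonneg hsub
  have h4 : (q : ℂ) • (l : ℂ) • (g - w) - (q : ℂ) • (l : ℂ) • (g - P w)
      = ((-(q * l) : ℝ) : ℂ) • (w - P w) := by
    push_cast
    module
  have h5 : A (w - P w) = (l : ℂ) • (w - P w) := by
    rw [map_sub, hPw'.1, hw, map_sub, hg'.1, hhA]
    module
  rw [h4, h5, inner_smul_left, inner_smul_right, Complex.conj_ofReal, inner_self_ofReal]
    at h3
  have h6 : 0 ≤ -(q * l) * (l * ‖w - P w‖ ^ 2) := by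
    rw [← Complex.ofReal_mul, ← Complex.ofReal_mul, Complex.ofReal_re] at h3
    exact h3
  have h8 : ‖w - P w‖ ^ 2 ≤ 0 := by
    have h9 : 0 < q * l ^ 2 := mul_pos S.q_pos (by positivity)
    by_contra hcon
    push Not at hcon
    nlinarith [mul_pos h9 hcon]
  have h10 : w - P w = 0 := by
    rw [← norm_eq_zero]
    nlinarith [norm_nonneg (w - P w)]
  have hwG : w ∈ (groundOp A b l).ker := by rw [sub_eq_zero.1 h10]; exact hPw
  have hhG : R g ∈ (groundOp A b l).ker := by
    have := Submodule.sub_mem _ hg hwG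
    rwa [hw, sub_sub_cancel] at this
  have huG : β g ∈ (groundOp A b l).ker := (S.mem_ker_groundOp hC).2
    ⟨huA, S.K_of_Xs ((S.mem_ker_groundOp hC).1 hhG).2 (hR.mem g)⟩
  refine ⟨⟨R g, hhG⟩, ⟨β g, huG⟩, ⟨w, hwG⟩, (hT _ _).2 (hR.mem g), (hT _ _).2 (hw ▸ hR.mem_sa S.K_sa g),
    Subtype.ext ?_⟩
  simp [hw]

end DecoupledSystem

end Ground

end

/-! ### Copies of the ground space produced by `X`. -/

section

open Filter Topology

section Chain

variable {H : Type*} [NormedAddCommGroup H] [InnerProductSpace ℂ H] [CompleteSpace H]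
  {G : Type*} [NormedAddCommGroup G] [InnerProductSpace ℂ G] [CompleteSpace G]

theorem dense_range_of_isSelfAdjoint {b : G →L[ℂ] G} (hb : IsSelfAdjoint b)
    (h0 : ∀ x, b x = 0 → x = 0) : DenseRange b := by
  have h1 : (LinearMap.range (b : G →ₗ[ℂ] G)).topologicalClosure = ⊤ := by
    rw [Submodule.topologicalClosure_eq_top_iff, Submodule.eq_bot_iff]
    intro x hx
    refine h0 x (ext_inner_left ℂ fun y => ?_)
    rw [inner_zero_right, ← ContinuousLinearMap.adjoint_inner_left,
      ← ContinuousLinearMap.star_eq_adjoint, hb.star_eq]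
    exact (Submodule.mem_orthogonal _ _).1 hx _ ⟨y, rfl⟩
  have h2 := Submodule.dense_iff_topologicalClosure_eq_top.2 h1
  exact h2

theorem exists_isometry_of_norm_eq {b : G →L[ℂ] G} (hb : DenseRange b) {F : G →L[ℂ] H}
    (h : ∀ g, ‖F g‖ = ‖b g‖) : ∃ V : G →ₗᵢ[ℂ] H, ∀ g, V (b g) = F g := by
  have h1 : ∀ g, (F : G →ₗ[ℂ] H).extendOfNorm (b : G →ₗ[ℂ] G) (b g) = F g := fun g =>
    LinearMap.extendOfNorm_eq (f := (F : G →ₗ[ℂ] H)) (e := (b : G →ₗ[ℂ] G)) hb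
      ⟨1, fun x => by simpa using (h x).le⟩ g
  refine ⟨⟨((F : G →ₗ[ℂ] H).extendOfNorm (b : G →ₗ[ℂ] G) : G →ₗ[ℂ] H), fun x => ?_⟩, h1⟩
  refine congrFun (Continuous.ext_on hb
    (f := fun x => ‖(F : G →ₗ[ℂ] H).extendOfNorm (b : G →ₗ[ℂ] G) x‖)
    (g := fun x => ‖x‖) (by fun_prop) (by fun_prop) ?_) x
  rintro _ ⟨g, rfl⟩
  simp only [h1, h]

namespace IsGraphResolvent

variable {S : G →ₗ.[ℂ] G} {R b : G →L[ℂ] G}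

theorem injective_b (h : IsGraphResolvent S R b) (hk : ∀ x, (x, 0) ∈ S.graph → x = 0) {x : G}
    (hx : b x = 0) : x = 0 :=
  h.injective (hk _ (hx ▸ h.mem x))

theorem denseRange_b (h : IsGraphResolvent S R b) (hS : IsSelfAdjoint S)
    (hk : ∀ x, (x, 0) ∈ S.graph → x = 0) : DenseRange b :=
  dense_range_of_isSelfAdjoint (h.isSelfAdjoint_b hS) fun _ hx => h.injective_b hk hx

theorem inverse (h : IsGraphResolvent S R b) (hS : IsSelfAdjoint S)
    (hk : ∀ x, (x, 0) ∈ S.graph → x = 0) : IsGraphResolvent S.inverse (1 - R) b := by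
  constructor
  · intro g
    exact (mem_graph_inverse hk).2 (h.mem_sa hS g)
  · intro g
    rw [LinearPMap.isSelfAdjoint_def.1 (sa_inverse hS hk), mem_graph_inverse hk]
    have : g - (1 - R) g = R g := by simp
    rw [this]
    exact h.mem g

end IsGraphResolvent

namespace DecoupledSystem

variable {q c : ℝ} {A B : H →L[ℂ] H} {X Y K : H →ₗ.[ℂ] H}

/-- The action of the operators on the `j`-th copy of the ground space. -/
structure IsLevel (q c : ℝ) (A : H →L[ℂ] H) (X K : H →ₗ.[ℂ] H) (l : ℝ) (T : G →ₗ.[ℂ] G) (j : ℕ)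
    (V : G →ₗᵢ[ℂ] H) : Prop where
  A_V : ∀ η, A (V η) = (l : ℂ) • V η
  K_V : ∀ {η ζ}, (η, ζ) ∈ T.graph → (V η, ((q : ℂ) ^ j)⁻¹ • V ζ) ∈ K.graph
  XXs_V : ∀ {η ζ}, (η, ζ) ∈ (opPow T.inverse 4).graph →
    (V η, (1 - (q : ℂ) ^ (2 * j)) • ((c : ℂ) • V η + ((l : ℂ) ^ 2 * (q : ℂ) ^ (2 * j)) • V ζ))
      ∈ (opMul X X.adjoint).graph

variable {l : ℝ} {T : G →ₗ.[ℂ] G} {j : ℕ} {V : G →ₗᵢ[ℂ] H}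

/-- Formally `Y = q K⁻² A`, and on this copy `K⁻²` acts as `q^{2j} T⁻²` and `A` as `l`. -/
theorem IsLevel.Y_V (hV : IsLevel q c A X K l T j V) (S : DecoupledSystem q c A B X Y K)
    (hk : ∀ x, (x, 0) ∈ T.graph → x = 0) {η ζ : G}
    (h : (η, ζ) ∈ (opMul T.inverse T.inverse).graph) :
    (V η, ((q : ℂ) ^ (2 * j) * q * l) • V ζ) ∈ Y.graph := by
  obtain ⟨ξ, h1, h2⟩ := mem_graph_opMul.1 h
  rw [mem_graph_inverse hk] at h1 h2
  have hq : (q : ℂ) ≠ 0 := by exact_mod_cast S.q_pos.ne'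
  have h3 := S.Y_of_K (hV.K_V h2) (K.graph.smul_mem ((q : ℂ) ^ j)⁻¹ (hV.K_V h1))
  have h4 := Y.graph.smul_mem ((q : ℂ) ^ (2 * j)) h3
  rw [hV.A_V] at h4
  convert h4 using 1
  rw [Prod.smul_mk, smul_smul, smul_smul, smul_smul, smul_smul]
  congr 1
  rw [show (q : ℂ) ^ (2 * j) * ((q : ℂ) ^ j)⁻¹ * ((q : ℂ) ^ j)⁻¹ = 1 by
    rw [two_mul, pow_add]; field_simp, one_smul]

/-- The relation between `X* X` and `X X*` is evaluated with `Y² = (q^{2j} q l)² T⁻⁴`. In the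
constant term the factors combine as `q² (1 - q^{2j}) + (1 - q²) = 1 - q^{2(j+1)}`, and similarly in
the term with `T⁻⁴`. -/
theorem IsLevel.XsX_V (hV : IsLevel q c A X K l T j V) (S : DecoupledSystem q c A B X Y K)
    (hk : ∀ x, (x, 0) ∈ T.graph → x = 0) {η ζ : G} (h : (η, ζ) ∈ (opPow T.inverse 4).graph) :
    (V η, (1 - (q : ℂ) ^ (2 * (j + 1))) •
      ((c : ℂ) • V η + ((l : ℂ) ^ 2 * (q : ℂ) ^ (2 * (j + 1))) • V ζ))
      ∈ (opMul X.adjoint X).graph := by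
  rw [S.rel_X_Xs, mem_graph_add]
  have h1 := h
  rw [opPow_four] at h1
  obtain ⟨ξ, h2, h3⟩ := mem_graph_opMul.1 h1
  have hY : (V η, ((q : ℂ) ^ (2 * j) * q * l) ^ 2 • V ζ) ∈ (opMul Y Y).graph := by
    refine mem_graph_opMul.2 ⟨_, hV.Y_V S hk h2, ?_⟩
    have := Y.graph.smul_mem ((q : ℂ) ^ (2 * j) * q * l) (hV.Y_V S hk h3)
    rwa [Prod.smul_mk, smul_smul, ← pow_two] at this
  refine ⟨_, _, mem_graph_smul.2 ⟨_, hV.XXs_V h, rfl⟩, mem_graph_smul.2 ⟨_, mem_graph_add.2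
    ⟨_, _, hY, mem_graph_smul.2 ⟨_, mem_graph_idOp.2 rfl, rfl⟩, rfl⟩, rfl⟩, ?_⟩
  match_scalars <;> ring

/-- From one copy of the ground space to the next. -/
theorem IsLevel.exists_succ (hV : IsLevel q c A X K l T j V) (S : DecoupledSystem q c A B X Y K)
    (hT : IsSelfAdjoint T) (hk : ∀ x, (x, 0) ∈ T.graph → x = 0) (hl : l ≠ 0)
    {Q : G →ₗ.[ℂ] G}
    (hQ : IsPositiveSqrt Q (((l⁻¹ ^ 2 * (q ^ (2 * (j + 1)))⁻¹ * c : ℝ) : ℂ) • (idOp : G →ₗ.[ℂ] G)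
      + opPow T.inverse 4))
    (hQk : ∀ x, (x, 0) ∈ Q.graph → x = 0) (hQT : ∀ C, Commutes C T → Commutes C Q) {a : ℝ}
    (ha : 0 < a) (ha2 : a ^ 2 = l ^ 2 * (1 - q ^ (2 * (j + 1))) * q ^ (2 * (j + 1))) :
    ∃ V' : G →ₗᵢ[ℂ] H, IsLevel q c A X K l T (j + 1) V' ∧
      (∀ η ζ, (η, ζ) ∈ Q.graph → (V η, (a : ℂ) • V' ζ) ∈ X.graph) ∧
      (∀ η ζ, (η, ζ) ∈ Q.graph → (V' η, (a : ℂ) • V ζ) ∈ X.adjoint.graph) := by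
  have hq : (q : ℂ) ≠ 0 := by exact_mod_cast S.q_pos.ne'
  have hl' : (l : ℂ) ≠ 0 := by exact_mod_cast hl
  have ha' : (a : ℂ) ≠ 0 := by exact_mod_cast ha.ne'
  have ha2' : (a : ℂ) ^ 2 = (l : ℂ) ^ 2 * (1 - (q : ℂ) ^ (2 * (j + 1))) * (q : ℂ) ^ (2 * (j + 1)) := by
    exact_mod_cast ha2
  obtain ⟨C, bX, hC⟩ := exists_isGraphResolvent S.X_dense S.X_closed
  obtain ⟨R, b, hR⟩ := sa_exists_resolvent hQ.1
  obtain ⟨R', b', hR'⟩ := sa_exists_resolvent hT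
  have hQQ : ∀ {η ζ}, (η, ζ) ∈ (opMul Q Q).graph → ∃ v, (η, v) ∈ (opPow T.inverse 4).graph ∧
      ζ = ((l⁻¹ ^ 2 * (q ^ (2 * (j + 1)))⁻¹ * c : ℝ) : ℂ) • η + v := by
    intro η ζ h
    rw [hQ.2.2, mem_graph_add] at h
    obtain ⟨u, v, h1, h2, rfl⟩ := h
    obtain ⟨u, h3, rfl⟩ := mem_graph_smul.1 h1
    exact ⟨v, h2, by rw [mem_graph_idOp.1 h3]⟩
  -- The number `a` and the constant in `Q²` are chosen so that `X* X V = a² V Q²`. Hence `|X|`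
  -- corresponds to `a Q`, and `V'` is the polar part of `X` on the copy `V`.
  have hXX : ∀ {η ζ}, (η, ζ) ∈ (opMul Q Q).graph →
      (V η, (a : ℂ) ^ 2 • V ζ) ∈ (opMul X.adjoint X).graph := by
    intro η ζ h
    obtain ⟨v, hv, rfl⟩ := hQQ h
    convert hV.XsX_V S hk hv using 2
    rw [map_add, map_smul, ha2']
    push_cast
    match_scalars <;> field_simp
  -- `F = X V R` with `R = (1 + Q²)⁻¹`, written as a bounded operator: `b_X` sends `x + X* X x` to
  -- `X x`, and for `x = V R g` this argument is `V R g + a² V (g - R g)`.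
  set F : G →L[ℂ] H := bX ∘L ((V.toContinuousLinearMap ∘L R)
    + (a : ℂ) ^ 2 • (V.toContinuousLinearMap ∘L (1 - R))) with hF
  have hFX : ∀ g, (V (R g), F g) ∈ X.graph ∧ (F g, (a : ℂ) ^ 2 • V (g - R g)) ∈ X.adjoint.graph := by
    intro g
    obtain ⟨y, h1, h2⟩ := mem_graph_opMul.1 (hXX (mem_graph_opMul.2 ⟨b g, hR.mem g,
      hR.mem_sa hQ.1 g⟩))
    have h3 : y = F g := (hC.unique S.X_dense h1 h2).2.symm
    rw [← h3]
    exact ⟨h1, h2⟩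
  -- `‖X V R g‖² = ⟪X* X V R g, V R g⟫ = a² ‖Q R g‖²`. So `b g ↦ a⁻¹ F g` is isometric on the dense
  -- range of `b = Q R`.
  have hFn : ∀ g, ‖((a : ℂ)⁻¹ • F) g‖ = ‖b g‖ := by
    intro g
    have h1 := (mem_graph_adjoint S.X_dense).1 (hFX g).2 _ _ (hFX g).1
    have h2 := sa_symm hQ.1 (hR.mem_sa hQ.1 g) (hR.mem g)
    rw [inner_smul_left, V.inner_map_map, h2, inner_self_ofReal, inner_self_ofReal] at h1
    have h3 : a ^ 2 * ‖b g‖ ^ 2 = ‖F g‖ ^ 2 := by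
      have : (starRingEnd ℂ) ((a : ℂ) ^ 2) = ((a ^ 2 : ℝ) : ℂ) := by
        rw [← Complex.ofReal_pow, Complex.conj_ofReal]
      rw [this] at h1
      exact_mod_cast h1
    rw [smul_apply, norm_smul, norm_inv, Complex.norm_real, Real.norm_of_nonneg ha.le]
    have h4 : a * ‖b g‖ = ‖F g‖ := by
      rw [← mul_pow] at h3
      exact (pow_left_inj₀ (by positivity) (norm_nonneg _) two_ne_zero).1 h3
    rw [← h4]
    field_simp
  have hbd := hR.denseRange_b hQ.1 hQk
  obtain ⟨V', hV'⟩ := exists_isometry_of_norm_eq hbd hFn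
  have hV'F : ∀ g, (a : ℂ) • V' (b g) = F g := by
    intro g
    rw [hV', smul_apply, smul_smul, mul_inv_cancel₀ ha', one_smul]
  have h5 : ∀ η ζ, (η, ζ) ∈ Q.graph → (V η, (a : ℂ) • V' ζ) ∈ X.graph := by
    intro η ζ h
    refine hR.graph_induction hQ.1.dense_domain (sa_isClosed_graph hQ.1)
      (p := fun v => (V v.1, (a : ℂ) • V' v.2) ∈ X.graph) ?_ dense_univ (fun g _ => ?_) h
    · exact S.X_closed.preimage (f := fun v : G × G => (V v.1, (a : ℂ) • V' v.2)) (by fun_prop)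
    · change (V (R g), (a : ℂ) • V' (b g)) ∈ X.graph
      rw [hV'F]
      exact (hFX g).1
  -- The values of `X*` are known on the vectors `V' (b g)`. For this reason the core used is that
  -- of `Q⁻¹`, whose resolvent is `1 - R`: it consists of the pairs of `Q` that start at `b g`.
  have h4 : ∀ η ζ, (η, ζ) ∈ Q.graph → (V' η, (a : ℂ) • V ζ) ∈ X.adjoint.graph := by
    intro η ζ h
    have hcl : IsClosed (X.adjoint.graph : Set (H × H)) := LinearPMap.adjoint_isClosed S.X_dense
    refine (hR.inverse hQ.1 hQk).graph_induction (sa_inverse hQ.1 hQk).dense_domain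
      (sa_isClosed_graph (sa_inverse hQ.1 hQk))
      (p := fun v => (V' v.2, (a : ℂ) • V v.1) ∈ X.adjoint.graph) ?_ dense_univ (fun g _ => ?_)
      ((mem_graph_inverse hQk).2 h)
    · exact hcl.preimage (f := fun v : G × G => (V' v.2, (a : ℂ) • V v.1)) (by fun_prop)
    · change (V' (b g), (a : ℂ) • V ((1 - R) g)) ∈ X.adjoint.graph
      have := X.adjoint.graph.smul_mem (a : ℂ)⁻¹ (hFX g).2
      rw [Prod.smul_mk, ← hV'F, smul_smul, smul_smul, inv_mul_cancel₀ ha', one_smul,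
        show (a : ℂ)⁻¹ * (a : ℂ) ^ 2 = a by field_simp] at this
      exact this
  refine ⟨V', ⟨?_, ?_, ?_⟩, h5, h4⟩
  · intro η
    refine congrFun (Continuous.ext_on hbd (f := fun η => A (V' η))
      (g := fun η => (l : ℂ) • V' η) (by fun_prop) (by fun_prop) ?_) η
    rintro _ ⟨g, rfl⟩
    dsimp only
    have e1 := S.A_X _ _ (hFX g).1
    rw [hV.A_V] at e1
    have e2 := graph_unique e1 (X.graph.smul_mem (l : ℂ) (hFX g).1)
    rw [hV', smul_apply, map_smul, e2, smul_comm]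
  · intro η ζ h
    refine hR'.graph_induction hT.dense_domain (sa_isClosed_graph hT)
      (p := fun v => (V' v.1, ((q : ℂ) ^ (j + 1))⁻¹ • V' v.2) ∈ K.graph) ?_ hbd
      (fun g hg => ?_) h
    · exact (sa_isClosed_graph S.K_sa).preimage
        (f := fun v : G × G => (V' v.1, ((q : ℂ) ^ (j + 1))⁻¹ • V' v.2)) (by fun_prop)
    · obtain ⟨g, rfl⟩ := hg
      -- The relation `K X v = q⁻¹ X K v` needs both `v` and `K v` in `D(X)`. With `v = V R R' g`
      -- this holds because the bounded functions `R'`, `b'` of `T` commute with the resolvent `R`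
      -- of `Q²`.
      obtain ⟨e1, e2⟩ := hR'.commutes hT
      obtain ⟨e3, e4⟩ := hR.commute_of_commutes hQ.1 (hQT _ e1)
      obtain ⟨e5, e6⟩ := hR.commute_of_commutes hQ.1 (hQT _ e2)
      have hap : ∀ {D E : G →L[ℂ] G}, Commute D E → ∀ g, D (E g) = E (D g) := fun h g =>
        congrArg (fun F : G →L[ℂ] G => F g) h.eq
      change (V' (R' (b g)), ((q : ℂ) ^ (j + 1))⁻¹ • V' (b' (b g))) ∈ K.graph
      rw [hap e4, hap e6, hV', hV', smul_apply, smul_apply]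
      have k1 := hV.K_V (hR'.mem (R g))
      rw [hap e3, hap e5] at k1
      have k2 := S.K_of_X (hFX (R' g)).1 k1 (X.graph.smul_mem ((q : ℂ) ^ j)⁻¹ (hFX (b' g)).1)
      have k3 := K.graph.smul_mem (a : ℂ)⁻¹ k2
      convert k3 using 1
      rw [Prod.smul_mk]
      congr 1
      dsimp only
      rw [smul_smul, smul_smul, smul_smul, pow_succ]
      congr 1
      field_simp
  · intro η v h
    have h1 : (η, ((l⁻¹ ^ 2 * (q ^ (2 * (j + 1)))⁻¹ * c : ℝ) : ℂ) • η + v) ∈ (opMul Q Q).graph := by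
      rw [hQ.2.2, mem_graph_add]
      exact ⟨_, _, mem_graph_smul.2 ⟨_, mem_graph_idOp.2 rfl, rfl⟩, h, rfl⟩
    obtain ⟨ξ, e1, e2⟩ := mem_graph_opMul.1 h1
    refine mem_graph_opMul.2 ⟨_, h4 _ _ e1, ?_⟩
    convert X.graph.smul_mem (a : ℂ) (h5 _ _ e2) using 1
    rw [Prod.smul_mk, smul_smul, ← pow_two, map_add, map_smul, ha2']
    push_cast
    congr 1
    match_scalars <;> field_simp

end DecoupledSystem

end Chain

end

/-! ### The sequence of copies inside one eigenspace of `A`. -/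

section

open Filter Topology

section Levels

variable {H : Type*} [NormedAddCommGroup H] [InnerProductSpace ℂ H] [CompleteSpace H]
  {G : Type*} [NormedAddCommGroup G] [InnerProductSpace ℂ G] [CompleteSpace G]

namespace DecoupledSystem

variable {q c : ℝ} {A B : H →L[ℂ] H} {X Y K : H →ₗ.[ℂ] H} {l : ℝ}

theorem lamN_sq {q : ℝ} (h0 : 0 < q) (h1 : q < 1) (j : ℕ) : lamN q j ^ 2 = 1 - q ^ (2 * j) :=
  Real.sq_sqrt (sub_nonneg.2 (pow_le_one₀ h0.le h1.le))

theorem lamN_succ_pos {q : ℝ} (h0 : 0 < q) (h1 : q < 1) (j : ℕ) : 0 < lamN q (j + 1) :=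
  Real.sqrt_pos.2 (sub_pos.2 (pow_lt_one₀ h0.le h1 (by omega)))

/-- The eigenspace of `A` for the eigenvalue `l`, decomposed into copies of the ground space. -/
structure LevelFamily (q c : ℝ) (A : H →L[ℂ] H) (X K : H →ₗ.[ℂ] H) (l : ℝ) (T : G →ₗ.[ℂ] G)
    (Q : ℕ → G →ₗ.[ℂ] G) (V : ℕ → G →ₗᵢ[ℂ] H) : Prop where
  T_sa : IsSelfAdjoint T
  T_inj : ∀ x, (x, 0) ∈ T.graph → x = 0
  Q_sqrt : ∀ j, IsPositiveSqrt (Q j)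
    (((l⁻¹ ^ 2 * (q ^ (2 * j))⁻¹ * c : ℝ) : ℂ) • (idOp : G →ₗ.[ℂ] G) + opPow T.inverse 4)
  Q_inj : ∀ j x, (x, 0) ∈ (Q j).graph → x = 0
  level : ∀ j, IsLevel q c A X K l T j (V j)
  X_V : ∀ j {η ζ}, (η, ζ) ∈ (Q (j + 1)).graph →
    (V j η, ((|l| * lamN q (j + 1) * q ^ (j + 1) : ℝ) : ℂ) • V (j + 1) ζ) ∈ X.graph
  Xs_V : ∀ j {η ζ}, (η, ζ) ∈ (Q (j + 1)).graph →
    (V (j + 1) η, ((|l| * lamN q (j + 1) * q ^ (j + 1) : ℝ) : ℂ) • V j ζ) ∈ X.adjoint.graph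
  Xs_V_zero : ∀ η, (V 0 η, 0) ∈ X.adjoint.graph
  ground : ∀ x, A x = (l : ℂ) • x → (x, 0) ∈ X.adjoint.graph → ∃ η, V 0 η = x

/-- Iteration of `IsLevel.exists_succ`, beginning with the inclusion of the ground space and with
`T` the part of `K` in it. -/
theorem exists_levelFamily (S : DecoupledSystem q c A B X Y K) (hl : l ≠ 0) {C b : H →L[ℂ] H}
    (hC : IsGraphResolvent X C b) :
    ∃ (T : (groundOp A b l).ker →ₗ.[ℂ] (groundOp A b l).ker)
      (Q : ℕ → (groundOp A b l).ker →ₗ.[ℂ] (groundOp A b l).ker)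
      (V : ℕ → (groundOp A b l).ker →ₗᵢ[ℂ] H), LevelFamily q c A X K l T Q V := by
  obtain ⟨T, hT⟩ := exists_part K (groundOp A b l).ker
  have hTsa := S.isSelfAdjoint_part hC hl hT
  have hTk : ∀ x, (x, 0) ∈ T.graph → x = 0 := fun x hx =>
    Subtype.ext (S.K_inj _ ((hT _ _).1 hx))
  have hκ : ∀ j : ℕ, 0 ≤ l⁻¹ ^ 2 * (q ^ (2 * j))⁻¹ * c := fun j =>
    mul_nonneg (mul_nonneg (sq_nonneg _) (inv_nonneg.2 (pow_nonneg S.q_pos.le _))) S.c_nonneg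
  choose Q hQ1 hQ2 hQ3 using fun j : ℕ => exists_sqrt_radicand hTsa hTk (hκ j)
  have hXs0 : ∀ η : (groundOp A b l).ker, ((η : H), 0) ∈ X.adjoint.graph := fun η =>
    ((S.mem_ker_groundOp hC).1 η.2).2
  -- For `j = 0` the factor `1 - q^{2j}` vanishes, in accordance with `X X* = 0` on the ground
  -- space.
  have h0 : IsLevel q c A X K l T 0 (groundOp A b l).ker.subtypeₗᵢ := by
    refine ⟨fun η => ((S.mem_ker_groundOp hC).1 η.2).1, fun {η ζ} h => ?_, fun {η ζ} _ => ?_⟩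
    · rw [pow_zero, inv_one, one_smul]
      exact (hT _ _).1 h
    · rw [mul_zero, pow_zero, sub_self, zero_smul]
      exact mem_graph_opMul.2 ⟨0, hXs0 η, X.graph.zero_mem⟩
  have hstep : ∀ (j : ℕ) (V : {V : (groundOp A b l).ker →ₗᵢ[ℂ] H // IsLevel q c A X K l T j V}),
      ∃ V' : {V : (groundOp A b l).ker →ₗᵢ[ℂ] H // IsLevel q c A X K l T (j + 1) V},
        (∀ η ζ, (η, ζ) ∈ (Q (j + 1)).graph →
          (V.1 η, ((|l| * lamN q (j + 1) * q ^ (j + 1) : ℝ) : ℂ) • V'.1 ζ) ∈ X.graph) ∧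
        (∀ η ζ, (η, ζ) ∈ (Q (j + 1)).graph →
          (V'.1 η, ((|l| * lamN q (j + 1) * q ^ (j + 1) : ℝ) : ℂ) • V.1 ζ) ∈ X.adjoint.graph) := by
    intro j V
    obtain ⟨V', h1, h2, h3⟩ := V.2.exists_succ S hTsa hTk hl (hQ1 (j + 1)) (hQ2 (j + 1))
      (hQ3 (j + 1)) (a := |l| * lamN q (j + 1) * q ^ (j + 1))
      (mul_pos (mul_pos (abs_pos.2 hl) (lamN_succ_pos S.q_pos S.q_lt_one j))
        (pow_pos S.q_pos _))
      (by rw [mul_pow, mul_pow, sq_abs, lamN_sq S.q_pos S.q_lt_one]; ring)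
    exact ⟨⟨V', h1⟩, h2, h3⟩
  choose next hn1 hn2 using hstep
  let V : ∀ j : ℕ, {V : (groundOp A b l).ker →ₗᵢ[ℂ] H // IsLevel q c A X K l T j V} := fun j =>
    Nat.rec ⟨_, h0⟩ (fun j V => next j V) j
  refine ⟨T, Q, fun j => (V j).1, hTsa, hTk, hQ1, hQ2, fun j => (V j).2, fun j {η ζ} h => hn1 j (V j) η ζ h,
    fun j {η ζ} h => hn2 j (V j) η ζ h, hXs0, fun x h1 h2 => ?_⟩
  exact ⟨⟨x, (S.mem_ker_groundOp hC).2 ⟨h1, h2⟩⟩, rfl⟩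

namespace LevelFamily

variable {T : G →ₗ.[ℂ] G} {Q : ℕ → G →ₗ.[ℂ] G} {V : ℕ → G →ₗᵢ[ℂ] H}

theorem coeff_pos (S : DecoupledSystem q c A B X Y K) (hl : l ≠ 0) (j : ℕ) :
    0 < |l| * lamN q (j + 1) * q ^ (j + 1) :=
  mul_pos (mul_pos (abs_pos.2 hl) (lamN_succ_pos S.q_pos S.q_lt_one j)) (pow_pos S.q_pos _)

/-- A closed condition that holds on the range of `Q j` holds everywhere. -/
theorem eq_zero_of_range (F : LevelFamily q c A X K l T Q V) (j : ℕ) {v : G}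
    (h : ∀ η ζ, (η, ζ) ∈ (Q j).graph → ⟪v, ζ⟫_ℂ = 0) : v = 0 :=
  sa_eq_zero_of_orthogonal_range (F.Q_sqrt j).1 (F.Q_inj j) h

theorem eq_zero_of_domain (F : LevelFamily q c A X K l T Q V) (j : ℕ) {v : G}
    (h : ∀ η ζ, (η, ζ) ∈ (Q j).graph → ⟪v, η⟫_ℂ = 0) : v = 0 :=
  eq_zero_of_forall_inner_graph (F.Q_sqrt j).1.dense_domain h

/-- Moving `X` across the inner product lowers both indices by one, until `X* V 0 = 0` is reached.
The unbounded factors `Q` are removed because their domains and ranges are dense. -/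
theorem orthogonal_of_lt (F : LevelFamily q c A X K l T Q V) (S : DecoupledSystem q c A B X Y K)
    (hl : l ≠ 0) : ∀ (j k : ℕ), j < k → ∀ η ζ, ⟪V j η, V k ζ⟫_ℂ = 0 := by
  have hadj : ∀ {x y u v}, (x, y) ∈ X.graph → (u, v) ∈ X.adjoint.graph → ⟪v, x⟫_ℂ = ⟪u, y⟫_ℂ :=
    fun h h' => (mem_graph_adjoint S.X_dense).1 h' _ _ h
  have ha : ∀ k, ((|l| * lamN q (k + 1) * q ^ (k + 1) : ℝ) : ℂ) ≠ 0 := fun k => by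
    exact_mod_cast (coeff_pos S hl k).ne'
  intro j
  induction j with
  | zero =>
    intro k hk η
    obtain ⟨k, rfl⟩ : ∃ m, k = m + 1 := ⟨k - 1, by omega⟩
    have h1 : ContinuousLinearMap.adjoint (V (k + 1)).toContinuousLinearMap (V 0 η) = 0 := by
      refine F.eq_zero_of_range (k + 1) fun ξ ζ h => ?_
      rw [ContinuousLinearMap.adjoint_inner_left]
      have h2 := hadj (F.X_V k h) (F.Xs_V_zero η)
      rw [inner_zero_left, inner_smul_right] at h2
      exact (mul_eq_zero.1 h2.symm).resolve_left (ha k)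
    intro ζ
    have h2 := ContinuousLinearMap.adjoint_inner_left (V (k + 1)).toContinuousLinearMap ζ (V 0 η)
    rw [h1, inner_zero_left] at h2
    exact h2.symm
  | succ j ih =>
    intro k hk η ζ
    obtain ⟨k, rfl⟩ : ∃ m, k = m + 1 := ⟨k - 1, by omega⟩
    have h1 : ∀ ζ' ζ'', (ζ', ζ'') ∈ (Q (k + 1)).graph → ∀ η, ⟪V (j + 1) η, V (k + 1) ζ'⟫_ℂ = 0 := by
      intro ζ' ζ'' hζ η
      have h3 : ContinuousLinearMap.adjoint (V (j + 1)).toContinuousLinearMap (V (k + 1) ζ') = 0 := by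
        refine F.eq_zero_of_range (j + 1) fun ξ ξ' h => ?_
        rw [ContinuousLinearMap.adjoint_inner_left]
        have h2 := hadj (F.X_V j h) (F.Xs_V k hζ)
        rw [inner_smul_left, ← inner_conj_symm, ih k (by omega), map_zero, mul_zero,
          inner_smul_right] at h2
        exact (mul_eq_zero.1 h2.symm).resolve_left (ha j)
      have h4 := ContinuousLinearMap.adjoint_inner_right (V (j + 1)).toContinuousLinearMap η (V (k + 1) ζ')
      rw [h3, inner_zero_right] at h4
      exact h4.symm
    have h5 : ContinuousLinearMap.adjoint (V (k + 1)).toContinuousLinearMap (V (j + 1) η) = 0 := by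
      refine F.eq_zero_of_domain (k + 1) fun ξ ξ' h => ?_
      rw [ContinuousLinearMap.adjoint_inner_left]
      exact h1 _ _ h η
    have h6 := ContinuousLinearMap.adjoint_inner_left (V (k + 1)).toContinuousLinearMap ζ (V (j + 1) η)
    rw [h5, inner_zero_left] at h6
    exact h6.symm

theorem orthogonal (F : LevelFamily q c A X K l T Q V) (S : DecoupledSystem q c A B X Y K)
    (hl : l ≠ 0) {j k : ℕ} (hjk : j ≠ k) (η ζ : G) : ⟪V j η, V k ζ⟫_ℂ = 0 := by
  rcases lt_or_gt_of_ne hjk with h | h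
  · exact F.orthogonal_of_lt S hl j k h η ζ
  · rw [← inner_conj_symm, F.orthogonal_of_lt S hl k j h, map_zero]

end LevelFamily

end DecoupledSystem

end Levels

end

/-! ### Subspaces without ground vectors are trivial. -/

section

open Filter Topology

section Exhaustion

variable {H : Type*} [NormedAddCommGroup H] [InnerProductSpace ℂ H] [CompleteSpace H]
  {G : Type*} [NormedAddCommGroup G] [InnerProductSpace ℂ G] [CompleteSpace G]

theorem sa_inner {D : H →L[ℂ] H} (hD : IsSelfAdjoint D) (x y : H) : ⟪D x, y⟫_ℂ = ⟪x, D y⟫_ℂ := by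
  rw [← ContinuousLinearMap.adjoint_inner_right, ← ContinuousLinearMap.star_eq_adjoint, hD.star_eq]

theorem exists_sqrt_bounded {C : H →L[ℂ] H} (hC : 0 ≤ C) :
    ∃ r : H →L[ℂ] H, IsSelfAdjoint r ∧ r * r = C ∧ ∀ F, Commute C F → Commute r F := by
  have hsp : (CFC.sqrt C).IsPositive :=
    (ContinuousLinearMap.nonneg_iff_isPositive _).1 (CFC.sqrt_nonneg C)
  refine ⟨CFC.sqrt C, hsp.isSelfAdjoint, CFC.sqrt_mul_sqrt_self C hC, fun F hF => ?_⟩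
  exact hF.cfcₙ_nnreal _

/-- A closed subspace that is invariant under a self-adjoint `C` is invariant under everything in
the bicommutant of `C`. -/
theorem mapsTo_of_bicommutant {L : Submodule ℂ H} [L.HasOrthogonalProjection] {C r : H →L[ℂ] H}
    (hC : IsSelfAdjoint C) (hL : ∀ x ∈ L, C x ∈ L) (hr : ∀ F, Commute C F → Commute r F) :
    ∀ x ∈ L, r x ∈ L := by
  have h1 : Commute C L.starProjection := by
    ext x
    change C (L.starProjection x) = L.starProjection (C x)
    have h2 : L.starProjection (C (L.starProjection x)) = C (L.starProjection x) :=
      Submodule.starProjection_eq_self_iff.2 (hL _ (Submodule.starProjection_apply_mem _ _))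
    rw [← h2]
    refine ext_inner_right ℂ fun y => ?_
    have hs : ∀ u v, ⟪L.starProjection u, v⟫_ℂ = ⟪u, L.starProjection v⟫_ℂ :=
      Submodule.inner_starProjection_left_eq_right _
    rw [hs, sa_inner hC, hs, hs, sa_inner hC]
    congr 1
    exact Submodule.starProjection_eq_self_iff.2 (hL _ (Submodule.starProjection_apply_mem _ _))
  intro x hx
  have h3 := congrArg (fun D : H →L[ℂ] H => D x) (hr _ h1).eq
  simp only [mul_apply_eq_comp, Submodule.starProjection_eq_self_iff.2 hx] at h3
  rw [h3]
  exact Submodule.starProjection_apply_mem _ _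

/-- A relative bound on a core extends to the closure. -/
theorem exists_graph_of_bound {T : H →ₗ.[ℂ] H} (hT : IsClosed (T.graph : Set (H × H)))
    {𝒞 : Submodule ℂ (H × H)} {β : ℝ} (hβ : 0 < β)
    (h : ∀ x y, (x, y) ∈ 𝒞 → ∃ z, (x, z) ∈ T.graph ∧ β * ‖z‖ ^ 2 ≤ ‖y‖ ^ 2) {x y : H}
    (hxy : (x, y) ∈ 𝒞.topologicalClosure) :
    ∃ z, (x, z) ∈ T.graph ∧ β * ‖z‖ ^ 2 ≤ ‖y‖ ^ 2 := by
  obtain ⟨s, hs, hl⟩ := mem_closure_iff_seq_limit.1 hxy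
  choose z hz1 hz2 using fun n => h (s n).1 (s n).2 (hs n)
  have hsn : Tendsto (fun n => (s n).2) atTop (𝓝 y) := (continuous_snd.tendsto _).comp hl
  have hd : ∀ n m, dist (z n) (z m) ≤ (√β)⁻¹ * dist (s n).2 (s m).2 := by
    intro n m
    obtain ⟨w, hw1, hw2⟩ := h _ _ (𝒞.sub_mem (hs n) (hs m))
    have e := graph_unique hw1 (show ((s n).1 - (s m).1, z n - z m) ∈ T.graph from
      T.graph.sub_mem (hz1 n) (hz1 m))
    rw [e] at hw2
    rw [dist_eq_norm, dist_eq_norm, le_inv_mul_iff₀ (Real.sqrt_pos.2 hβ)]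
    refine abs_le_of_sq_le_sq' ?_ (norm_nonneg _) |>.2
    rw [mul_pow, Real.sq_sqrt hβ.le]
    exact hw2
  have hc : CauchySeq z := by
    have hc1 := hsn.cauchySeq
    rw [Metric.cauchySeq_iff] at hc1 ⊢
    intro ε hε
    obtain ⟨N, hN⟩ := hc1 (√β * ε) (mul_pos (Real.sqrt_pos.2 hβ) hε)
    refine ⟨N, fun m hm n hn => (hd m n).trans_lt ?_⟩
    rw [inv_mul_lt_iff₀ (Real.sqrt_pos.2 hβ)]
    exact hN m hm n hn
  obtain ⟨w, hw⟩ := cauchySeq_tendsto_of_complete hc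
  have hsx : Tendsto (fun n => (s n).1) atTop (𝓝 x) := (continuous_fst.tendsto _).comp hl
  refine ⟨w, hT.mem_of_tendsto (hsx.prodMk_nhds hw) (Eventually.of_forall hz1), ?_⟩
  exact le_of_tendsto_of_tendsto (((continuous_norm.tendsto _).comp hw).pow 2 |>.const_mul β)
    (((continuous_norm.tendsto _).comp hsn).pow 2) (Eventually.of_forall hz2)

namespace DecoupledSystem

variable {q c : ℝ} {A B : H →L[ℂ] H} {X Y K : H →ₗ.[ℂ] H} {l : ℝ}

theorem graph_mem_closure {C b : H →L[ℂ] H} (S : DecoupledSystem q c A B X Y K)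
    (hC : IsGraphResolvent X C b) {x y : H} (hxy : (x, y) ∈ X.graph) :
    (x, y) ∈ (LinearMap.range ((C.prod b : H →L[ℂ] H × H) : H →ₗ[ℂ] H × H)).topologicalClosure :=
  hC.graph_induction S.X_dense S.X_closed
    (p := fun v => v ∈ (LinearMap.range
      ((C.prod b : H →L[ℂ] H × H) : H →ₗ[ℂ] H × H)).topologicalClosure)
    (Submodule.isClosed_topologicalClosure _) dense_univ
    (fun g _ => Submodule.le_topologicalClosure _ ⟨g, rfl⟩) hxy

/-- `X* X ≥ (1 - q²) Y²` and `X* X ≥ q² X X*`, in the form sense. -/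
theorem exists_bounds (S : DecoupledSystem q c A B X Y K) {x y : H} (hxy : (x, y) ∈ X.graph) :
    (∃ z, (x, z) ∈ Y.graph ∧ (1 - q ^ 2) * ‖z‖ ^ 2 ≤ ‖y‖ ^ 2) ∧
      ∃ p, (x, p) ∈ X.adjoint.graph ∧ q ^ 2 * ‖p‖ ^ 2 ≤ ‖y‖ ^ 2 := by
  obtain ⟨C, b, hC⟩ := exists_isGraphResolvent S.X_dense S.X_closed
  have hq2 : 0 < 1 - q ^ 2 := sub_pos.2 (pow_lt_one₀ S.q_pos.le S.q_lt_one two_ne_zero)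
  -- On the core the relation for `X* X` is an equality of vectors. Paired with `C g` it reads `‖X
  -- x‖² = q² ‖X* x‖² + (1 - q²)(‖Y x‖² + c ‖x‖²)` with `x = C g`, and dropping nonnegative terms
  -- gives both bounds.
  have key : ∀ x y, (x, y) ∈ LinearMap.range ((C.prod b : H →L[ℂ] H × H) : H →ₗ[ℂ] H × H) →
      (∃ z, (x, z) ∈ Y.graph ∧ (1 - q ^ 2) * ‖z‖ ^ 2 ≤ ‖y‖ ^ 2) ∧
      ∃ p, (x, p) ∈ X.adjoint.graph ∧ q ^ 2 * ‖p‖ ^ 2 ≤ ‖y‖ ^ 2 := by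
    rintro _ _ ⟨g, hg⟩
    obtain ⟨rfl, rfl⟩ := Prod.mk.inj hg
    change (∃ z, (C g, z) ∈ Y.graph ∧ (1 - q ^ 2) * ‖z‖ ^ 2 ≤ ‖b g‖ ^ 2) ∧
      ∃ p, (C g, p) ∈ X.adjoint.graph ∧ q ^ 2 * ‖p‖ ^ 2 ≤ ‖b g‖ ^ 2
    have h1 : (C g, g - C g) ∈ (opMul X.adjoint X).graph :=
      mem_graph_opMul.2 ⟨b g, hC.mem g, hC.mem_adj g⟩
    rw [S.rel_X_Xs, mem_graph_add] at h1
    obtain ⟨u', v', h2, h3, h4⟩ := h1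
    obtain ⟨u, h5, rfl⟩ := mem_graph_smul.1 h2
    obtain ⟨v, h6, rfl⟩ := mem_graph_smul.1 h3
    obtain ⟨p, h7, h8⟩ := mem_graph_opMul.1 h5
    obtain ⟨v1, v2, h9, h10, rfl⟩ := mem_graph_add.1 h6
    obtain ⟨r, h11, h12⟩ := mem_graph_opMul.1 h9
    obtain ⟨v3, h13, rfl⟩ := mem_graph_smul.1 h10
    rw [mem_graph_idOp.1 h13] at h4
    have e1 := (mem_graph_adjoint S.X_dense).1 (hC.mem_adj g) _ _ (hC.mem g)
    have e2 := (mem_graph_adjoint S.X_dense).1 h7 _ _ h8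
    have e3 := sa_symm S.Y_sa h11 h12
    have e2' : ⟪u, C g⟫_ℂ = ⟪p, p⟫_ℂ := by
      rw [← inner_conj_symm, ← e2, inner_conj_symm]
    have e3' : ⟪v1, C g⟫_ℂ = ⟪r, r⟫_ℂ := by
      rw [← inner_conj_symm, ← e3, inner_conj_symm]
    rw [h4, inner_add_left, inner_smul_left, inner_smul_left, inner_add_left, inner_smul_left, e2',
      e3', inner_self_ofReal, inner_self_ofReal, inner_self_ofReal, inner_self_ofReal] at e1
    simp only [map_sub, map_one, map_pow, Complex.conj_ofReal] at e1
    have e5 : q ^ 2 * ‖p‖ ^ 2 + (1 - q ^ 2) * (‖r‖ ^ 2 + c * ‖C g‖ ^ 2) = ‖b g‖ ^ 2 := by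
      exact_mod_cast e1
    have f1 : 0 ≤ (1 - q ^ 2) * (c * ‖C g‖ ^ 2) :=
      mul_nonneg hq2.le (mul_nonneg S.c_nonneg (sq_nonneg _))
    refine ⟨⟨r, h11, ?_⟩, p, h7, ?_⟩
    · nlinarith [mul_nonneg (sq_nonneg q) (sq_nonneg ‖p‖)]
    · nlinarith [mul_nonneg hq2.le (sq_nonneg ‖r‖)]
  have hcl := S.graph_mem_closure hC hxy
  exact ⟨exists_graph_of_bound (sa_isClosed_graph S.Y_sa) hq2 (fun x y h => (key x y h).1) hcl,
    exists_graph_of_bound (LinearPMap.adjoint_isClosed S.X_dense) (pow_pos S.q_pos 2)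
      (fun x y h => (key x y h).2) hcl⟩

/-- A closed subspace that reduces the decoupled operators and meets `ker X*` trivially is
trivial. -/
theorem eq_bot_of_reducing (S : DecoupledSystem q c A B X Y K) {C b : H →L[ℂ] H}
    (hC : IsGraphResolvent X C b) {R β : H →L[ℂ] H} (hR : IsGraphResolvent Y R β)
    {L : Submodule ℂ H} (hL : IsClosed (L : Set H)) (hLX : ∀ x ∈ L, ∀ y, (x, y) ∈ X.graph → y ∈ L)
    (hLXs : ∀ x ∈ L, ∀ y, (x, y) ∈ X.adjoint.graph → y ∈ L) (hLC : ∀ x ∈ L, C x ∈ L)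
    (hLR : ∀ x ∈ L, R x ∈ L) (hL0 : ∀ x ∈ L, (x, 0) ∈ X.adjoint.graph → x = 0) :
    ∀ x ∈ L, x = 0 := by
  have : CompleteSpace L := hL.completeSpace_coe
  have hCsa := hC.isSelfAdjoint S.X_dense
  -- `r = C^{1/2}` and `t = (1 - C)^{1/2}` serve as bounded substitutes for functions of `|X|`:
  -- formally `|X| = t r⁻¹`, and `‖b g‖ = ‖t r g‖`. Both lie in the bicommutant of `C`, so they
  -- commute with `Y` and preserve `L`.
  obtain ⟨r, hrs, hrr, hrc⟩ := exists_sqrt_bounded (hC.nonneg S.X_dense)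
  obtain ⟨t, hts, htt, htc'⟩ := exists_sqrt_bounded (hC.one_sub_nonneg S.X_dense)
  have htc : ∀ F, Commute C F → Commute t F := fun F hF => htc' F ((Commute.one_left F).sub_left hF)
  have hLr := mapsTo_of_bicommutant hCsa hLC hrc
  have hLt := mapsTo_of_bicommutant hCsa hLC htc
  have hCY := S.commutes_Y hC hCsa (fun _ h => h)
  have hrY := S.commutes_Y hC hrs hrc
  have htY := S.commutes_Y hC hts htc
  have hap : ∀ {D E : H →L[ℂ] H}, Commute D E → ∀ g, D (E g) = E (D g) := fun h g =>
    congrArg (fun F : H →L[ℂ] H => F g) h.eq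
  have hCr := hap (hrc C (Commute.refl C)).symm
  have hCt := hap (htc C (Commute.refl C)).symm
  have hrt := hap (hrc t (htc C (Commute.refl C)).symm)
  have hRr := hap (hR.commute_of_commutes S.Y_sa hrY).1
  have hrr' : ∀ x, r (r x) = C x := fun x => congrArg (fun F : H →L[ℂ] H => F x) hrr
  have htt' : ∀ x, t (t x) = x - C x := fun x => congrArg (fun F : H →L[ℂ] H => F x) htt
  have hr0 : ∀ x, r x = 0 → x = 0 := fun x hx => hC.injective (by rw [← hrr', hx, map_zero])
  have hRsa := hR.isSelfAdjoint S.Y_sa.dense_domain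
  have hbn : ∀ g, ‖b g‖ ^ 2 = ‖t (r g)‖ ^ 2 := by
    intro g
    have h1 := (mem_graph_adjoint S.X_dense).1 (hC.mem_adj g) _ _ (hC.mem g)
    rw [← htt', ← hrr', sa_inner hts, ← hrt, ← hrt, ← sa_inner hrs, hrt,
      inner_self_ofReal, inner_self_ofReal] at h1
    exact_mod_cast h1.symm
  -- the core of `X*` in `L`
  set Φ : H →L[ℂ] H × H := (b ∘L r ∘L R).prod ((1 - C) ∘L r ∘L R) with hΦ
  set 𝒞 : Submodule ℂ (H × H) := L.map (Φ : H →ₗ[ℂ] H × H) with h𝒞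
  -- An element `(u, z)` of the graph of `X*` over `L` that is orthogonal to the core satisfies `⟪r
  -- R g, z⟫ = 0` for all `g` in `L`, so `z = 0`. Then `u` lies in `ker X* ∩ L`, which is trivial.
  have hcore : ∀ u ∈ L, ∀ z, (u, z) ∈ X.adjoint.graph → (u, z) ∈ 𝒞.topologicalClosure := by
    intro u hu z hz
    have h1 : 𝒞 ≤ X.adjoint.graph ⊓ L.comap (LinearMap.fst ℂ H H) := by
      rintro _ ⟨g, hg, rfl⟩
      refine ⟨hC.mem_adj (r (R g)), hLX _ (hLC _ (hLr _ (hLR g hg))) _ (hC.mem (r (R g)))⟩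
    refine le_topologicalClosure_of_graph_orthogonal h1 ?_ ?_ ⟨hz, hu⟩
    · exact IsClosed.inter (LinearPMap.adjoint_isClosed S.X_dense) (hL.preimage continuous_fst)
    · rintro u z ⟨huz, hu⟩ ho
      have hzL := hLXs u hu z huz
      have h2 : ∀ g ∈ L, ⟪r (R g), z⟫_ℂ = 0 := by
        intro g hg
        have h3 := ho (b (r (R g))) ((1 - C) (r (R g))) ⟨g, hg, rfl⟩
        have h4 := (mem_graph_adjoint S.X_dense).1 huz _ _ (hC.mem (r (R g)))
        have h5 : ⟪C (r (R g)), z⟫_ℂ = ⟪b (r (R g)), u⟫_ℂ := by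
          rw [← inner_conj_symm, h4, inner_conj_symm]
        rw [← h5, sub_apply, one_apply_eq_self, ← inner_add_left, add_sub_cancel] at h3
        exact h3
      have h6 : z = 0 := by
        have h7 := h2 (R (r z)) (hLR _ (hLr _ hzL))
        rw [sa_inner hrs, sa_inner hRsa, inner_self_eq_zero] at h7
        exact hr0 _ (hR.injective h7)
      subst h6
      exact ⟨hL0 u hu huz, rfl⟩
  have hq2 : 0 < 1 - q ^ 2 := sub_pos.2 (pow_lt_one₀ S.q_pos.le S.q_lt_one two_ne_zero)
  -- On `L` the polar part `U` of `X` is unitary, `X X* = U (X* X) U*` and `Y U = q² U Y`. So a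
  -- bound `X* X ≥ γ Y²` becomes `X X* ≥ γ q⁻⁴ Y²`, and together with `X* X ≥ q² X X*` the constant
  -- grows by `q⁻²`.
  have claim : ∀ n : ℕ, ∀ x ∈ L, ∀ y, (x, y) ∈ X.graph →
      ∃ z, (x, z) ∈ Y.graph ∧ ((1 - q ^ 2) * ((q ^ 2)⁻¹) ^ n) * ‖z‖ ^ 2 ≤ ‖y‖ ^ 2 := by
    intro n
    induction n with
    | zero =>
      intro x _ y hxy
      rw [pow_zero, mul_one]
      exact (S.exists_bounds hxy).1
    | succ n ih =>
      intro x hx y hxy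
      obtain ⟨p, hp, hpy⟩ := (S.exists_bounds hxy).2
      set γ := (1 - q ^ 2) * ((q ^ 2)⁻¹) ^ n with hγ
      have hγ0 : 0 < γ := mul_pos hq2 (pow_pos (inv_pos.2 (pow_pos S.q_pos 2)) n)
      -- The transported bound on the core, with `U` avoided: the induction hypothesis is applied to
      -- `C t R g`. There `‖X C t R g‖ = ‖(1 - C) r R g‖` is the norm of `X* u` for `u = b r R g`,
      -- and `‖Y u‖ = q² ‖t C β g‖`, where `t C β g = Y C t R g`.
      have h1 : ∀ u z, (u, z) ∈ 𝒞 → ∃ w, (u, w) ∈ Y.graph ∧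
          (γ * ((q ^ 2)⁻¹) ^ 2) * ‖w‖ ^ 2 ≤ ‖z‖ ^ 2 := by
        rintro _ _ ⟨g, hg, hgg⟩
        obtain ⟨rfl, rfl⟩ := Prod.mk.inj hgg
        change ∃ w, (b (r (R g)), w) ∈ Y.graph ∧
          (γ * ((q ^ 2)⁻¹) ^ 2) * ‖w‖ ^ 2 ≤ ‖r (R g) - C (r (R g))‖ ^ 2
        obtain ⟨z, hz, hzb⟩ := ih (C (t (R g))) (hLC _ (hLt _ (hLR g hg))) _ (hC.mem _)
        rw [graph_unique hz (hCY _ _ (htY _ _ (hR.mem g)))] at hzb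
        refine ⟨_, S.Y_b hC (hrY _ _ (hR.mem g)), ?_⟩
        rw [norm_smul, mul_pow, hbn, hrr', norm_pow, Complex.norm_real,
          Real.norm_of_nonneg S.q_pos.le]
        rw [hbn, hrt, htt'] at hzb
        rw [show C (t (β g)) = t (C (β g)) from hCt _] at hzb
        refine le_trans (le_of_eq ?_) hzb
        have := S.q_pos.ne'
        field_simp
      obtain ⟨z, hz1, hz2⟩ := exists_graph_of_bound (sa_isClosed_graph S.Y_sa)
        (mul_pos hγ0 (pow_pos (inv_pos.2 (pow_pos S.q_pos 2)) 2)) h1 (hcore x hx p hp)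
      refine ⟨z, hz1, le_trans ?_ hpy⟩
      refine le_trans (le_of_eq ?_) (mul_le_mul_of_nonneg_left hz2 (sq_nonneg q))
      have hw : q ^ 2 * (q ^ 2)⁻¹ = 1 := mul_inv_cancel₀ (pow_ne_zero 2 S.q_pos.ne')
      rw [pow_succ, hγ]
      linear_combination -((1 - q ^ 2) * (q ^ 2)⁻¹ ^ n * (q ^ 2)⁻¹ * ‖z‖ ^ 2) * hw
  intro g hg
  refine hC.injective (S.Y_inj _ ?_)
  obtain ⟨z, hz, -⟩ := claim 0 (C g) (hLC g hg) _ (hC.mem g)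
  -- The constants `(1 - q²) q^{-2n}` are unbounded, while `‖X C g‖` is fixed.
  have hz0 : z = 0 := by
    by_contra hne
    have hpos : 0 < (1 - q ^ 2) * ‖z‖ ^ 2 := mul_pos hq2 (pow_pos (norm_pos_iff.2 hne) 2)
    have hq1 : 1 < (q ^ 2)⁻¹ :=
      (one_lt_inv₀ (pow_pos S.q_pos 2)).2 (pow_lt_one₀ S.q_pos.le S.q_lt_one two_ne_zero)
    obtain ⟨n, hn⟩ := pow_unbounded_of_one_lt (‖b g‖ ^ 2 / ((1 - q ^ 2) * ‖z‖ ^ 2)) hq1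
    obtain ⟨z', hz', hb⟩ := claim n (C g) (hLC g hg) _ (hC.mem g)
    rw [graph_unique hz' hz] at hb
    rw [div_lt_iff₀ hpos] at hn
    nlinarith
  rw [← hz0]
  exact hz

end DecoupledSystem

end Exhaustion

end

/-! ### Totality: the copies fill the eigenspaces, and the eigenspaces generate everything. -/

section

open Filter Topology

section Columns

variable {H : Type*} [NormedAddCommGroup H] [InnerProductSpace ℂ H] [CompleteSpace H]
  {G : Type*} [NormedAddCommGroup G] [InnerProductSpace ℂ G] [CompleteSpace G]

namespace DecoupledSystem

variable {q c : ℝ} {A B : H →L[ℂ] H} {X Y K : H →ₗ.[ℂ] H} {l : ℝ}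

theorem inner_eq_zero_of_eigenvalues (S : DecoupledSystem q c A B X Y K) {l l' : ℝ} (h : l ≠ l')
    {x y : H} (hx : A x = (l : ℂ) • x) (hy : A y = (l' : ℂ) • y) : ⟪x, y⟫_ℂ = 0 := by
  have h1 := sa_inner S.A_sa x y
  rw [hx, hy, inner_smul_left, inner_smul_right, Complex.conj_ofReal, ← sub_eq_zero,
    ← sub_mul] at h1
  refine (mul_eq_zero.1 h1).resolve_left ?_
  exact sub_ne_zero.2 (by exact_mod_cast h)

namespace LevelFamily

variable {T : G →ₗ.[ℂ] G} {Q : ℕ → G →ₗ.[ℂ] G} {V : ℕ → G →ₗᵢ[ℂ] H}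

/-- Each copy of the ground space is invariant under `(1 + X* X)⁻¹`, since `X* X` acts on it as the
square of a real multiple of `Q (j + 1)`; uniqueness of the resolvent identifies the two. -/
theorem resolvent_X (F : LevelFamily q c A X K l T Q V) (S : DecoupledSystem q c A B X Y K)
    (hl : l ≠ 0) {C b : H →L[ℂ] H} (hC : IsGraphResolvent X C b) (j : ℕ) :
    ∃ R : G →L[ℂ] G, ∀ g, C (V j g) = V j (R g) := by
  have hsa := sa_smul (F.Q_sqrt (j + 1)).1 (coeff_pos S hl j).ne'
  obtain ⟨R, β, hR⟩ := sa_exists_resolvent hsa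
  refine ⟨R, fun g => ?_⟩
  obtain ⟨u, h1, h2⟩ := mem_graph_smul.1 (hR.mem g)
  obtain ⟨v, h3, h4⟩ := mem_graph_smul.1 (hR.mem_sa hsa g)
  have h5 := F.X_V j h1
  have h6 := F.Xs_V j h3
  rw [← map_smul, ← h2] at h5
  rw [← map_smul, ← h4] at h6
  have h7 := (hC.unique S.X_dense h5 h6).1
  rwa [← map_add, add_sub_cancel] at h7

theorem resolvent_Y (F : LevelFamily q c A X K l T Q V) (S : DecoupledSystem q c A B X Y K)
    (hl : l ≠ 0) {C b : H →L[ℂ] H} (hC : IsGraphResolvent Y C b) (j : ℕ) :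
    ∃ R : G →L[ℂ] G, ∀ g, C (V j g) = V j (R g) := by
  have h0 : q ^ (2 * j) * q * l ≠ 0 :=
    mul_ne_zero (mul_ne_zero (pow_ne_zero _ S.q_pos.ne') S.q_pos.ne') hl
  have hsa := sa_smul (sa_opMul_self (sa_inverse F.T_sa F.T_inj)) h0
  obtain ⟨R, β, hR⟩ := sa_exists_resolvent hsa
  refine ⟨R, fun g => ?_⟩
  obtain ⟨u, h1, h2⟩ := mem_graph_smul.1 (hR.mem g)
  obtain ⟨v, h3, h4⟩ := mem_graph_smul.1 (hR.mem_sa hsa g)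
  have h5 := (F.level j).Y_V S F.T_inj h1
  have h6 := (F.level j).Y_V S F.T_inj h3
  push_cast at h2 h4
  rw [← map_smul, ← h2] at h5
  rw [← map_smul, ← h4] at h6
  have h7 := (hC.unique_sa S.Y_sa h5 h6).1
  rwa [← map_add, add_sub_cancel] at h7

/-- The copies of the ground space exhaust the eigenspace. -/
theorem eq_zero_of_orthogonal (F : LevelFamily q c A X K l T Q V)
    (S : DecoupledSystem q c A B X Y K) (hl : l ≠ 0) {x : H} (hx : A x = (l : ℂ) • x)
    (hxV : ∀ j η, ⟪V j η, x⟫_ℂ = 0) : x = 0 := by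
  obtain ⟨C, b, hC⟩ := exists_isGraphResolvent S.X_dense S.X_closed
  obtain ⟨R, β, hR⟩ := sa_exists_resolvent S.Y_sa
  have ha : ∀ k, ((|l| * lamN q (k + 1) * q ^ (k + 1) : ℝ) : ℂ) ≠ 0 := fun k => by
    exact_mod_cast (coeff_pos S hl k).ne'
  have hadj : ∀ {x y u v}, (x, y) ∈ X.graph → (u, v) ∈ X.adjoint.graph → ⟪v, x⟫_ℂ = ⟪u, y⟫_ℂ :=
    fun h h' => (mem_graph_adjoint S.X_dense).1 h' _ _ h
  have hCA : ∀ x, A (C x) = C (A x) := by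
    intro x
    have h1 := (hC.unique S.X_dense (S.A_X _ _ (hC.mem x)) (S.A_Xs _ _ (hC.mem_adj x))).1
    rw [← map_add, add_sub_cancel] at h1
    exact h1.symm
  have hRA : ∀ x, A (R x) = R (A x) := fun x =>
    congrArg (fun D : H →L[ℂ] H => D x) (hR.commute_of_commutes S.Y_sa S.A_Y).1.eq
  have hinv : ∀ D : H →L[ℂ] H, IsSelfAdjoint D → (∀ j, ∃ R : G →L[ℂ] G, ∀ g, D (V j g) = V j (R g)) →
      ∀ y, (∀ j η, ⟪V j η, y⟫_ℂ = 0) → ∀ j η, ⟪V j η, D y⟫_ℂ = 0 := by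
    intro D hD hDV y hy j η
    obtain ⟨R, hR⟩ := hDV j
    rw [← sa_inner hD, hR, hy]
  have hzero : ∀ (j k : ℕ) (y : H), (∀ η ζ, (η, ζ) ∈ (Q k).graph → ⟪V j η, y⟫_ℂ = 0) →
      ∀ η, ⟪V j η, y⟫_ℂ = 0 := by
    intro j k y hy η
    have h1 : ContinuousLinearMap.adjoint (V j).toContinuousLinearMap y = 0 := by
      refine F.eq_zero_of_domain k fun ξ ξ' h => ?_
      rw [ContinuousLinearMap.adjoint_inner_left, ← inner_conj_symm]
      change (starRingEnd ℂ) ⟪V j ξ, y⟫_ℂ = 0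
      rw [hy _ _ h, map_zero]
    have h2 := ContinuousLinearMap.adjoint_inner_right (V j).toContinuousLinearMap η y
    rw [h1, inner_zero_right] at h2
    exact h2.symm
  -- `L` is the complement of all copies in the eigenspace. It reduces `X` and the resolvents, and
  -- it contains no nonzero vector of `ker X*` because the ground space is the copy with index `0`.
  let L : Submodule ℂ H :=
    { carrier := {x | A x = (l : ℂ) • x ∧ ∀ j η, ⟪V j η, x⟫_ℂ = 0}
      zero_mem' := ⟨by simp, by simp⟩
      add_mem' := fun {x y} hx hy => ⟨by rw [map_add, hx.1, hy.1, smul_add], fun j η => by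
        rw [inner_add_right, hx.2, hy.2, add_zero]⟩
      smul_mem' := fun r x hx => ⟨by rw [map_smul, hx.1, smul_comm], fun j η => by
        rw [inner_smul_right, hx.2, mul_zero]⟩ }
  have hLcl : IsClosed (L : Set H) := by
    have : (L : Set H) = {x | A x = (l : ℂ) • x} ∩ ⋂ j, ⋂ η, {x | ⟪V j η, x⟫_ℂ = 0} := by
      ext x
      simp only [Set.mem_inter_iff, Set.mem_iInter, Set.mem_ofPred_eq]
      rfl
    rw [this]
    exact (isClosed_eq (by fun_prop) (by fun_prop)).inter (isClosed_iInter fun j =>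
      isClosed_iInter fun η => isClosed_eq (by fun_prop) (by fun_prop))
  refine S.eq_bot_of_reducing hC hR hLcl ?_ ?_ ?_ ?_ ?_ x ⟨hx, hxV⟩
  · intro x hx y hxy
    refine ⟨?_, fun j => ?_⟩
    · have h1 := S.A_X _ _ hxy
      rw [hx.1] at h1
      exact graph_unique h1 (X.graph.smul_mem _ hxy)
    · rcases j with _ | j
      · intro η
        rw [← hadj hxy (F.Xs_V_zero η), inner_zero_left]
      · refine hzero _ (j + 1) y fun η ζ h => ?_
        rw [← hadj hxy (F.Xs_V j h), inner_smul_left, hx.2, mul_zero]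
  · intro x hx y hxy
    refine ⟨?_, fun j => ?_⟩
    · have h1 := S.A_Xs _ _ hxy
      rw [hx.1] at h1
      exact graph_unique h1 (X.adjoint.graph.smul_mem _ hxy)
    · refine hzero _ (j + 1) y fun η ζ h => ?_
      rw [← inner_conj_symm, hadj (F.X_V j h) hxy, inner_smul_right, ← inner_conj_symm, hx.2,
        map_zero, mul_zero, map_zero]
  · intro x hx
    exact ⟨by rw [hCA, hx.1, map_smul],
      hinv C (hC.isSelfAdjoint S.X_dense) (F.resolvent_X S hl hC) x hx.2⟩
  · intro x hx
    exact ⟨by rw [hRA, hx.1, map_smul],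
      hinv R (hR.isSelfAdjoint S.Y_sa.dense_domain) (F.resolvent_Y S hl hR) x hx.2⟩
  · intro x hx hx0
    obtain ⟨η, rfl⟩ := F.ground x hx.1 hx0
    exact inner_self_eq_zero.1 (hx.2 0 η)

end LevelFamily

/-- The eigenvectors of `A` generated from its two extreme eigenspaces by `B*` are total. -/
theorem eq_zero_of_forall_pow (S : DecoupledSystem q c A B X Y K) {l₁ l₂ : ℝ} (hne : l₁ ≠ l₂)
    (hadd : l₁ + l₂ = 1) (hmul : l₁ * l₂ = -c) {x : H}
    (hx : ∀ n y, A y = (l₁ : ℂ) • y ∨ A y = (l₂ : ℂ) • y → ⟪y, (B ^ n) x⟫_ℂ = 0) : x = 0 := by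
  have hadd' : (l₁ : ℂ) + l₂ = 1 := by exact_mod_cast hadd
  have hmul' : (l₁ : ℂ) * l₂ = -c := by exact_mod_cast hmul
  -- By construction `M` is invariant under `B`, and it is invariant under `A` because `A` and `B`
  -- commute up to a factor.
  let M : Submodule ℂ H :=
    { carrier := {x | ∀ n y, A y = (l₁ : ℂ) • y ∨ A y = (l₂ : ℂ) • y → ⟪y, (B ^ n) x⟫_ℂ = 0}
      zero_mem' := fun n y _ => by simp
      add_mem' := fun {x y} hx hy n z hz => by
        rw [map_add, inner_add_right, hx n z hz, hy n z hz, add_zero]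
      smul_mem' := fun r x hx n z hz => by rw [map_smul, inner_smul_right, hx n z hz, mul_zero] }
  have hMcl : IsClosed (M : Set H) := by
    have : (M : Set H) = ⋂ n, ⋂ y, ⋂ (_ : A y = (l₁ : ℂ) • y ∨ A y = (l₂ : ℂ) • y),
        {x | ⟪y, (B ^ n) x⟫_ℂ = 0} := by
      ext x
      simp only [Set.mem_iInter, Set.mem_ofPred_eq]
      rfl
    rw [this]
    exact isClosed_iInter fun n => isClosed_iInter fun y => isClosed_iInter fun _ =>
      isClosed_eq (by fun_prop) (by fun_prop)
  have : CompleteSpace M := hMcl.completeSpace_coe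
  have hq2 : (q : ℂ) ^ 2 ≠ 0 := pow_ne_zero 2 (by exact_mod_cast S.q_pos.ne')
  have hBA : ∀ x, B (A x) = (q : ℂ) ^ 2 • A (B x) := by
    intro x
    have h1 := congrArg (fun D : H →L[ℂ] H => D x) S.AB
    simp only [mul_apply_eq_comp, smul_apply] at h1
    rw [h1, smul_smul, mul_inv_cancel₀ hq2, one_smul]
  have hBnA : ∀ n x, (B ^ n) (A x) = ((q : ℂ) ^ 2) ^ n • A ((B ^ n) x) := by
    intro n
    induction n with
    | zero => intro x; simp
    | succ n ih =>
      intro x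
      rw [pow_succ, mul_apply_eq_comp, mul_apply_eq_comp, hBA, map_smul, ih, smul_smul, ← pow_succ']
  have hMA : ∀ x ∈ M, A x ∈ M := by
    intro x hx n y hy
    rw [hBnA, inner_smul_right, ← sa_inner S.A_sa]
    rcases hy with hy | hy
    · rw [hy, inner_smul_left, hx n y (Or.inl hy), mul_zero, mul_zero]
    · rw [hy, inner_smul_left, hx n y (Or.inr hy), mul_zero, mul_zero]
  have hMB : ∀ x ∈ M, B x ∈ M := by
    intro x hx n y hy
    have := hx (n + 1) y hy
    rwa [pow_succ, mul_apply_eq_comp] at this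
  set D := ContinuousLinearMap.adjoint B * B with hD
  have hDsa : IsSelfAdjoint D := IsSelfAdjoint.star_mul_self B
  have hD0 : 0 ≤ D := star_mul_self_nonneg B
  have hDx : ∀ x, D x = A x - A (A x) + (c : ℂ) • x := by
    intro x
    rw [hD, S.BsB]
    simp
  obtain ⟨r, hrs, hrr, hrc⟩ := exists_sqrt_bounded hD0
  have hrM := mapsTo_of_bicommutant hDsa (L := M) (fun x hx => by
    rw [hDx]
    exact M.add_mem (M.sub_mem (hMA x hx) (hMA _ (hMA x hx))) (M.smul_mem _ hx)) hrc
  have hrA : ∀ x, r (A x) = A (r x) := by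
    have h1 : Commute D A := by
      ext x
      change D (A x) = A (D x)
      rw [hDx, hDx]
      simp
    exact fun x => congrArg (fun F : H →L[ℂ] H => F x) (hrc A h1).eq
  have hrB : ∀ x, ‖r x‖ = ‖B x‖ := by
    intro x
    have h1 : ⟪r x, r x⟫_ℂ = ⟪B x, B x⟫_ℂ := by
      rw [sa_inner hrs, ← ContinuousLinearMap.adjoint_inner_right]
      exact congrArg (fun F : H →L[ℂ] H => ⟪x, F x⟫_ℂ) hrr
    rw [inner_self_ofReal, inner_self_ofReal] at h1
    have h2 : ‖r x‖ ^ 2 = ‖B x‖ ^ 2 := by exact_mod_cast h1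
    exact (pow_left_inj₀ (norm_nonneg _) (norm_nonneg _) two_ne_zero).1 h2
  -- `B* B = -(A - l₁)(A - l₂)`, so on its kernel `(A - l₁) x` and `(A - l₂) x` are eigenvectors for
  -- the other root. Both lie in `M`, which is orthogonal to the two eigenspaces, so both vanish,
  -- and `l₁ ≠ l₂` gives `x = 0`.
  have hr0 : ∀ x ∈ M, r x = 0 → x = 0 := by
    intro x hx hrx
    have h1 : D x = 0 := by rw [← hrr, mul_apply_eq_comp, hrx, map_zero]
    rw [hDx] at h1
    have hpair : ∀ m m' : ℝ, ((m : ℂ) + m' = 1) → ((m : ℂ) * m' = -c) →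
        A (A x - (m : ℂ) • x) = (m' : ℂ) • (A x - (m : ℂ) • x) := by
      intro m m' h2 h3
      rw [map_sub, map_smul, ← sub_eq_zero]
      have h4 : A (A x) = A x + (c : ℂ) • x := by
        rw [← sub_eq_zero, ← neg_eq_zero, ← h1]
        abel
      have h5 : (m' : ℂ) = 1 - m := by rw [← h2]; ring
      have h6 : (c : ℂ) = -(m * (1 - m)) := by rw [← h5, h3, neg_neg]
      rw [h4, h5, h6]
      module
    have ha := hpair l₁ l₂ hadd' hmul'
    have hb := hpair l₂ l₁ (by rw [add_comm, hadd']) (by rw [mul_comm, hmul'])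
    have hMl : ∀ m : ℂ, A x - m • x ∈ M := fun m => M.sub_mem (hMA x hx) (M.smul_mem m hx)
    have ha0 : A x - (l₁ : ℂ) • x = 0 := by
      have := hMl l₁ 0 _ (Or.inr ha)
      rw [pow_zero, one_apply_eq_self] at this
      exact inner_self_eq_zero.1 this
    have hb0 : A x - (l₂ : ℂ) • x = 0 := by
      have := hMl l₂ 0 _ (Or.inl hb)
      rw [pow_zero, one_apply_eq_self] at this
      exact inner_self_eq_zero.1 this
    have hsub : ((l₁ : ℂ) - l₂) • x = 0 := by
      rw [sub_smul, ← sub_eq_zero.1 ha0, ← sub_eq_zero.1 hb0, sub_self]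
    refine (smul_eq_zero.1 hsub).resolve_left ?_
    exact sub_ne_zero.2 (by exact_mod_cast hne)
  have hdense : M ≤ (M.map (r : H →ₗ[ℂ] H)).topologicalClosure := by
    have hle : (M.map (r : H →ₗ[ℂ] H)).topologicalClosure ≤ M := by
      refine Submodule.topologicalClosure_minimal _ ?_ hMcl
      rintro _ ⟨y, hy, rfl⟩
      exact hrM y hy
    have : CompleteSpace (M.map (r : H →ₗ[ℂ] H)).topologicalClosure :=
      (Submodule.isClosed_topologicalClosure _).completeSpace_coe
    have h1 := Submodule.sup_orthogonal_inf_of_hasOrthogonalProjection hle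
    have h2 : (M.map (r : H →ₗ[ℂ] H)).topologicalClosureᗮ ⊓ M = ⊥ := by
      rw [Submodule.eq_bot_iff]
      rintro v ⟨hv, hvM⟩
      refine hr0 v hvM (inner_self_eq_zero (𝕜 := ℂ).1 ?_)
      rw [← sa_inner hrs]
      exact (Submodule.mem_orthogonal _ _).1 hv _ (Submodule.le_topologicalClosure _
        ⟨r v, hrM v hvM, rfl⟩)
    rw [h2, sup_bot_eq] at h1
    exact h1.ge
  -- On vectors `r y`, which are dense in `M`, one has `‖A r y‖ = ‖B A y‖ = q² ‖A B y‖` and `‖r y‖ =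
  -- ‖B y‖`. Hence a bound for `A` on `M` improves by `q²` at each step.
  have hstep : ∀ n : ℕ, ∀ x ∈ M, ‖A x‖ ≤ ((q ^ 2) ^ n * ‖A‖) * ‖x‖ := by
    intro n
    induction n with
    | zero => intro x _; rw [pow_zero, one_mul]; exact A.le_opNorm x
    | succ n ih =>
      intro x hx
      have hcl : IsClosed {x | ‖A x‖ ≤ ((q ^ 2) ^ (n + 1) * ‖A‖) * ‖x‖} :=
        isClosed_le (by fun_prop) (by fun_prop)
      refine closure_minimal ?_ hcl (hdense hx)
      rintro _ ⟨y, hy, rfl⟩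
      change ‖A (r y)‖ ≤ ((q ^ 2) ^ (n + 1) * ‖A‖) * ‖r y‖
      rw [← hrA, hrB, hrB, hBA, norm_smul, norm_pow, Complex.norm_real,
        Real.norm_of_nonneg S.q_pos.le]
      refine (mul_le_mul_of_nonneg_left (ih (B y) (hMB y hy)) (sq_nonneg q)).trans (le_of_eq ?_)
      ring
  refine S.A_inj x ?_
  have hlim : Tendsto (fun n : ℕ => ((q ^ 2) ^ n * ‖A‖) * ‖x‖) atTop (𝓝 ((0 * ‖A‖) * ‖x‖)) :=
    ((tendsto_pow_atTop_nhds_zero_of_lt_one (sq_nonneg q)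
      (pow_lt_one₀ S.q_pos.le S.q_lt_one two_ne_zero)).mul_const _).mul_const _
  have := ge_of_tendsto' hlim (fun n => hstep n x hx)
  rw [zero_mul, zero_mul] at this
  exact norm_le_zero_iff.1 this

end DecoupledSystem

end Columns

end

/-! ### The grid generated by `B*` from the copies. -/

section

open Filter Topology

section Grid

variable {H : Type*} [NormedAddCommGroup H] [InnerProductSpace ℂ H] [CompleteSpace H]
  {G : Type*} [NormedAddCommGroup G] [InnerProductSpace ℂ G] [CompleteSpace G]
  {G' : Type*} [NormedAddCommGroup G'] [InnerProductSpace ℂ G'] [CompleteSpace G']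

namespace DecoupledSystem

variable {q c : ℝ} {A B : H →L[ℂ] H} {X Y K : H →ₗ.[ℂ] H} {l : ℝ}

/-- The coefficient of `B` on the eigenvectors of `A` for the eigenvalue `l q^{2n}`. -/
def gridCoeff (q c l : ℝ) (n : ℕ) : ℝ := √(c + l * q ^ (2 * n) - (l * q ^ (2 * n)) ^ 2)

/-- Isometric copies `J (n, j)` of `G` on which the operators act by the formulas of the
representations `(I)`. -/
structure Grid (q c : ℝ) (A B : H →L[ℂ] H) (X K : H →ₗ.[ℂ] H) (l : ℝ) (T : G →ₗ.[ℂ] G)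
    (Q : ℕ → G →ₗ.[ℂ] G) (J : ℕ × ℕ → G →ₗᵢ[ℂ] H) : Prop where
  A_J : ∀ n j η, A (J (n, j) η) = ((l * q ^ (2 * n) : ℝ) : ℂ) • J (n, j) η
  Bs_J : ∀ n j η, ContinuousLinearMap.adjoint B (J (n, j) η)
    = (gridCoeff q c l (n + 1) : ℂ) • J (n + 1, j) η
  B_J_zero : ∀ j η, B (J (0, j) η) = 0
  B_J_succ : ∀ n j η, B (J (n + 1, j) η) = (gridCoeff q c l (n + 1) : ℂ) • J (n, j) η
  K_J : ∀ n j {η ζ}, (η, ζ) ∈ T.graph →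
    (J (n, j) η, ((q ^ ((n : ℤ) - (j : ℤ)) : ℝ) : ℂ) • J (n, j) ζ) ∈ K.graph
  X_J : ∀ n j {η ζ}, (η, ζ) ∈ (Q (j + 1)).graph →
    (J (n, j) η, ((|l| * lamN q (j + 1) * q ^ (j + 1) : ℝ) : ℂ) • J (n, j + 1) ζ) ∈ X.graph
  Xs_J_zero : ∀ n η, (J (n, 0) η, 0) ∈ X.adjoint.graph
  Xs_J_succ : ∀ n j {η ζ}, (η, ζ) ∈ (Q (j + 1)).graph →
    (J (n, j + 1) η, ((|l| * lamN q (j + 1) * q ^ (j + 1) : ℝ) : ℂ) • J (n, j) ζ)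
      ∈ X.adjoint.graph
  orthogonal : ∀ {i i'}, i ≠ i' → ∀ η ζ, ⟪J i η, J i' ζ⟫_ℂ = 0

/-- `J (n, j)` is `B*ⁿ V j` normalized. On eigenvectors of `A` for `l q^{2n}` the product `B B*` is
the positive scalar `gridCoeff q c l (n + 1) ^ 2`, so normalized `B*` is isometric. It commutes with
`X` and `X*` and `q`-commutes with `K`, so the formulas for the row `n = 0` propagate. -/
theorem exists_grid (S : DecoupledSystem q c A B X Y K) {T : G →ₗ.[ℂ] G}
    {Q : ℕ → G →ₗ.[ℂ] G} {V : ℕ → G →ₗᵢ[ℂ] H} (F : LevelFamily q c A X K l T Q V) (hl : l ≠ 0)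
    (hroot : l ^ 2 = l + c)
    (hpos : ∀ n : ℕ, 0 < c + l * q ^ (2 * (n + 1)) - (l * q ^ (2 * (n + 1))) ^ 2) :
    ∃ J : ℕ × ℕ → G →ₗᵢ[ℂ] H, Grid q c A B X K l T Q J ∧ ∀ j, J (0, j) = V j := by
  have hq : (q : ℂ) ≠ 0 := by exact_mod_cast S.q_pos.ne'
  have hgp : ∀ n, 0 < gridCoeff q c l (n + 1) := fun n => Real.sqrt_pos.2 (hpos n)
  have hgs : ∀ n, gridCoeff q c l (n + 1) ^ 2
      = c + l * q ^ (2 * (n + 1)) - (l * q ^ (2 * (n + 1))) ^ 2 := fun n =>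
    Real.sq_sqrt (hpos n).le
  have hgc : ∀ n, (gridCoeff q c l (n + 1) : ℂ) ≠ 0 := fun n => by exact_mod_cast (hgp n).ne'
  have hBBs : ∀ (n : ℕ) (v : H), A v = ((l * q ^ (2 * n) : ℝ) : ℂ) • v →
      B (ContinuousLinearMap.adjoint B v) = ((gridCoeff q c l (n + 1) ^ 2 : ℝ) : ℂ) • v := by
    intro n v hv
    have h1 := congrArg (fun D : H →L[ℂ] H => D v) S.BBs
    simp only [mul_apply_eq_comp, add_apply, sub_apply, smul_apply, one_apply_eq_self, hv,
      map_smul] at h1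
    rw [h1, hgs]
    push_cast
    module
  have hABs : ∀ v, A (ContinuousLinearMap.adjoint B v)
      = (q : ℂ) ^ 2 • ContinuousLinearMap.adjoint B (A v) := by
    intro v
    refine ext_inner_right ℂ fun w => ?_
    have h1 := congrArg (fun D : H →L[ℂ] H => D w) S.AB
    simp only [mul_apply_eq_comp, smul_apply] at h1
    rw [sa_inner S.A_sa, ContinuousLinearMap.adjoint_inner_left, inner_smul_left,
      ContinuousLinearMap.adjoint_inner_left, sa_inner S.A_sa, h1, inner_smul_right, ← mul_assoc]
    rw [map_pow, Complex.conj_ofReal, mul_inv_cancel₀ (pow_ne_zero 2 hq), one_mul]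
  have hstep : ∀ (n : ℕ) (W : {W : G →ₗᵢ[ℂ] H //
      ∀ η, A (W η) = ((l * q ^ (2 * n) : ℝ) : ℂ) • W η}), ∃ W' : {W : G →ₗᵢ[ℂ] H //
      ∀ η, A (W η) = ((l * q ^ (2 * (n + 1)) : ℝ) : ℂ) • W η},
      ∀ η, ContinuousLinearMap.adjoint B (W.1 η) = (gridCoeff q c l (n + 1) : ℂ) • W'.1 η := by
    rintro n ⟨W, hW⟩
    have hn : ∀ η, ‖ContinuousLinearMap.adjoint B (W η)‖ = gridCoeff q c l (n + 1) * ‖η‖ := by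
      intro η
      have h1 := ContinuousLinearMap.adjoint_inner_left B (ContinuousLinearMap.adjoint B (W η)) (W η)
      rw [hBBs n _ (hW η), inner_smul_right, inner_self_ofReal, inner_self_ofReal,
        W.norm_map] at h1
      have h2 : ‖ContinuousLinearMap.adjoint B (W η)‖ ^ 2
          = (gridCoeff q c l (n + 1) * ‖η‖) ^ 2 := by
        rw [mul_pow]
        exact_mod_cast h1
      exact (pow_left_inj₀ (norm_nonneg _) (mul_nonneg (hgp n).le (norm_nonneg _)) two_ne_zero).1 h2
    refine ⟨⟨⟨(gridCoeff q c l (n + 1) : ℂ)⁻¹ •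
      ((ContinuousLinearMap.adjoint B : H →ₗ[ℂ] H) ∘ₗ W.toLinearMap), fun η => ?_⟩, fun η => ?_⟩,
      fun η => ?_⟩
    · change ‖(gridCoeff q c l (n + 1) : ℂ)⁻¹ • ContinuousLinearMap.adjoint B (W η)‖ = ‖η‖
      rw [norm_smul, hn, norm_inv, Complex.norm_real, Real.norm_of_nonneg (hgp n).le, ← mul_assoc,
        inv_mul_cancel₀ (hgp n).ne', one_mul]
    · change A ((gridCoeff q c l (n + 1) : ℂ)⁻¹ • ContinuousLinearMap.adjoint B (W η))
        = _ • (gridCoeff q c l (n + 1) : ℂ)⁻¹ • ContinuousLinearMap.adjoint B (W η)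
      rw [map_smul, hABs, hW, map_smul]
      push_cast
      module
    · change _ = (gridCoeff q c l (n + 1) : ℂ) •
        (gridCoeff q c l (n + 1) : ℂ)⁻¹ • ContinuousLinearMap.adjoint B (W η)
      rw [smul_smul, mul_inv_cancel₀ (hgc n), one_smul]
  choose next hnext using hstep
  let J' : ∀ (j n : ℕ), {W : G →ₗᵢ[ℂ] H // ∀ η, A (W η) = ((l * q ^ (2 * n) : ℝ) : ℂ) • W η} :=
    fun j n => Nat.rec ⟨V j, fun η => by
      change A (V j η) = ((l * q ^ (2 * 0) : ℝ) : ℂ) • V j η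
      rw [mul_zero, pow_zero, mul_one]
      exact (F.level j).A_V η⟩ (fun n W => next n W) n
  obtain ⟨J, hJ⟩ : ∃ J : ℕ × ℕ → G →ₗᵢ[ℂ] H, ∀ n j, J (n, j) = (J' j n).1 :=
    ⟨fun i => (J' i.2 i.1).1, fun _ _ => rfl⟩
  have hJ0 : ∀ j, J (0, j) = V j := fun j => hJ 0 j
  have hA : ∀ n j η, A (J (n, j) η) = ((l * q ^ (2 * n) : ℝ) : ℂ) • J (n, j) η := fun n j η => by
    rw [hJ]; exact (J' j n).2 η
  have hBs : ∀ n j η, ContinuousLinearMap.adjoint B (J (n, j) η)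
      = (gridCoeff q c l (n + 1) : ℂ) • J (n + 1, j) η := fun n j η => by
    rw [hJ, hJ]; exact hnext n (J' j n) η
  have hJs : ∀ n j η, J (n + 1, j) η
      = (gridCoeff q c l (n + 1) : ℂ)⁻¹ • ContinuousLinearMap.adjoint B (J (n, j) η) :=
    fun n j η => by rw [hBs, smul_smul, inv_mul_cancel₀ (hgc n), one_smul]
  have hXadj : IsClosed (X.adjoint.graph : Set (H × H)) := LinearPMap.adjoint_isClosed S.X_dense
  refine ⟨J, ⟨hA, hBs, ?_, ?_, ?_, ?_, ?_, ?_, ?_⟩, hJ0⟩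
  -- On the first row `B* B` is `l - l² + c`, which is zero because `l` is a root.
  · intro j η
    have h1 := congrArg (fun D : H →L[ℂ] H => D (J (0, j) η)) S.BsB
    have h2 := hA 0 j η
    rw [mul_zero, pow_zero, mul_one] at h2
    simp only [mul_apply_eq_comp, add_apply, sub_apply, smul_apply, one_apply_eq_self, h2,
      map_smul] at h1
    have h3 : (l : ℂ) • J (0, j) η - (l : ℂ) • (l : ℂ) • J (0, j) η + (c : ℂ) • J (0, j) η = 0 := by
      have : (l : ℂ) ^ 2 = l + c := by exact_mod_cast hroot
      have h4 : (l : ℂ) - l * l + c = 0 := by rw [← pow_two, this]; ring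
      rw [smul_smul, ← sub_smul, ← add_smul, h4, zero_smul]
    rw [h3] at h1
    rw [← inner_self_eq_zero (𝕜 := ℂ), ← ContinuousLinearMap.adjoint_inner_left, h1,
      inner_zero_left]
  · intro n j η
    rw [hJs, map_smul, hBBs n _ (hA n j η), smul_smul]
    congr 1
    push_cast
    field_simp [hgc n]
  · intro n
    induction n with
    | zero =>
      intro j η ζ h
      rw [hJ0]
      have := (F.level j).K_V h
      convert this using 2
      congr 1
      push_cast
      rw [zero_sub, zpow_neg, zpow_natCast]
    | succ n ih =>
      intro j η ζ h
      have := K.graph.smul_mem (gridCoeff q c l (n + 1) : ℂ)⁻¹ (S.K_Bs (ih j h))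
      rw [Prod.smul_mk, ← hJs] at this
      convert this using 2
      rw [map_smul, hBs, smul_smul, smul_smul, smul_smul]
      congr 1
      have h2 : (((n + 1 : ℕ) : ℤ) - (j : ℤ)) = 1 + ((n : ℤ) - j) := by push_cast; ring
      rw [h2, zpow_add₀ S.q_pos.ne', zpow_one]
      push_cast
      field_simp [hgc n]
  · intro n
    induction n with
    | zero => intro j η ζ h; rw [hJ0, hJ0]; exact F.X_V j h
    | succ n ih =>
      intro j η ζ h
      have := X.graph.smul_mem (gridCoeff q c l (n + 1) : ℂ)⁻¹ (S.Bs_X _ _ (ih j h))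
      rw [Prod.smul_mk, ← hJs] at this
      convert this using 2
      rw [map_smul, smul_comm, ← hJs]
  · intro n
    induction n with
    | zero => intro η; rw [hJ0]; exact F.Xs_V_zero η
    | succ n ih =>
      intro η
      have := X.adjoint.graph.smul_mem (gridCoeff q c l (n + 1) : ℂ)⁻¹ (S.Bs_Xs _ _ (ih η))
      rwa [Prod.smul_mk, ← hJs, map_zero, smul_zero] at this
  · intro n
    induction n with
    | zero => intro j η ζ h; rw [hJ0, hJ0]; exact F.Xs_V j h
    | succ n ih =>
      intro j η ζ h
      have := X.adjoint.graph.smul_mem (gridCoeff q c l (n + 1) : ℂ)⁻¹ (S.Bs_Xs _ _ (ih j h))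
      rw [Prod.smul_mk, ← hJs] at this
      convert this using 2
      rw [map_smul, smul_comm, ← hJs]
  -- Different `n` belong to different eigenvalues of `A`. For equal `n` the pairing descends to the
  -- first row through the scalar `B B*`.
  · rintro ⟨n, j⟩ ⟨n', j'⟩ hne η ζ
    by_cases hn : n = n'
    · subst hn
      have hj : j ≠ j' := fun h => hne (by rw [h])
      clear hne
      induction n with
      | zero => rw [hJ0, hJ0]; exact F.orthogonal S hl hj η ζ
      | succ n ih =>
        rw [hJs, inner_smul_left, ContinuousLinearMap.adjoint_inner_left, hJs, map_smul,
          hBBs n _ (hA n j' ζ), inner_smul_right, inner_smul_right, ih, mul_zero, mul_zero, mul_zero]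
    · refine S.inner_eq_zero_of_eigenvalues ?_ (hA n j η) (hA n' j' ζ)
      intro h
      have h1 := mul_left_cancel₀ hl h
      have h2 := (pow_right_injective₀ S.q_pos S.q_lt_one.ne) h1
      omega

/-- Vectors orthogonal to the grid are orthogonal to all translates of the eigenspace. -/
theorem Grid.inner_pow_eq_zero {T : G →ₗ.[ℂ] G} {Q : ℕ → G →ₗ.[ℂ] G} {V : ℕ → G →ₗᵢ[ℂ] H}
    {J : ℕ × ℕ → G →ₗᵢ[ℂ] H} (hJ : Grid q c A B X K l T Q J) (hJV : ∀ j, J (0, j) = V j)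
    (F : LevelFamily q c A X K l T Q V) (S : DecoupledSystem q c A B X Y K) (hl : l ≠ 0) {x : H}
    (hx : ∀ i η, ⟪J i η, x⟫_ℂ = 0) (n : ℕ) {y : H} (hy : A y = (l : ℂ) • y) :
    ⟪y, (B ^ n) x⟫_ℂ = 0 := by
  have h1 : ∀ n i η, ⟪J i η, (B ^ n) x⟫_ℂ = 0 := by
    intro n
    induction n with
    | zero => intro i η; rw [pow_zero]; exact hx i η
    | succ n ih =>
      rintro ⟨m, j⟩ η
      rw [pow_succ', mul_apply_eq_comp, ← ContinuousLinearMap.adjoint_inner_left, hJ.Bs_J,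
        inner_smul_left, ih, mul_zero]
  set e : H →L[ℂ] H := A - (l : ℂ) • 1
  have hmem : ∀ v, v ∈ e.ker ↔ A v = (l : ℂ) • v := fun v => by
    have : v ∈ e.ker ↔ e v = 0 := Iff.rfl
    rw [this, sub_apply, smul_apply, one_apply_eq_self, sub_eq_zero]
  have hP : ∀ v w, A v = (l : ℂ) • v → ⟪v, e.ker.starProjection w⟫_ℂ = ⟪v, w⟫_ℂ := by
    intro v w hv
    rw [← Submodule.inner_starProjection_left_eq_right,
      Submodule.starProjection_eq_self_iff.2 ((hmem v).2 hv)]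
  -- `B ^ n x` is still orthogonal to the grid, since `B*` maps the grid into itself up to scalars.
  -- Its component in the eigenspace is then orthogonal to all copies, and these fill the
  -- eigenspace.
  have h2 : e.ker.starProjection ((B ^ n) x) = 0 := by
    refine F.eq_zero_of_orthogonal S hl ((hmem _).1 (Submodule.starProjection_apply_mem _ _))
      fun j η => ?_
    rw [hP _ _ ((F.level j).A_V η), ← hJV, h1]
  rw [← hP y _ hy, h2, inner_zero_right]

end DecoupledSystem

end Grid

end

/-! ### Coordinates with respect to isometric copies. -/

section

open Filter Topology

section Coordinates

variable {H : Type*} [NormedAddCommGroup H] [InnerProductSpace ℂ H] [CompleteSpace H]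
  {G : Type*} [NormedAddCommGroup G] [InnerProductSpace ℂ G] [CompleteSpace G]
  {G' : Type*} [NormedAddCommGroup G'] [InnerProductSpace ℂ G'] [CompleteSpace G']

/-- The coordinate of a vector in the isometric copy `J` of `G`. -/
def coord (J : G →ₗᵢ[ℂ] H) : H →L[ℂ] G := ContinuousLinearMap.adjoint J.toContinuousLinearMap

theorem inner_coord (J : G →ₗᵢ[ℂ] H) (η : G) (x : H) : ⟪η, coord J x⟫_ℂ = ⟪J η, x⟫_ℂ :=
  ContinuousLinearMap.adjoint_inner_right J.toContinuousLinearMap η x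

theorem coord_inner (J : G →ₗᵢ[ℂ] H) (η : G) (x : H) : ⟪coord J x, η⟫_ℂ = ⟪x, J η⟫_ℂ :=
  ContinuousLinearMap.adjoint_inner_left J.toContinuousLinearMap η x

/-- An orthogonal family gives an isometry of the Hilbert sum. Its range is closed and has trivial
complement by totality, so it is onto. -/
theorem exists_unitary {ι : Type*} {J : ι → G →ₗᵢ[ℂ] H}
    (ho : ∀ {i i'}, i ≠ i' → ∀ η ζ, ⟪J i η, J i' ζ⟫_ℂ = 0)
    (ht : ∀ x, (∀ i η, ⟪J i η, x⟫_ℂ = 0) → x = 0) :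
    ∃ U : H ≃ₗᵢ[ℂ] lp (fun _ : ι => G) 2, ∀ x i, U x i = coord (J i) x := by
  classical
  have hof : OrthogonalFamily ℂ (fun _ : ι => G) J := fun i i' h η ζ => ho h η ζ
  set Φ := hof.linearIsometry with hΦ
  have hs : ∀ i (η : G), Φ (lp.single 2 i η) = J i η := fun i η => by
    rw [hΦ]; exact hof.linearIsometry_apply_single η
  have hsurj : Function.Surjective Φ := by
    have hcl : IsClosed (LinearMap.range Φ.toLinearMap : Set H) := by
      have := Φ.isometry.isClosedEmbedding.isClosed_range
      exact this
    have : CompleteSpace (LinearMap.range Φ.toLinearMap) := hcl.completeSpace_coe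
    have h1 : LinearMap.range Φ.toLinearMap = ⊤ := by
      rw [← Submodule.orthogonal_eq_bot_iff, Submodule.eq_bot_iff]
      intro x hx
      refine ht x fun i η => ?_
      rw [← hs]
      exact (Submodule.mem_orthogonal _ _).1 hx _ ⟨_, rfl⟩
    exact LinearMap.range_eq_top.1 h1
  refine ⟨(LinearIsometryEquiv.ofSurjective Φ hsurj).symm, fun x i => ?_⟩
  refine ext_inner_left ℂ fun η => ?_
  obtain ⟨a, rfl⟩ := hsurj x
  rw [inner_coord, ← hs, Φ.inner_map_map, lp.inner_single_left]
  congr 2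
  exact congrArg (fun f : lp (fun _ : ι => G) 2 => f i)
    ((LinearIsometryEquiv.ofSurjective Φ hsurj).symm_apply_apply a)

theorem exists_unitary_prod {ι : Type*} {J : ι → G →ₗᵢ[ℂ] H} {J' : ι → G' →ₗᵢ[ℂ] H}
    (ho : ∀ {i i'}, i ≠ i' → ∀ η ζ, ⟪J i η, J i' ζ⟫_ℂ = 0)
    (ho' : ∀ {i i'}, i ≠ i' → ∀ η ζ, ⟪J' i η, J' i' ζ⟫_ℂ = 0)
    (hoo : ∀ i i' η ζ, ⟪J i η, J' i' ζ⟫_ℂ = 0)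
    (ht : ∀ x, (∀ i η, ⟪J i η, x⟫_ℂ = 0) → (∀ i η, ⟪J' i η, x⟫_ℂ = 0) → x = 0) :
    ∃ U : H ≃ₗᵢ[ℂ] WithLp 2 (lp (fun _ : ι => G) 2 × lp (fun _ : ι => G') 2),
      ∀ x i, (U x).fst i = coord (J i) x ∧ (U x).snd i = coord (J' i) x := by
  classical
  have hof : OrthogonalFamily ℂ (fun _ : ι => G) J := fun i i' h η ζ => ho h η ζ
  have hof' : OrthogonalFamily ℂ (fun _ : ι => G') J' := fun i i' h η ζ => ho' h η ζ
  set Φ := hof.linearIsometry with hΦ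
  set Φ' := hof'.linearIsometry with hΦ'
  have hs : ∀ i (η : G), Φ (lp.single 2 i η) = J i η := fun i η => by
    rw [hΦ]; exact hof.linearIsometry_apply_single η
  have hs' : ∀ i (η : G'), Φ' (lp.single 2 i η) = J' i η := fun i η => by
    rw [hΦ']; exact hof'.linearIsometry_apply_single η
  have hcross : ∀ a b, ⟪Φ a, Φ' b⟫_ℂ = 0 := by
    intro a b
    have h1 := (hof'.hasSum_linearIsometry b).mapL (innerSL ℂ (Φ a))
    refine h1.unique ?_
    have h2 : ∀ i, innerSL ℂ (Φ a) (J' i (b i)) = 0 := by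
      intro i
      rw [innerSL_apply_apply, ← inner_conj_symm]
      have h3 := (hof.hasSum_linearIsometry a).mapL (innerSL ℂ (J' i (b i)))
      have h4 : ∀ i', innerSL ℂ (J' i (b i)) (J i' (a i')) = 0 := fun i' => by
        rw [innerSL_apply_apply, ← inner_conj_symm, hoo, map_zero]
      simp only [h4] at h3
      have h5 := h3.unique hasSum_zero
      rw [innerSL_apply_apply] at h5
      rw [h5, map_zero]
    simp only [h2]
    exact hasSum_zero
  let Ψ : WithLp 2 (lp (fun _ : ι => G) 2 × lp (fun _ : ι => G') 2) →ₗᵢ[ℂ] H :=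
    LinearMap.isometryOfInner
      { toFun := fun v => Φ v.fst + Φ' v.snd
        map_add' := fun v w => by
          rw [WithLp.add_fst, WithLp.add_snd, map_add, map_add]; abel
        map_smul' := fun r v => by
          rw [WithLp.smul_fst, WithLp.smul_snd, map_smul, map_smul, RingHom.id_apply, smul_add] }
      (fun v w => by
        change ⟪Φ v.fst + Φ' v.snd, Φ w.fst + Φ' w.snd⟫_ℂ = _
        rw [inner_add_left, inner_add_right, inner_add_right, hcross,
          ← inner_conj_symm (Φ' v.snd) (Φ w.fst), hcross, map_zero, Φ.inner_map_map,
          Φ'.inner_map_map, add_zero, zero_add, WithLp.prod_inner_apply]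
        rfl)
  have hΨ : ∀ v, Ψ v = Φ v.fst + Φ' v.snd := fun v => rfl
  have hsurj : Function.Surjective Ψ := by
    have hcl : IsClosed (LinearMap.range Ψ.toLinearMap : Set H) := by
      have := Ψ.isometry.isClosedEmbedding.isClosed_range
      exact this
    have : CompleteSpace (LinearMap.range Ψ.toLinearMap) := hcl.completeSpace_coe
    have h1 : LinearMap.range Ψ.toLinearMap = ⊤ := by
      rw [← Submodule.orthogonal_eq_bot_iff, Submodule.eq_bot_iff]
      intro x hx
      refine ht x (fun i η => ?_) fun i η => ?_
      · have h2 := (Submodule.mem_orthogonal _ _).1 hx _ ⟨WithLp.toLp 2 (lp.single 2 i η, 0), rfl⟩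
        have h3 : Ψ.toLinearMap (WithLp.toLp 2 (lp.single 2 i η, 0)) = J i η := by
          change Φ (lp.single 2 i η) + Φ' 0 = _
          rw [map_zero, add_zero, hs]
        rwa [h3] at h2
      · have h2 := (Submodule.mem_orthogonal _ _).1 hx _ ⟨WithLp.toLp 2 (0, lp.single 2 i η), rfl⟩
        have h3 : Ψ.toLinearMap (WithLp.toLp 2 (0, lp.single 2 i η)) = J' i η := by
          change Φ 0 + Φ' (lp.single 2 i η) = _
          rw [map_zero, zero_add, hs']
        rwa [h3] at h2
    exact LinearMap.range_eq_top.1 h1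
  refine ⟨(LinearIsometryEquiv.ofSurjective Ψ hsurj).symm, fun x i => ?_⟩
  obtain ⟨a, rfl⟩ := hsurj x
  rw [show (LinearIsometryEquiv.ofSurjective Ψ hsurj).symm (Ψ a) = a from
    (LinearIsometryEquiv.ofSurjective Ψ hsurj).symm_apply_apply a]
  constructor
  · refine ext_inner_left ℂ fun η => ?_
    rw [inner_coord, ← hs, hΨ, inner_add_right, Φ.inner_map_map, hcross, add_zero,
      lp.inner_single_left]
  · refine ext_inner_left ℂ fun η => ?_
    rw [inner_coord, ← hs', hΨ, inner_add_right, Φ'.inner_map_map,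
      ← inner_conj_symm (Φ' (lp.single 2 i η)) (Φ a.fst), hcross, map_zero, zero_add,
      lp.inner_single_left]

namespace DecoupledSystem

variable {q c : ℝ} {A B : H →L[ℂ] H} {X Y K : H →ₗ.[ℂ] H} {l : ℝ}

namespace Grid

variable {T : G →ₗ.[ℂ] G} {Q : ℕ → G →ₗ.[ℂ] G} {V : ℕ → G →ₗᵢ[ℂ] H} {J : ℕ × ℕ → G →ₗᵢ[ℂ] H}

theorem coord_A (hJ : Grid q c A B X K l T Q J) (S : DecoupledSystem q c A B X Y K) (n j : ℕ)
    (x : H) : coord (J (n, j)) (A x) = ((l * q ^ (2 * n) : ℝ) : ℂ) • coord (J (n, j)) x := by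
  refine ext_inner_right ℂ fun η => ?_
  rw [coord_inner, sa_inner S.A_sa, hJ.A_J, inner_smul_right, inner_smul_left, coord_inner,
    Complex.conj_ofReal]

theorem coord_B (hJ : Grid q c A B X K l T Q J) (n j : ℕ) (x : H) :
    coord (J (n, j)) (B x) = (gridCoeff q c l (n + 1) : ℂ) • coord (J (n + 1, j)) x := by
  refine ext_inner_right ℂ fun η => ?_
  rw [coord_inner, ← ContinuousLinearMap.adjoint_inner_right, hJ.Bs_J, inner_smul_right,
    inner_smul_left, coord_inner, Complex.conj_ofReal]

theorem coord_Bs_zero (hJ : Grid q c A B X K l T Q J) (j : ℕ) (x : H) :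
    coord (J (0, j)) (ContinuousLinearMap.adjoint B x) = 0 := by
  refine ext_inner_right ℂ fun η => ?_
  rw [coord_inner, ContinuousLinearMap.adjoint_inner_left, hJ.B_J_zero, inner_zero_right,
    inner_zero_left]

theorem coord_Bs_succ (hJ : Grid q c A B X K l T Q J) (n j : ℕ) (x : H) :
    coord (J (n + 1, j)) (ContinuousLinearMap.adjoint B x)
      = (gridCoeff q c l (n + 1) : ℂ) • coord (J (n, j)) x := by
  refine ext_inner_right ℂ fun η => ?_
  rw [coord_inner, ContinuousLinearMap.adjoint_inner_left, hJ.B_J_succ, inner_smul_right,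
    inner_smul_left, coord_inner, Complex.conj_ofReal]

/-- Only the action of `K` on grid vectors is known. It transfers to coordinates of arbitrary
vectors by symmetry of `K`, and self-adjointness of `T` turns the resulting weak identity into
membership in the graph of `T`. The lemmas for `X` and `X*` work in the same way with `Q`. -/
theorem coord_K (hJ : Grid q c A B X K l T Q J) (F : LevelFamily q c A X K l T Q V)
    (S : DecoupledSystem q c A B X Y K) (n j : ℕ) {x y : H} (h : (x, y) ∈ K.graph) :
    ∃ z, (coord (J (n, j)) x, z) ∈ T.graph ∧
      coord (J (n, j)) y = ((q ^ ((n : ℤ) - (j : ℤ)) : ℝ) : ℂ) • z := by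
  have hq : ((q ^ ((n : ℤ) - (j : ℤ)) : ℝ) : ℂ) ≠ 0 := by
    exact_mod_cast (zpow_pos S.q_pos _).ne'
  refine ⟨((q ^ ((n : ℤ) - (j : ℤ)) : ℝ) : ℂ)⁻¹ • coord (J (n, j)) y, ?_, ?_⟩
  · rw [sa_mem_graph F.T_sa]
    intro η ζ hη
    have h1 := sa_symm S.K_sa h (hJ.K_J n j hη)
    rw [inner_smul_right] at h1
    rw [inner_smul_left, coord_inner, coord_inner, h1, map_inv₀, Complex.conj_ofReal, ← mul_assoc,
      inv_mul_cancel₀ hq, one_mul]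
  · rw [smul_smul, mul_inv_cancel₀ hq, one_smul]

theorem coord_Xs (hJ : Grid q c A B X K l T Q J) (F : LevelFamily q c A X K l T Q V)
    (S : DecoupledSystem q c A B X Y K) (hl : l ≠ 0) (n j : ℕ) {x y : H}
    (h : (x, y) ∈ X.adjoint.graph) :
    ∃ z, (coord (J (n, j + 1)) x, z) ∈ (Q (j + 1)).graph ∧
      coord (J (n, j)) y = ((|l| * lamN q (j + 1) * q ^ (j + 1) : ℝ) : ℂ) • z := by
  have ha : ((|l| * lamN q (j + 1) * q ^ (j + 1) : ℝ) : ℂ) ≠ 0 := by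
    exact_mod_cast (LevelFamily.coeff_pos S hl j).ne'
  refine ⟨((|l| * lamN q (j + 1) * q ^ (j + 1) : ℝ) : ℂ)⁻¹ • coord (J (n, j)) y, ?_, ?_⟩
  · rw [sa_mem_graph (F.Q_sqrt (j + 1)).1]
    intro η ζ hη
    have h1 := (mem_graph_adjoint S.X_dense).1 h _ _ (hJ.X_J n j hη)
    rw [inner_smul_right] at h1
    rw [inner_smul_left, coord_inner, coord_inner, h1, map_inv₀, Complex.conj_ofReal, ← mul_assoc,
      inv_mul_cancel₀ ha, one_mul]
  · rw [smul_smul, mul_inv_cancel₀ ha, one_smul]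

theorem coord_X_zero (hJ : Grid q c A B X K l T Q J) (S : DecoupledSystem q c A B X Y K) (n : ℕ)
    {x y : H} (h : (x, y) ∈ X.graph) : coord (J (n, 0)) y = 0 := by
  refine ext_inner_left ℂ fun η => ?_
  rw [inner_coord, ← (mem_graph_adjoint S.X_dense).1 (hJ.Xs_J_zero n η) _ _ h, inner_zero_left,
    inner_zero_right]

theorem coord_X_succ (hJ : Grid q c A B X K l T Q J) (F : LevelFamily q c A X K l T Q V)
    (S : DecoupledSystem q c A B X Y K) (hl : l ≠ 0) (n j : ℕ) {x y : H}
    (h : (x, y) ∈ X.graph) :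
    ∃ z, (coord (J (n, j)) x, z) ∈ (Q (j + 1)).graph ∧
      coord (J (n, j + 1)) y = ((|l| * lamN q (j + 1) * q ^ (j + 1) : ℝ) : ℂ) • z := by
  have ha : ((|l| * lamN q (j + 1) * q ^ (j + 1) : ℝ) : ℂ) ≠ 0 := by
    exact_mod_cast (LevelFamily.coeff_pos S hl j).ne'
  refine ⟨((|l| * lamN q (j + 1) * q ^ (j + 1) : ℝ) : ℂ)⁻¹ • coord (J (n, j + 1)) y, ?_, ?_⟩
  · rw [sa_mem_graph (F.Q_sqrt (j + 1)).1]
    intro η ζ hη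
    have h1 := (mem_graph_adjoint S.X_dense).1 (hJ.Xs_J_succ n j hη) _ _ h
    rw [inner_smul_left, coord_inner, coord_inner, ← inner_conj_symm y, ← h1, inner_smul_left,
      map_mul, inner_conj_symm, map_inv₀, Complex.conj_conj, Complex.conj_ofReal, ← mul_assoc,
      inv_mul_cancel₀ ha, one_mul]
  · rw [smul_smul, mul_inv_cancel₀ ha, one_smul]

end Grid

end DecoupledSystem

end Coordinates

end

/-! ### The formulas `(I)` in coordinates. -/

section

section Formulas

variable {H : Type*} [NormedAddCommGroup H] [InnerProductSpace ℂ H] [CompleteSpace H]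
  {G : Type*} [NormedAddCommGroup G] [InnerProductSpace ℂ G] [CompleteSpace G]

open DecoupledSystem in
-- Dividing the radicand of `gridCoeff` by `(l q^n)²` gives that of `dSign`; the absolute value of
-- `l` accounts for the sign `±` in front of the formulas for `E` and `F`.
theorem dSign_eq {q c ε : ℝ} (hq : 0 < q) (hl : lamSign c ε ≠ 0) (n : ℕ) :
    dSign q c ε n = gridCoeff q c (lamSign c ε) n / (|lamSign c ε| * q ^ n) := by
  have h1 : |lamSign c ε| * q ^ n = √((lamSign c ε * q ^ n) ^ 2) := by
    rw [Real.sqrt_sq_eq_abs, abs_mul, abs_of_pos (pow_pos hq n)]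
  have h0 := hq.ne'
  rw [h1, gridCoeff, ← Real.sqrt_div' _ (sq_nonneg _), dSign]
  congr 1
  field_simp
  ring

theorem rpow_neg_half {q : ℝ} (hq : 0 < q) : q ^ (-(1 / 2) : ℝ) = (√q)⁻¹ := by
  rw [Real.rpow_neg hq.le, Real.sqrt_eq_rpow]

variable {q : ℝ} {c : ℝ≥0} {ε : ℝ} {π : StarRep (HatCrossProduct q c) H}
  {A B : H →L[ℂ] H} {T : G →ₗ.[ℂ] G} {Q : ℕ → G →ₗ.[ℂ] G} {V : ℕ → G →ₗᵢ[ℂ] H}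
  {J : ℕ × ℕ → G →ₗᵢ[ℂ] H}

open HatCrossProduct in
-- This recovers `E` from `X*`, `B*` and `K`, because `A` acts on each grid position as a nonzero
-- scalar.
theorem A_mul_E_apply (hq : 0 < q) (π : StarRep (HatCrossProduct q c) H) (x : π.domain) :
    (π.hom (star (X q c)) (π.hom (gen q c (.of .K)) x) : H)
      = ((√q * lam q : ℝ) : ℂ) • (π.hom (gen q c (.of .A)) (π.hom (gen q c (.of .E)) x) : H)
        + (q : ℂ) • (π.hom (gen q c (.of .Bs)) (π.hom (gen q c (.of .K)) x) : H) := by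
  have h0 := sqrt_coe_pos hq
  have h1 := ((crossRel hq c).decoupled h0).Xs_mul_K
  rw [← star_X_eq_elXs hq] at h1
  have h2 := congrArg (fun a => ((π.hom a x : π.domain) : H)) h1
  simp only [StarRep.mul_apply, StarRep.add_apply, StarRep.smul_apply] at h2
  rw [h2, lam]
  have h3 : ((√q : ℝ) : ℂ) ^ 2 = (q : ℂ) := by exact_mod_cast Real.sq_sqrt hq.le
  push_cast
  rw [h3]

open HatCrossProduct in
-- The corresponding identity for `F`, obtained by multiplying `X` on the right by `A⁻¹ K`.
theorem F_apply (hq : 0 < q) (π : StarRep (HatCrossProduct q c) H) (x : π.domain) :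
    (π.hom (X q c) (π.hom (gen q c .Ai) (π.hom (gen q c (.of .K)) x)) : H)
      = ((√q ^ 3 * lam q : ℝ) : ℂ) • (π.hom (gen q c (.of .F)) x : H)
        + (q : ℂ) • (π.hom (gen q c (.of .B)) (π.hom (gen q c .Ai)
          (π.hom (gen q c (.of .K)) x)) : H) := by
  have h1 : X q c * gen q c .Ai * gen q c (.of .K)
      = ((√q ^ 3 * lam q : ℝ) : ℂ) • gen q c (.of .F)
        + (q : ℂ) • (gen q c (.of .B) * gen q c .Ai * gen q c (.of .K)) := by
    have h3 : ((√q : ℝ) : ℂ) ^ 2 = (q : ℂ) := by exact_mod_cast Real.sq_sqrt hq.le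
    have h4 : gen q c (.of .F) * gen q c (.of .Ki) * gen q c (.of .A) * gen q c .Ai
        * gen q c (.of .K) = gen q c (.of .F) := by
      rw [mul_assoc _ (gen q c (.of .A)), gen_A_mul_Ai, mul_one, mul_assoc, (crossRel hq c).KiK,
        mul_one]
    rw [X_eq_elX hq, elX, add_mul, add_mul, smul_mul_assoc, smul_mul_assoc, smul_mul_assoc,
      smul_mul_assoc, h4, h3, lam]
    push_cast
    rfl
  have h2 := congrArg (fun a => ((π.hom a x : π.domain) : H)) h1
  simp only [StarRep.mul_apply, StarRep.add_apply, StarRep.smul_apply] at h2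
  exact h2

open HatCrossProduct DecoupledSystem in
-- `A`, `B`, `B*`, `K` act by the grid formulas and their inverses by solving these. `E` and `F` are
-- isolated from the expressions of `X* K` and `X A⁻¹ K`; the identities `ε l = |l|` and `ε² = 1`
-- convert the positive coefficients of `X` into the signs of the formulas.
theorem typeOneActs_coord (S : DecoupledSystem q c A B (π.cl (X q c)) (π.cl (Y q c))
    (π.cl (gen q c (.of .K)))) (hA : π.Extends A (gen q c (.of .A)))
    (hB : π.Extends B (gen q c (.of .B))) (hX : (π.cl (X q c)).adjoint = π.cl (star (X q c)))
    (hl : lamSign c ε ≠ 0) (hε : ε * lamSign c ε = |lamSign c ε|)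
    (hεε : ε * ε = 1)
    (F : LevelFamily q c A (π.cl (X q c)) (π.cl (gen q c (.of .K))) (lamSign c ε) T Q V)
    (hJ : Grid q c A B (π.cl (X q c)) (π.cl (gen q c (.of .K))) (lamSign c ε) T Q J)
    (g : HatGen) (x : π.domain) :
    TypeOneActs q c ε T g (fun i => coord (J i) x) (fun i => coord (J i) (π.hom (gen q c g) x)) := by
  have hq := S.q_pos
  have hqC : (q : ℂ) ≠ 0 := by exact_mod_cast hq.ne'
  have hlC : (lamSign c ε : ℂ) ≠ 0 := by exact_mod_cast hl
  have hAi : ∀ (y : π.domain) n j, coord (J (n, j)) (π.hom (gen q c .Ai) y : H)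
      = ((lamSign c ε * q ^ (2 * n) : ℝ) : ℂ)⁻¹ • coord (J (n, j)) (y : H) := by
    intro y n j
    have h1 : ((lamSign c ε * q ^ (2 * n) : ℝ) : ℂ) ≠ 0 := by
      push_cast; exact mul_ne_zero hlC (pow_ne_zero _ hqC)
    have h2 := hJ.coord_A S n j (π.hom (gen q c .Ai) y)
    rw [hA, ← StarRep.mul_apply, gen_A_mul_Ai, StarRep.one_apply] at h2
    rw [h2, smul_smul, inv_mul_cancel₀ h1, one_smul]
  have hBs : π.Extends (ContinuousLinearMap.adjoint B) (gen q c (.of .Bs)) := by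
    have := hB.adjoint
    rwa [star_gen] at this
  have hz : ∀ n j : ℕ, ((q ^ ((n : ℤ) - (j : ℤ)) : ℝ) : ℂ) = (q : ℂ) ^ n / (q : ℂ) ^ j := by
    intro n j
    rw [zpow_sub₀ hq.ne', zpow_natCast, zpow_natCast]
    push_cast; rfl
  have hlam : (lam q : ℂ) ≠ 0 := by
    have h1 : lam q < 0 := by
      rw [lam, sub_neg]
      exact S.q_lt_one.trans ((one_lt_inv₀ hq).2 S.q_lt_one)
    exact_mod_cast h1.ne
  have h0 := sqrt_coe_pos hq
  have hsq : ((√q : ℝ) : ℂ) ^ 2 = (q : ℂ) := by exact_mod_cast Real.sq_sqrt hq.le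
  have hεC : (ε : ℂ) * lamSign c ε = (|lamSign c ε| : ℝ) := by exact_mod_cast hε
  have habs : ((|lamSign c ε| : ℝ) : ℂ) ≠ 0 := by exact_mod_cast abs_ne_zero.2 hl
  have hε2 : (ε : ℂ) * (|lamSign c ε| : ℝ) = lamSign c ε := by
    have : (ε : ℂ) * ε = 1 := by exact_mod_cast hεε
    rw [← hεC, ← mul_assoc, this, one_mul]
  have hεi : (ε : ℂ)⁻¹ = ε := by
    have : (ε : ℂ) * ε = 1 := by exact_mod_cast hεε
    exact inv_eq_of_mul_eq_one_left this
  have hhalf : ((q ^ (-(1 / 2) : ℝ) : ℝ) : ℂ) = ((√q : ℝ) : ℂ)⁻¹ := by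
    rw [rpow_neg_half hq, Complex.ofReal_inv]
  obtain (_ | _ | _ | _ | _ | _ | _) | _ := g
  · intro n j
    change coord _ (_ : H) = _ • coord _ _
    rw [← hA x, hJ.coord_A S]
  · intro n j
    change coord _ (_ : H) = _ • coord _ _
    rw [← hB x, hJ.coord_B]
    rfl
  · intro n j
    change coord _ (_ : H) = _
    rw [← hBs x]
    cases n with
    | zero => rw [hJ.coord_Bs_zero]; exact (smul_zero _).symm
    | succ n => rw [hJ.coord_Bs_succ]; rfl
  · refine ⟨Q, F.Q_sqrt, fun n j => ?_⟩
    have hK := π.mem_graph_cl (gen q c (.of .K)) x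
    have hXs := π.mem_graph_cl (star (X q c)) (π.hom (gen q c (.of .K)) x)
    rw [← hX] at hXs
    obtain ⟨z, hz1, hz2⟩ := hJ.coord_K F S n (j + 1) hK
    obtain ⟨v, hv1, hv2⟩ := hJ.coord_Xs F S hl n j hXs
    have hr : (q : ℂ) ^ n / (q : ℂ) ^ (j + 1) ≠ 0 :=
      div_ne_zero (pow_ne_zero _ hqC) (pow_ne_zero _ hqC)
    rw [hz2, hz] at hv1
    have hv3 : (z, ((q : ℂ) ^ n / (q : ℂ) ^ (j + 1))⁻¹ • v) ∈ (Q (j + 1)).graph := by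
      have := (Q (j + 1)).graph.smul_mem ((q : ℂ) ^ n / (q : ℂ) ^ (j + 1))⁻¹ hv1
      rwa [Prod.smul_mk, smul_smul, inv_mul_cancel₀ hr, one_smul] at this
    -- The scalar `q^n / (q q^j)` is the weight of `K` at the position `(n - 1, j)`. For `n = 0` the
    -- left side vanishes and `w = 0` matches `η_{-1,j} = 0`.
    obtain ⟨w, hw1, hw2⟩ : ∃ w, (lowerN (fun i => coord (J i) (x : H)) (n, j), w) ∈ T.graph ∧
        coord (J (n, j)) (π.hom (gen q c (.of .Bs)) (π.hom (gen q c (.of .K)) x) : H)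
          = ((gridCoeff q c (lamSign c ε) n : ℂ) * ((q : ℂ) ^ n / ((q : ℂ) * (q : ℂ) ^ j))) • w := by
      rw [← hBs]
      cases n with
      | zero => exact ⟨0, T.graph.zero_mem, by rw [hJ.coord_Bs_zero, smul_zero]⟩
      | succ n =>
        obtain ⟨w, hw1, hw2⟩ := hJ.coord_K F S n j hK
        refine ⟨w, hw1, ?_⟩
        rw [hJ.coord_Bs_succ, hw2, hz, smul_smul]
        congr 2
        field_simp
        ring
    refine ⟨_, w, mem_graph_opMul.2 ⟨z, hz1, hv3⟩, hw1, ?_⟩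
    have e := congrArg (coord (J (n, j))) (A_mul_E_apply hq π x)
    rw [hv2, map_add, map_smul, map_smul, hw2, ← hA, hJ.coord_A S] at e
    change coord (J (n, j)) _ = _
    generalize coord (J (n, j)) (π.hom (gen q c (.of .E)) x : H) = y at e ⊢
    have e' : y = (((√q * lam q : ℝ) : ℂ) * ((lamSign c ε * q ^ (2 * n) : ℝ) : ℂ))⁻¹ •
        (((|lamSign c ε| * lamN q (j + 1) * q ^ (j + 1) : ℝ) : ℂ) • v - (q : ℂ) •
          ((gridCoeff q c (lamSign c ε) n : ℂ) * ((q : ℂ) ^ n / ((q : ℂ) * (q : ℂ) ^ j))) • w) := by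
      rw [e, add_sub_cancel_right, smul_smul, smul_smul, mul_assoc, inv_mul_cancel₀, one_smul]
      push_cast
      exact mul_ne_zero (mul_ne_zero h0 hlam) (mul_ne_zero hlC (pow_ne_zero _ hqC))
    rw [e', dSign_eq hq hl]
    push_cast
    rw [hhalf, ← hε2, ← hsq]
    generalize ((|lamSign c ε| : ℝ) : ℂ) = M at habs ⊢
    match_scalars <;> field_simp <;> ring_nf <;> rw [hεi]
  · refine ⟨Q, F.Q_sqrt, fun n j => ?_⟩
    have hK := π.mem_graph_cl (gen q c (.of .K)) x
    set ψ := π.hom (gen q c .Ai) (π.hom (gen q c (.of .K)) x) with hψ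
    have hXψ := π.mem_graph_cl (X q c) ψ
    -- Here `q^n q / q^j` is the weight of `K` at `(n, j - 1)`; for `j = 0` the image of `X` has no
    -- component and `z = 0`.
    obtain ⟨z, hz1, hz2⟩ : ∃ z, (lowerJ (fun i => coord (J i) (x : H)) (n, j), z)
          ∈ (opMul (Q j) T).graph ∧
        coord (J (n, j)) (π.hom (X q c) ψ : H)
          = (((|lamSign c ε| * lamN q j * q ^ j : ℝ) : ℂ) * (((lamSign c ε * q ^ (2 * n) : ℝ) : ℂ)⁻¹
            * ((q : ℂ) ^ n * (q : ℂ) / (q : ℂ) ^ j))) • z := by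
      cases j with
      | zero =>
        refine ⟨0, (opMul (Q 0) T).graph.zero_mem, ?_⟩
        rw [hJ.coord_X_zero S n hXψ, smul_zero]
      | succ j =>
        obtain ⟨z, hz1, hz2⟩ := hJ.coord_K F S n j hK
        obtain ⟨v, hv1, hv2⟩ := hJ.coord_X_succ F S hl n j hXψ
        have hr : ((lamSign c ε * q ^ (2 * n) : ℝ) : ℂ)⁻¹ * ((q : ℂ) ^ n / (q : ℂ) ^ j) ≠ 0 := by
          push_cast
          exact mul_ne_zero (inv_ne_zero (mul_ne_zero hlC (pow_ne_zero _ hqC)))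
            (div_ne_zero (pow_ne_zero _ hqC) (pow_ne_zero _ hqC))
        rw [hψ, hAi, hz2, hz, smul_smul] at hv1
        refine ⟨(((lamSign c ε * q ^ (2 * n) : ℝ) : ℂ)⁻¹ * ((q : ℂ) ^ n / (q : ℂ) ^ j))⁻¹ • v,
          mem_graph_opMul.2 ⟨z, hz1, ?_⟩, ?_⟩
        · have := (Q (j + 1)).graph.smul_mem
            (((lamSign c ε * q ^ (2 * n) : ℝ) : ℂ)⁻¹ * ((q : ℂ) ^ n / (q : ℂ) ^ j))⁻¹ hv1
          rwa [Prod.smul_mk, smul_smul, inv_mul_cancel₀ hr, one_smul] at this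
        · have h5 : (q : ℂ) ^ n * (q : ℂ) / (q : ℂ) ^ (j + 1) = (q : ℂ) ^ n / (q : ℂ) ^ j := by
            rw [pow_succ, mul_div_mul_right _ _ hqC]
          rw [hv2, h5, smul_smul, mul_assoc (Complex.ofReal _), mul_inv_cancel₀ hr, mul_one]
    obtain ⟨w, hw1, hw2⟩ := hJ.coord_K F S (n + 1) j hK
    refine ⟨z, w, hz1, hw1, ?_⟩
    have e := congrArg (coord (J (n, j))) (F_apply hq π x)
    rw [← hψ, hz2, map_add, map_smul, map_smul, ← hB, hJ.coord_B, hψ, hAi, hw2, hz] at e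
    change coord (J (n, j)) _ = _
    generalize coord (J (n, j)) (π.hom (gen q c (.of .F)) x : H) = y at e ⊢
    have e' := congrArg (fun u => ((√q ^ 3 * lam q : ℝ) : ℂ)⁻¹ • u) (eq_sub_of_add_eq e.symm)
    have h6 : ((√q ^ 3 * lam q : ℝ) : ℂ) ≠ 0 := by
      push_cast
      exact mul_ne_zero (pow_ne_zero _ h0) hlam
    beta_reduce at e'
    rw [smul_smul, inv_mul_cancel₀ h6, one_smul] at e'
    rw [e', dSign_eq hq hl]
    push_cast
    rw [hhalf, ← hε2, ← hsq]
    generalize ((|lamSign c ε| : ℝ) : ℂ) = M at habs ⊢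
    match_scalars <;> field_simp <;> ring_nf <;> rw [hεi]
  · intro n j
    exact hJ.coord_K F S n j (π.mem_graph_cl (gen q c (.of .K)) x)
  · intro n j
    have h1 := π.mem_graph_cl (gen q c (.of .K)) (π.hom (gen q c (.of .Ki)) x)
    rw [← StarRep.mul_apply, (crossRel hq c).KKi, StarRep.one_apply] at h1
    obtain ⟨z, hz1, hz2⟩ := hJ.coord_K F S n j h1
    have h2 : ((q ^ ((n : ℤ) - (j : ℤ)) : ℝ) : ℂ) ≠ 0 := by
      exact_mod_cast (zpow_pos hq _).ne'
    refine ⟨((q ^ ((n : ℤ) - (j : ℤ)) : ℝ) : ℂ) • coord (J (n, j)) (π.hom (gen q c (.of .Ki)) x),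
      ?_, ?_⟩
    · rw [mem_graph_inverse F.T_inj]
      change (_, coord (J (n, j)) (x : H)) ∈ _
      rw [hz2]
      exact T.graph.smul_mem _ hz1
    · rw [smul_smul, inv_mul_cancel₀ h2, one_smul]
  · exact hAi x

end Formulas

end

/-! ### The roots `λ_±` and the classification. -/

section

section Roots

variable {q c : ℝ}

theorem lamSign_sq (hc : 0 ≤ c) {ε : ℝ} (hε : ε * ε = 1) :
    lamSign c ε ^ 2 = lamSign c ε + c := by
  have h := Real.sq_sqrt (show 0 ≤ c + 1 / 4 by linarith)
  rw [lamSign]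
  linear_combination ε * ε * h + (c + 1 / 4) * hε

theorem lamSign_one_add (c : ℝ) : lamSign c 1 + lamSign c (-1) = 1 := by
  rw [lamSign, lamSign]; ring

theorem lamSign_one_mul (hc : 0 ≤ c) : lamSign c 1 * lamSign c (-1) = -c := by
  have h := Real.sq_sqrt (show 0 ≤ c + 1 / 4 by linarith)
  rw [lamSign, lamSign]
  linear_combination -h

theorem one_le_lamSign (hc : 0 ≤ c) : 1 ≤ lamSign c 1 := by
  have h : (1 / 2 : ℝ) ≤ √(c + 1 / 4) := Real.le_sqrt_of_sq_le (by linarith)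
  rw [lamSign]; linarith

theorem lamSign_neg_one_neg (hc : 0 < c) : lamSign c (-1) < 0 := by
  have h : (1 / 2 : ℝ) < √(c + 1 / 4) := Real.lt_sqrt_of_sq_lt (by linarith)
  rw [lamSign]; linarith

/-- After elimination of `c` the expression factors as `l (1 - s) (l (1 + s) - 1)`. The two last
hypotheses on `l` make the outer factors equal in sign. -/
theorem radicand_pos_of_root {l s : ℝ} (hc : 0 ≤ c) (hl : l ^ 2 = l + c) (h : 1 ≤ l ∨ l < 0)
    (hs0 : 0 < s) (hs1 : s < 1) : 0 < c + l * s - (l * s) ^ 2 := by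
  have e : c + l * s - (l * s) ^ 2 = l * (1 - s) * (l * (1 + s) - 1) := by
    linear_combination -hl
  rw [e]
  rcases h with h | h
  · exact mul_pos (mul_pos (by linarith) (by linarith)) (by nlinarith)
  · exact mul_pos_of_neg_of_neg (mul_neg_of_neg_of_pos h (by linarith)) (by nlinarith)

theorem lamSign_spec (hq0 : 0 < q) (hq1 : q < 1) (hc : 0 ≤ c) {ε : ℝ}
    (hε : ε = 1 ∨ ε = -1 ∧ 0 < c) :
    lamSign c ε ≠ 0 ∧ ε * lamSign c ε = |lamSign c ε| ∧ ε * ε = 1 ∧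
      lamSign c ε ^ 2 = lamSign c ε + c ∧
      ∀ n : ℕ, 0 < c + lamSign c ε * q ^ (2 * (n + 1)) - (lamSign c ε * q ^ (2 * (n + 1))) ^ 2 := by
  have hs0 : ∀ n : ℕ, 0 < q ^ (2 * (n + 1)) := fun n => pow_pos hq0 _
  have hs1 : ∀ n : ℕ, q ^ (2 * (n + 1)) < 1 := fun n => pow_lt_one₀ hq0.le hq1 (by omega)
  rcases hε with rfl | ⟨rfl, hc'⟩
  · have h := one_le_lamSign hc
    exact ⟨by linarith, by rw [abs_of_pos (by linarith), one_mul], one_mul 1,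
      lamSign_sq hc (one_mul 1),
      fun n => radicand_pos_of_root hc (lamSign_sq hc (one_mul 1)) (Or.inl h) (hs0 n) (hs1 n)⟩
  · have h := lamSign_neg_one_neg hc'
    have h1 : (-1 : ℝ) * -1 = 1 := by norm_num
    exact ⟨h.ne, by rw [abs_of_neg h]; ring, h1, lamSign_sq hc h1,
      fun n => radicand_pos_of_root hc (lamSign_sq hc h1) (Or.inr h) (hs0 n) (hs1 n)⟩

end Roots

section Classification

variable {H : Type u} [NormedAddCommGroup H] [InnerProductSpace ℂ H] [CompleteSpace H]

open HatCrossProduct DecoupledSystem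

theorem isInvertibleSelfAdjoint_of_graph {G : Type*} [NormedAddCommGroup G]
    [InnerProductSpace ℂ G] [CompleteSpace G] {T : G →ₗ.[ℂ] G} (hT : IsSelfAdjoint T)
    (h : ∀ x, (x, 0) ∈ T.graph → x = 0) : IsInvertibleSelfAdjoint T := by
  refine ⟨hT, fun x hx => h _ ?_⟩
  rw [← hx]
  exact LinearPMap.mem_graph _ x

/-- The part of a well-behaved representation belonging to the eigenvalue `l` of `A`. -/
theorem DecoupledSystem.exists_typeOne {q : ℝ} {c : ℝ≥0} {ε : ℝ}
    {π : StarRep (HatCrossProduct q c) H} {A B : H →L[ℂ] H}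
    (S : DecoupledSystem q c A B (π.cl (X q c)) (π.cl (Y q c)) (π.cl (gen q c (.of .K))))
    (hA : π.Extends A (gen q c (.of .A))) (hB : π.Extends B (gen q c (.of .B)))
    (hX : (π.cl (X q c)).adjoint = π.cl (star (X q c))) (hε : ε = 1 ∨ ε = -1 ∧ 0 < (c : ℝ)) :
    ∃ (G : Type u) (_ : NormedAddCommGroup G) (_ : InnerProductSpace ℂ G) (_ : CompleteSpace G)
      (T : G →ₗ.[ℂ] G) (J : ℕ × ℕ → G →ₗᵢ[ℂ] H), IsInvertibleSelfAdjoint T ∧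
      (∀ {i i'}, i ≠ i' → ∀ η ζ, ⟪J i η, J i' ζ⟫_ℂ = 0) ∧
      (∀ n j η, A (J (n, j) η) = ((lamSign c ε * q ^ (2 * n) : ℝ) : ℂ) • J (n, j) η) ∧
      (∀ x, (∀ i η, ⟪J i η, x⟫_ℂ = 0) →
        ∀ n y, A y = (lamSign c ε : ℂ) • y → ⟪y, (B ^ n) x⟫_ℂ = 0) ∧
      ∀ g (x : π.domain), TypeOneActs q c ε T g (fun i => coord (J i) x)
        (fun i => coord (J i) (π.hom (gen q c g) x)) := by
  obtain ⟨hl, hl1, hε1, hroot, hpos⟩ := lamSign_spec S.q_pos S.q_lt_one c.2 hε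
  obtain ⟨C, b, hC⟩ := exists_isGraphResolvent S.X_dense S.X_closed
  obtain ⟨T, Q, V, F⟩ := exists_levelFamily S hl hC
  obtain ⟨J, hJ, hJV⟩ := exists_grid S F hl hroot hpos
  refine ⟨_, _, _, inferInstance, T, J, isInvertibleSelfAdjoint_of_graph F.T_sa F.T_inj,
    hJ.orthogonal, hJ.A_J, fun x hx n y hy => hJ.inner_pow_eq_zero hJV F S hl hx n hy,
    typeOneActs_coord S hA hB hX hl hl1 hε1 F hJ⟩

/-- The grids of the two roots are orthogonal since their eigenvalues of `A` have opposite signs,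
and together they are total because a vector orthogonal to both satisfies the hypothesis of
`eq_zero_of_forall_pow`. -/
theorem WellBehaved.exists_unitary_of_pos {q : ℝ} (hq0 : 0 < q) (hq1 : q < 1) {c : ℝ≥0}
    (hc : 0 < c) {π : StarRep (HatCrossProduct q c) H} (hπ : WellBehaved q c π) :
    ∃ (G₁ : Type u) (_ : NormedAddCommGroup G₁) (_ : InnerProductSpace ℂ G₁)
      (_ : CompleteSpace G₁) (T₁ : G₁ →ₗ.[ℂ] G₁)
      (G₂ : Type u) (_ : NormedAddCommGroup G₂) (_ : InnerProductSpace ℂ G₂)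
      (_ : CompleteSpace G₂) (T₂ : G₂ →ₗ.[ℂ] G₂)
      (U : H ≃ₗᵢ[ℂ] WithLp 2 (DoubleSum G₁ × DoubleSum G₂)),
      IsInvertibleSelfAdjoint T₁ ∧ IsInvertibleSelfAdjoint T₂ ∧
      ∀ (g : HatGen) (x : π.domain),
        TypeOneActs q c 1 T₁ g (U (x : H)).fst (U (π.hom (gen q c g) x : H)).fst ∧
        TypeOneActs q c (-1) T₂ g (U (x : H)).snd (U (π.hom (gen q c g) x : H)).snd := by
  obtain ⟨A, B, hA, hB, S⟩ := hπ.exists_system hq0 hq1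
  obtain ⟨G₁, _, _, _, T₁, J₁, hT₁, ho₁, hA₁, ht₁, hact₁⟩ :=
    S.exists_typeOne hA hB hπ.adjoint_X (Or.inl rfl)
  obtain ⟨G₂, _, _, _, T₂, J₂, hT₂, ho₂, hA₂, ht₂, hact₂⟩ :=
    S.exists_typeOne hA hB hπ.adjoint_X (Or.inr ⟨rfl, hc⟩)
  have h1 := one_le_lamSign c.coe_nonneg
  have h2 := lamSign_neg_one_neg (c := c) hc
  obtain ⟨U, hU⟩ := exists_unitary_prod (J := J₁) (J' := J₂) ho₁ ho₂
    (fun i i' η ζ => S.inner_eq_zero_of_eigenvalues (by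
      have h3 : 0 < lamSign c 1 * q ^ (2 * i.1) := mul_pos (by linarith) (pow_pos hq0 _)
      have h4 : lamSign c (-1) * q ^ (2 * i'.1) < 0 := mul_neg_of_neg_of_pos h2 (pow_pos hq0 _)
      exact (h4.trans h3).ne') (hA₁ i.1 i.2 η) (hA₂ i'.1 i'.2 ζ))
    (fun x hx hx' => S.eq_zero_of_forall_pow (by linarith) (lamSign_one_add c)
      (lamSign_one_mul c.coe_nonneg) fun n y hy => hy.elim (ht₁ x hx n y) (ht₂ x hx' n y))
  refine ⟨G₁, _, _, _, T₁, G₂, _, _, _, T₂, U, hT₁, hT₂, fun g x => ⟨?_, ?_⟩⟩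
  · have := hact₁ g x
    simp only [← (hU _ _).1] at this
    exact this
  · have := hact₂ g x
    simp only [← (hU _ _).2] at this
    exact this

/-- For `c = 0` the roots are `1` and `0`. The eigenspace for `0` is `ker A = {0}`, so the single
grid of the root `1` is total. -/
theorem WellBehaved.exists_unitary_of_zero {q : ℝ} (hq0 : 0 < q) (hq1 : q < 1)
    {π : StarRep (HatCrossProduct q (0 : ℝ≥0)) H} (hπ : WellBehaved q 0 π) :
    ∃ (G : Type u) (_ : NormedAddCommGroup G) (_ : InnerProductSpace ℂ G)
      (_ : CompleteSpace G) (T : G →ₗ.[ℂ] G) (U : H ≃ₗᵢ[ℂ] DoubleSum G),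
      IsInvertibleSelfAdjoint T ∧ ∀ (g : HatGen) (x : π.domain),
        TypeOneActs q 0 1 T g (U (x : H)) (U (π.hom (gen q (0 : ℝ≥0) g) x : H)) := by
  obtain ⟨A, B, hA, hB, S⟩ := hπ.exists_system hq0 hq1
  obtain ⟨G, _, _, _, T, J, hT, ho, hA₁, ht, hact⟩ :=
    S.exists_typeOne hA hB hπ.adjoint_X (Or.inl rfl)
  obtain ⟨U, hU⟩ := exists_unitary (J := J) ho
    (fun x hx => by
      have h1 : lamSign ((0 : ℝ≥0) : ℝ) 1 = 1 := by
        have h3 : √(1 / 4 : ℝ) = 1 / 2 := by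
          rw [show (1 / 4 : ℝ) = (1 / 2) ^ 2 by norm_num, Real.sqrt_sq (by norm_num)]
        rw [lamSign, NNReal.coe_zero, zero_add, h3]; norm_num
      refine S.eq_zero_of_forall_pow (l₁ := 1) (l₂ := 0) one_ne_zero (add_zero 1) (by simp)
        fun n y hy => ?_
      rcases hy with hy | hy
      · exact ht x hx n y (by rw [h1]; exact hy)
      · rw [S.A_inj y (by rw [hy, Complex.ofReal_zero, zero_smul]), inner_zero_left])
  refine ⟨G, _, _, _, T, U, hT, fun g x => ?_⟩
  have := hact g x
  simp only [← hU, NNReal.coe_zero] at this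
  exact this

end Classification

end

/-! ### Smooth vectors of an injective self-adjoint operator. -/

section

section Smooth

variable {G : Type*} [NormedAddCommGroup G] [InnerProductSpace ℂ G]

theorem mem_smoothVectors {T : G →ₗ.[ℂ] G} {x : G} :
    x ∈ smoothVectors T ↔ ∀ k, x ∈ (opPow T k).domain ∧ x ∈ (opPow T.inverse k).domain := by
  rw [smoothVectors, Submodule.mem_iInf]
  rfl

theorem mem_domain_opPow_succ {T : G →ₗ.[ℂ] G} {k : ℕ} {x : G} :
    x ∈ (opPow T (k + 1)).domain ↔ ∃ y, (x, y) ∈ T.graph ∧ y ∈ (opPow T k).domain := by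
  simp only [mem_domain_iff_exists_graph, mem_graph_opPow_succ]
  exact ⟨fun ⟨z, y, h1, h2⟩ => ⟨y, h1, z, h2⟩, fun ⟨y, h1, z, h2⟩ => ⟨z, y, h1, h2⟩⟩

theorem mem_domain_opPow_zero {T : G →ₗ.[ℂ] G} (x : G) : x ∈ (opPow T 0).domain :=
  mem_domain_iff_exists_graph.2 ⟨x, mem_graph_opPow_zero.2 rfl⟩

variable {T : G →ₗ.[ℂ] G} (hk : ∀ x, (x, 0) ∈ T.graph → x = 0)

include hk

/-- A subspace that `T` maps into itself and onto itself lies in the domains of all powers of `T`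
and `T⁻¹`; this is the criterion for smoothness used below. -/
theorem le_smoothVectors {N : Submodule ℂ G} (h : ∀ x ∈ N, ∃ y ∈ N, (x, y) ∈ T.graph)
    (h' : ∀ x ∈ N, ∃ y ∈ N, (y, x) ∈ T.graph) : N ≤ smoothVectors T := by
  intro x hx
  rw [mem_smoothVectors]
  intro k
  induction k generalizing x with
  | zero => exact ⟨mem_domain_opPow_zero x, mem_domain_opPow_zero x⟩
  | succ k ih =>
    obtain ⟨y, hy, hxy⟩ := h x hx
    obtain ⟨z, hz, hzx⟩ := h' x hx
    exact ⟨mem_domain_opPow_succ.2 ⟨y, hxy, (ih hy).1⟩,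
      mem_domain_opPow_succ.2 ⟨z, (mem_graph_inverse hk).2 hzx, (ih hz).2⟩⟩

theorem mem_smoothVectors_iff_of_mem_graph {x y : G} (h : (x, y) ∈ T.graph) :
    x ∈ smoothVectors T ↔ y ∈ smoothVectors T := by
  have hd : ∀ {k x y}, (x, y) ∈ T.graph → ((x ∈ (opPow T (k + 1)).domain ↔ y ∈ (opPow T k).domain) ∧
      (y ∈ (opPow T.inverse (k + 1)).domain ↔ x ∈ (opPow T.inverse k).domain)) := by
    intro k x y h
    rw [mem_domain_opPow_succ, mem_domain_opPow_succ]
    refine ⟨⟨fun ⟨z, hz, hz'⟩ => ?_, fun h1 => ⟨y, h, h1⟩⟩, ⟨fun ⟨z, hz, hz'⟩ => ?_,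
      fun h1 => ⟨x, (mem_graph_inverse hk).2 h, h1⟩⟩⟩
    · rwa [← graph_unique hz h]
    · rwa [← graph_unique hz ((mem_graph_inverse hk).2 h)]
  rw [mem_smoothVectors, mem_smoothVectors]
  refine ⟨fun h1 k => ⟨(hd h).1.1 (h1 (k + 1)).1, ?_⟩, fun h1 k => ⟨?_, (hd h).2.1 (h1 (k + 1)).2⟩⟩
  · cases k with
    | zero => exact mem_domain_opPow_zero y
    | succ k => exact (hd h).2.2 (h1 k).2
  · cases k with
    | zero => exact mem_domain_opPow_zero x
    | succ k => exact (hd h).1.2 (h1 k).1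

omit hk in
theorem exists_graph_of_mem_smoothVectors {x : G} (h : x ∈ smoothVectors T) :
    ∃ y, (x, y) ∈ T.graph := by
  have := (mem_smoothVectors.1 h 1).1
  rwa [opPow_one, mem_domain_iff_exists_graph] at this

theorem exists_graph_of_mem_smoothVectors' {x : G} (h : x ∈ smoothVectors T) :
    ∃ y, (y, x) ∈ T.graph := by
  have := (mem_smoothVectors.1 h 1).2
  rw [opPow_one, mem_domain_iff_exists_graph] at this
  obtain ⟨y, hy⟩ := this
  exact ⟨y, (mem_graph_inverse hk).1 hy⟩

/-- The restriction of `T` to its smooth vectors. -/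
theorem exists_smooth_equiv : ∃ t : smoothVectors T ≃ₗ[ℂ] smoothVectors T,
    ∀ x : smoothVectors T, ((x : G), (t x : G)) ∈ T.graph := by
  choose f hf using fun x : smoothVectors T => exists_graph_of_mem_smoothVectors x.2
  choose g hg using fun x : smoothVectors T => exists_graph_of_mem_smoothVectors' hk x.2
  have hfm : ∀ x, f x ∈ smoothVectors T := fun x =>
    (mem_smoothVectors_iff_of_mem_graph hk (hf x)).1 x.2
  have hgm : ∀ x, g x ∈ smoothVectors T := fun x =>
    (mem_smoothVectors_iff_of_mem_graph hk (hg x)).2 x.2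
  refine ⟨{ toFun := fun x => ⟨f x, hfm x⟩
            map_add' := fun x y => Subtype.ext
              (graph_unique (hf (x + y)) (T.graph.add_mem (hf x) (hf y)))
            map_smul' := fun r x => Subtype.ext
              (graph_unique (hf (r • x)) (T.graph.smul_mem r (hf x)))
            invFun := fun x => ⟨g x, hgm x⟩
            left_inv := fun x => Subtype.ext ?_
            right_inv := fun x => Subtype.ext ?_ }, hf⟩
  · have h1 := T.graph.sub_mem (hg ⟨f x, hfm x⟩) (hf x)
    rw [Prod.mk_sub_mk, sub_self] at h1
    exact sub_eq_zero.1 (hk _ h1)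
  · exact graph_unique (hf ⟨g x, hgm x⟩) (hg x)

variable [CompleteSpace G] (hT : IsSelfAdjoint T)

include hT

/-- The operator `b = T (1 + T²)⁻¹` is bounded, self-adjoint and has dense range. Where `|b|` is
bounded away from `0`, both `T` and `T⁻¹` are bounded, so vectors cut off there are smooth, and they
approximate every `b y`. -/
theorem dense_smoothVectors : Dense (smoothVectors T : Set G) := by
  obtain ⟨C, b, hC⟩ := sa_exists_resolvent hT
  have hb := hC.isSelfAdjoint_b hT
  have hbC : Commute b C := (hC.commute_of_commutes hT (hC.commutes hT).2).1
  have key : ∀ δ : ℝ, 0 < δ → ∀ y, ∃ x ∈ smoothVectors T, ‖x - b y‖ ≤ δ * ‖y‖ := by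
    intro δ hδ y
    -- `f` is a continuous function equal to `1/s` for `|s| ≥ δ`, and `p` agrees with `s` up to `δ`
    -- and vanishes for `|s| ≤ δ`. Hence `s f(s) p(s) = p(s)` everywhere.
    let f : ℝ → ℝ := fun s => s / max (s ^ 2) (δ ^ 2)
    let p : ℝ → ℝ := fun s => s - max (-δ) (min s δ)
    have hm : ∀ s : ℝ, max (s ^ 2) (δ ^ 2) ≠ 0 := fun s =>
      (lt_max_of_lt_right (pow_pos hδ 2)).ne'
    have hf : Continuous f := continuous_id.div (by fun_prop) hm
    have hp : Continuous p := by fun_prop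
    have hfp : ∀ s, s * f s * p s = p s := by
      intro s
      by_cases hs : δ ^ 2 ≤ s ^ 2
      · have h0 : s ≠ 0 := by
          rintro rfl
          nlinarith [pow_pos hδ 2]
        simp only [f, max_eq_left hs]
        field_simp
      · have h1 := abs_lt_of_sq_lt_sq' (not_le.1 hs) hδ.le
        simp only [p, min_eq_left h1.2.le, max_eq_right h1.1.le, sub_self, mul_zero]
    set r : G →L[ℂ] G := cfc f b
    set e : G →L[ℂ] G := cfc p b
    have hbr : b * r = cfc (fun s => s * f s) b := by
      rw [cfc_mul (fun s => s) f b (by fun_prop) hf.continuousOn, cfc_id' ℝ b]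
    have hbre : b * r * e = e := by
      rw [hbr, ← cfc_mul (fun s => s * f s) p b (by fun_prop) hp.continuousOn]
      exact cfc_congr fun s _ => hfp s
    have hbrc : Commute b r := (Commute.refl b).cfc_real f |>.symm
    have hrC : Commute r C := hbC.cfc_real f
    -- On `N` the operator `r` inverts `b`. For `x = b r x` the graph of `T` contains `(x, r x - C r
    -- x)` and `(C r x, x)`, so `T` maps `N` bijectively onto itself.
    let N : Submodule ℂ G := LinearMap.ker ((b * r - 1 : G →L[ℂ] G) : G →ₗ[ℂ] G)
    have hN : ∀ x, x ∈ N ↔ b (r x) = x := by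
      intro x
      change (b * r - 1 : G →L[ℂ] G) x = 0 ↔ _
      rw [sub_apply, sub_eq_zero]
      rfl
    have happ : ∀ {D D' : G →L[ℂ] G}, Commute D D' → ∀ x, D (D' x) = D' (D x) := fun h x =>
      congrArg (fun E : G →L[ℂ] G => E x) h.eq
    have hNr : ∀ x ∈ N, r x ∈ N := fun x hx => by
      rw [hN] at hx ⊢
      rw [happ hbrc, hx]
    have hNC : ∀ x ∈ N, C x ∈ N := fun x hx => by
      rw [hN] at hx ⊢
      rw [happ hrC, happ hbC, hx]
    have hNT : ∀ x ∈ N, (x, r x - C (r x)) ∈ T.graph := fun x hx => by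
      have := hC.mem_sa hT (r x)
      rwa [(hN x).1 hx] at this
    have hNT' : ∀ x ∈ N, (C (r x), x) ∈ T.graph := fun x hx => by
      have := hC.mem (r x)
      rwa [(hN x).1 hx] at this
    refine ⟨e y, le_smoothVectors hk (fun x hx => ⟨_, ?_, hNT x hx⟩)
      (fun x hx => ⟨_, hNC _ (hNr x hx), hNT' x hx⟩) ((hN _).2 ?_), ?_⟩
    · exact N.sub_mem (hNr x hx) (hNC _ (hNr x hx))
    · exact congrArg (fun E : G →L[ℂ] G => E y) hbre
    · have h1 : ‖e - b‖ ≤ δ := by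
        have h2 : e - b = cfc (fun s => p s - s) b := by
          rw [cfc_sub p (fun s => s) b hp.continuousOn (by fun_prop), cfc_id' ℝ b]
        rw [h2]
        refine norm_cfc_le hδ.le fun s _ => ?_
        simp only [p, sub_sub_cancel_left, norm_neg, Real.norm_eq_abs]
        rw [abs_le]
        exact ⟨le_max_left _ _, max_le (by linarith) (min_le_right _ _)⟩
      exact ((e - b).le_opNorm y).trans (by gcongr)
  rw [Metric.dense_iff]
  intro z ε hε
  obtain ⟨y, hy⟩ := Metric.denseRange_iff.1 (hC.denseRange_b hT hk) z (ε / 2) (by linarith)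
  obtain ⟨x, hx, hxy⟩ := key (ε / (2 * (‖y‖ + 1))) (by positivity) y
  refine ⟨x, ?_, hx⟩
  rw [Metric.mem_ball, dist_comm]
  refine (dist_triangle z (b y) x).trans_lt ?_
  have h3 : dist (b y) x ≤ ε / 2 := by
    rw [dist_comm, dist_eq_norm]
    refine hxy.trans ?_
    rw [div_mul_eq_mul_div, div_le_div_iff₀ (by positivity) two_pos]
    nlinarith [norm_nonneg y]
  linarith

/-- The square root of `κ + T⁻⁴` on the smooth vectors. -/
theorem exists_smooth_sqrt {κ : ℝ} (hκ : 0 ≤ κ) (t : smoothVectors T ≃ₗ[ℂ] smoothVectors T)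
    (ht : ∀ x : smoothVectors T, ((x : G), (t x : G)) ∈ T.graph) :
    ∃ (S : G →ₗ.[ℂ] G) (s : smoothVectors T →ₗ[ℂ] smoothVectors T),
      IsPositiveSqrt S ((κ : ℂ) • (idOp : G →ₗ.[ℂ] G) + opPow T.inverse 4) ∧
      (∀ x : smoothVectors T, ((x : G), (s x : G)) ∈ S.graph) ∧ (∀ x, s (t x) = t (s x)) ∧
      ∀ x, s (s x) = (κ : ℂ) • x + t.symm (t.symm (t.symm (t.symm x))) := by
  obtain ⟨S, hS, -, hSC⟩ := exists_sqrt_radicand hT hk hκ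
  obtain ⟨C, b, hC⟩ := sa_exists_resolvent hT
  have hti : ∀ x : smoothVectors T, ((x : G), (t.symm x : G)) ∈ T.inverse.graph := fun x => by
    rw [mem_graph_inverse hk]
    have := ht (t.symm x)
    rwa [t.apply_symm_apply] at this
  have hrad : ∀ x : smoothVectors T, ((x : G), (κ : ℂ) • (x : G)
      + (t.symm (t.symm (t.symm (t.symm x))) : G)) ∈ (opMul S S).graph := by
    intro x
    rw [hS.2.2, mem_graph_add]
    refine ⟨_, _, mem_graph_smul.2 ⟨x, mem_graph_idOp.2 rfl, rfl⟩, ?_, rfl⟩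
    rw [opPow_four, mem_graph_opMul]
    exact ⟨_, mem_graph_opMul.2 ⟨_, hti _, hti _⟩, mem_graph_opMul.2 ⟨_, hti _, hti _⟩⟩
  choose f hf hf' using fun x => mem_graph_opMul.1 (hrad x)
  -- With `v = S (x + T² x)` one has `S x = C v` and `S T x = b v`, because `C` and `b` commute with
  -- `S` and send `x + T² x` to `x` and `T x`. So `T S x = S T x` follows from `T C = b`.
  have hcomm : ∀ x, (f x, f (t x)) ∈ T.graph := by
    intro x
    have h1 := hC.unique_sa hT (ht x) (ht (t x))
    have h2 : (((x + t (t x) : smoothVectors T) : G), f (x + t (t x))) ∈ S.graph := hf _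
    have h3 := hSC C (hC.commutes hT).1 _ _ h2
    have h4 := hSC b (hC.commutes hT).2 _ _ h2
    rw [Submodule.coe_add, h1.1] at h3
    rw [Submodule.coe_add, h1.2] at h4
    rw [graph_unique (hf x) h3, graph_unique (hf (t x)) h4]
    exact hC.mem _
  let L : smoothVectors T →ₗ[ℂ] G :=
    { toFun := f
      map_add' := fun x y => graph_unique (hf (x + y)) (S.graph.add_mem (hf x) (hf y))
      map_smul' := fun r x => graph_unique (hf (r • x)) (S.graph.smul_mem r (hf x)) }
  have hfm : ∀ x, L x ∈ smoothVectors T := by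
    intro x
    refine le_smoothVectors hk (N := LinearMap.range L) ?_ ?_ ⟨x, rfl⟩
    · rintro _ ⟨x, rfl⟩
      exact ⟨_, ⟨t x, rfl⟩, hcomm x⟩
    · rintro _ ⟨x, rfl⟩
      refine ⟨_, ⟨t.symm x, rfl⟩, ?_⟩
      have := hcomm (t.symm x)
      rwa [t.apply_symm_apply] at this
  refine ⟨S, L.codRestrict _ hfm, hS, hf, fun x => Subtype.ext ?_, fun x => Subtype.ext ?_⟩
  · exact graph_unique (hcomm x) (ht ⟨f x, hfm x⟩)
  · exact graph_unique (hf ⟨f x, hfm x⟩) (hf' x)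

end Smooth

end

/-! ### Verification of the relations on families of vectors. -/

section

section Formulas

variable {M : Type*} [NormedAddCommGroup M] [InnerProductSpace ℂ M]

/-- The linear map `x ↦ lowerN x i`. -/
def lowerNHom : ℕ × ℕ → ((ℕ × ℕ → M) →ₗ[ℂ] M)
  | (0, _) => 0
  | (n + 1, j) => LinearMap.proj (n, j)

/-- The linear map `x ↦ lowerJ x i`. -/
def lowerJHom : ℕ × ℕ → ((ℕ × ℕ → M) →ₗ[ℂ] M)
  | (_, 0) => 0
  | (n, j + 1) => LinearMap.proj (n, j)

theorem lowerNHom_apply (i : ℕ × ℕ) (x : ℕ × ℕ → M) : lowerNHom i x = lowerN x i := by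
  obtain ⟨_ | n, j⟩ := i <;> rfl

theorem lowerJHom_apply (i : ℕ × ℕ) (x : ℕ × ℕ → M) : lowerJHom i x = lowerJ x i := by
  obtain ⟨n, _ | j⟩ := i <;> rfl

/-- The scalars that enter the formulas `(I)_{±,H}`: `h = q^{1/2}`, `l = λ_±`, `e = ±1`,
`g n = c_±(n)`, `m j = λ_j`. -/
structure GridScalars (h l e c : ℂ) (g m : ℕ → ℂ) : Prop where
  h_ne : h ≠ 0
  h_ne' : h ^ 2 - (h ^ 2)⁻¹ ≠ 0
  l_ne : l ≠ 0
  e_mul : e * e = 1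
  g_zero : g 0 = 0
  g_mul : ∀ n, g n * g n = c + l * h ^ (4 * n) - l ^ 2 * h ^ (8 * n)
  m_zero : m 0 = 0
  m_mul : ∀ j, m j * m j = 1 - h ^ (4 * j)

/-- The action of the generators on families of vectors by the formulas `(I)_{±,H}`. -/
def gridOp (h l e : ℂ) (g m : ℕ → ℂ) (t : M ≃ₗ[ℂ] M) (s : ℕ → M →ₗ[ℂ] M) :
    HatGen → Module.End ℂ (ℕ × ℕ → M)
  | .of .A => LinearMap.pi fun i => (l * h ^ (4 * i.1)) • LinearMap.proj i
  | .Ai => LinearMap.pi fun i => (l * h ^ (4 * i.1))⁻¹ • LinearMap.proj i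
  | .of .B => LinearMap.pi fun i => g (i.1 + 1) • LinearMap.proj (i.1 + 1, i.2)
  | .of .Bs => LinearMap.pi fun i => g i.1 • lowerNHom i
  | .of .K => LinearMap.pi fun i => (h ^ (2 * i.1) * (h ^ (2 * i.2))⁻¹) • t.toLinearMap ∘ₗ
      LinearMap.proj i
  | .of .Ki => LinearMap.pi fun i => ((h ^ (2 * i.1))⁻¹ * h ^ (2 * i.2)) • t.symm.toLinearMap ∘ₗ
      LinearMap.proj i
  | .of .E => LinearMap.pi fun i => (h⁻¹ * (h ^ 2 - (h ^ 2)⁻¹)⁻¹) •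
      ((e * (h ^ (2 * i.1))⁻¹ * m (i.2 + 1)) • s (i.2 + 1) ∘ₗ t.toLinearMap ∘ₗ
          LinearMap.proj (i.1, i.2 + 1)
        - (g i.1 * l⁻¹ * (h ^ (2 * i.1))⁻¹ * (h ^ (2 * i.2))⁻¹) • t.toLinearMap ∘ₗ lowerNHom i)
  | .of .F => LinearMap.pi fun i => (h⁻¹ * (h ^ 2 - (h ^ 2)⁻¹)⁻¹) •
      ((e * (h ^ (2 * i.1))⁻¹ * m i.2) • s i.2 ∘ₗ t.toLinearMap ∘ₗ lowerJHom i
        - (g (i.1 + 1) * l⁻¹ * (h ^ (2 * (i.1 + 1)))⁻¹ * (h ^ (2 * i.2))⁻¹) • t.toLinearMap ∘ₗ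
          LinearMap.proj (i.1 + 1, i.2))

variable {h l e c : ℂ} {g m : ℕ → ℂ} {t : M ≃ₗ[ℂ] M} {s : ℕ → M →ₗ[ℂ] M}

section Apply

variable (x : ℕ × ℕ → M) (n j : ℕ)

theorem gridOp_A : gridOp h l e g m t s (.of .A) x (n, j) = (l * h ^ (4 * n)) • x (n, j) := rfl

theorem gridOp_Ai : gridOp h l e g m t s .Ai x (n, j) = (l * h ^ (4 * n))⁻¹ • x (n, j) := rfl

theorem gridOp_B : gridOp h l e g m t s (.of .B) x (n, j) = g (n + 1) • x (n + 1, j) := rfl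

theorem gridOp_Bs : gridOp h l e g m t s (.of .Bs) x (n, j) = g n • lowerN x (n, j) :=
  congrArg _ (lowerNHom_apply _ _)

theorem gridOp_K : gridOp h l e g m t s (.of .K) x (n, j)
    = (h ^ (2 * n) * (h ^ (2 * j))⁻¹) • t (x (n, j)) := rfl

theorem gridOp_Ki : gridOp h l e g m t s (.of .Ki) x (n, j)
    = ((h ^ (2 * n))⁻¹ * h ^ (2 * j)) • t.symm (x (n, j)) := rfl

theorem gridOp_E : gridOp h l e g m t s (.of .E) x (n, j) = (h⁻¹ * (h ^ 2 - (h ^ 2)⁻¹)⁻¹) •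
    ((e * (h ^ (2 * n))⁻¹ * m (j + 1)) • s (j + 1) (t (x (n, j + 1)))
      - (g n * l⁻¹ * (h ^ (2 * n))⁻¹ * (h ^ (2 * j))⁻¹) • t (lowerN x (n, j))) := by
  rw [← lowerNHom_apply]; rfl

theorem gridOp_F : gridOp h l e g m t s (.of .F) x (n, j) = (h⁻¹ * (h ^ 2 - (h ^ 2)⁻¹)⁻¹) •
    ((e * (h ^ (2 * n))⁻¹ * m j) • s j (t (lowerJ x (n, j)))
      - (g (n + 1) * l⁻¹ * (h ^ (2 * (n + 1)))⁻¹ * (h ^ (2 * j))⁻¹) • t (x (n + 1, j))) := by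
  rw [← lowerJHom_apply]; rfl

end Apply

theorem gridOp_A_mul_Ai (H : GridScalars h l e c g m) :
    gridOp h l e g m t s (.of .A) * gridOp h l e g m t s .Ai = 1 := by
  refine LinearMap.ext fun x => funext fun ⟨n, j⟩ => ?_
  rw [Module.End.mul_apply, gridOp_A, gridOp_Ai, smul_smul, mul_inv_cancel₀
    (mul_ne_zero H.l_ne (pow_ne_zero _ H.h_ne)), one_smul]
  rfl

theorem gridOp_Ai_mul_A (H : GridScalars h l e c g m) :
    gridOp h l e g m t s .Ai * gridOp h l e g m t s (.of .A) = 1 := by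
  refine LinearMap.ext fun x => funext fun ⟨n, j⟩ => ?_
  rw [Module.End.mul_apply, gridOp_Ai, gridOp_A, smul_smul, inv_mul_cancel₀
    (mul_ne_zero H.l_ne (pow_ne_zero _ H.h_ne)), one_smul]
  rfl

set_option maxHeartbeats 4000000 in
-- No topology is involved: `t` is a bijection commuting with all `s j`, and after the operators
-- have been sorted every relation is an identity between scalars, modulo the formulas for the
-- squares of `g`, `m` and `e`.
theorem gridOp_crossRel (H : GridScalars h l e c g m) (hst : ∀ j x, s j (t x) = t (s j x))
    (hss : ∀ j x, s j (s j x)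
      = (l⁻¹ ^ 2 * (h ^ (4 * j))⁻¹ * c) • x + t.symm (t.symm (t.symm (t.symm x)))) :
    CrossRel h 1 c (fun x => gridOp h l e g m t s (.of x)) := by
  have h0 := H.h_ne
  have h1 := H.h_ne'
  have hl := H.l_ne
  have h4 : h ^ 4 - 1 ≠ 0 := by
    intro h4
    apply h1
    field_simp
    rw [h4, mul_zero]
  have he : e ^ 2 = 1 := by rw [sq, H.e_mul]
  have hm : ∀ j, m j ^ 2 = 1 - h ^ (4 * j) := fun j => by rw [sq, H.m_mul]
  -- Since `g 0 = 0`, the formula for `g 0 * g 0` says that `l` is a root, and `c` can be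
  -- eliminated.
  obtain rfl : c = l ^ 2 - l := by
    have := H.g_mul 0
    rw [H.g_zero] at this
    linear_combination -this
  have hg : ∀ n, g n ^ 2 = l ^ 2 - l + l * h ^ (4 * n) - l ^ 2 * h ^ (8 * n) := fun n => by
    rw [sq, H.g_mul]
  constructor
  all_goals
    refine LinearMap.ext fun x => funext fun ⟨n, j⟩ => ?_
    simp only [Module.End.mul_apply, LinearMap.smul_apply, LinearMap.add_apply,
      LinearMap.sub_apply, Pi.smul_apply, Pi.add_apply, Pi.sub_apply, Module.End.one_apply,
      gridOp_A, gridOp_B, gridOp_Bs, gridOp_K, gridOp_Ki, gridOp_E, gridOp_F, map_smul, map_add,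
      map_sub, hst, hss, LinearEquiv.apply_symm_apply, LinearEquiv.symm_apply_apply]
  -- Boundary positions are separated, because the lowered families are zero there; this agrees with
  -- the interior formulas through `g 0 = 0` and `m 0 = 0`.
  all_goals
    obtain _ | n := n
    all_goals obtain _ | j := j
    all_goals
      (try simp only [lowerN, lowerJ, gridOp_A, gridOp_B, gridOp_Bs, gridOp_K, gridOp_E, gridOp_F,
        map_smul, map_add, map_sub, hst, hss, LinearEquiv.apply_symm_apply, map_zero, smul_zero,
        H.g_zero, H.m_zero]) <;>
      match_scalars <;> (try field_simp) <;> (try ring_nf) <;> (try simp only [hg, hm, he]) <;>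
        (try ring1)

end Formulas

end

/-! ### Representations of presented `*`-algebras from operators on generators. -/

section

section Presentation

variable {Z : Type} [InvolutiveStar Z] {H : Type*} [NormedAddCommGroup H] [InnerProductSpace ℂ H]
  {D : Submodule ℂ H} {O : Z → Module.End ℂ D}

/-- The homomorphism of the free algebra determined by the images of the generators. -/
def FreeStarAlgebra.lift {Z : Type} {A : Type*} [Ring A] [Algebra ℂ A] (O : Z → A) :
    FreeStarAlgebra Z →ₐ[ℂ] A :=
  (FreeAlgebra.lift ℂ O : FreeAlgebra ℂ Z →ₐ[ℂ] A)

theorem FreeStarAlgebra.lift_gen {Z : Type} {A : Type*} [Ring A] [Algebra ℂ A] (O : Z → A)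
    (z : Z) : FreeStarAlgebra.lift O (FreeStarAlgebra.gen z) = O z :=
  FreeAlgebra.lift_ι_apply O z

theorem FreeStarAlgebra.induction {p : FreeStarAlgebra Z → Prop}
    (h1 : ∀ r, p (algebraMap ℂ (FreeStarAlgebra Z) r)) (h2 : ∀ z, p (FreeStarAlgebra.gen z))
    (h3 : ∀ a b, p a → p b → p (a * b)) (h4 : ∀ a b, p a → p b → p (a + b))
    (a : FreeStarAlgebra Z) : p a :=
  FreeAlgebra.induction (R := ℂ) (X := Z) (motive := p) h1 h2 h3 h4 a

/-- The homomorphism of a presented algebra determined by a homomorphism of the free algebra that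
respects the relations. -/
def PresentedStarAlgebra.lift {R : Set (FreeStarAlgebra Z × FreeStarAlgebra Z)} {A : Type*}
    [Ring A] [Algebra ℂ A] (f : FreeStarAlgebra Z →ₐ[ℂ] A)
    (hf : ∀ a b, StarClosure R a b → f a = f b) : PresentedStarAlgebra R →ₐ[ℂ] A :=
  (RingQuot.liftAlgHom ℂ ⟨f, fun a b => hf a b⟩ : RingQuot (StarClosure R) →ₐ[ℂ] A)

theorem PresentedStarAlgebra.lift_mk {R : Set (FreeStarAlgebra Z × FreeStarAlgebra Z)} {A : Type*}
    [Ring A] [Algebra ℂ A] (f : FreeStarAlgebra Z →ₐ[ℂ] A)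
    (hf : ∀ a b, StarClosure R a b → f a = f b) (a : FreeStarAlgebra Z) :
    PresentedStarAlgebra.lift f hf (PresentedStarAlgebra.mk R a) = f a :=
  RingQuot.liftAlgHom_mkAlgHom_apply ℂ f (fun a b => hf a b) a

theorem PresentedStarAlgebra.mk_surjective (R : Set (FreeStarAlgebra Z × FreeStarAlgebra Z)) :
    Function.Surjective (PresentedStarAlgebra.mk R) :=
  RingQuot.mkAlgHom_surjective ℂ (StarClosure R)

theorem freeLift_adjoint
    (hadj : ∀ z (x y : D), ⟪(O z x : H), (y : H)⟫_ℂ = ⟪(x : H), (O (star z) y : H)⟫_ℂ)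
    (a : FreeStarAlgebra Z) : ∀ x y : D, ⟪(FreeStarAlgebra.lift O a x : H), (y : H)⟫_ℂ
        = ⟪(x : H), (FreeStarAlgebra.lift O (star a) y : H)⟫_ℂ := by
  refine FreeStarAlgebra.induction (p := fun a => ∀ x y : D,
    ⟪(FreeStarAlgebra.lift O a x : H), (y : H)⟫_ℂ
      = ⟪(x : H), (FreeStarAlgebra.lift O (star a) y : H)⟫_ℂ) ?_ ?_ ?_ ?_ a
  · intro r x y
    rw [show star (algebraMap ℂ (FreeStarAlgebra Z) r) = algebraMap ℂ _ (starRingEnd ℂ r) from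
      freeStar_algebraMap r, AlgHom.commutes, AlgHom.commutes, Module.algebraMap_end_apply,
      Module.algebraMap_end_apply, Submodule.coe_smul, Submodule.coe_smul, inner_smul_left,
      inner_smul_right]
  · intro z x y
    rw [show star (FreeStarAlgebra.gen z) = FreeStarAlgebra.gen (star z) from
      freeStar_gen z, FreeStarAlgebra.lift_gen, FreeStarAlgebra.lift_gen, hadj]
  · intro a b ha hb x y
    rw [star_mul, map_mul, map_mul, Module.End.mul_apply, Module.End.mul_apply, ha, hb]
  · intro a b ha hb x y
    rw [star_add, map_add, map_add, LinearMap.add_apply, LinearMap.add_apply, Submodule.coe_add,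
      Submodule.coe_add, inner_add_left, inner_add_right, ha, hb]

/-- Only the listed relations have to be checked: the adjoint of a relation follows by moving it
across the inner product and using density of `D`. -/
theorem freeLift_eq_of_starClosure (hD : Dense (D : Set H))
    (hadj : ∀ z (x y : D), ⟪(O z x : H), (y : H)⟫_ℂ = ⟪(x : H), (O (star z) y : H)⟫_ℂ)
    {R : Set (FreeStarAlgebra Z × FreeStarAlgebra Z)}
    (hR : ∀ p ∈ R, FreeStarAlgebra.lift O p.1 = FreeStarAlgebra.lift O p.2)
    (a b : FreeStarAlgebra Z) (h : StarClosure R a b) :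
    FreeStarAlgebra.lift O a = FreeStarAlgebra.lift O b := by
  obtain ⟨a, b, h⟩ | ⟨a, b, h⟩ := h
  · exact hR _ h
  · refine LinearMap.ext fun y => Subtype.ext (hD.eq_of_inner_right ℂ fun x hx => ?_)
    rw [← freeLift_adjoint hadj a ⟨x, hx⟩ y, ← freeLift_adjoint hadj b ⟨x, hx⟩ y]
    exact congrArg (fun e : Module.End ℂ D => ⟪(e ⟨x, hx⟩ : H), (y : H)⟫_ℂ) (hR _ h)

/-- The `*`-representation of a presented `*`-algebra given by operators that satisfy the
relations and are formally adjoint to each other. -/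
def StarRep.ofGenerators (D : Submodule ℂ H) (O : Z → Module.End ℂ D) (hD : Dense (D : Set H))
    (hadj : ∀ z (x y : D), ⟪(O z x : H), (y : H)⟫_ℂ = ⟪(x : H), (O (star z) y : H)⟫_ℂ)
    (R : Set (FreeStarAlgebra Z × FreeStarAlgebra Z))
    (hR : ∀ p ∈ R, FreeStarAlgebra.lift O p.1 = FreeStarAlgebra.lift O p.2) :
    StarRep (PresentedStarAlgebra R) H where
  domain := D
  dense_domain := hD
  hom := PresentedStarAlgebra.lift (FreeStarAlgebra.lift O)
    (freeLift_eq_of_starClosure hD hadj hR)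
  inner_hom := fun a x y => by
    obtain ⟨a, rfl⟩ := PresentedStarAlgebra.mk_surjective R a
    rw [PresentedStarAlgebra.star_mk, PresentedStarAlgebra.lift_mk, PresentedStarAlgebra.lift_mk]
    exact freeLift_adjoint hadj a x y

theorem StarRep.ofGenerators_gen (D : Submodule ℂ H) (O : Z → Module.End ℂ D)
    (hD : Dense (D : Set H))
    (hadj : ∀ z (x y : D), ⟪(O z x : H), (y : H)⟫_ℂ = ⟪(x : H), (O (star z) y : H)⟫_ℂ)
    (R : Set (FreeStarAlgebra Z × FreeStarAlgebra Z))
    (hR : ∀ p ∈ R, FreeStarAlgebra.lift O p.1 = FreeStarAlgebra.lift O p.2) (z : Z) :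
    (StarRep.ofGenerators D O hD hadj R hR).hom (PresentedStarAlgebra.gen R z) = O z :=
  (PresentedStarAlgebra.lift_mk _ _ _).trans (FreeStarAlgebra.lift_gen O z)

end Presentation

end

/-! ### Formal adjointness on finitely supported families. -/

section

section Pairing

variable {M : Type*} [NormedAddCommGroup M] [InnerProductSpace ℂ M]

theorem finite_ne_zero_of_imp {ι : Type*} {N : Type*} [Zero N] {y : ι → N} {S : Set ι}
    (hS : S.Finite) (h : ∀ i, i ∉ S → y i = 0) : {i | y i ≠ 0}.Finite :=
  hS.subset fun i hi => by_contra fun h' => hi (h i h')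

theorem injective_succ_fst : Function.Injective fun i : ℕ × ℕ => (i.1 + 1, i.2) := by
  rintro ⟨a, b⟩ ⟨c, d⟩ h
  simpa using h

theorem injective_succ_snd : Function.Injective fun i : ℕ × ℕ => (i.1, i.2 + 1) := by
  rintro ⟨a, b⟩ ⟨c, d⟩ h
  simpa using h

theorem lowerN_eq_zero_of_notMem {x : ℕ × ℕ → M} {i : ℕ × ℕ}
    (h : i ∉ (fun i : ℕ × ℕ => (i.1 + 1, i.2)) '' {i | x i ≠ 0}) : lowerN x i = 0 := by
  obtain ⟨_ | n, j⟩ := i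
  · rfl
  · exact by_contra fun h' => h ⟨(n, j), h', rfl⟩

theorem lowerJ_eq_zero_of_notMem {x : ℕ × ℕ → M} {i : ℕ × ℕ}
    (h : i ∉ (fun i : ℕ × ℕ => (i.1, i.2 + 1)) '' {i | x i ≠ 0}) : lowerJ x i = 0 := by
  obtain ⟨n, _ | j⟩ := i
  · rfl
  · exact by_contra fun h' => h ⟨(n, j), h', rfl⟩

theorem tsum_eq_tsum_of_injective {ι : Type*} {u v : ι → ℂ} {σ : ι → ι}
    (hσ : Function.Injective σ) (h : ∀ i, u i = v (σ i)) (h0 : ∀ k, k ∉ Set.range σ → v k = 0) :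
    ∑' i, u i = ∑' i, v i := by
  simp only [h]
  exact hσ.tsum_eq fun k hk => by_contra fun h' => hk (h0 k h')

variable {h l e c : ℂ} {g m : ℕ → ℂ} {t : M ≃ₗ[ℂ] M} {s : ℕ → M →ₗ[ℂ] M}

theorem finite_gridOp (z : HatGen) {x : ℕ × ℕ → M} (hx : {i | x i ≠ 0}.Finite) :
    {i | gridOp h l e g m t s z x i ≠ 0}.Finite := by
  have h1 := hx.preimage (f := fun i : ℕ × ℕ => (i.1 + 1, i.2)) injective_succ_fst.injOn
  have h2 := hx.preimage (f := fun i : ℕ × ℕ => (i.1, i.2 + 1)) injective_succ_snd.injOn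
  have h3 := hx.image fun i : ℕ × ℕ => (i.1 + 1, i.2)
  have h4 := hx.image fun i : ℕ × ℕ => (i.1, i.2 + 1)
  refine finite_ne_zero_of_imp (hx.union (h1.union (h2.union (h3.union h4)))) ?_
  rintro ⟨n, j⟩ hi
  simp only [Set.mem_union, not_or] at hi
  obtain ⟨i0, i1, i2, i3, i4⟩ := hi
  have j0 : x (n, j) = 0 := by_contra fun h' => i0 h'
  have j1 : x (n + 1, j) = 0 := by_contra fun h' => i1 h'
  have j2 : x (n, j + 1) = 0 := by_contra fun h' => i2 h'
  have j3 := lowerN_eq_zero_of_notMem i3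
  have j4 := lowerJ_eq_zero_of_notMem i4
  obtain (_ | _ | _ | _ | _ | _ | _) | _ := z <;>
    simp only [gridOp_A, gridOp_Ai, gridOp_B, gridOp_Bs, gridOp_K, gridOp_Ki, gridOp_E, gridOp_F,
      j0, j1, j2, j3, j4, map_zero, smul_zero, sub_zero]

theorem summable_inner_of_finite {x y : ℕ × ℕ → M} (hy : {i | y i ≠ 0}.Finite) :
    Summable fun i => ⟪x i, y i⟫_ℂ :=
  summable_of_hasFiniteSupport (hy.subset fun i hi h' => hi (by
    simp only [h', inner_zero_right]))

theorem summable_inner_of_finite' {x y : ℕ × ℕ → M} (hx : {i | x i ≠ 0}.Finite) :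
    Summable fun i => ⟪x i, y i⟫_ℂ :=
  summable_of_hasFiniteSupport (hx.subset fun i hi h' => hi (by
    simp only [h', inner_zero_left]))

/-- The scalars of the formulas are real. -/
structure GridScalarsReal (h l e : ℂ) (g m : ℕ → ℂ) : Prop where
  h_conj : starRingEnd ℂ h = h
  l_conj : starRingEnd ℂ l = l
  e_conj : starRingEnd ℂ e = e
  g_conj : ∀ n, starRingEnd ℂ (g n) = g n
  m_conj : ∀ j, starRingEnd ℂ (m j) = m j

/-- For `B` and for each of the two terms of `E` the claim is a shift of the summation index, with
zero terms on the boundary. Finite supports are needed to split the sums for `E` and `F`. -/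
theorem gridOp_adjoint (hr : GridScalarsReal h l e g m)
    (hst : ∀ j x, s j (t x) = t (s j x)) (ht : ∀ x y, ⟪t x, y⟫_ℂ = ⟪x, t y⟫_ℂ)
    (hs : ∀ j x y, ⟪s j x, y⟫_ℂ = ⟪x, s j y⟫_ℂ) (z : HatGen) {x y : ℕ × ℕ → M}
    (hx : {i | x i ≠ 0}.Finite) (hy : {i | y i ≠ 0}.Finite) :
    ∑' i, ⟪gridOp h l e g m t s z x i, y i⟫_ℂ
      = ∑' i, ⟪x i, gridOp h l e g m t s (star z) y i⟫_ℂ := by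
  have hti : ∀ x y, ⟪t.symm x, y⟫_ℂ = ⟪x, t.symm y⟫_ℂ := fun x y => by
    have := ht (t.symm x) (t.symm y)
    rw [t.apply_symm_apply, t.apply_symm_apply] at this
    exact this.symm
  have hB : ∀ {x y : ℕ × ℕ → M}, ∑' i, ⟪gridOp h l e g m t s (.of .B) x i, y i⟫_ℂ
      = ∑' i, ⟪x i, gridOp h l e g m t s (.of .Bs) y i⟫_ℂ := by
    intro x y
    refine tsum_eq_tsum_of_injective injective_succ_fst ?_ ?_
    · rintro ⟨n, j⟩
      rw [gridOp_B, gridOp_Bs, inner_smul_left, inner_smul_right, hr.g_conj]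
      rfl
    · rintro ⟨_ | n, j⟩ hk
      · rw [gridOp_Bs, lowerN, smul_zero, inner_zero_right]
      · exact absurd ⟨(n, j), rfl⟩ hk
  have hE : ∀ {x y : ℕ × ℕ → M}, {i | x i ≠ 0}.Finite → {i | y i ≠ 0}.Finite →
      ∑' i, ⟪gridOp h l e g m t s (.of .E) x i, y i⟫_ℂ
        = ∑' i, ⟪x i, gridOp h l e g m t s (.of .F) y i⟫_ℂ := by
    intro x y hx hy
    have h1 : ∀ i, ⟪gridOp h l e g m t s (.of .E) x i, y i⟫_ℂ = (h⁻¹ * (h ^ 2 - (h ^ 2)⁻¹)⁻¹) *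
        (⟪(e * (h ^ (2 * i.1))⁻¹ * m (i.2 + 1)) • s (i.2 + 1) (t (x (i.1, i.2 + 1))), y i⟫_ℂ
        - ⟪(g i.1 * l⁻¹ * (h ^ (2 * i.1))⁻¹ * (h ^ (2 * i.2))⁻¹) • t (lowerN x i), y i⟫_ℂ) := by
      rintro ⟨n, j⟩
      rw [gridOp_E, inner_smul_left, inner_sub_left]
      simp only [map_mul, map_inv₀, map_sub, map_pow, hr.h_conj]
    have h2 : ∀ i, ⟪x i, gridOp h l e g m t s (.of .F) y i⟫_ℂ = (h⁻¹ * (h ^ 2 - (h ^ 2)⁻¹)⁻¹) *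
        (⟪x i, (e * (h ^ (2 * i.1))⁻¹ * m i.2) • s i.2 (t (lowerJ y i))⟫_ℂ
        - ⟪x i, (g (i.1 + 1) * l⁻¹ * (h ^ (2 * (i.1 + 1)))⁻¹ * (h ^ (2 * i.2))⁻¹) •
          t (y (i.1 + 1, i.2))⟫_ℂ) := by
      rintro ⟨n, j⟩
      rw [gridOp_F, inner_smul_right, inner_sub_right]
    simp only [h1, h2, tsum_mul_left]
    rw [(summable_inner_of_finite hy).tsum_sub (summable_inner_of_finite hy),
      (summable_inner_of_finite' hx).tsum_sub (summable_inner_of_finite' hx)]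
    congr 2
    · refine tsum_eq_tsum_of_injective injective_succ_snd ?_ ?_
      · rintro ⟨n, j⟩
        simp only [inner_smul_left, inner_smul_right, map_mul, map_inv₀, map_pow, hr.h_conj,
          hr.e_conj, hr.m_conj, lowerJ, hst, ht, hs]
      · rintro ⟨n, _ | j⟩ hk
        · simp only [lowerJ, map_zero, smul_zero, inner_zero_right]
        · exact absurd ⟨(n, j), rfl⟩ hk
    · refine (tsum_eq_tsum_of_injective injective_succ_fst ?_ ?_).symm
      · rintro ⟨n, j⟩
        simp only [inner_smul_left, inner_smul_right, map_mul, map_inv₀, map_pow, hr.h_conj,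
          hr.l_conj, hr.g_conj, lowerN, ht]
      · rintro ⟨_ | n, j⟩ hk
        · simp only [lowerN, map_zero, smul_zero, inner_zero_left]
        · exact absurd ⟨(n, j), rfl⟩ hk
  have hconj : ∀ {u v u' v' : ℕ × ℕ → M}, (∑' i, ⟪u i, v i⟫_ℂ = ∑' i, ⟪u' i, v' i⟫_ℂ) →
      ∑' i, ⟪v i, u i⟫_ℂ = ∑' i, ⟪v' i, u' i⟫_ℂ := by
    intro u v u' v' h
    have := congrArg (starRingEnd ℂ) h
    simpa only [Complex.conj_tsum, inner_conj_symm] using this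
  obtain (_ | _ | _ | _ | _ | _ | _) | _ := z
  · refine tsum_congr fun ⟨n, j⟩ => ?_
    change _ = ⟪x (n, j), gridOp h l e g m t s (.of .A) y (n, j)⟫_ℂ
    rw [gridOp_A, gridOp_A, inner_smul_left, inner_smul_right]
    simp only [map_mul, map_pow, hr.h_conj, hr.l_conj]
  · exact hB
  · exact (hconj hB).symm
  · exact hE hx hy
  · exact (hconj (hE hy hx)).symm
  · refine tsum_congr fun ⟨n, j⟩ => ?_
    change _ = ⟪x (n, j), gridOp h l e g m t s (.of .K) y (n, j)⟫_ℂ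
    rw [gridOp_K, gridOp_K, inner_smul_left, inner_smul_right, ht]
    simp only [map_mul, map_pow, map_inv₀, hr.h_conj]
  · refine tsum_congr fun ⟨n, j⟩ => ?_
    change _ = ⟪x (n, j), gridOp h l e g m t s (.of .Ki) y (n, j)⟫_ℂ
    rw [gridOp_Ki, gridOp_Ki, inner_smul_left, inner_smul_right, hti]
    simp only [map_mul, map_pow, map_inv₀, hr.h_conj]
  · refine tsum_congr fun ⟨n, j⟩ => ?_
    change _ = ⟪x (n, j), gridOp h l e g m t s .Ai y (n, j)⟫_ℂ
    rw [gridOp_Ai, gridOp_Ai, inner_smul_left, inner_smul_right]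
    simp only [map_mul, map_pow, map_inv₀, hr.h_conj, hr.l_conj]

end Pairing

end

/-! ### The representations `(I)_{±,H}` on finite sums of smooth vectors. -/

section

section TypeOneRep

variable {G : Type*} [NormedAddCommGroup G] [InnerProductSpace ℂ G] {T : G →ₗ.[ℂ] G}

/-- The family of components of a finite sum of smooth vectors. -/
def components (T : G →ₗ.[ℂ] G) : typeOneDomain T →ₗ[ℂ] (ℕ × ℕ → smoothVectors T) where
  toFun x := fun i => ⟨(x : DoubleSum G) i, x.2.2 i⟩
  map_add' _ _ := rfl
  map_smul' _ _ := rfl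

theorem components_injective : Function.Injective (components T) := fun x y h =>
  Subtype.ext (lp.ext (funext fun i => congrArg Subtype.val (congrFun h i)))

theorem finite_components (x : typeOneDomain T) : {i | components T x i ≠ 0}.Finite :=
  x.2.1.subset fun i hi h => hi (Subtype.ext h)

theorem exists_components_eq {y : ℕ × ℕ → smoothVectors T} (hy : {i | y i ≠ 0}.Finite) :
    ∃ x, components T x = y := by
  have h1 : Memℓp (fun i => (y i : G)) 2 :=
    (memℓp_zero (hy.subset fun i hi h => hi (by simp only [h]; rfl))).of_exponent_ge zero_le
  refine ⟨⟨⟨fun i => (y i : G), h1⟩, hy.subset fun i hi h => hi ?_, fun i => (y i).2⟩, rfl⟩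
  exact congrArg Subtype.val h

theorem exists_restrict {O : Module.End ℂ (ℕ × ℕ → smoothVectors T)}
    (hO : ∀ y, {i | y i ≠ 0}.Finite → {i | O y i ≠ 0}.Finite) :
    ∃ P : Module.End ℂ (typeOneDomain T), ∀ x, components T (P x) = O (components T x) := by
  choose f hf using fun x : typeOneDomain T => exists_components_eq (hO _ (finite_components x))
  refine ⟨{ toFun := f
            map_add' := fun x y => components_injective ?_
            map_smul' := fun r x => components_injective ?_ }, hf⟩
  · rw [hf, map_add, map_add, map_add, hf, hf]
  · rw [hf, map_smul, map_smul, RingHom.id_apply, map_smul, hf]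

theorem inner_typeOneDomain (x y : typeOneDomain T) :
    ⟪(x : DoubleSum G), (y : DoubleSum G)⟫_ℂ
      = ∑' i, ⟪components T x i, components T y i⟫_ℂ :=
  lp.inner_eq_tsum _ _

theorem single_mem_typeOneDomain (i : ℕ × ℕ) {η : G} (hη : η ∈ smoothVectors T) :
    (lp.single 2 i η : DoubleSum G) ∈ typeOneDomain T := by
  refine ⟨(Set.finite_singleton i).subset fun k hk => ?_, fun k => ?_⟩
  · by_contra h
    exact hk (by rw [lp.coeFn_single, Pi.single_eq_of_ne h])
  · by_cases h : k = i
    · subst h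
      rwa [lp.coeFn_single, Pi.single_eq_same]
    · rw [lp.coeFn_single, Pi.single_eq_of_ne h]
      exact Submodule.zero_mem _

variable [CompleteSpace G]

theorem dense_typeOneDomain (hk : ∀ x, (x, 0) ∈ T.graph → x = 0) (hT : IsSelfAdjoint T) :
    Dense (typeOneDomain T : Set (DoubleSum G)) := by
  rw [Submodule.dense_iff_topologicalClosure_eq_top, Submodule.topologicalClosure_eq_top_iff,
    Submodule.eq_bot_iff]
  intro x hx
  refine lp.ext (funext fun i => (dense_smoothVectors hk hT).eq_of_inner_right ℂ fun η hη => ?_)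
  have := (Submodule.mem_orthogonal _ _).1 hx _ (single_mem_typeOneDomain i hη)
  rw [lp.inner_single_left] at this
  rw [this]
  exact (inner_zero_right _).symm

end TypeOneRep

section Scalars

open DecoupledSystem

variable {q c ε : ℝ}

theorem gridScalars (hq0 : 0 < q) (hq1 : q < 1) (hc : 0 ≤ c) (hε : ε = 1 ∨ ε = -1 ∧ 0 < c) :
    GridScalars ((√q : ℝ) : ℂ) (lamSign c ε) ε c (fun n => (cSign q c ε n : ℂ))
      (fun j => (lamN q j : ℂ)) := by
  obtain ⟨hl, -, hεε, hroot, hpos⟩ := lamSign_spec hq0 hq1 hc hε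
  have hsq : ((√q : ℝ) : ℂ) ^ 2 = (q : ℂ) := by exact_mod_cast Real.sq_sqrt hq0.le
  have h4 : ∀ n : ℕ, ((√q : ℝ) : ℂ) ^ (4 * n) = ((q ^ (2 * n) : ℝ) : ℂ) := fun n => by
    push_cast
    rw [← hsq, ← pow_mul]
    congr 1
    ring
  have h8 : ∀ n : ℕ, ((√q : ℝ) : ℂ) ^ (8 * n) = ((q ^ (2 * n) : ℝ) : ℂ) ^ 2 := fun n => by
    rw [← h4, ← pow_mul]
    congr 1
    ring
  have hnn : ∀ n : ℕ, 0 ≤ c + lamSign c ε * q ^ (2 * n) - (lamSign c ε * q ^ (2 * n)) ^ 2 := by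
    rintro (_ | n)
    · rw [mul_zero, pow_zero, mul_one, hroot]
      linarith
    · exact (hpos n).le
  refine ⟨sqrt_coe_pos hq0, ?_, by exact_mod_cast hl, by exact_mod_cast hεε, ?_, fun n => ?_, ?_,
    fun j => ?_⟩
  · rw [hsq]
    have h1 : q - q⁻¹ < 0 := by
      rw [sub_neg]
      exact hq1.trans ((one_lt_inv₀ hq0).2 hq1)
    exact_mod_cast h1.ne
  · rw [cSign, mul_zero, pow_zero, mul_one, hroot,
      show c + lamSign c ε - (lamSign c ε + c) = 0 by ring, Real.sqrt_zero, Complex.ofReal_zero]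
  · have := Real.mul_self_sqrt (hnn n)
    rw [← Complex.ofReal_mul, cSign, this, h4, h8]
    push_cast
    ring
  · simp [lamN]
  · have := lamN_sq hq0 hq1 j
    rw [← Complex.ofReal_mul, ← sq, this, h4]
    push_cast
    rfl

theorem gridScalarsReal (q c ε : ℝ) :
    GridScalarsReal ((√q : ℝ) : ℂ) (lamSign c ε) ε (fun n => (cSign q c ε n : ℂ))
      (fun j => (lamN q j : ℂ)) :=
  ⟨Complex.conj_ofReal _, Complex.conj_ofReal _, Complex.conj_ofReal _,
    fun _ => Complex.conj_ofReal _, fun _ => Complex.conj_ofReal _⟩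

end Scalars

section Existence

open DecoupledSystem

variable {G : Type*} [NormedAddCommGroup G] [InnerProductSpace ℂ G] {T : G →ₗ.[ℂ] G}
  {q c ε : ℝ} {t : smoothVectors T ≃ₗ[ℂ] smoothVectors T}
  {s : ℕ → smoothVectors T →ₗ[ℂ] smoothVectors T} {S : ℕ → G →ₗ.[ℂ] G}

theorem lowerN_coe {M : Submodule ℂ G} (x : ℕ × ℕ → M) (i : ℕ × ℕ) :
    lowerN (fun i => (x i : G)) i = ((lowerN x i : M) : G) := by
  obtain ⟨_ | n, j⟩ := i <;> rfl

theorem lowerJ_coe {M : Submodule ℂ G} (x : ℕ × ℕ → M) (i : ℕ × ℕ) :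
    lowerJ (fun i => (x i : G)) i = ((lowerJ x i : M) : G) := by
  obtain ⟨n, _ | j⟩ := i <;> rfl

variable [CompleteSpace G]

theorem typeOneActs_gridOp (hq : 0 < q) (hl : lamSign c ε ≠ 0)
    (hε : ε * lamSign c ε = |lamSign c ε|) (hεε : ε * ε = 1)
    (hk : ∀ x, (x, 0) ∈ T.graph → x = 0) (ht : ∀ x : smoothVectors T, ((x : G), (t x : G)) ∈ T.graph)
    (hS : ∀ j, IsPositiveSqrt (S j) (radicand q c ε T j))
    (hs : ∀ j (x : smoothVectors T), ((x : G), (s j x : G)) ∈ (S j).graph) (z : HatGen)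
    (x : ℕ × ℕ → smoothVectors T) :
    TypeOneActs q c ε T z (fun i => (x i : G))
      (fun i => (gridOp ((√q : ℝ) : ℂ) (lamSign c ε) ε (fun n => (cSign q c ε n : ℂ))
        (fun j => (lamN q j : ℂ)) t s z x i : G)) := by
  have hqC : (q : ℂ) ≠ 0 := by exact_mod_cast hq.ne'
  have hlC : (lamSign c ε : ℂ) ≠ 0 := by exact_mod_cast hl
  have hεC : (ε : ℂ) ≠ 0 := by
    rintro h
    have : ε = 0 := by exact_mod_cast h
    rw [this, mul_zero] at hεε
    exact zero_ne_one hεε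
  have h0 := sqrt_coe_pos hq
  have hsq : ((√q : ℝ) : ℂ) ^ 2 = (q : ℂ) := by exact_mod_cast Real.sq_sqrt hq.le
  have h2 : ∀ n : ℕ, ((√q : ℝ) : ℂ) ^ (2 * n) = (q : ℂ) ^ n := fun n => by rw [pow_mul, hsq]
  have h4 : ∀ n : ℕ, ((√q : ℝ) : ℂ) ^ (4 * n) = (q : ℂ) ^ (2 * n) := fun n => by
    rw [← h2]
    congr 1
    ring
  have hz : ∀ n j : ℕ, ((q ^ ((n : ℤ) - (j : ℤ)) : ℝ) : ℂ) = (q : ℂ) ^ n * ((q : ℂ) ^ j)⁻¹ := by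
    intro n j
    rw [zpow_sub₀ hq.ne', zpow_natCast, zpow_natCast]
    push_cast; rfl
  have hhalf : ((q ^ (-(1 / 2) : ℝ) : ℝ) : ℂ) = ((√q : ℝ) : ℂ)⁻¹ := by
    rw [rpow_neg_half hq, Complex.ofReal_inv]
  have hlam : (lam q : ℂ) = ((√q : ℝ) : ℂ) ^ 2 - (((√q : ℝ) : ℂ) ^ 2)⁻¹ := by
    rw [hsq, lam]
    push_cast
    rfl
  -- Multiplication by `ε` replaces `|l|` by `l`, which is why the second coefficients of `gridOp`
  -- for `E` and `F` carry `l⁻¹` and no sign.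
  have hd : ∀ n, (dSign q c ε n : ℂ) * ε = cSign q c ε n * (lamSign c ε : ℂ)⁻¹ * ((q : ℂ) ^ n)⁻¹ := by
    intro n
    have : dSign q c ε n = cSign q c ε n / (|lamSign c ε| * q ^ n) := dSign_eq hq hl n
    rw [this, ← hε]
    push_cast
    field_simp
  obtain (_ | _ | _ | _ | _ | _ | _) | _ := z
  · intro n j
    change ((_ : smoothVectors T) : G) = _
    rw [gridOp_A, h4]
    push_cast
    rfl
  · intro n j
    rfl
  · intro n j
    change ((_ : smoothVectors T) : G) = _
    rw [gridOp_Bs, lowerN_coe]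
    rfl
  · refine ⟨S, hS, fun n j => ⟨(s (j + 1) (t (x (n, j + 1))) : G), (t (lowerN x (n, j)) : G),
      mem_graph_opMul.2 ⟨_, ht _, hs _ _⟩, ?_, ?_⟩⟩
    · rw [lowerN_coe]
      exact ht _
    · change ((_ : smoothVectors T) : G) = _
      rw [gridOp_E]
      push_cast
      rw [hhalf, hlam, h2, h2, ← hd, smul_sub, smul_sub, smul_smul, smul_smul, smul_smul, smul_smul]
      congr 2 <;> ring
  · refine ⟨S, hS, fun n j => ⟨(s j (t (lowerJ x (n, j))) : G), (t (x (n + 1, j)) : G),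
      mem_graph_opMul.2 ⟨(t (lowerJ x (n, j)) : G), ?_, hs _ _⟩, ht _, ?_⟩⟩
    · rw [lowerJ_coe]
      exact ht _
    · change ((_ : smoothVectors T) : G) = _
      rw [gridOp_F]
      push_cast
      rw [hhalf, hlam, h2, h2, h2, ← hd, smul_sub, smul_sub, smul_smul, smul_smul, smul_smul,
        smul_smul]
      congr 2 <;> ring
  · intro n j
    refine ⟨_, ht _, ?_⟩
    change ((_ : smoothVectors T) : G) = _
    rw [gridOp_K, hz, h2, h2]
    rfl
  · intro n j
    refine ⟨(t.symm (x (n, j)) : G), ?_, ?_⟩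
    · rw [mem_graph_inverse hk]
      have := ht (t.symm (x (n, j)))
      rwa [t.apply_symm_apply] at this
    · change ((_ : smoothVectors T) : G) = _
      rw [gridOp_Ki, hz, h2, h2, mul_inv, inv_inv]
      rfl
  · intro n j
    change ((_ : smoothVectors T) : G) = _
    rw [gridOp_Ai, h4]
    push_cast
    rfl

open HatCrossProduct in
/-- The formulas `(I)_{±,H}` define a `*`-representation. -/
theorem exists_typeOneRep (hq0 : 0 < q) (hq1 : q < 1) (c : ℝ≥0) (hε : ε = 1 ∨ ε = -1 ∧ 0 < c)
    (hT : IsInvertibleSelfAdjoint T) :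
    ∃ π : StarRep (HatCrossProduct q c) (DoubleSum G), π.domain = typeOneDomain T ∧
      ∀ (g : HatGen) (x : π.domain), TypeOneActs q c ε T g (x : DoubleSum G)
        (π.hom (gen q c g) x : DoubleSum G) := by
  have hTs := hT.1
  have hk : ∀ x, (x, 0) ∈ T.graph → x = 0 := fun x hx => by
    obtain ⟨y, rfl, hy⟩ := (LinearPMap.mem_graph_iff T).1 hx
    exact hT.2 y hy
  have hε' : ε = 1 ∨ ε = -1 ∧ 0 < (c : ℝ) := hε
  obtain ⟨hl, hl1, hεε, -, -⟩ := lamSign_spec hq0 hq1 c.coe_nonneg hε'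
  have hsc := gridScalars hq0 hq1 c.coe_nonneg hε'
  have hsr := gridScalarsReal q c ε
  obtain ⟨t, ht⟩ := exists_smooth_equiv hk
  have hκ : ∀ j : ℕ, 0 ≤ (lamSign c ε)⁻¹ ^ 2 * (q ^ (2 * j))⁻¹ * (c : ℝ) := fun j => by
    have := c.coe_nonneg
    positivity
  choose S s hS hs hst hss using fun j : ℕ => exists_smooth_sqrt hk hTs (hκ j) t ht
  have hss' : ∀ j x, s j (s j x) = (((lamSign c ε : ℝ) : ℂ)⁻¹ ^ 2
      * (((√q : ℝ) : ℂ) ^ (4 * j))⁻¹ * ((c : ℝ) : ℂ)) • x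
      + t.symm (t.symm (t.symm (t.symm x))) := fun j x => by
    rw [hss]
    congr 2
    have hsq : ((√q : ℝ) : ℂ) ^ 2 = (q : ℂ) := by exact_mod_cast Real.sq_sqrt hq0.le
    push_cast
    rw [← hsq, ← pow_mul, show 2 * (2 * j) = 4 * j by ring]
  have hrel := gridOp_crossRel hsc hst hss'
  have htt : ∀ x y, ⟪t x, y⟫_ℂ = ⟪x, t y⟫_ℂ := fun x y => sa_symm hTs (ht x) (ht y) 
  have hsS : ∀ j x y, ⟪s j x, y⟫_ℂ = ⟪x, s j y⟫_ℂ := fun j x y => sa_symm (hS j).1 (hs j x) (hs j y)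
  choose O hO using fun z : HatGen => exists_restrict (fun y hy =>
    finite_gridOp (h := ((√q : ℝ) : ℂ)) (l := lamSign c ε) (e := ε)
      (g := fun n => (cSign q c ε n : ℂ)) (m := fun j => (lamN q j : ℂ)) (t := t) (s := s) z hy)
  have hadj : ∀ z (x y : typeOneDomain T), ⟪(O z x : DoubleSum G), (y : DoubleSum G)⟫_ℂ
      = ⟪(x : DoubleSum G), (O (star z) y : DoubleSum G)⟫_ℂ := by
    intro z x y
    rw [inner_typeOneDomain, inner_typeOneDomain, hO, hO]
    exact gridOp_adjoint hsr hst htt hsS z (finite_components x) (finite_components y)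
  -- Taking components is injective and intertwines the two lifts, so the relations need to hold
  -- only for operators on all families of smooth vectors, where they have been verified.
  have hlift : ∀ a x, components T (FreeStarAlgebra.lift O a x)
      = FreeStarAlgebra.lift (gridOp ((√q : ℝ) : ℂ) (lamSign c ε) ε (fun n => (cSign q c ε n : ℂ))
        (fun j => (lamN q j : ℂ)) t s) a (components T x) := by
    refine FreeStarAlgebra.induction (fun r x => ?_) (fun z x => ?_) (fun a b ha hb x => ?_)
      fun a b ha hb x => ?_
    · rw [AlgHom.commutes, AlgHom.commutes, Module.algebraMap_end_apply,
        Module.algebraMap_end_apply, map_smul]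
    · rw [FreeStarAlgebra.lift_gen, FreeStarAlgebra.lift_gen, hO]
    · rw [map_mul, map_mul, Module.End.mul_apply, Module.End.mul_apply, ha, hb]
    · rw [map_add, map_add, LinearMap.add_apply, LinearMap.add_apply, map_add, ha, hb]
  have hR : ∀ p ∈ hatRelations q (linCoeff c) (constCoeff c),
      FreeStarAlgebra.lift O p.1 = FreeStarAlgebra.lift O p.2 := by
    intro p hp
    refine LinearMap.ext fun x => components_injective ?_
    rw [hlift, hlift]
    refine congrArg (fun e : Module.End ℂ _ => e (components T x)) ?_
    rcases hp with hp | rfl | rfl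
    · refine (crossRel_iff hq0 _ _ _ _).2 ?_ p hp
      simp only [FreeStarAlgebra.lift_gen]
      have h1 : linCoeff c = 1 := by simp [linCoeff]
      have h2 : constCoeff c = c := by simp [constCoeff]
      rw [h1, h2, Complex.ofReal_one]
      exact hrel
    · simp only [map_mul, map_one, FreeStarAlgebra.lift_gen]
      exact gridOp_A_mul_Ai hsc
    · simp only [map_mul, map_one, FreeStarAlgebra.lift_gen]
      exact gridOp_Ai_mul_A hsc
  have hact : ∀ (g : HatGen) (x : typeOneDomain T), TypeOneActs q c ε T g (x : DoubleSum G)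
      (O g x : DoubleSum G) := by
    intro g x
    have := typeOneActs_gridOp hq0 hl hl1 hεε hk ht hS hs g (components T x)
    rw [← hO] at this
    exact this
  refine ⟨StarRep.ofGenerators (typeOneDomain T) O (dense_typeOneDomain hk hTs) hadj _ hR, rfl,
    fun g x => ?_⟩
  have h1 : (StarRep.ofGenerators (typeOneDomain T) O (dense_typeOneDomain hk hTs) hadj _ hR).hom
      (gen q c g) = O g := StarRep.ofGenerators_gen ..
  rw [h1]
  exact hact g x

end Existence

end

end Podles

end

theorem mainTheorem3 (q : ℝ) (hq0 : 0 < q) (hq1 : q < 1) :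
    -- the kernel of `A` is trivial
    (∀ (c : ℝ≥0∞) (H : Type u) [NormedAddCommGroup H] [InnerProductSpace ℂ H] [CompleteSpace H]
      (π : Podles.StarRep (Podles.CrossProduct q c) H),
      Podles.StronglyCommute (π.cl (Podles.CrossProduct.gen q c .A))
        (π.cl (Podles.CrossProduct.gen q c .K)) →
      ∀ x : (π.cl (Podles.CrossProduct.gen q c .A)).domain,
        π.cl (Podles.CrossProduct.gen q c .A) x = 0 → (x : H) = 0) ∧
    -- classification of the well-behaved representations for `0 < c < ∞`
    (∀ (c : ℝ≥0), 0 < c →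
      ∀ (H : Type u) [NormedAddCommGroup H] [InnerProductSpace ℂ H] [CompleteSpace H]
        (π : Podles.StarRep (Podles.HatCrossProduct q c) H), Podles.WellBehaved q c π →
      ∃ (G₁ : Type u) (_ : NormedAddCommGroup G₁) (_ : InnerProductSpace ℂ G₁)
        (_ : CompleteSpace G₁) (T₁ : G₁ →ₗ.[ℂ] G₁)
        (G₂ : Type u) (_ : NormedAddCommGroup G₂) (_ : InnerProductSpace ℂ G₂)
        (_ : CompleteSpace G₂) (T₂ : G₂ →ₗ.[ℂ] G₂)
        (U : H ≃ₗᵢ[ℂ] WithLp 2 (Podles.DoubleSum G₁ × Podles.DoubleSum G₂)),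
        Podles.IsInvertibleSelfAdjoint T₁ ∧ Podles.IsInvertibleSelfAdjoint T₂ ∧
        ∀ (g : Podles.HatGen) (x : π.domain),
          Podles.TypeOneActs q c 1 T₁ g (U (x : H)).fst
            (U (π.hom (Podles.HatCrossProduct.gen q c g) x : H)).fst ∧
          Podles.TypeOneActs q c (-1) T₂ g (U (x : H)).snd
            (U (π.hom (Podles.HatCrossProduct.gen q c g) x : H)).snd) ∧
    -- classification of the well-behaved representations for `c = 0`
    (∀ (H : Type u) [NormedAddCommGroup H] [InnerProductSpace ℂ H] [CompleteSpace H]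
        (π : Podles.StarRep (Podles.HatCrossProduct q (0 : ℝ≥0)) H), Podles.WellBehaved q 0 π →
      ∃ (G : Type u) (_ : NormedAddCommGroup G) (_ : InnerProductSpace ℂ G)
        (_ : CompleteSpace G) (T : G →ₗ.[ℂ] G) (U : H ≃ₗᵢ[ℂ] Podles.DoubleSum G),
        Podles.IsInvertibleSelfAdjoint T ∧
        ∀ (g : Podles.HatGen) (x : π.domain),
          Podles.TypeOneActs q 0 1 T g (U (x : H))
            (U (π.hom (Podles.HatCrossProduct.gen q (0 : ℝ≥0) g) x : H))) ∧
    -- the formulas define `*`-representations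
    (∀ (c : ℝ≥0) (ε : ℝ), (ε = 1 ∨ (ε = -1 ∧ 0 < c)) →
      ∀ (G : Type u) [NormedAddCommGroup G] [InnerProductSpace ℂ G] [CompleteSpace G]
        (T : G →ₗ.[ℂ] G), Podles.IsInvertibleSelfAdjoint T →
      ∃ π : Podles.StarRep (Podles.HatCrossProduct q c) (Podles.DoubleSum G),
        π.domain = Podles.typeOneDomain T ∧
        ∀ (g : Podles.HatGen) (x : π.domain),
          Podles.TypeOneActs q c ε T g (x : Podles.DoubleSum G)
            (π.hom (Podles.HatCrossProduct.gen q c g) x : Podles.DoubleSum G)) := by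
  refine ⟨?_, ?_, ?_, ?_⟩
  · intro c H _ _ _ π _ x hx
    exact π.ker_A_eq_zero hq0 hq1 c x hx
  · intro c hc H _ _ _ π hπ
    exact hπ.exists_unitary_of_pos hq0 hq1 hc
  · intro H _ _ _ π hπ
    exact hπ.exists_unitary_of_zero hq0 hq1
  · intro c ε hε G _ _ _ T hT
    exact Podles.exists_typeOneRep hq0 hq1 c hε hT
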